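/- **Setting.** Fix $N\ge 1$, exponents $0<d_1\le\dots\le d_N$, the dilations $r\cdot \mathbf x=(r^{d_1}x_1,\dots,r^{d_N}x_N)$ on $\mathbb R^N$, and a smooth homogeneous norm $|\cdot|$ (continuous, $\ge 0$, vanishing only at $0$, $C^\infty$ away from $0$, $|r\cdot\mathbf x|=r|\mathbf x|$ for $r>0$). Scalars are real or complex (one choice throughout, for functions and distributions). Let $N=a_1+\dots+a_n$ with integers $a_j\ge1$, write $\mathbb R^N=\mathbb R^{a_1}\oplus\dots\oplus\mathbb R^{a_n}$, $\mathbf x=(\mathbf x_1,\dots,\mathbf x_n)$, let $J_l$ be the set of indices of the coordinates in $\mathbf x_l$, and put $Q_l=\sum_{s\in J_l}d_s$, $N_l(\mathbf x_l)=\max_{s\in J_l}|x_s|^{1/d_s}$, and $[\![\bar\alpha_l]\!]=\sum_{s\in J_l}\alpha_sd_s$ for $\alpha\in\mathbb N^N$. The standard flag $\mathcal F$ of this decomposition is $(0)\subset\mathbb R^{a_n}\subset\mathbb R^{a_{n-1}}\oplus\mathbb R^{a_n}\subset\dots\subset\mathbb R^N$. The flag of another decomposition $N=b_1+\dots+b_s$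 is strictly coarser than $\mathcal F$ if $(b_1,\dots,b_s)\neq(a_1,\dots,a_n)$ and each $b_k$ is the sum of a run of consecutive $a_j$'s, that is, there are $1=\alpha_1<\dots<\alpha_{s+1}=n+1$ with $b_k=\sum_{j=\alpha_k}^{\alpha_{k+1}-1}a_j$. Let $\|\varphi\|_{(m)}=\sup_{|\alpha|\le m,\,\mathbf x}|\partial^\alpha\varphi(\mathbf x)|$. A *flag kernel* adapted to $\mathcal F$ is a tempered distribution $\mathcal K\in\mathcal S'(\mathbb R^N)$ such that: (a) on test functions supported away from $\{\mathbf x_1=0\}$, $\mathcal K$ is integration against a function $K$ that is $C^\infty$ on $\{\mathbf x_1\ne0\}$ and satisfies there, for every $\alpha$, $$|\partial^\alpha K(\mathbf x)|\le C_\alpha\prod_{k=1}^n\big[N_1(\mathbf x_1)+\dots+N_k(\mathbf x_k)\big]^{-Q_k-[\![\bar\alpha_k]\!]};$$ (b) for all complementary subsets $L,M$ of $\{1,\dots,n\}$, all $\psi\in C_0^\infty\big(\bigoplus_{m\in M}\mathbb R^{a_m}\big)$ and all $R_m>0$ ($m\in M$), put $\psi_R\big((\mathbf x_m)_{m\in M}\big)=\psi\big((R_m\cdot\mathbf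 x_m)_{m\in M}\big)$. Then the distribution $\varphi\mapsto\langle\mathcal K,\psi_R\otimes\varphi\rangle$ in the variables $(\mathbf x_l)_{l\in L}$ satisfies the conditions of (a) for the decomposition $\bigoplus_{l\in L}\mathbb R^{a_l}$ (for $L=\emptyset$ it is a number, to be bounded), and for every $\alpha$ and every $r>0$ there are $C$ and $p$, independent of $R$ and $\psi$, such that the constant for $\partial^\alpha$ can be taken to be $C\|\psi\|_{(p)}$ whenever $\psi$ is supported in the Euclidean ball of radius $r$. The constants $C_\alpha$ in (a) and $C,p$ in (b) are the *flag kernel constants* of $\mathcal K$. Let $\mathcal E_n=\{I\in\mathbb Z^n: i_1\le\dots\le i_n\}$ and, for $I\in\mathcal E_n$, $[\varphi]_I(\mathbf x)=2^{-\sum_l Q_li_l}\,\varphi(2^{-i_1}\cdot\mathbf x_1,\dots,2^{-i_n}\cdot\mathbf x_n)$. **Theorem.** Let $\mathcal K$ be a flag kernel adapted to the standard flag $\mathcal F$. Then there are tempered distributions with $\mathcal K=\mathcal K_0+\mathcal K_1+\dots+\mathcal K_n$ such that: (1) For each $I\in\mathcal E_n$ there is $\varphi^I\in C_0^\infty(\mathbb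 R^N)$ so that $\mathcal K_0=\sum_{I\in\mathcal E_n}[\varphi^I]_I$, with unconditional convergence in the sense of tempered distributions. Moreover: (a) the support of each $\varphi^I$ is contained in the unit ball $\{|\mathbf x|\le1\}$; (b) there are constants $C_m>0$, depending only on the flag kernel constants of $\mathcal K$ (and on the fixed dilations, decomposition and norm), so that $\|\varphi^I\|_{(m)}\le C_m$ for all $I\in\mathcal E_n$ and all $m\ge0$; (c) each $\varphi^I$ has strong cancellation: for $1\le j\le n$, $\int_{\mathbb R^{a_j}}\varphi^I(\mathbf x_1,\dots,\mathbf x_n)\,d\mathbf x_j=0$ for all values of the other variables; (d) $\varphi^I(\mathbf x)=0$ whenever $|\mathbf x_1|<\frac18$, where $|\mathbf x_1|=|(\mathbf x_1,0,\dots,0)|$. (2) If $n\ge2$, then for $1\le j\le n$ the distribution $\mathcal K_j$ is a flag kernel adapted to a standard flag that is strictly coarser than $\mathcal F$ (which flag may depend on $j$). If $n=1$, where there is no strictly coarser flag, $\mathcal K_1=0$. -/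

import Mathlib

open scoped SchwartzMap ContDiff

noncomputable section

namespace FlagKernel

/-! ### Multi-index derivatives and test functions -/

section General

variable {𝕜 : Type*} [RCLike 𝕜] {ι : Type*} [Fintype ι] [LinearOrder ι]

/-- The list of coordinates in increasing order, each `i` repeated `α i` times. -/
def coordList (α : ι → ℕ) : List ι :=
  (Finset.univ : Finset ι).sort.flatMap fun i => List.replicate (α i) i

/-- The partial derivative `∂^α f`. -/
def partialDeriv (α : ι → ℕ) (f : EuclideanSpace ℝ ι → 𝕜) (x : EuclideanSpace ℝ ι) : 𝕜 :=
  iteratedFDeriv ℝ (coordList α).length f x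
    fun t => EuclideanSpace.single ((coordList α).get t) (1 : ℝ)

/-- `‖f‖_(m) ≤ c`, where `‖f‖_(m)` is the supremum of `|∂^α f(x)|` over all `x` and
all `α` with `|α| ≤ m`. -/
def CmNormLE (m : ℕ) (f : EuclideanSpace ℝ ι → 𝕜) (c : ℝ) : Prop :=
  ∀ α : ι → ℕ, ∑ i, α i ≤ m → ∀ x, ‖partialDeriv α f x‖ ≤ c

end General

section Dilations

variable {ι : Type*} [Fintype ι]

/-- The one-parameter dilations `r · x = (r ^ (d i) * x i)_i`. -/
def dilate (d : ι → ℝ) (r : ℝ) (x : EuclideanSpace ℝ ι) : EuclideanSpace ℝ ι :=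
  WithLp.toLp 2 fun i => r ^ d i * x i

/-- A smooth homogeneous norm for the dilations with exponents `d`. -/
structure IsSmoothHomogeneousNorm (d : ι → ℝ) (ρ : EuclideanSpace ℝ ι → ℝ) : Prop where
  continuous : Continuous ρ
  nonneg : ∀ x, 0 ≤ ρ x
  eq_zero_iff : ∀ x, ρ x = 0 ↔ x = 0
  smooth : ContDiffOn ℝ ∞ ρ {0}ᶜ
  homogeneous : ∀ r : ℝ, 0 < r → ∀ x, ρ (dilate d r x) = r * ρ x

/-- Multiplication of each coordinate by a nonzero number, as a linear isomorphism. -/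
def diagEquiv (c : ι → ℝ) (hc : ∀ i, c i ≠ 0) : EuclideanSpace ℝ ι ≃L[ℝ] EuclideanSpace ℝ ι :=
  LinearEquiv.toContinuousLinearEquiv
    { toFun := fun x => WithLp.toLp 2 fun i => c i * x i
      invFun := fun x => WithLp.toLp 2 fun i => (c i)⁻¹ * x i
      map_add' := fun x y => by ext i; simp [mul_add]
      map_smul' := fun a x => by ext i; simp; ring
      left_inv := fun x => by ext i; simp [hc i]
      right_inv := fun x => by ext i; simp [hc i] }

end Dilations

/-! ### Tensor products of Schwartz functions -/

section Tensor

variable {𝕜 : Type*} [RCLike 𝕜] {N : ℕ}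

/-- The projection of `ℝ^N` onto the coordinates satisfying `p`. -/
def restrict (p : Fin N → Prop) [DecidablePred p] :
    EuclideanSpace ℝ (Fin N) →L[ℝ] EuclideanSpace ℝ {i // p i} :=
  LinearMap.toContinuousLinearMap
    { toFun := fun x => WithLp.toLp 2 fun i => x i.1
      map_add' := fun x y => by ext i; simp
      map_smul' := fun a x => by ext i; simp }

theorem norm_le_restrict (p : Fin N → Prop) [DecidablePred p] (x : EuclideanSpace ℝ (Fin N)) :
    ‖x‖ ≤ ‖restrict p x‖ + ‖restrict (fun i => ¬ p i) x‖ := by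
  have h : ‖x‖ ^ 2 = ‖restrict p x‖ ^ 2 + ‖restrict (fun i => ¬ p i) x‖ ^ 2 := by
    simp only [EuclideanSpace.norm_sq_eq]
    exact (Fintype.sum_subtype_add_sum_subtype p fun i => ‖x i‖ ^ 2).symm
  refine abs_le_of_sq_le_sq' ?_ (by positivity) |>.2
  nlinarith [norm_nonneg (restrict p x), norm_nonneg (restrict (fun i => ¬ p i) x)]

theorem norm_iteratedFDeriv_comp_restrict (p : Fin N → Prop) [DecidablePred p]
    (f : 𝓢(EuclideanSpace ℝ {i // p i}, 𝕜)) (k n : ℕ) :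
    ∃ C : ℝ, 0 ≤ C ∧ ∀ x, (1 + ‖restrict p x‖) ^ k *
      ‖iteratedFDeriv ℝ n (fun y => f (restrict p y)) x‖ ≤ C := by
  refine ⟨2 ^ k * ((Finset.Iic (k, n)).sup fun m => SchwartzMap.seminorm 𝕜 m.1 m.2) f *
    ‖restrict p‖ ^ n, by positivity, fun x => ?_⟩
  have h1 := SchwartzMap.one_add_le_sup_seminorm_apply (𝕜 := 𝕜) (m := (k, n)) le_rfl le_rfl f
    (restrict p x)
  have h2 : iteratedFDeriv ℝ n (fun y => f (restrict p y)) x =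
      (iteratedFDeriv ℝ n f (restrict p x)).compContinuousLinearMap fun _ => restrict p :=
    (restrict p).iteratedFDeriv_comp_right (f.smooth n) x le_rfl
  have h3 := (iteratedFDeriv ℝ n f (restrict p x)).norm_compContinuousLinearMap_le
    fun _ => restrict p
  rw [Finset.prod_const, Finset.card_univ, Fintype.card_fin] at h3
  rw [h2]
  calc _ ≤ (1 + ‖restrict p x‖) ^ k *
        (‖iteratedFDeriv ℝ n f (restrict p x)‖ * ‖restrict p‖ ^ n) := by gcongr
    _ = ((1 + ‖restrict p x‖) ^ k * ‖iteratedFDeriv ℝ n f (restrict p x)‖) *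
        ‖restrict p‖ ^ n := by ring
    _ ≤ _ := by gcongr

/-- The tensor product `(f ⊗ g)(x) = f(x') g(x'')`, where `x'` consists of the coordinates of `x`
satisfying `p` and `x''` of the others. -/
def tensor (p : Fin N → Prop) [DecidablePred p] (f : 𝓢(EuclideanSpace ℝ {i // p i}, 𝕜))
    (g : 𝓢(EuclideanSpace ℝ {i // ¬ p i}, 𝕜)) : 𝓢(EuclideanSpace ℝ (Fin N), 𝕜) where
  toFun x := f (restrict p x) * g (restrict (fun i => ¬ p i) x)
  smooth' := ((f.smooth ⊤).comp (restrict p).contDiff).mul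
    ((g.smooth ⊤).comp (restrict (fun i => ¬ p i)).contDiff)
  decay' k n := by
    choose A hA0 hA using fun j => norm_iteratedFDeriv_comp_restrict p f k j
    choose B hB0 hB using fun j => norm_iteratedFDeriv_comp_restrict (fun i => ¬ p i) g k j
    refine ⟨∑ j ∈ Finset.range (n + 1), (n.choose j : ℝ) * (A j * B (n - j)), fun x => ?_⟩
    have hF : ContDiff ℝ ∞ fun y => f (restrict p y) :=
      (f.smooth ⊤).comp (restrict p).contDiff
    have hG : ContDiff ℝ ∞ fun y => g (restrict (fun i => ¬ p i) y) :=
      (g.smooth ⊤).comp (restrict (fun i => ¬ p i)).contDiff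
    have h := norm_iteratedFDeriv_mul_le hF hG x (n := n) (by exact_mod_cast le_top)
    have hx : ‖x‖ ^ k ≤ (1 + ‖restrict p x‖) ^ k * (1 + ‖restrict (fun i => ¬ p i) x‖) ^ k := by
      rw [← mul_pow]
      gcongr
      have := norm_le_restrict p x
      nlinarith [norm_nonneg (restrict p x), norm_nonneg (restrict (fun i => ¬ p i) x)]
    refine (mul_le_mul hx h (norm_nonneg _) (by positivity)).trans ?_
    rw [Finset.mul_sum]
    refine Finset.sum_le_sum fun j _ => ?_
    calc _ = (n.choose j : ℝ) *
          (((1 + ‖restrict p x‖) ^ k * ‖iteratedFDeriv ℝ j (fun y => f (restrict p y)) x‖) *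
          ((1 + ‖restrict (fun i => ¬ p i) x‖) ^ k *
            ‖iteratedFDeriv ℝ (n - j) (fun y => g (restrict (fun i => ¬ p i) y)) x‖)) := by ring
      _ ≤ _ := by
        gcongr
        · exact hA0 j
        · exact hA j x
        · exact hB (n - j) x

end Tensor

/-! ### Differential inequalities

Coordinates are indexed by `ι`, the coordinate `i` has homogeneity `d i` and belongs to the factor
with label `π i`; the labels of the factors form the set `L`, ordered increasingly. -/

section DifferentialInequalities

variable {𝕜 : Type*} [RCLike 𝕜] {ι : Type*} [Fintype ι] [LinearOrder ι] {n : ℕ}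

/-- `N_k(x_k) = sup_s |x_s| ^ (1 / d_s)`, over the coordinates `s` of the factor `k`. -/
def blockNorm (d : ι → ℝ) (π : ι → Fin n) (k : Fin n) (x : EuclideanSpace ℝ ι) : ℝ :=
  ⨆ s : {s // π s = k}, |x s.1| ^ (1 / d s.1)

/-- The set of points whose component in the first factor is nonzero
(the whole space when there is no factor). -/
def offFirst (π : ι → Fin n) (L : Finset (Fin n)) : Set (EuclideanSpace ℝ ι) :=
  {x | ∀ k ∈ L, (∀ l ∈ L, k ≤ l) → ∃ s, π s = k ∧ x s ≠ 0}

/-- The product over `k ∈ L` of `(∑_{l ∈ L, l ≤ k} N_l(x_l)) ^ (- Q_k - ⟦α_k⟧)`, where `Q_k` and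
`⟦α_k⟧` are the sums of `d s` and of `α s * d s` over the coordinates `s` of the factor `k`. -/
def flagWeight (d : ι → ℝ) (π : ι → Fin n) (L : Finset (Fin n)) (α : ι → ℕ)
    (x : EuclideanSpace ℝ ι) : ℝ :=
  ∏ k ∈ L, (∑ l ∈ L with l ≤ k, blockNorm d π l x) ^
    (-(∑ s with π s = k, d s) - ∑ s with π s = k, (α s : ℝ) * d s)

/-- The distribution `T` is given, for test functions supported away from the subspace where the
first component vanishes, by integration against a function `K` which is smooth there. -/
def IsGivenBy (π : ι → Fin n) (L : Finset (Fin n)) (T : 𝓢(EuclideanSpace ℝ ι, 𝕜) → 𝕜)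
    (K : EuclideanSpace ℝ ι → 𝕜) : Prop :=
  ContDiffOn ℝ ∞ K (offFirst π L) ∧
    ∀ f : 𝓢(EuclideanSpace ℝ ι, 𝕜), HasCompactSupport f → tsupport f ⊆ offFirst π L →
      T f = ∫ x, K x * f x

end DifferentialInequalities

/-! ### Standard flags and flag kernels

The standard flag of the decomposition `ℝ^N = ℝ^{a_1} ⊕ ⋯ ⊕ ℝ^{a_n}` is represented by the
composition `A = (a_1, …, a_n)` of `N`; the coordinate `i` belongs to the factor `A.index i`. -/

section Flags

variable {N : ℕ}

/-- `A` is finer than `B`: each part of `B` is the sum of a run of consecutive parts of `A`. -/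
def Finer (A B : Composition N) : Prop :=
  ∃ a : Fin (B.length + 1) → Fin (A.length + 1),
    StrictMono a ∧ a 0 = 0 ∧ a (Fin.last B.length) = Fin.last A.length ∧
      ∀ k : Fin B.length, B.blocksFun k =
        ∑ j : Fin A.length with a k.castSucc ≤ j.castSucc ∧ j.castSucc < a k.succ, A.blocksFun j

/-- The flag of `B` is strictly coarser than the flag of `A`. -/
def StrictlyCoarser (B A : Composition N) : Prop :=
  Finer A B ∧ A ≠ B

/-- The coordinates of the factors with label in `L`. -/
abbrev InBlocks (A : Composition N) (L : Finset (Fin A.length)) (i : Fin N) : Prop :=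
  A.index i ∈ L

/-- The label of the factor of a coordinate among those of the factors in `L`. -/
def label (A : Composition N) (L : Finset (Fin A.length)) (i : {i // InBlocks A L i}) :
    Fin A.length :=
  A.index i.1

/-- Flag kernel constants: `size α` is the constant `C_α` in the differential inequalities of the
kernel. In the cancellation condition with remaining factors `L`, for functions `ψ` supported in
the ball of radius `r`, the constant for the derivative `∂^α` is `cancel L α r` times the
`C^(order L α r)` norm of `ψ`. -/
structure FlagConstants (A : Composition N) where
  size : (Fin N → ℕ) → ℝ
  cancel : (L : Finset (Fin A.length)) → ({i // InBlocks A L i} → ℕ) → ℝ → ℝ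
  order : (L : Finset (Fin A.length)) → ({i // InBlocks A L i} → ℕ) → ℝ → ℕ

variable {𝕜 : Type*} [RCLike 𝕜]

/-- `ψ_R(x_{m_1}, …, x_{m_β}) = ψ(R_{m_1} · x_{m_1}, …, R_{m_β} · x_{m_β})`, in the variables of
the factors with label not in `L`. -/
def dilateTest (d : Fin N → ℝ) (A : Composition N) (L : Finset (Fin A.length))
    (R : Fin A.length → ℝ) (hR : ∀ k, 0 < R k)
    (ψ : 𝓢(EuclideanSpace ℝ {i // ¬ InBlocks A L i}, 𝕜)) :
    𝓢(EuclideanSpace ℝ {i // ¬ InBlocks A L i}, 𝕜) :=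
  SchwartzMap.compCLMOfContinuousLinearEquiv 𝕜
    (diagEquiv (fun i : {i // ¬ InBlocks A L i} => R (A.index i.1) ^ d i.1)
      fun _ => (Real.rpow_pos_of_pos (hR _) _).ne') ψ

/-- The distribution `K^#_{ψ,R}`, that is `φ ↦ ⟨K, ψ_R ⊗ φ⟩`, in the variables of the factors
with label in `L`. -/
def sharp (d : Fin N → ℝ) (A : Composition N) (L : Finset (Fin A.length))
    (T : 𝓢(EuclideanSpace ℝ (Fin N), 𝕜) →L[𝕜] 𝕜)
    (ψ : 𝓢(EuclideanSpace ℝ {i // ¬ InBlocks A L i}, 𝕜))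
    (R : Fin A.length → ℝ) (hR : ∀ k, 0 < R k)
    (φ : 𝓢(EuclideanSpace ℝ {i // InBlocks A L i}, 𝕜)) : 𝕜 :=
  T (tensor (InBlocks A L) φ (dilateTest d A L R hR ψ))

/-- The tempered distribution `T` is a flag kernel adapted to the standard flag of `A`, with flag
kernel constants `c`. -/
structure IsFlagKernelWith (d : Fin N → ℝ) (A : Composition N) (c : FlagConstants A)
    (T : 𝓢(EuclideanSpace ℝ (Fin N), 𝕜) →L[𝕜] 𝕜) : Prop where
  /-- The differential inequalities. -/
  differential : ∃ K : EuclideanSpace ℝ (Fin N) → 𝕜, IsGivenBy A.index Finset.univ T K ∧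
    ∀ (α : Fin N → ℕ), ∀ x ∈ offFirst A.index Finset.univ,
      ‖partialDeriv α K x‖ ≤ c.size α * flagWeight d A.index Finset.univ α x
  /-- The cancellation conditions: `K^#_{ψ,R}` satisfies the differential inequalities of the
  decomposition into the factors in `L`, with constants independent of `R`. -/
  cancellation : ∀ (L : Finset (Fin A.length))
    (ψ : 𝓢(EuclideanSpace ℝ {i // ¬ InBlocks A L i}, 𝕜)), HasCompactSupport ψ →
    ∀ (R : Fin A.length → ℝ) (hR : ∀ k, 0 < R k),
      ∃ K : EuclideanSpace ℝ {i // InBlocks A L i} → 𝕜,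
        IsGivenBy (label A L) L (sharp d A L T ψ R hR) K ∧
        ∀ (α : {i // InBlocks A L i} → ℕ) (r b : ℝ),
          tsupport ψ ⊆ Metric.closedBall 0 r → CmNormLE (c.order L α r) ψ b →
          ∀ x ∈ offFirst (label A L) L,
            ‖partialDeriv α K x‖ ≤
              c.cancel L α r * b * flagWeight (fun i => d i.1) (label A L) L α x

/-- The tempered distribution `T` is a flag kernel adapted to the standard flag of `A`. -/
def IsFlagKernel (d : Fin N → ℝ) (A : Composition N)
    (T : 𝓢(EuclideanSpace ℝ (Fin N), 𝕜) →L[𝕜] 𝕜) : Prop :=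
  ∃ c : FlagConstants A, IsFlagKernelWith d A c T

/-! ### Dyadic dilations and strong cancellation -/

/-- The set `𝓔_n` of increasing `n`-tuples of integers. -/
abbrev IncreasingIndex (n : ℕ) : Type :=
  {I : Fin n → ℤ // Monotone I}

/-- `[f]_I(x) = 2 ^ (- ∑ Q_l i_l) f(2^{-i_1} · x_1, …, 2^{-i_n} · x_n)`, where `Q_l` is the sum of
the exponents `d s` over the coordinates `s` of the factor `l`. -/
def dyadic (d : Fin N → ℝ) (A : Composition N) (I : Fin A.length → ℤ)
    (f : EuclideanSpace ℝ (Fin N) → 𝕜) (x : EuclideanSpace ℝ (Fin N)) : 𝕜 :=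
  (((2 : ℝ) ^ (-∑ l, (∑ s with A.index s = l, d s) * (I l : ℝ)) : ℝ) : 𝕜) *
    f (WithLp.toLp 2 fun i => (2 : ℝ) ^ (-(d i * (I (A.index i) : ℝ))) * x i)

/-- The point `x` with its component `x_k` replaced by `y`. -/
def replaceBlock (A : Composition N) (k : Fin A.length) (x : EuclideanSpace ℝ (Fin N))
    (y : {i // A.index i = k} → ℝ) : EuclideanSpace ℝ (Fin N) :=
  WithLp.toLp 2 fun i => if h : A.index i = k then y ⟨i, h⟩ else x i

/-- Strong cancellation: the integral over each of the factors vanishes identically. -/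
def StrongCancellation (A : Composition N) (f : EuclideanSpace ℝ (Fin N) → 𝕜) : Prop :=
  ∀ (k : Fin A.length) (x : EuclideanSpace ℝ (Fin N)),
    ∫ y : {i // A.index i = k} → ℝ, f (replaceBlock A k x y) = 0

/-- The component `x_1`, identified with `(x_1, 0, …, 0)`. -/
def firstBlock (A : Composition N) (x : EuclideanSpace ℝ (Fin N)) : EuclideanSpace ℝ (Fin N) :=
  WithLp.toLp 2 fun i => if (A.index i).val = 0 then x i else 0

end Flags

end FlagKernel

end

/-!
Why a flag kernel is a sum of dyadic bumps, up to flag kernels for coarser flags.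

For each factor `k` of the decomposition and each scale `i` consider two operators on test
functions: the truncation `H k i`, multiplication by a cutoff of the component `x_k` rescaled by
`2 ^ i`, and the average `R k i`, which replaces the dependence on `x_k` by an average against a
density of integral one supported away from zero and multiplies by the same cutoff, both at scale
`2 ^ i`. Since truncations and averages in a factor agree on functions which do not depend on the
variables of this factor, every product with a factor `E k i = H k i - R k i` annihilates these
functions. Truncations in different factors and at different scales commute, and all identities
are derived in a polynomial ring with one variable for each truncation and each average; a kernel
and a test function define a linear functional on it by the values of the words with one operator
in each factor (`wordValue`, `wordFunctional`).

For a test function the product of the truncations in all factors at a large scale is the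
identity. Splitting off the average in the last factor and telescoping the rest over the scale `i`
of this factor yields factors `E k i - E k (i - 1)` behind a truncation of the other factors at
scale `i`, and factors `E k (i - 1)` behind an increment of this truncation. Expanding the
truncations of the other factors in the same way leads to the expansion of the identity in
`hasSum_fullPath`. It consists of products of five types of factors (`Pat`) at increasing scales.
The ends of the telescoping sums are controlled by the cancellation condition in all variables: at
small scales the difference of truncation and average is a rescaled pairing with a test function
which tends to zero (`IsCutoffSystem.tendsto_corrected`), and at large scales the averages vanish
(`IsCutoffSystem.tendsto_corrected_top`).

The value of the kernel on a term of the expansion is the integral of the test function against a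
dyadic bump (`exists_bump_wordOp`, `IsCutoffSystem.exists_patternBump`). Indeed the averaged
factors form a dilated test function of part of the variables, and by the cancellation condition
the kernel then acts on the other variables as a function. An increment of a truncation localizes
this function away from its singularity, and every other truncation that occurs is preceded by
such an increment at the same scale. By homogeneity the bounds do not depend on the scales. The
bumps have cancellation in each factor of one of the types `E k i - E k (i - 1)` and
`E k (i - 1)`.

There are finitely many patterns of types, and the terms of each pattern sum to a tempered
distribution (`FlagSeries.exists_sum`): for each factor with cancellation, the pairing with a test
function has a gain away from scale one, and the scales of these factors determine the term. If
all factors are of type `E k i - E k (i - 1)`, this is the dyadic sum with strong cancellation.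
Otherwise some factor carries no cancellation. Such a factor is not the last one and has the same
scale as its successor, so the terms are dyadic bumps for the decomposition in which these two
factors are merged (`flagSeries_merge`), and a sum of such bumps is a flag kernel for the merged
decomposition (`FlagSeries.isFlagKernel`). Finally, the identity of the kernel with the sum of all
these distributions is tested on compactly supported functions, which are dense
(`ext_of_hasCompactSupport`).
-/

set_option linter.unusedSectionVars false

noncomputable section

namespace FlagKernel

open MeasureTheory

/-! ### Iterated directional derivatives -/

section DirectionalDerivatives

variable {V : Type*} [NormedAddCommGroup V] [NormedSpace ℝ V]
  {F : Type*} [NormedAddCommGroup F] [NormedSpace ℝ F]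

theorem two_le_infty : ((1 : WithTop ℕ∞) + 1) ≤ ∞ := by
  have : ((2 : ℕ∞) : WithTop ℕ∞) ≤ ((⊤ : ℕ∞) : WithTop ℕ∞) := by exact_mod_cast le_top
  have h2 : ((1 : WithTop ℕ∞) + 1) = ((2 : ℕ∞) : WithTop ℕ∞) := one_add_one_eq_two
  rw [h2]; exact this

/-- The iterated derivative of `f` in the directions of a list of vectors; the derivative in the
direction of the head is taken last. -/
def dirDeriv (l : List V) (f : V → F) : V → F :=
  match l with
  | [] => f
  | v :: l => fun x => fderiv ℝ (dirDeriv l f) x v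

theorem contDiffOn_dirDeriv {U : Set V} (hU : IsOpen U) {f : V → F} (hf : ContDiffOn ℝ ∞ f U)
    (l : List V) : ContDiffOn ℝ ∞ (dirDeriv l f) U := by
  induction l with
  | nil => exact hf
  | cons v l ih =>
    have : ContDiffOn ℝ ∞ (fderiv ℝ (dirDeriv l f)) U :=
      ih.fderiv_of_isOpen hU (by simp)
    exact this.clm_apply contDiffOn_const

theorem contDiff_dirDeriv {f : V → F} (hf : ContDiff ℝ ∞ f) (l : List V) :
    ContDiff ℝ ∞ (dirDeriv l f) :=
  contDiffOn_univ.1 (contDiffOn_dirDeriv isOpen_univ hf.contDiffOn l)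

theorem iteratedFDeriv_eq_dirDeriv {U : Set V} (hU : IsOpen U) {f : V → F}
    (hf : ContDiffOn ℝ ∞ f U) (m : ℕ) (v : Fin m → V) {x : V} (hx : x ∈ U) :
    iteratedFDeriv ℝ m f x v = dirDeriv (List.ofFn v) f x := by
  induction m generalizing x with
  | zero => simp [dirDeriv]
  | succ m ih =>
    have hd : DifferentiableAt ℝ (iteratedFDeriv ℝ m f) x := by
      have h1 : ContDiffAt ℝ ∞ f x := hf.contDiffAt (hU.mem_nhds hx)
      exact h1.differentiableAt_iteratedFDeriv (by exact_mod_cast WithTop.coe_lt_top m)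
    rw [List.ofFn_succ, dirDeriv, hd.iteratedFDeriv_succ_apply_left']
    congr 1
    apply Filter.EventuallyEq.fderiv_eq
    filter_upwards [hU.mem_nhds hx] with y hy
    exact ih _ hy

/-- Symmetry of higher derivatives: the order of the directions is irrelevant. -/
theorem dirDeriv_perm {U : Set V} (hU : IsOpen U) {f : V → F}
    (hf : ContDiffOn ℝ ∞ f U) {l l' : List V} (h : l.Perm l') {x : V} (hx : x ∈ U) :
    dirDeriv l f x = dirDeriv l' f x := by
  induction h generalizing x with
  | nil => rfl
  | cons v _ ih =>
    simp only [dirDeriv]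
    congr 1
    apply Filter.EventuallyEq.fderiv_eq
    filter_upwards [hU.mem_nhds hx] with y hy
    exact ih hy
  | swap v w l =>
    have hg := contDiffOn_dirDeriv hU hf l
    have hg' := hg.contDiffAt (hU.mem_nhds hx)
    simp only [dirDeriv]
    have hd : DifferentiableAt ℝ (fderiv ℝ (dirDeriv l f)) x :=
      (hg'.fderiv_right (m := 1) two_le_infty).differentiableAt (by simp)
    rw [fderiv_clm_apply hd (differentiableAt_const _),
      fderiv_clm_apply hd (differentiableAt_const _)]
    simp only [fderiv_fun_const, Pi.zero_apply, ContinuousLinearMap.comp_zero, zero_add,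
      ContinuousLinearMap.flip_apply]
    exact (hg'.isSymmSndFDerivAt (by
      rw [minSmoothness_of_isRCLikeNormedField, ← one_add_one_eq_two]; exact two_le_infty)).eq w v
  | trans _ _ ih1 ih2 => exact (ih1 hx).trans (ih2 hx)

end DirectionalDerivatives

section PartialDerivatives

variable {𝕜 : Type*} [RCLike 𝕜] {ι : Type*} [Fintype ι] [LinearOrder ι]

theorem count_coordList (α : ι → ℕ) (i : ι) : (coordList α).count i = α i := by
  have h : ∀ l : List ι, l.Nodup →
      (l.flatMap fun i => List.replicate (α i) i).count i = if i ∈ l then α i else 0 := by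
    intro l hl
    induction l with
    | nil => simp
    | cons j l ih =>
      rw [List.nodup_cons] at hl
      rw [List.flatMap_cons, List.count_append, ih hl.2, List.count_replicate]
      by_cases hj : j = i
      · subst hj; simp [hl.1]
      · simp [hj, Ne.symm hj]
  rw [coordList, h _ (Finset.sort_nodup _ _)]
  simp

theorem length_coordList (α : ι → ℕ) : (coordList α).length = ∑ i, α i := by
  rw [coordList, List.length_flatMap]
  simp only [List.length_replicate]
  have := Finset.sum_map_toList (Finset.univ : Finset ι) α
  rw [← this]
  exact ((Finset.sort_perm_toList _ _).map _).sum_eq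

theorem partialDeriv_eq_dirDeriv {U : Set (EuclideanSpace ℝ ι)} (hU : IsOpen U)
    {f : EuclideanSpace ℝ ι → 𝕜} (hf : ContDiffOn ℝ ∞ f U) (α : ι → ℕ)
    {x : EuclideanSpace ℝ ι} (hx : x ∈ U) :
    partialDeriv α f x =
      dirDeriv ((coordList α).map fun i => EuclideanSpace.single i (1 : ℝ)) f x := by
  rw [partialDeriv, iteratedFDeriv_eq_dirDeriv hU hf _ _ hx]
  congr 1
  conv_rhs => rw [← List.ofFn_get (coordList α)]
  rw [List.map_ofFn]
  rfl

theorem norm_partialDeriv_le (α : ι → ℕ) (f : EuclideanSpace ℝ ι → 𝕜) (x : EuclideanSpace ℝ ι) :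
    ‖partialDeriv α f x‖ ≤ ‖iteratedFDeriv ℝ (∑ i, α i) f x‖ := by
  rw [partialDeriv, ← length_coordList α]
  refine ((iteratedFDeriv ℝ _ f x).le_opNorm _).trans ?_
  simp

/-- A multilinear map on a Euclidean space is bounded by its values on the basis vectors. -/
theorem norm_multilinear_le_of_basis {m : ℕ}
    (M : ContinuousMultilinearMap ℝ (fun _ : Fin m => EuclideanSpace ℝ ι) 𝕜) {b : ℝ} (hb : 0 ≤ b)
    (h : ∀ v : Fin m → ι, ‖M fun t => EuclideanSpace.single (v t) (1 : ℝ)‖ ≤ b) :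
    ‖M‖ ≤ (Fintype.card ι : ℝ) ^ m * b := by
  refine M.opNorm_le_bound (by positivity) fun w => ?_
  have hw : w = fun t => ∑ i, w t i • EuclideanSpace.single i (1 : ℝ) := by
    funext t; ext j
    simp [Pi.single_apply]
  have h1 : M w = ∑ r : Fin m → ι, (∏ t, w t (r t)) •
      M fun t => EuclideanSpace.single (r t) (1 : ℝ) := by
    conv_lhs => rw [hw]
    rw [M.map_sum]
    refine Finset.sum_congr rfl fun r _ => ?_
    rw [M.map_smul_univ]
  rw [h1]
  refine (norm_sum_le _ _).trans ?_
  have h2 : ∀ r ∈ (Finset.univ : Finset (Fin m → ι)), ‖(∏ t, w t (r t)) •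
      M fun t => EuclideanSpace.single (r t) (1 : ℝ)‖ ≤ (∏ t, ‖w t‖) * b := by
    intro r _
    rw [norm_smul, norm_prod]
    gcongr with t
    · exact PiLp.norm_apply_le (w t) (r t)
    · exact h r
  refine (Finset.sum_le_card_nsmul _ _ _ h2).trans ?_
  simp only [Finset.card_univ, Fintype.card_pi, Finset.prod_const, Fintype.card_fin, nsmul_eq_mul]
  push_cast
  apply le_of_eq; ring

theorem norm_iteratedFDeriv_le_of_partialDeriv {U : Set (EuclideanSpace ℝ ι)} (hU : IsOpen U)
    {f : EuclideanSpace ℝ ι → 𝕜} (hf : ContDiffOn ℝ ∞ f U) {x : EuclideanSpace ℝ ι} (hx : x ∈ U)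
    {m : ℕ} {b : ℝ} (hb : 0 ≤ b) (h : ∀ α : ι → ℕ, ∑ i, α i = m → ‖partialDeriv α f x‖ ≤ b) :
    ‖iteratedFDeriv ℝ m f x‖ ≤ (Fintype.card ι : ℝ) ^ m * b := by
  refine norm_multilinear_le_of_basis _ hb fun v => ?_
  rw [iteratedFDeriv_eq_dirDeriv hU hf _ _ hx]
  set α : ι → ℕ := fun i => (List.ofFn v).count i
  have hperm : (List.ofFn v).Perm (coordList α) :=
    List.perm_iff_count.2 fun i => (count_coordList α i).symm
  have hlist : List.ofFn (fun t => EuclideanSpace.single (v t) (1 : ℝ)) =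
      (List.ofFn v).map fun i => EuclideanSpace.single i (1 : ℝ) := by
    rw [List.map_ofFn]; rfl
  rw [hlist, dirDeriv_perm hU hf (hperm.map _) hx, ← partialDeriv_eq_dirDeriv hU hf α hx]
  refine h α ?_
  rw [← length_coordList, ← hperm.length_eq, List.length_ofFn]

theorem partialDeriv_zero (f : EuclideanSpace ℝ ι → 𝕜) (x : EuclideanSpace ℝ ι) :
    partialDeriv 0 f x = f x := by
  have h : (coordList (0 : ι → ℕ)).length = 0 := by simp [length_coordList]
  have key : ∀ (n : ℕ) (v : Fin n → EuclideanSpace ℝ ι), n = 0 →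
      iteratedFDeriv ℝ n f x v = f x := by
    rintro n v rfl
    simp
  exact key _ _ h

end PartialDerivatives

/-! ### Diagonal maps -/

section Diagonal

variable {ι : Type*} [Fintype ι]

/-- Multiplication of each coordinate by a number, as a continuous linear map. -/
def diag (c : ι → ℝ) : EuclideanSpace ℝ ι →L[ℝ] EuclideanSpace ℝ ι :=
  LinearMap.toContinuousLinearMap
    { toFun := fun x => WithLp.toLp 2 fun i => c i * x i
      map_add' := fun x y => by ext i; simp [mul_add]
      map_smul' := fun a x => by ext i; simp; ring }

@[simp] theorem diag_apply (c : ι → ℝ) (x : EuclideanSpace ℝ ι) (i : ι) :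
    diag c x i = c i * x i := rfl

theorem coe_diagEquiv (c : ι → ℝ) (hc : ∀ i, c i ≠ 0) : ⇑(diagEquiv c hc) = diag c := rfl

theorem diag_diag (b c : ι → ℝ) (x : EuclideanSpace ℝ ι) :
    diag b (diag c x) = diag (fun i => b i * c i) x := by
  ext i; simp [mul_assoc]

theorem diag_one_apply (x : EuclideanSpace ℝ ι) : diag (fun _ => 1) x = x := by
  ext i; simp

theorem partialDeriv_comp_diag {𝕜 : Type*} [RCLike 𝕜] [LinearOrder ι] (c : ι → ℝ)
    (hc : ∀ i, c i ≠ 0) (f : EuclideanSpace ℝ ι → 𝕜) (α : ι → ℕ) (x : EuclideanSpace ℝ ι) :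
    partialDeriv α (fun y => f (diag c y)) x =
      ((∏ i, c i ^ α i : ℝ) : 𝕜) * partialDeriv α f (diag c x) := by
  have h : iteratedFDeriv ℝ (coordList α).length (f ∘ ⇑(diagEquiv c hc)) x =
      (iteratedFDeriv ℝ (coordList α).length f (diagEquiv c hc x)).compContinuousLinearMap
        fun _ => (diagEquiv c hc : EuclideanSpace ℝ ι →L[ℝ] EuclideanSpace ℝ ι) := by
    have := (diagEquiv c hc).iteratedFDerivWithin_comp_right f uniqueDiffOn_univ
      (Set.mem_univ (diagEquiv c hc x)) (coordList α).length
    simpa only [Set.preimage_univ, iteratedFDerivWithin_univ] using this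
  rw [partialDeriv, partialDeriv]
  change iteratedFDeriv ℝ _ (f ∘ ⇑(diagEquiv c hc)) x _ = _
  rw [h]
  simp only [ContinuousMultilinearMap.compContinuousLinearMap_apply, coe_diagEquiv]
  have h2 : (fun t => (diagEquiv c hc : EuclideanSpace ℝ ι →L[ℝ] EuclideanSpace ℝ ι)
      (EuclideanSpace.single ((coordList α).get t) (1 : ℝ))) =
      fun t => c ((coordList α).get t) • EuclideanSpace.single ((coordList α).get t) (1 : ℝ) := by
    funext t; ext j
    change c j * _ = _
    by_cases hj : j = (coordList α).get t
    · subst hj; simp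
    · have hj' : j ≠ (coordList α)[(t : ℕ)] := hj
      simp [hj']
  rw [h2, ContinuousMultilinearMap.map_smul_univ, RCLike.real_smul_eq_coe_mul]
  congr 2
  have h3 : ∏ t, c ((coordList α).get t) = ((coordList α).map c).prod := by
    rw [← List.prod_ofFn]
    congr 1
    conv_rhs => rw [← List.ofFn_get (coordList α)]
    rw [List.map_ofFn]
    rfl
  rw [h3, Finset.prod_list_map_count]
  simp only [count_coordList]
  refine Finset.prod_subset (Finset.subset_univ _) fun i _ hi => ?_
  have : (coordList α).count i = 0 := List.count_eq_zero.2 (by simpa using hi)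
  rw [count_coordList] at this
  simp [this]

end Diagonal

/-! ### Smoothness of integrals depending on a parameter -/

section ParametricIntegrals

variable {P Y : Type} [NormedAddCommGroup P] [NormedSpace ℝ P] [FiniteDimensional ℝ P]
  [NormedAddCommGroup Y] [NormedSpace ℝ Y] [FiniteDimensional ℝ Y] [MeasurableSpace Y]
  [BorelSpace Y] {μ : Measure Y} [IsFiniteMeasureOnCompacts μ]

/-- Differentiation under the integral sign, for an integrand that vanishes off a compact set which
does not depend on the parameter. -/
theorem hasFDerivAt_integral_of_compact {F : Type*} [NormedAddCommGroup F] [NormedSpace ℝ F]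
    {g : P → Y → F} (hg : ContDiff ℝ 1 (Function.uncurry g)) {K : Set Y} (hK : IsCompact K)
    (h0 : ∀ p, ∀ y ∉ K, g p y = 0) (p : P) :
    HasFDerivAt (fun p => ∫ y, g p y ∂μ) (∫ y, fderiv ℝ (fun p => g p y) p ∂μ) p := by
  have hproper : ProperSpace P := FiniteDimensional.proper ℝ P
  have hproper' : ProperSpace Y := FiniteDimensional.proper ℝ Y
  have hD : Continuous fun q : P × Y => fderiv ℝ (fun p => g p q.2) q.1 := by
    refine (ContDiff.fderiv (m := 1) (n := 0) (f := fun (q : P × Y) (p : P) => g p q.2)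
      (g := Prod.fst) ?_ contDiff_fst (by simp)).continuous
    exact hg.comp (contDiff_snd.prodMk (contDiff_snd.comp contDiff_fst))
  have hcont : ∀ p, Continuous (g p) := fun p =>
    hg.continuous.comp (Continuous.prodMk_right p)
  have hD0 : ∀ q, ∀ y ∉ K, fderiv ℝ (fun p => g p y) q = 0 := by
    intro q y hy
    have : (fun p => g p y) = fun _ => 0 := funext fun p => h0 p y hy
    rw [this]; simp
  obtain ⟨C, hC⟩ := (((isCompact_closedBall p 1).prod hK).image hD).isBounded.exists_norm_le
  have hsupp : ∀ q, HasCompactSupport (g q) := fun q => HasCompactSupport.intro hK (h0 q)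
  refine hasFDerivAt_integral_of_dominated_of_fderiv_le (s := Metric.closedBall p 1)
    (bound := K.indicator fun _ => C)
    (F' := fun q y => fderiv ℝ (fun p => g p y) q)
    (Metric.closedBall_mem_nhds p one_pos) ?_ ?_ ?_ ?_ ?_ ?_
  · exact Filter.Eventually.of_forall fun q => (hcont q).aestronglyMeasurable
  · exact (hcont p).integrable_of_hasCompactSupport (hsupp p)
  · exact (hD.comp (Continuous.prodMk_right p)).aestronglyMeasurable
  · refine Filter.Eventually.of_forall fun y q hq => ?_
    by_cases hy : y ∈ K
    · rw [Set.indicator_of_mem hy]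
      exact hC _ ⟨(q, y), ⟨hq, hy⟩, rfl⟩
    · rw [hD0 q y hy, Set.indicator_of_notMem hy, norm_zero]
  · exact (integrable_indicator_iff hK.measurableSet).2
      (integrableOn_const (hs := hK.measure_lt_top.ne))
  · refine Filter.Eventually.of_forall fun y q _ => ?_
    have : ContDiff ℝ 1 fun p => g p y := hg.comp (contDiff_id.prodMk contDiff_const)
    exact (this.differentiable (by simp) q).hasFDerivAt

theorem contDiff_integral_of_compact {F : Type*} [NormedAddCommGroup F] [NormedSpace ℝ F]
    [CompleteSpace F] {g : P → Y → F} (hg : ContDiff ℝ ∞ (Function.uncurry g)) {K : Set Y}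
    (hK : IsCompact K) (h0 : ∀ p, ∀ y ∉ K, g p y = 0) : ContDiff ℝ ∞ fun p => ∫ y, g p y ∂μ := by
  rw [contDiff_infty]
  intro m
  induction m generalizing F with
  | zero =>
    exact contDiff_zero.2 (continuous_iff_continuousAt.2 fun p =>
      (hasFDerivAt_integral_of_compact (μ := μ) (hg.of_le (by simp)) hK h0 p).continuousAt)
  | succ m ih =>
    have hF := fun p => hasFDerivAt_integral_of_compact (μ := μ) (hg.of_le (by simp)) hK h0 p
    push_cast
    rw [contDiff_succ_iff_fderiv]
    refine ⟨fun p => (hF p).differentiableAt, by simp, ?_⟩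
    have : (fderiv ℝ fun p => ∫ y, g p y ∂μ) =
        fun p => ∫ y, fderiv ℝ (fun p => g p y) p ∂μ := funext fun p => (hF p).fderiv
    rw [this]
    refine ih (g := fun p y => fderiv ℝ (fun p => g p y) p) ?_ ?_
    · refine ContDiff.fderiv (m := ∞) (f := fun (q : P × Y) (p : P) => g p q.2)
        (g := Prod.fst) ?_ contDiff_fst (by simp)
      exact hg.comp (contDiff_snd.prodMk (contDiff_snd.comp contDiff_fst))
    · intro q y hy
      have : (fun p => g p y) = fun _ => 0 := funext fun p => h0 p y hy
      rw [this]; simp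

theorem dirDeriv_integral_of_compact {F : Type*} [NormedAddCommGroup F] [NormedSpace ℝ F]
    [CompleteSpace F] {g : P → Y → F} (hg : ContDiff ℝ ∞ (Function.uncurry g)) {K : Set Y}
    (hK : IsCompact K) (h0 : ∀ p, ∀ y ∉ K, g p y = 0) (l : List P) :
    ContDiff ℝ ∞ (Function.uncurry fun p y => dirDeriv l (fun p => g p y) p) ∧
    (∀ p, ∀ y ∉ K, dirDeriv l (fun p => g p y) p = 0) ∧
    dirDeriv l (fun p => ∫ y, g p y ∂μ) = fun p => ∫ y, dirDeriv l (fun p => g p y) p ∂μ := by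
  have hproper : ProperSpace P := FiniteDimensional.proper ℝ P
  have hproper' : ProperSpace Y := FiniteDimensional.proper ℝ Y
  induction l with
  | nil => exact ⟨hg, h0, rfl⟩
  | cons v l ih =>
    obtain ⟨h1, h2, h3⟩ := ih
    have hD : ContDiff ℝ ∞ fun q : P × Y =>
        fderiv ℝ (fun p => dirDeriv l (fun p => g p q.2) p) q.1 := by
      refine ContDiff.fderiv (m := ∞)
        (f := fun (q : P × Y) (p : P) => dirDeriv l (fun p => g p q.2) p)
        (g := Prod.fst) ?_ contDiff_fst (by simp)
      exact h1.comp (contDiff_snd.prodMk (contDiff_snd.comp contDiff_fst))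
    have hD0 : ∀ q, ∀ y ∉ K, fderiv ℝ (fun p => dirDeriv l (fun p => g p y) p) q = 0 := by
      intro q y hy
      have : (fun p => dirDeriv l (fun p => g p y) p) = fun _ => 0 := funext fun p => h2 p y hy
      rw [this]; simp
    refine ⟨hD.clm_apply contDiff_const, fun p y hy => ?_, ?_⟩
    · change fderiv ℝ (fun p => dirDeriv l (fun p => g p y) p) p v = 0
      rw [hD0 p y hy]; rfl
    · funext p
      change fderiv ℝ (dirDeriv l fun p => ∫ y, g p y ∂μ) p v =
        ∫ y, fderiv ℝ (fun p => dirDeriv l (fun p => g p y) p) p v ∂μ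
      rw [h3, (hasFDerivAt_integral_of_compact (h1.of_le (by simp)) hK h2 p).fderiv]
      refine ContinuousLinearMap.integral_apply ?_ v
      refine Continuous.integrable_of_hasCompactSupport
        (hD.continuous.comp (Continuous.prodMk_right p)) ?_
      exact HasCompactSupport.intro hK (hD0 p)

end ParametricIntegrals

theorem partialDeriv_integral_of_compact {𝕜 : Type*} [RCLike 𝕜] {ι : Type} [Fintype ι]
    [LinearOrder ι] {Y : Type} [NormedAddCommGroup Y] [NormedSpace ℝ Y] [FiniteDimensional ℝ Y]
    [MeasurableSpace Y] [BorelSpace Y] {μ : Measure Y} [IsFiniteMeasureOnCompacts μ]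
    {g : EuclideanSpace ℝ ι → Y → 𝕜} (hg : ContDiff ℝ ∞ (Function.uncurry g)) {K : Set Y}
    (hK : IsCompact K) (h0 : ∀ p, ∀ y ∉ K, g p y = 0) (α : ι → ℕ) (x : EuclideanSpace ℝ ι) :
    partialDeriv α (fun p => ∫ y, g p y ∂μ) x = ∫ y, partialDeriv α (fun p => g p y) x ∂μ := by
  rw [partialDeriv_eq_dirDeriv isOpen_univ
    (contDiff_integral_of_compact hg hK h0).contDiffOn α (Set.mem_univ x),
    (dirDeriv_integral_of_compact hg hK h0 _).2.2]
  refine integral_congr_ae (Filter.Eventually.of_forall fun y => ?_)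
  have : ContDiff ℝ ∞ fun p => g p y := hg.comp (contDiff_id.prodMk contDiff_const)
  exact (partialDeriv_eq_dirDeriv isOpen_univ this.contDiffOn α (Set.mem_univ x)).symm

/-! ### Integrals on Euclidean spaces -/

section Fubini

variable {ι : Type}

/-- The point with coordinates `u i` where `p i` holds and `v i` elsewhere. -/
def glue (p : ι → Prop) [DecidablePred p] (u : EuclideanSpace ℝ {i // p i})
    (v : EuclideanSpace ℝ {i // ¬ p i}) : EuclideanSpace ℝ ι :=
  WithLp.toLp 2 fun i => if h : p i then u ⟨i, h⟩ else v ⟨i, h⟩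

variable (p : ι → Prop) [DecidablePred p]

theorem glue_apply (u : EuclideanSpace ℝ {i // p i}) (v : EuclideanSpace ℝ {i // ¬ p i}) (i : ι) :
    glue p u v i = if h : p i then u ⟨i, h⟩ else v ⟨i, h⟩ := rfl

variable [Fintype ι]

theorem contDiff_glue : ContDiff ℝ ∞ fun q : EuclideanSpace ℝ {i // p i} ×
    EuclideanSpace ℝ {i // ¬ p i} => glue p q.1 q.2 := by
  refine contDiff_euclidean.2 fun i => ?_
  by_cases h : p i
  · simp only [glue_apply, h, dite_true]
    exact (contDiff_euclidean.1 contDiff_fst _)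
  · simp only [glue_apply, h, dite_false]
    exact (contDiff_euclidean.1 contDiff_snd _)

theorem measurePreserving_glue :
    MeasurePreserving (fun q : EuclideanSpace ℝ {i // p i} × EuclideanSpace ℝ {i // ¬ p i} =>
      glue p q.1 q.2) := by
  have h1 := (volume_preserving_piEquivPiSubtypeProd (fun _ : ι => ℝ) p).symm
  have h2 := (PiLp.volume_preserving_ofLp {i // p i}).prod
    (PiLp.volume_preserving_ofLp {i // ¬ p i})
  exact (PiLp.volume_preserving_toLp ι).comp (h1.comp h2)

theorem measurableEmbedding_glue :
    MeasurableEmbedding (fun q : EuclideanSpace ℝ {i // p i} × EuclideanSpace ℝ {i // ¬ p i} =>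
      glue p q.1 q.2) := by
  refine MeasurableEmbedding.of_measurable_inverse (g := fun x : EuclideanSpace ℝ ι =>
    ((WithLp.toLp 2 fun i => x i.1, WithLp.toLp 2 fun i => x i.1) :
      EuclideanSpace ℝ {i // p i} × EuclideanSpace ℝ {i // ¬ p i}))
    (contDiff_glue p).continuous.measurable ?_ ?_ ?_
  · have : (Set.range fun q : EuclideanSpace ℝ {i // p i} × EuclideanSpace ℝ {i // ¬ p i} =>
        glue p q.1 q.2) = Set.univ := by
      refine Set.eq_univ_of_forall fun x => ⟨(WithLp.toLp 2 fun i => x i.1,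
        WithLp.toLp 2 fun i => x i.1), ?_⟩
      ext i; simp [glue_apply]
    rw [this]; exact MeasurableSet.univ
  · refine Continuous.measurable ?_
    fun_prop
  · rintro ⟨u, v⟩
    refine Prod.ext ?_ ?_
    · ext i; simp [glue_apply, i.2]
    · ext i; simp [glue_apply, i.2]

theorem integral_glue {F : Type*} [NormedAddCommGroup F] [NormedSpace ℝ F]
    {f : EuclideanSpace ℝ ι → F} (hf : Integrable f) :
    ∫ x, f x = ∫ u, ∫ v, f (glue p u v) := by
  rw [← (measurePreserving_glue p).integral_comp (measurableEmbedding_glue p)]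
  exact integral_prod _ ((measurePreserving_glue p).integrable_comp_of_integrable hf)

theorem integral_comp_diag {F : Type*} [NormedAddCommGroup F] [NormedSpace ℝ F] (c : ι → ℝ)
    (hc : ∀ i, 0 < c i) (f : EuclideanSpace ℝ ι → F) :
    ∫ x, f x = (∏ i, c i) • ∫ x, f (diag c x) := by
  classical
  have hdet : (Matrix.diagonal c).det = ∏ i, c i := Matrix.det_diagonal
  have hpos : 0 < ∏ i, c i := Finset.prod_pos fun i _ => hc i
  have h := Real.smul_map_diagonal_volume_pi (D := c) (by rw [hdet]; exact hpos.ne')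
  rw [hdet, abs_of_pos hpos] at h
  have e1 : ∀ g : EuclideanSpace ℝ ι → F, ∫ x, g x = ∫ y : ι → ℝ, g (WithLp.toLp 2 y) := fun g =>
    ((PiLp.volume_preserving_toLp ι).integral_comp
      (MeasurableEquiv.toLp 2 (ι → ℝ)).measurableEmbedding g).symm
  rw [e1, e1]
  conv_lhs => rw [← h]
  rw [integral_smul_measure, ENNReal.toReal_ofReal hpos.le]
  congr 1
  have hemb : MeasurableEmbedding (Matrix.toLin' (Matrix.diagonal c)) := by
    refine Measurable.measurableEmbedding
      (LinearMap.continuous_of_finiteDimensional _).measurable ?_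
    intro x y hxy
    funext i
    have := congrFun hxy i
    simp only [Matrix.toLin'_apply, Matrix.mulVec_diagonal] at this
    exact mul_left_cancel₀ (hc i).ne' this
  rw [hemb.integral_map]
  refine integral_congr_ae (Filter.Eventually.of_forall fun y => ?_)
  change f (WithLp.toLp 2 (Matrix.toLin' (Matrix.diagonal c) y)) = f (diag c (WithLp.toLp 2 y))
  congr 1
  ext i
  simp [Matrix.mulVec_diagonal]

end Fubini

/-! ### Dyadic sums -/

section DyadicSums

/-- The function `min (t ^ ε) (t ^ (-ε))`, which measures the distance of `t` from `1` on a
logarithmic scale. -/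
def decay (ε t : ℝ) : ℝ := min (t ^ ε) (t ^ (-ε))

theorem decay_nonneg {ε t : ℝ} (ht : 0 < t) : 0 ≤ decay ε t :=
  le_min (Real.rpow_nonneg ht.le _) (Real.rpow_nonneg ht.le _)

theorem decay_le_one {ε t : ℝ} (hε : 0 ≤ ε) (ht : 0 < t) : decay ε t ≤ 1 := by
  rcases le_total t 1 with h | h
  · exact (min_le_left _ _).trans (Real.rpow_le_one ht.le h hε)
  · exact (min_le_right _ _).trans (Real.rpow_le_one_of_one_le_of_nonpos h (by linarith))

theorem decay_rpow {ε t s : ℝ} (ht : 0 < t) (hs : 0 ≤ s) : decay ε t ^ s = decay (ε * s) t := by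
  have e1 : t ^ (ε * s) = (t ^ ε) ^ s := Real.rpow_mul ht.le _ _
  have e2 : t ^ (-(ε * s)) = (t ^ (-ε)) ^ s := by rw [← Real.rpow_mul ht.le]; ring_nf
  have hp := Real.rpow_nonneg ht.le ε
  have hn := Real.rpow_nonneg ht.le (-ε)
  rw [decay, decay, e1, e2]
  rcases le_total (t ^ ε) (t ^ (-ε)) with h | h
  · rw [min_eq_left h, min_eq_left (Real.rpow_le_rpow hp h hs)]
  · rw [min_eq_right h, min_eq_right (Real.rpow_le_rpow hn h hs)]

theorem summable_pow_natAbs {r : ℝ} (h0 : 0 ≤ r) (h1 : r < 1) :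
    Summable fun j : ℤ => r ^ j.natAbs := by
  refine Summable.of_nat_of_neg ?_ ?_ <;> simpa using summable_geometric_of_lt_one h0 h1

/-- The sum of `decay` over all dyadic scales is bounded uniformly in the centre `x⁻¹`. -/
theorem exists_sum_decay_le {ε : ℝ} (hε : 0 < ε) :
    ∃ C : ℝ, 1 ≤ C ∧ ∀ x : ℝ, 0 < x → ∀ F : Finset ℤ,
      ∑ i ∈ F, decay ε ((2 : ℝ) ^ (i : ℝ) * x) ≤ C := by
  set r : ℝ := (2 : ℝ) ^ (-ε) with hr
  have hr0 : 0 < r := by positivity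
  have hr1 : r < 1 := Real.rpow_lt_one_of_one_lt_of_neg one_lt_two (by linarith)
  have hs := summable_pow_natAbs hr0.le hr1
  have hnn : 0 ≤ (2 : ℝ) ^ ε * ∑' j : ℤ, r ^ j.natAbs :=
    mul_nonneg (by positivity) (tsum_nonneg fun j => by positivity)
  refine ⟨1 + (2 : ℝ) ^ ε * ∑' j : ℤ, r ^ j.natAbs, by linarith, fun x hx F => ?_⟩
  -- With `x = 2 ^ s`, the summand is a power of `2 ^ (-ε)` whose exponent differs from
  -- `|i + ⌊s⌋|` by at most one.
  set s := Real.logb 2 x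
  have hxs : x = (2 : ℝ) ^ s := (Real.rpow_logb two_pos (by norm_num) hx).symm
  have key : ∀ i : ℤ, decay ε ((2 : ℝ) ^ (i : ℝ) * x) ≤ (2 : ℝ) ^ ε * r ^ (i + ⌊s⌋).natAbs := by
    intro i
    have e : (2 : ℝ) ^ (i : ℝ) * x = (2 : ℝ) ^ ((i : ℝ) + s) := by
      rw [hxs, ← Real.rpow_add two_pos]
    have hcast : ((i + ⌊s⌋).natAbs : ℝ) = |(i : ℝ) + ⌊s⌋| := by
      rw [Nat.cast_natAbs]; push_cast; rfl
    have hrp : (2 : ℝ) ^ ε * r ^ (i + ⌊s⌋).natAbs =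
        (2 : ℝ) ^ (ε - ε * |(i : ℝ) + ⌊s⌋|) := by
      rw [hr, ← Real.rpow_natCast, hcast, ← Real.rpow_mul two_pos.le, ← Real.rpow_add two_pos]
      ring_nf
    rw [e, hrp, decay, ← Real.rpow_mul two_pos.le, ← Real.rpow_mul two_pos.le]
    have hf1 := Int.floor_le s
    have hf2 := Int.lt_floor_add_one s
    rcases le_total 0 ((i : ℝ) + ⌊s⌋) with h | h
    · refine (min_le_right _ _).trans (Real.rpow_le_rpow_of_exponent_le one_le_two ?_)
      rw [abs_of_nonneg h]; nlinarith
    · refine (min_le_left _ _).trans (Real.rpow_le_rpow_of_exponent_le one_le_two ?_)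
      rw [abs_of_nonpos h]; nlinarith
  calc ∑ i ∈ F, decay ε ((2 : ℝ) ^ (i : ℝ) * x)
      ≤ ∑ i ∈ F, (2 : ℝ) ^ ε * r ^ (i + ⌊s⌋).natAbs := Finset.sum_le_sum fun i _ => key i
    _ = (2 : ℝ) ^ ε * ∑ j ∈ F.map (Equiv.addRight ⌊s⌋).toEmbedding, r ^ j.natAbs := by
        rw [Finset.sum_map, Finset.mul_sum]; rfl
    _ ≤ (2 : ℝ) ^ ε * ∑' j : ℤ, r ^ j.natAbs := by
        gcongr
        exact hs.sum_le_tsum _ fun j _ => by positivity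
    _ ≤ _ := by linarith

/-- Products of `decay`, one factor for each `e`, are summable over any family of multi-indices
that is determined by the entries which occur, with a bound independent of the centres. -/
theorem exists_sum_prod_decay_le {Θ : Type*} [Fintype Θ] {ε : ℝ} (hε : 0 < ε) :
    ∃ C : ℝ, 0 < C ∧ ∀ {Λ : Type} (i : Λ → Θ → ℤ), Function.Injective i →
      ∀ x : Θ → ℝ, (∀ e, 0 < x e) → ∀ F : Finset Λ,
      ∑ a ∈ F, ∏ e, decay ε ((2 : ℝ) ^ (i a e : ℝ) * x e) ≤ C := by
  classical
  obtain ⟨C, hC1, hC⟩ := exists_sum_decay_le hε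
  refine ⟨C ^ Fintype.card Θ, by positivity, fun {Λ} i hi x hx F => ?_⟩
  have hnn : ∀ e (j : ℤ), 0 ≤ decay ε ((2 : ℝ) ^ (j : ℝ) * x e) := fun e j =>
    decay_nonneg (mul_pos (by positivity) (hx e))
  calc ∑ a ∈ F, ∏ e, decay ε ((2 : ℝ) ^ (i a e : ℝ) * x e)
      = ∑ j ∈ F.map ⟨i, hi⟩, ∏ e, decay ε ((2 : ℝ) ^ (j e : ℝ) * x e) := by
        rw [Finset.sum_map]; rfl
    _ ≤ ∑ j ∈ Fintype.piFinset fun e => F.image fun a => i a e,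
        ∏ e, decay ε ((2 : ℝ) ^ (j e : ℝ) * x e) := by
        refine Finset.sum_le_sum_of_subset_of_nonneg ?_ fun j _ _ =>
          Finset.prod_nonneg fun e _ => hnn e _
        intro j hj
        obtain ⟨a, ha, rfl⟩ := Finset.mem_map.1 hj
        exact Fintype.mem_piFinset.2 fun e => Finset.mem_image.2 ⟨a, ha, rfl⟩
    _ = ∏ e, ∑ j ∈ F.image fun a => i a e, decay ε ((2 : ℝ) ^ (j : ℝ) * x e) := by
        rw [Finset.prod_univ_sum]
    _ ≤ ∏ _e : Θ, C := by
        refine Finset.prod_le_prod (fun e _ => Finset.sum_nonneg fun j _ => hnn e j) ?_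
        intro e _
        exact hC (x e) (hx e) _
    _ = C ^ Fintype.card Θ := by simp

/-- For `t` bounded below, a negative power of `t` is controlled by `decay`. -/
theorem rpow_neg_le_decay {ε q c t : ℝ} (hε : 0 ≤ ε) (hq : ε ≤ q) (hc : 0 < c) (hct : c ≤ t) :
    t ^ (-q) ≤ (1 + c ^ (-(q + ε))) * decay ε t := by
  have ht : 0 < t := hc.trans_le hct
  have hcp : 0 ≤ c ^ (-(q + ε)) := Real.rpow_nonneg hc.le _
  rcases le_total t 1 with h | h
  · have hd : decay ε t = t ^ ε :=
      min_eq_left (Real.rpow_le_rpow_of_exponent_ge ht h (by linarith))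
    have e : t ^ (-q) = t ^ (-(q + ε)) * t ^ ε := by rw [← Real.rpow_add ht]; ring_nf
    rw [hd, e]
    have h1 : t ^ (-(q + ε)) ≤ c ^ (-(q + ε)) :=
      Real.rpow_le_rpow_of_nonpos hc hct (by linarith)
    gcongr
    linarith
  · have hd : decay ε t = t ^ (-ε) :=
      min_eq_right (Real.rpow_le_rpow_of_exponent_le h (by linarith))
    have h1 : t ^ (-q) ≤ t ^ (-ε) := Real.rpow_le_rpow_of_exponent_le h (by linarith)
    rw [hd]
    nlinarith [Real.rpow_nonneg ht.le (-ε)]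

/-- The minimum of finitely many numbers in `[0, 1]` is at most the product of their powers with
exponents adding up to at most one. -/
theorem le_prod_rpow_of_forall_le {Θ : Type*} (s : Finset Θ) {a : ℝ} (ha : 0 ≤ a) (ha1 : a ≤ 1)
    {g : Θ → ℝ} (h : ∀ e ∈ s, a ≤ g e) {n : ℕ} (hn : s.card ≤ n) (hn0 : 0 < n) :
    a ≤ ∏ e ∈ s, g e ^ (1 / (n : ℝ)) := by
  have hn' : (0 : ℝ) < n := by exact_mod_cast hn0
  calc a ≤ a ^ ((s.card : ℝ) * (1 / n)) := by
        rcases ha.eq_or_lt with rfl | hpos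
        · exact Real.rpow_nonneg le_rfl _
        · conv_lhs => rw [← Real.rpow_one a]
          refine Real.rpow_le_rpow_of_exponent_ge hpos ha1 ?_
          rw [mul_one_div, div_le_one hn']
          exact_mod_cast hn
    _ = ∏ _e ∈ s, a ^ (1 / (n : ℝ)) := by
        rw [Finset.prod_const, ← Real.rpow_natCast, ← Real.rpow_mul ha]; ring_nf
    _ ≤ _ := Finset.prod_le_prod (fun e _ => Real.rpow_nonneg ha _) fun e he =>
        Real.rpow_le_rpow ha (h e he) (by positivity)

end DyadicSums

/-! ### Series of functions adapted to increasing scales -/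

theorem exists_pos_forall_le {ι : Type*} [Finite ι] (f : ι → ℝ) (hf : ∀ i, 0 < f i) :
    ∃ δ : ℝ, 0 < δ ∧ ∀ i, δ ≤ f i := by
  cases isEmpty_or_nonempty ι
  · exact ⟨1, one_pos, fun i => isEmptyElim i⟩
  · obtain ⟨i, hi⟩ := Finite.exists_min f
    exact ⟨f i, hf i, hi⟩

section Series

variable {𝕜 : Type*} [RCLike 𝕜] {ι : Type} [Fintype ι] [LinearOrder ι] {n : ℕ}

theorem isOpen_offFirst (π : ι → Fin n) (L : Finset (Fin n)) : IsOpen (offFirst π L) := by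
  have : offFirst π L = ⋂ k ∈ {k | k ∈ L ∧ ∀ l ∈ L, k ≤ l}, ⋃ s ∈ {s | π s = k},
      {x : EuclideanSpace ℝ ι | x s ≠ 0} := by
    ext x; simp [offFirst]
  rw [this]
  refine (Set.toFinite _).isOpen_biInter fun k _ => isOpen_biUnion fun s _ => ?_
  exact isOpen_ne_fun (by fun_prop) continuous_const

theorem blockNorm_le_iff {d : ι → ℝ} (hd : ∀ i, 0 < d i) (π : ι → Fin n) (l : Fin n)
    (x : EuclideanSpace ℝ ι) {R : ℝ} (hR : 0 ≤ R) :
    blockNorm d π l x ≤ R ↔ ∀ s, π s = l → |x s| ≤ R ^ d s := by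
  have key : ∀ s, |x s| ^ (1 / d s) ≤ R ↔ |x s| ≤ R ^ d s := by
    intro s
    rw [one_div, Real.rpow_inv_le_iff_of_pos (abs_nonneg _) hR (hd s)]
  constructor
  · intro h s hs
    refine (key s).1 (le_trans ?_ h)
    exact le_ciSup (f := fun s : {s // π s = l} => |x s.1| ^ (1 / d s.1))
      (Set.finite_range _).bddAbove ⟨s, hs⟩
  · intro h
    exact Real.iSup_le (fun s => (key s.1).2 (h s.1 s.2)) hR

theorem blockNorm_nonneg (d : ι → ℝ) (π : ι → Fin n) (l : Fin n) (x : EuclideanSpace ℝ ι) :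
    0 ≤ blockNorm d π l x :=
  Real.iSup_nonneg fun _ => Real.rpow_nonneg (abs_nonneg _) _

theorem blockNorm_pos {d : ι → ℝ} (hd : ∀ i, 0 < d i) {π : ι → Fin n} {l : Fin n}
    {x : EuclideanSpace ℝ ι} {s : ι} (hs : π s = l) (hx : x s ≠ 0) : 0 < blockNorm d π l x := by
  by_contra h
  have := (blockNorm_le_iff hd π l x le_rfl).1 (not_lt.1 h) s hs
  rw [Real.zero_rpow (hd s).ne'] at this
  exact hx (abs_nonpos_iff.1 this)

/-- The sum of the norms of the components up to the factor `l`. -/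
def partialNorm (d : ι → ℝ) (π : ι → Fin n) (L : Finset (Fin n)) (l : Fin n)
    (x : EuclideanSpace ℝ ι) : ℝ :=
  ∑ l' ∈ L with l' ≤ l, blockNorm d π l' x

theorem partialNorm_pos {d : ι → ℝ} (hd : ∀ i, 0 < d i) {π : ι → Fin n} {L : Finset (Fin n)}
    {l : Fin n} (hl : l ∈ L) {x : EuclideanSpace ℝ ι} (hx : x ∈ offFirst π L) :
    0 < partialNorm d π L l x := by
  have hne : L.Nonempty := ⟨l, hl⟩
  obtain ⟨s, hs, hxs⟩ := hx (L.min' hne) (L.min'_mem hne) fun l hl => L.min'_le l hl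
  refine Finset.sum_pos' (fun l' _ => blockNorm_nonneg d π l' x) ⟨L.min' hne, ?_, ?_⟩
  · exact Finset.mem_filter.2 ⟨L.min'_mem hne, L.min'_le l hl⟩
  · exact blockNorm_pos hd hs hxs

/-- The exponent `Q_l + ⟦α_l⟧`. -/
def blockExponent (d : ι → ℝ) (π : ι → Fin n) (α : ι → ℕ) (l : Fin n) : ℝ :=
  (∑ s with π s = l, d s) + ∑ s with π s = l, (α s : ℝ) * d s

theorem flagWeight_eq (d : ι → ℝ) (π : ι → Fin n) (L : Finset (Fin n)) (α : ι → ℕ)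
    (x : EuclideanSpace ℝ ι) :
    flagWeight d π L α x = ∏ l ∈ L, partialNorm d π L l x ^ (-blockExponent d π α l) := by
  unfold flagWeight partialNorm blockExponent
  refine Finset.prod_congr rfl fun l _ => ?_
  congr 1; ring

theorem le_blockExponent {d : ι → ℝ} (hd : ∀ i, 0 < d i) {π : ι → Fin n} {l : Fin n} {ε : ℝ}
    (hε : ε ≤ ∑ s with π s = l, d s) (α : ι → ℕ) : ε ≤ blockExponent d π α l := by
  have : 0 ≤ ∑ s with π s = l, (α s : ℝ) * d s :=
    Finset.sum_nonneg fun s _ => mul_nonneg (Nat.cast_nonneg _) (hd s).le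
  unfold blockExponent; linarith

/-- A family of functions `k a`, living at the scales `2 ^ sc a l` in the factors `l ∈ L`, with
weights `γ a` for which the scales are summable around any centre, uniformly. -/
structure AdaptedSeries (d : ι → ℝ) (π : ι → Fin n) (L : Finset (Fin n)) {Λ : Type}
    (sc : Λ → Fin n → ℤ) (γ : Λ → ℝ) (ε c Γ : ℝ) (k : Λ → EuclideanSpace ℝ ι → 𝕜) : Prop where
  dpos : ∀ i, 0 < d i
  εpos : 0 < ε
  cpos : 0 < c
  εle : ∀ l ∈ L, ε ≤ ∑ s with π s = l, d s
  γnonneg : ∀ a, 0 ≤ γ a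
  mono : ∀ a, ∀ l ∈ L, ∀ l' ∈ L, l' ≤ l → sc a l' ≤ sc a l
  smooth : ∀ a, ContDiff ℝ ∞ (k a)
  supp : ∀ a x, k a x ≠ 0 → ∀ s, |x s| ≤ (c * (2 : ℝ) ^ (sc a (π s) : ℝ)) ^ d s
  sum : ∀ ν : Fin n → ℝ, (∀ l ∈ L, 0 < ν l) → ∀ F : Finset Λ,
    ∑ a ∈ F, γ a * ∏ l ∈ L, decay ε ((2 : ℝ) ^ (sc a l : ℝ) * ν l) ≤ Γ

/-- The differential inequality for `∂^α` of the members of an adapted series. -/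
def SeriesBound (d : ι → ℝ) (π : ι → Fin n) (L : Finset (Fin n)) {Λ : Type}
    (sc : Λ → Fin n → ℤ) (γ : Λ → ℝ) (k : Λ → EuclideanSpace ℝ ι → 𝕜) (α : ι → ℕ) (B : ℝ) : Prop :=
  ∀ a x, ‖partialDeriv α (k a) x‖ ≤
    B * (γ a * ∏ l ∈ L, ((2 : ℝ) ^ (sc a l : ℝ)) ^ (-blockExponent d π α l))

variable {d : ι → ℝ} {π : ι → Fin n} {L : Finset (Fin n)} {Λ : Type}
    {sc : Λ → Fin n → ℤ} {γ : Λ → ℝ} {ε c Γ : ℝ} {k : Λ → EuclideanSpace ℝ ι → 𝕜}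

/-- On a compact set off the singular set, only the members whose scales are bounded below in all
factors contribute to the series. -/
theorem AdaptedSeries.localize (h : AdaptedSeries d π L sc γ ε c Γ k)
    {S : Set (EuclideanSpace ℝ ι)} (hS : IsCompact S) (hSL : S ⊆ offFirst π L) :
    ∃ (good : Set Λ) (δ : ℝ), 0 < δ ∧ (∀ a ∉ good, ∀ x ∈ S, k a x = 0) ∧
      ∀ a ∈ good, ∀ l ∈ L, δ ≤ (2 : ℝ) ^ (sc a l : ℝ) := by
  rcases L.eq_empty_or_nonempty with hL | hL
  · subst hL
    exact ⟨Set.univ, 1, one_pos, by simp, by simp⟩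
  set l₀ := L.min' hL with hl₀
  have hl₀L : l₀ ∈ L := L.min'_mem hL
  have hg : Continuous fun x : EuclideanSpace ℝ ι => ∑ s with π s = l₀, |x s| := by fun_prop
  obtain ⟨m, hm0, hm⟩ := hS.exists_forall_le' hg.continuousOn (a := 0) (by
    intro x hx
    obtain ⟨s, hs, hxs⟩ := hSL hx l₀ hl₀L fun l hl => L.min'_le l hl
    exact Finset.sum_pos' (fun _ _ => abs_nonneg _)
      ⟨s, by simp [hs], abs_pos.2 hxs⟩)
  -- If all coordinates of the first factor were smaller than `η`, their sum would be less than `m`;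
  -- so the scale of a contributing member in the first factor, and hence in all others, is at least
  -- `δ`.
  set η : ℝ := m / (Fintype.card ι + 1) with hη
  have hη0 : 0 < η := by positivity
  obtain ⟨δ, hδ0, hδ⟩ := exists_pos_forall_le (fun s : ι => η ^ (1 / d s) / c) fun s =>
    div_pos (Real.rpow_pos_of_pos hη0 _) h.cpos
  refine ⟨{a | ∃ s, π s = l₀ ∧ η ≤ (c * (2 : ℝ) ^ (sc a l₀ : ℝ)) ^ d s}, δ, hδ0, ?_, ?_⟩
  · intro a ha x hx
    by_contra hk
    have h1 : ∑ s with π s = l₀, |x s| ≤ ∑ s with π s = l₀, η := by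
      refine Finset.sum_le_sum fun s hs => ?_
      have hs' : π s = l₀ := by simpa using hs
      have h2 := h.supp a x hk s
      rw [hs'] at h2
      by_contra h3
      exact ha ⟨s, hs', (not_le.1 h3).le.trans h2⟩
    have h2 : ∑ s with π s = l₀, η ≤ Fintype.card ι * η := by
      rw [Finset.sum_const, nsmul_eq_mul]
      gcongr
      exact Finset.card_le_univ _
    have h3 : (Fintype.card ι : ℝ) * η < m := by
      have : m = (Fintype.card ι + 1) * η := by rw [hη]; field_simp
      rw [this]; linarith
    linarith [hm x hx]
  · rintro a ⟨s, hs, hle⟩ l hl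
    have hcp : 0 < c * (2 : ℝ) ^ (sc a l₀ : ℝ) := mul_pos h.cpos (by positivity)
    have h1 : η ^ (1 / d s) ≤ c * (2 : ℝ) ^ (sc a l₀ : ℝ) := by
      rw [one_div, Real.rpow_inv_le_iff_of_pos hη0.le hcp.le (h.dpos s)]; exact hle
    have h2 : (sc a l₀ : ℝ) ≤ sc a l := by
      exact_mod_cast h.mono a l hl l₀ hl₀L (L.min'_le l hl)
    calc δ ≤ η ^ (1 / d s) / c := hδ s
      _ ≤ (2 : ℝ) ^ (sc a l₀ : ℝ) := by rw [div_le_iff₀' h.cpos]; exact h1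
      _ ≤ _ := Real.rpow_le_rpow_of_exponent_le one_le_two h2

/-- Where the scales are bounded below, negative powers of the scales are dominated by `decay`, so
the derivatives of the members are summable. -/
theorem AdaptedSeries.summable_good (h : AdaptedSeries d π L sc γ ε c Γ k) {good : Set Λ} {δ : ℝ}
    (hδ : 0 < δ) (hgood : ∀ a ∈ good, ∀ l ∈ L, δ ≤ (2 : ℝ) ^ (sc a l : ℝ)) (α : ι → ℕ) :
    Summable (good.indicator fun a =>
      γ a * ∏ l ∈ L, ((2 : ℝ) ^ (sc a l : ℝ)) ^ (-blockExponent d π α l)) := by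
  set M : ℝ := ∏ l ∈ L, (1 + δ ^ (-(blockExponent d π α l + ε)))
  have hM : 0 ≤ M := Finset.prod_nonneg fun l _ => by positivity
  refine summable_of_sum_le (c := M * Γ) (fun a => ?_) fun F => ?_
  · exact Set.indicator_nonneg (fun a _ => mul_nonneg (h.γnonneg a)
      (Finset.prod_nonneg fun l _ => by positivity)) a
  · have h1 := h.sum (fun _ => 1) (fun _ _ => one_pos) F
    refine le_trans ?_ (mul_le_mul_of_nonneg_left h1 hM)
    rw [Finset.mul_sum]
    refine Finset.sum_le_sum fun a _ => ?_
    have hnn : 0 ≤ ∏ l ∈ L, decay ε ((2 : ℝ) ^ (sc a l : ℝ) * 1) :=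
      Finset.prod_nonneg fun l _ => decay_nonneg (by positivity)
    by_cases ha : a ∈ good
    · rw [Set.indicator_of_mem ha, mul_left_comm]
      refine mul_le_mul_of_nonneg_left ?_ (h.γnonneg a)
      rw [← Finset.prod_mul_distrib]
      refine Finset.prod_le_prod (fun l _ => by positivity) fun l hl => ?_
      rw [mul_one]
      exact rpow_neg_le_decay h.εpos.le (le_blockExponent h.dpos (h.εle l hl) α) hδ
        (hgood a ha l hl)
    · rw [Set.indicator_of_notMem ha]
      exact mul_nonneg hM (mul_nonneg (h.γnonneg a) hnn)

/-- Near a point off the singular set, the sum of an adapted series can be replaced by a series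
with globally summable derivatives. -/
theorem AdaptedSeries.exists_local_series (h : AdaptedSeries d π L sc γ ε c Γ k)
    (hB : ∀ α, ∃ B, 0 ≤ B ∧ SeriesBound d π L sc γ k α B) {x₀ : EuclideanSpace ℝ ι}
    (hx₀ : x₀ ∈ offFirst π L) :
    ∃ (good : Set Λ) (U : Set (EuclideanSpace ℝ ι)), IsOpen U ∧ x₀ ∈ U ∧
      (∀ a ∉ good, ∀ x ∈ U, k a x = 0) ∧
      (∀ α, Summable (good.indicator fun a =>
        γ a * ∏ l ∈ L, ((2 : ℝ) ^ (sc a l : ℝ)) ^ (-blockExponent d π α l))) ∧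
      ContDiff ℝ ∞ (fun x => ∑' a, good.indicator (fun a => k a) a x) ∧
      ∀ m, iteratedFDeriv ℝ m (fun x => ∑' a, good.indicator (fun a => k a) a x) x₀ =
        ∑' a, iteratedFDeriv ℝ m (good.indicator (fun a => k a) a) x₀ ∧
        Summable fun a => iteratedFDeriv ℝ m (good.indicator (fun a => k a) a) x₀ := by
  obtain ⟨r, hr0, hr⟩ := Metric.nhds_basis_closedBall.mem_iff.1
    ((isOpen_offFirst π L).mem_nhds hx₀)
  obtain ⟨good, δ, hδ, h1, h2⟩ := h.localize (isCompact_closedBall x₀ r) hr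
  choose B hB0 hB using hB
  have hsum := fun α => h.summable_good hδ h2 α
  have hsm : ∀ a, ContDiff ℝ ∞ (good.indicator (fun a => k a) a) := by
    intro a
    by_cases ha : a ∈ good
    · rw [Set.indicator_of_mem ha]; exact h.smooth a
    · rw [Set.indicator_of_notMem ha]; exact contDiff_const
  let v : ℕ → Λ → ℝ := fun m a => (Fintype.card ι : ℝ) ^ m *
    ∑ α ∈ Finset.piAntidiag (Finset.univ : Finset ι) m, B α * good.indicator (fun a =>
      γ a * ∏ l ∈ L, ((2 : ℝ) ^ (sc a l : ℝ)) ^ (-blockExponent d π α l)) a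
  have hv : ∀ m : ℕ, Summable (v m) := fun m =>
    Summable.mul_left _ (summable_sum fun α _ => (hsum α).mul_left _)
  have hnn : ∀ α a, 0 ≤ B α * good.indicator (fun a =>
      γ a * ∏ l ∈ L, ((2 : ℝ) ^ (sc a l : ℝ)) ^ (-blockExponent d π α l)) a := fun α a =>
    mul_nonneg (hB0 α) (Set.indicator_nonneg (fun a _ => mul_nonneg (h.γnonneg a)
      (Finset.prod_nonneg fun l _ => by positivity)) a)
  have hbd : ∀ (m : ℕ) (a : Λ) (x : EuclideanSpace ℝ ι),
      ‖iteratedFDeriv ℝ m (good.indicator (fun a => k a) a) x‖ ≤ v m a := by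
    intro m a x
    refine norm_iteratedFDeriv_le_of_partialDeriv isOpen_univ (hsm a).contDiffOn
      (Set.mem_univ x) (Finset.sum_nonneg fun α _ => hnn α a) fun α hα => ?_
    refine le_trans ?_ (Finset.single_le_sum (fun α _ => hnn α a)
      (Finset.mem_piAntidiag.2 ⟨hα, fun i _ => Finset.mem_univ i⟩))
    by_cases ha : a ∈ good
    · rw [Set.indicator_of_mem ha, Set.indicator_of_mem ha]; exact hB α a x
    · rw [Set.indicator_of_notMem ha, Set.indicator_of_notMem ha]
      refine (norm_partialDeriv_le _ _ _).trans ?_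
      change ‖iteratedFDeriv ℝ _ (fun _ => (0 : 𝕜)) x‖ ≤ _
      simp [iteratedFDeriv_fun_zero]
  refine ⟨good, Metric.ball x₀ r, Metric.isOpen_ball, Metric.mem_ball_self hr0, fun a ha x hx =>
    h1 a ha x (Metric.ball_subset_closedBall hx), hsum, ?_, fun m => ⟨?_, ?_⟩⟩
  · exact contDiff_tsum (N := ⊤) hsm (fun m _ => hv m) fun m a x _ => hbd m a x
  · exact iteratedFDeriv_tsum_apply (N := ⊤) hsm (fun m _ => hv m) (fun m a x _ => hbd m a x)
      le_top x₀
  · exact Summable.of_norm_bounded (hv m) fun a => hbd m a x₀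

theorem tsum_indicator_eq {good : Set Λ} {U : Set (EuclideanSpace ℝ ι)}
    (h1 : ∀ a ∉ good, ∀ x ∈ U, k a x = 0) {x : EuclideanSpace ℝ ι} (hx : x ∈ U) :
    ∑' a, k a x = ∑' a, good.indicator (fun a => k a) a x := by
  refine tsum_congr fun a => ?_
  by_cases ha : a ∈ good
  · rw [Set.indicator_of_mem ha]
  · rw [Set.indicator_of_notMem ha]; exact h1 a ha x hx

theorem AdaptedSeries.contDiffOn_tsum (h : AdaptedSeries d π L sc γ ε c Γ k)
    (hB : ∀ α, ∃ B, 0 ≤ B ∧ SeriesBound d π L sc γ k α B) :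
    ContDiffOn ℝ ∞ (fun x => ∑' a, k a x) (offFirst π L) := by
  intro x₀ hx₀
  obtain ⟨good, U, hU, hxU, h1, -, h3, -⟩ := h.exists_local_series hB hx₀
  refine (h3.contDiffAt.congr_of_eventuallyEq ?_).contDiffWithinAt
  filter_upwards [hU.mem_nhds hxU] with x hx
  exact tsum_indicator_eq h1 hx

/-- The constant in the differential inequalities of the sum of an adapted series. -/
def seriesConst (d : ι → ℝ) (π : ι → Fin n) (L : Finset (Fin n)) (ε c : ℝ) (α : ι → ℕ) : ℝ :=
  ∏ l ∈ L, (1 + (1 / ((n + 1) * c)) ^ (-(blockExponent d π α l + ε)))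

theorem seriesConst_nonneg (hc : 0 < c) (α : ι → ℕ) : 0 ≤ seriesConst d π L ε c α :=
  Finset.prod_nonneg fun l _ => by positivity

/-- On the support of a member of the series, the partial norms are bounded by the scales, because
the scales increase. -/
theorem partialNorm_le (h : AdaptedSeries d π L sc γ ε c Γ k) {a : Λ} {x : EuclideanSpace ℝ ι}
    (hx : ∀ s, |x s| ≤ (c * (2 : ℝ) ^ (sc a (π s) : ℝ)) ^ d s) {l : Fin n} (hl : l ∈ L) :
    partialNorm d π L l x ≤ (n + 1) * c * (2 : ℝ) ^ (sc a l : ℝ) := by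
  have hcp : 0 < c * (2 : ℝ) ^ (sc a l : ℝ) := mul_pos h.cpos (by positivity)
  have h1 : ∀ l' ∈ L.filter (· ≤ l), blockNorm d π l' x ≤ c * (2 : ℝ) ^ (sc a l : ℝ) := by
    intro l' hl'
    rw [Finset.mem_filter] at hl'
    have h2 : (sc a l' : ℝ) ≤ sc a l := by exact_mod_cast h.mono a l hl l' hl'.1 hl'.2
    have h3 : blockNorm d π l' x ≤ c * (2 : ℝ) ^ (sc a l' : ℝ) := by
      refine (blockNorm_le_iff h.dpos π l' x (mul_pos h.cpos (by positivity)).le).2 ?_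
      rintro s rfl
      exact hx s
    refine h3.trans (mul_le_mul_of_nonneg_left ?_ h.cpos.le)
    exact Real.rpow_le_rpow_of_exponent_le one_le_two h2
  refine (Finset.sum_le_card_nsmul _ _ _ h1).trans ?_
  rw [nsmul_eq_mul, mul_assoc]
  gcongr
  have : (L.filter (· ≤ l)).card ≤ n := (Finset.card_le_univ _).trans (by simp)
  have : ((L.filter (· ≤ l)).card : ℝ) ≤ n := by exact_mod_cast this
  linarith

/-- The differential inequalities for the sum of an adapted series. At a point of the support of a
member, each scale is bounded below by a multiple of the partial norm, so the power of the scale is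
at most the same power of the partial norm times `decay`, and the latter is summable. -/
theorem AdaptedSeries.norm_partialDeriv_tsum_le (h : AdaptedSeries d π L sc γ ε c Γ k)
    (hB : ∀ α, ∃ B, 0 ≤ B ∧ SeriesBound d π L sc γ k α B) {α : ι → ℕ} {B : ℝ} (hB0 : 0 ≤ B)
    (hBα : SeriesBound d π L sc γ k α B) {x₀ : EuclideanSpace ℝ ι} (hx₀ : x₀ ∈ offFirst π L) :
    ‖partialDeriv α (fun x => ∑' a, k a x) x₀‖ ≤
      seriesConst d π L ε c α * Γ * B * flagWeight d π L α x₀ := by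
  obtain ⟨good, U, hU, hxU, h1, h2, h3, h4⟩ := h.exists_local_series hB hx₀
  have e1 : iteratedFDeriv ℝ (coordList α).length (fun x => ∑' a, k a x) x₀ =
      iteratedFDeriv ℝ (coordList α).length
        (fun x => ∑' a, good.indicator (fun a => k a) a x) x₀ := by
    refine Filter.EventuallyEq.eq_of_nhds (Filter.EventuallyEq.iteratedFDeriv ℝ ?_ _)
    filter_upwards [hU.mem_nhds hxU] with x hx
    exact tsum_indicator_eq h1 hx
  have e2 : partialDeriv α (fun x => ∑' a, k a x) x₀ =
      ∑' a, partialDeriv α (good.indicator (fun a => k a) a) x₀ := by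
    rw [partialDeriv, e1, (h4 _).1]
    exact ContinuousMultilinearMap.tsum_eval (h4 _).2 _
  rw [e2]
  have hνpos : ∀ l ∈ L, 0 < partialNorm d π L l x₀ := fun l hl => partialNorm_pos h.dpos hl hx₀
  -- The centres of the summation are the partial norms of `x₀`.
  set ν : Fin n → ℝ := fun l => (partialNorm d π L l x₀)⁻¹ with hν
  have hν0 : ∀ l ∈ L, 0 < ν l := fun l hl => inv_pos.2 (hνpos l hl)
  set u : Λ → ℝ := fun a => seriesConst d π L ε c α * B * flagWeight d π L α x₀ *
    (γ a * ∏ l ∈ L, decay ε ((2 : ℝ) ^ (sc a l : ℝ) * ν l)) with hu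
  have hfw : 0 ≤ flagWeight d π L α x₀ := by
    rw [flagWeight_eq]
    exact Finset.prod_nonneg fun l hl => Real.rpow_nonneg (hνpos l hl).le _
  have hCB : 0 ≤ seriesConst d π L ε c α * B * flagWeight d π L α x₀ :=
    mul_nonneg (mul_nonneg (seriesConst_nonneg h.cpos α) hB0) hfw
  have hdec : ∀ a, 0 ≤ γ a * ∏ l ∈ L, decay ε ((2 : ℝ) ^ (sc a l : ℝ) * ν l) := fun a =>
    mul_nonneg (h.γnonneg a) (Finset.prod_nonneg fun l hl =>
      decay_nonneg (mul_pos (by positivity) (hν0 l hl)))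
  have hu0 : ∀ a, 0 ≤ u a := fun a => mul_nonneg hCB (hdec a)
  have hle : ∀ a, ‖partialDeriv α (good.indicator (fun a => k a) a) x₀‖ ≤ u a := by
    intro a
    by_cases hz : x₀ ∈ tsupport (k a)
    · have hcl : IsClosed {x : EuclideanSpace ℝ ι |
          ∀ s, |x s| ≤ (c * (2 : ℝ) ^ (sc a (π s) : ℝ)) ^ d s} := by
        simp only [Set.ofPred_forall]
        exact isClosed_iInter fun s => isClosed_le (by fun_prop) continuous_const
      have hmem := closure_minimal (s := Function.support (k a)) (fun x hx => h.supp a x hx) hcl hz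
      have hterm : ‖partialDeriv α (good.indicator (fun a => k a) a) x₀‖ ≤
          B * (γ a * ∏ l ∈ L, ((2 : ℝ) ^ (sc a l : ℝ)) ^ (-blockExponent d π α l)) := by
        by_cases ha : a ∈ good
        · rw [Set.indicator_of_mem ha]; exact hBα a x₀
        · rw [Set.indicator_of_notMem ha]
          have : partialDeriv α (0 : EuclideanSpace ℝ ι → 𝕜) x₀ = 0 := by
            rw [partialDeriv]
            change iteratedFDeriv ℝ _ (fun _ => (0 : 𝕜)) x₀ _ = 0
            simp [iteratedFDeriv_fun_zero]
          rw [this, norm_zero]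
          exact mul_nonneg hB0 (mul_nonneg (h.γnonneg a)
            (Finset.prod_nonneg fun l _ => by positivity))
      refine hterm.trans ?_
      have hprod : ∏ l ∈ L, ((2 : ℝ) ^ (sc a l : ℝ)) ^ (-blockExponent d π α l) ≤
          seriesConst d π L ε c α * flagWeight d π L α x₀ *
            ∏ l ∈ L, decay ε ((2 : ℝ) ^ (sc a l : ℝ) * ν l) := by
        rw [seriesConst, flagWeight_eq, ← Finset.prod_mul_distrib, ← Finset.prod_mul_distrib]
        refine Finset.prod_le_prod (fun l _ => by positivity) fun l hl => ?_
        have hp := hνpos l hl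
        have h2i : (2 : ℝ) ^ (sc a l : ℝ) =
            partialNorm d π L l x₀ * ((2 : ℝ) ^ (sc a l : ℝ) * ν l) := by
          rw [hν]; field_simp
        have hge : 1 / ((n + 1) * c) ≤ (2 : ℝ) ^ (sc a l : ℝ) * ν l := by
          have := partialNorm_le h hmem hl
          have hc := h.cpos
          rw [hν]
          change _ ≤ _ * (partialNorm d π L l x₀)⁻¹
          rw [← div_eq_mul_inv, div_le_div_iff₀ (by positivity) hp]
          linarith
        have hd := rpow_neg_le_decay h.εpos.le (le_blockExponent h.dpos (h.εle l hl) α)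
          (one_div_pos.2 (mul_pos (by positivity) h.cpos)) hge
        -- Split off the power of the partial norm from the power of the scale.
        conv_lhs => rw [h2i, Real.mul_rpow hp.le (mul_pos (by positivity) (hν0 l hl)).le]
        calc _ ≤ partialNorm d π L l x₀ ^ (-blockExponent d π α l) *
              ((1 + (1 / ((n + 1) * c)) ^ (-(blockExponent d π α l + ε))) *
              decay ε ((2 : ℝ) ^ (sc a l : ℝ) * ν l)) := by gcongr
          _ = _ := by ring
      calc _ ≤ B * (γ a * (seriesConst d π L ε c α * flagWeight d π L α x₀ *
            ∏ l ∈ L, decay ε ((2 : ℝ) ^ (sc a l : ℝ) * ν l))) := by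
            have := h.γnonneg a
            gcongr
        _ = u a := by rw [hu]; ring
    · have hz' : x₀ ∉ tsupport (good.indicator (fun a => k a) a) := by
        by_cases ha : a ∈ good
        · rwa [Set.indicator_of_mem ha]
        · rw [Set.indicator_of_notMem ha]; simp
      have : iteratedFDeriv ℝ (coordList α).length (good.indicator (fun a => k a) a) x₀ = 0 := by
        by_contra hne
        exact hz' (support_iteratedFDeriv_subset _ hne)
      rw [partialDeriv, this]
      simpa using hu0 a
  have hsum : ∀ F : Finset Λ, ∑ a ∈ F, u a ≤
      seriesConst d π L ε c α * Γ * B * flagWeight d π L α x₀ := by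
    intro F
    rw [hu, ← Finset.mul_sum]
    calc _ ≤ seriesConst d π L ε c α * B * flagWeight d π L α x₀ * Γ :=
          mul_le_mul_of_nonneg_left (h.sum ν hν0 F) hCB
      _ = _ := by ring
  have hus : Summable u := summable_of_sum_le hu0 hsum
  exact (tsum_of_norm_bounded hus.hasSum hle).trans (hus.tsum_le_of_sum_le hsum)

/-- Off the singular set the series may be integrated term by term. -/
theorem AdaptedSeries.hasSum_integral [Countable Λ] (h : AdaptedSeries d π L sc γ ε c Γ k)
    (hB : ∃ B, 0 ≤ B ∧ SeriesBound d π L sc γ k 0 B) {f : EuclideanSpace ℝ ι → 𝕜}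
    (hf : Continuous f) (hfc : HasCompactSupport f) (hfs : tsupport f ⊆ offFirst π L) :
    HasSum (fun a => ∫ x, k a x * f x) (∫ x, (∑' a, k a x) * f x) := by
  obtain ⟨good, δ, hδ, h1, h2⟩ := h.localize hfc hfs
  obtain ⟨B, hB0, hB⟩ := hB
  have hsum := h.summable_good hδ h2 0
  have hint : ∀ a, Integrable fun x => k a x * f x := fun a =>
    ((h.smooth a).continuous.mul hf).integrable_of_hasCompactSupport hfc.mul_left
  have hfi : Integrable f := hf.integrable_of_hasCompactSupport hfc
  have key := hasSum_integral_of_summable_integral_norm hint (by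
    refine Summable.of_nonneg_of_le (fun a => by positivity) (fun a => ?_)
      ((hsum.mul_left B).mul_right (∫ x, ‖f x‖))
    rw [← integral_const_mul]
    refine integral_mono (hint a).norm (hfi.norm.const_mul _) fun x => ?_
    dsimp only
    rw [norm_mul]
    by_cases ha : a ∈ good
    · rw [Set.indicator_of_mem ha]
      gcongr
      have := hB a x
      rwa [partialDeriv_zero] at this
    · rw [Set.indicator_of_notMem ha]
      by_cases hx : x ∈ tsupport f
      · rw [h1 a ha x hx]; simp
      · rw [image_eq_zero_of_notMem_tsupport hx]; simp)
  simp only [tsum_mul_right] at key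
  exact key

end Series

/-! ### Gains from cancellation and from decay -/

section Gain

variable {𝕜 : Type*} [RCLike 𝕜] {ι : Type} [Fintype ι]

theorem norm_diag_le {c : ι → ℝ} {M : ℝ} (hM : 0 ≤ M) (hc : ∀ i, |c i| ≤ M)
    (x : EuclideanSpace ℝ ι) : ‖diag c x‖ ≤ M * ‖x‖ := by
  have h : ‖diag c x‖ ^ 2 ≤ (M * ‖x‖) ^ 2 := by
    rw [mul_pow, EuclideanSpace.norm_sq_eq, EuclideanSpace.norm_sq_eq, Finset.mul_sum]
    refine Finset.sum_le_sum fun i _ => ?_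
    rw [diag_apply, norm_mul, mul_pow]
    gcongr
    exact hc i
  exact le_of_sq_le_sq h (by positivity)

/-- The quantitative properties of test functions that control pairings with bumps. -/
structure TestBound (ψ : EuclideanSpace ℝ ι → 𝕜) (b : ℝ) : Prop where
  smooth : ContDiff ℝ ∞ ψ
  norm_le : ∀ x, ‖ψ x‖ ≤ b
  fderiv_le : ∀ x, ‖fderiv ℝ ψ x‖ ≤ b
  decay_le : ∀ x s, ‖ψ x‖ ≤ b * (1 + |x s|) ^ (-2 : ℝ)

/-- The coordinate projection that annihilates the coordinates in `e`. -/
def killCoords (e : ι → Prop) [DecidablePred e] : EuclideanSpace ℝ ι →L[ℝ] EuclideanSpace ℝ ι :=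
  diag fun i => if e i then 0 else 1

/-- Where the scale `τ` of the coordinates in `e` is at most one, a dilated test function is close
to its restriction to the subspace on which these coordinates vanish, by the mean value inequality.
-/
theorem TestBound.sub_kill_le {ψ : EuclideanSpace ℝ ι → 𝕜} {b : ℝ} (hψ : TestBound ψ b)
    {d t : ι → ℝ} {ε : ℝ} (hε : ∀ i, ε ≤ d i) (e : ι → Prop)
    [DecidablePred e] {τ : ℝ} (hτ : ∀ i, e i → t i = τ) (hτ0 : 0 < τ) (hτ1 : τ ≤ 1)
    (y : EuclideanSpace ℝ ι) :
    ‖ψ (diag (fun i => t i ^ d i) y) - ψ (diag (fun i => t i ^ d i) (killCoords e y))‖ ≤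
      b * τ ^ ε * ‖y‖ := by
  have h1 := Convex.norm_image_sub_le_of_norm_fderiv_le (𝕜 := ℝ) (f := ψ) (s := Set.univ)
    (fun x _ => hψ.smooth.differentiable (by simp) x) (fun x _ => hψ.fderiv_le x) convex_univ
    (Set.mem_univ (diag (fun i => t i ^ d i) (killCoords e y)))
    (Set.mem_univ (diag (fun i => t i ^ d i) y))
  have hb : 0 ≤ b := (norm_nonneg _).trans (hψ.norm_le 0)
  refine h1.trans ?_
  rw [mul_assoc]
  gcongr
  have h2 : diag (fun i => t i ^ d i) y - diag (fun i => t i ^ d i) (killCoords e y) =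
      diag (fun i => if e i then τ ^ d i else 0) y := by
    ext i
    by_cases he : e i
    · simp [killCoords, he, hτ i he]
    · simp [killCoords, he]
  rw [h2]
  refine norm_diag_le (Real.rpow_nonneg hτ0.le _) (fun i => ?_) y
  by_cases he : e i
  · simp only [he, if_true]
    rw [abs_of_nonneg (Real.rpow_nonneg hτ0.le _)]
    exact Real.rpow_le_rpow_of_exponent_ge hτ0 hτ1 (hε i)
  · simp only [he, if_false, abs_zero]
    exact Real.rpow_nonneg hτ0.le _

open Classical in
/-- A majorant on a ball, decaying in the coordinate `s`. -/
def slab (r : ℝ) (s : ι) (y : EuclideanSpace ℝ ι) : ℝ :=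
  ∏ i, if i = s then (1 + |y i|) ^ (-2 : ℝ) else (Set.Icc (-r) r).indicator (fun _ => 1) (y i)

open Classical in
theorem integrable_slab_comp_diag (r : ℝ) (s : ι) {a : ℝ} (ha : a ≠ 0) :
    Integrable fun y => slab r s (diag (fun i => if i = s then a else 1) y) := by
  have h : Integrable (fun y : ι → ℝ => ∏ i, (if i = s then fun u : ℝ =>
      (1 + |a * u|) ^ (-2 : ℝ) else (Set.Icc (-r) r).indicator (fun _ => (1 : ℝ))) (y i)) := by
    refine Integrable.fintype_prod (f := fun i => if i = s then fun u : ℝ =>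
      (1 + |a * u|) ^ (-2 : ℝ) else (Set.Icc (-r) r).indicator (fun _ => (1 : ℝ))) fun i => ?_
    by_cases hi : i = s
    · simp only [hi, if_true]
      have := integrable_one_add_norm (E := ℝ) (μ := volume) (r := 2) (by simp)
      exact this.comp_mul_left' ha
    · simp only [hi, if_false]
      exact (integrable_indicator_iff measurableSet_Icc).2 (integrableOn_const (hs := by simp))
  have h2 := (PiLp.volume_preserving_ofLp ι).integrable_comp_of_integrable h
  refine h2.congr (Filter.Eventually.of_forall fun y => ?_)
  simp only [Function.comp, slab]
  refine Finset.prod_congr rfl fun i _ => ?_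
  by_cases hi : i = s <;> simp [hi]

theorem slab_nonneg (r : ℝ) (s : ι) (y : EuclideanSpace ℝ ι) : 0 ≤ slab r s y := by
  classical
  refine Finset.prod_nonneg fun i _ => ?_
  split_ifs
  · positivity
  · exact Set.indicator_nonneg (fun _ _ => zero_le_one) _

/-- The total mass of the majorants `slab`. -/
def slabConst (ι : Type) [Fintype ι] (r : ℝ) : ℝ := ∑ s : ι, ∫ y, slab r s y

theorem slabConst_nonneg (r : ℝ) : 0 ≤ slabConst ι r :=
  Finset.sum_nonneg fun s _ => integral_nonneg (slab_nonneg r s)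

/-- Where the scale of a coordinate is at least one, the mass of a dilated test function on a ball
is small, by the decay of the test function in this coordinate. -/
theorem TestBound.setIntegral_le {ψ : EuclideanSpace ℝ ι → 𝕜} {b : ℝ} (hψ : TestBound ψ b)
    {d t : ι → ℝ} (ht : ∀ i, 0 < t i) {ε : ℝ} (hε : ∀ i, ε ≤ d i) {r : ℝ} {s : ι}
    (hs : 1 ≤ t s) :
    ∫ y in Metric.closedBall (0 : EuclideanSpace ℝ ι) r, ‖ψ (diag (fun i => t i ^ d i) y)‖ ≤
      slabConst ι r * b * t s ^ (-ε) := by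
  classical
  have hb : 0 ≤ b := (norm_nonneg _).trans (hψ.norm_le 0)
  -- Rescale the coordinate `s` only; in the other coordinates the majorant is the indicator
  -- of an interval containing the ball.
  set c : ι → ℝ := fun i => if i = s then t s ^ d s else 1 with hc
  have hc0 : ∀ i, 0 < c i := by
    intro i; simp only [hc]; split_ifs
    · exact Real.rpow_pos_of_pos (ht s) _
    · exact one_pos
  have hprod : ∏ i, c i = t s ^ d s := by simp [hc]
  have hI := integral_comp_diag c hc0 (slab r s)
  rw [hprod, smul_eq_mul] at hI
  have hts : 0 < t s ^ d s := Real.rpow_pos_of_pos (ht s) _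
  have hint : Integrable fun y => slab r s (diag c y) := integrable_slab_comp_diag r s hts.ne'
  have hle : ∀ y ∈ Metric.closedBall (0 : EuclideanSpace ℝ ι) r,
      ‖ψ (diag (fun i => t i ^ d i) y)‖ ≤ b * slab r s (diag c y) := by
    intro y hy
    have h1 := hψ.decay_le (diag (fun i => t i ^ d i) y) s
    have h2 : slab r s (diag c y) = (1 + |t s ^ d s * y s|) ^ (-2 : ℝ) := by
      rw [slab, Finset.prod_eq_single s]
      · simp [hc]
      · intro i _ hi
        have : y i ∈ Set.Icc (-r) r := by
          rw [Set.mem_Icc, ← abs_le]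
          exact (PiLp.norm_apply_le y i).trans (by simpa using hy)
        simp [hi, hc, this]
      · simp
    rw [h2]; exact h1
  calc _ ≤ ∫ y in Metric.closedBall (0 : EuclideanSpace ℝ ι) r, b * slab r s (diag c y) := by
        refine setIntegral_mono_on ?_ (hint.const_mul b).integrableOn
          Metric.isClosed_closedBall.measurableSet hle
        refine ContinuousOn.integrableOn_compact (isCompact_closedBall _ _) ?_
        exact (hψ.smooth.continuous.comp (diag _).continuous).norm.continuousOn
    _ ≤ ∫ y, b * slab r s (diag c y) :=
        setIntegral_le_integral (hint.const_mul b) (Filter.Eventually.of_forall fun y =>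
          mul_nonneg hb (slab_nonneg _ _ _))
    _ = b * ((t s ^ d s)⁻¹ * ∫ y, slab r s y) := by
        rw [integral_const_mul, hI]; field_simp
    _ ≤ b * (t s ^ (-ε) * slabConst ι r) := by
        have h3 : (t s ^ d s)⁻¹ ≤ t s ^ (-ε) := by
          rw [← Real.rpow_neg (ht s).le]
          exact Real.rpow_le_rpow_of_exponent_le hs (neg_le_neg (hε s))
        have h4 : ∫ y, slab r s y ≤ slabConst ι r :=
          Finset.single_le_sum (f := fun s => ∫ y, slab r s y)
            (fun s _ => integral_nonneg (slab_nonneg r s)) (Finset.mem_univ s)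
        have h5 : 0 ≤ ∫ y, slab r s y := integral_nonneg (slab_nonneg r s)
        gcongr
    _ = _ := by ring

end Gain

section PartialPairing

variable {𝕜 : Type*} [RCLike 𝕜] {ι : Type} [Fintype ι]

theorem norm_sq_glue (p : ι → Prop) [DecidablePred p] (u : EuclideanSpace ℝ {i // p i})
    (v : EuclideanSpace ℝ {i // ¬ p i}) : ‖glue p u v‖ ^ 2 = ‖u‖ ^ 2 + ‖v‖ ^ 2 := by
  simp only [EuclideanSpace.norm_sq_eq]
  rw [← Fintype.sum_subtype_add_sum_subtype p fun i => ‖glue p u v i‖ ^ 2]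
  congr 1
  · refine Finset.sum_congr rfl fun i _ => ?_
    rw [glue_apply, dif_pos i.2]
  · refine Finset.sum_congr rfl fun i _ => ?_
    rw [glue_apply, dif_neg i.2]

theorem norm_le_norm_glue_left (p : ι → Prop) [DecidablePred p] (u : EuclideanSpace ℝ {i // p i})
    (v : EuclideanSpace ℝ {i // ¬ p i}) : ‖u‖ ≤ ‖glue p u v‖ :=
  le_of_sq_le_sq (by rw [norm_sq_glue]; nlinarith [norm_nonneg v]) (norm_nonneg _)

theorem norm_le_norm_glue_right (p : ι → Prop) [DecidablePred p]
    (u : EuclideanSpace ℝ {i // p i}) (v : EuclideanSpace ℝ {i // ¬ p i}) : ‖v‖ ≤ ‖glue p u v‖ :=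
  le_of_sq_le_sq (by rw [norm_sq_glue]; nlinarith [norm_nonneg u]) (norm_nonneg _)

/-- The inclusion of the space of the coordinates satisfying `p`. -/
def extendLeft (p : ι → Prop) [DecidablePred p] :
    EuclideanSpace ℝ {i // p i} →L[ℝ] EuclideanSpace ℝ ι :=
  LinearMap.toContinuousLinearMap
    { toFun := fun u => glue p u 0
      map_add' := fun u v => by
        ext i; by_cases h : p i <;> simp [glue_apply, h]
      map_smul' := fun a u => by
        ext i; by_cases h : p i <;> simp [glue_apply, h] }

theorem extendLeft_apply (p : ι → Prop) [DecidablePred p] (u : EuclideanSpace ℝ {i // p i}) :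
    extendLeft p u = glue p u 0 := rfl

theorem norm_extendLeft_le (p : ι → Prop) [DecidablePred p] : ‖extendLeft p‖ ≤ 1 := by
  refine ContinuousLinearMap.opNorm_le_bound _ zero_le_one fun u => ?_
  rw [one_mul, extendLeft_apply]
  refine le_of_sq_le_sq ?_ (norm_nonneg _)
  rw [norm_sq_glue]; simp

theorem norm_iteratedFDeriv_comp_glue_le (p : ι → Prop) [DecidablePred p]
    {φ : EuclideanSpace ℝ ι → 𝕜} (hφ : ContDiff ℝ ∞ φ) (v : EuclideanSpace ℝ {i // ¬ p i}) (m : ℕ)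
    (z : EuclideanSpace ℝ {i // p i}) :
    ‖iteratedFDeriv ℝ m (fun z => φ (glue p z v)) z‖ ≤ ‖iteratedFDeriv ℝ m φ (glue p z v)‖ := by
  have e0 : ∀ z, glue p z v = extendLeft p z + glue p 0 v := by
    intro z; ext i
    by_cases h : p i <;> simp [extendLeft_apply, glue_apply, h]
  have e1 : (fun z => φ (glue p z v)) = (fun x => φ (x + glue p 0 v)) ∘ extendLeft p := by
    funext z; simp only [Function.comp, e0 z]
  have hs : ContDiff ℝ ∞ fun x => φ (x + glue p 0 v) := hφ.comp (contDiff_id.add contDiff_const)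
  rw [e1, (extendLeft p).iteratedFDeriv_comp_right hs z (by exact_mod_cast le_top)]
  refine (ContinuousMultilinearMap.norm_compContinuousLinearMap_le _ _).trans ?_
  rw [iteratedFDeriv_comp_add_right, ← e0 z]
  have : ∏ _i : Fin m, ‖extendLeft p‖ ≤ 1 :=
    Finset.prod_le_one (fun _ _ => norm_nonneg _) fun _ _ => norm_extendLeft_le p
  exact mul_le_of_le_one_right (norm_nonneg _) this

theorem partialDeriv_mul_const [LinearOrder ι] {g : EuclideanSpace ℝ ι → 𝕜}
    {x : EuclideanSpace ℝ ι} (hg : ContDiffAt ℝ ∞ g x) (c : 𝕜) (α : ι → ℕ) :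
    partialDeriv α (fun y => g y * c) x = partialDeriv α g x * c := by
  have h : (fun y => g y * c) = c • g := by funext y; simp [mul_comm]
  rw [partialDeriv, h, iteratedFDeriv_const_smul_apply
    (hg.of_le (by exact_mod_cast le_top)), partialDeriv]
  simp [mul_comm]

/-- A smooth bump of a given size: supported in a ball, with bounds for all derivatives. -/
structure IsBump (r : ℝ) (C : ℕ → ℝ) (φ : EuclideanSpace ℝ ι → 𝕜) : Prop where
  smooth : ContDiff ℝ ∞ φ
  supp : ∀ x, φ x ≠ 0 → ‖x‖ ≤ r
  bound : ∀ m x, ‖iteratedFDeriv ℝ m φ x‖ ≤ C m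

variable {r : ℝ} {C : ℕ → ℝ} {φ : EuclideanSpace ℝ ι → 𝕜}

theorem IsBump.hasCompactSupport (h : IsBump r C φ) : HasCompactSupport φ :=
  HasCompactSupport.intro (isCompact_closedBall (0 : EuclideanSpace ℝ ι) r) fun x hx => by
    by_contra hne
    exact hx (by simpa using h.supp x hne)

theorem IsBump.norm_le (h : IsBump r C φ) (x : EuclideanSpace ℝ ι) : ‖φ x‖ ≤ C 0 := by
  have := h.bound 0 x
  rwa [norm_iteratedFDeriv_zero] at this

theorem IsBump.nonneg (h : IsBump r C φ) (m : ℕ) : 0 ≤ C m := (norm_nonneg _).trans (h.bound m 0)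

section
variable (p : ι → Prop) [DecidablePred p]

/-- The pairing of a bump with a function of the variables not satisfying `p`. -/
def pairRight (φ : EuclideanSpace ℝ ι → 𝕜) (w : EuclideanSpace ℝ {i // ¬ p i} → 𝕜)
    (z : EuclideanSpace ℝ {i // p i}) : 𝕜 :=
  ∫ v, φ (glue p z v) * w v

variable {w : EuclideanSpace ℝ {i // ¬ p i} → 𝕜}

theorem IsBump.glue_eq_zero (h : IsBump r C φ) (z : EuclideanSpace ℝ {i // p i})
    {v : EuclideanSpace ℝ {i // ¬ p i}} (hv : v ∉ Metric.closedBall 0 r) :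
    φ (glue p z v) = 0 := by
  by_contra hne
  exact hv (by simpa using (norm_le_norm_glue_right p z v).trans (h.supp _ hne))

theorem IsBump.contDiff_uncurry (h : IsBump r C φ) (hw : ContDiff ℝ ∞ w) :
    ContDiff ℝ ∞ (Function.uncurry fun (z : EuclideanSpace ℝ {i // p i})
      (v : EuclideanSpace ℝ {i // ¬ p i}) => φ (glue p z v) * w v) :=
  (h.smooth.comp (contDiff_glue p)).mul (hw.comp contDiff_snd)

theorem IsBump.contDiff_pairRight (h : IsBump r C φ) (hw : ContDiff ℝ ∞ w) :
    ContDiff ℝ ∞ (pairRight p φ w) :=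
  contDiff_integral_of_compact (h.contDiff_uncurry p hw) (isCompact_closedBall 0 r)
    fun z v hv => by rw [h.glue_eq_zero p z hv, zero_mul]

theorem IsBump.norm_partialDeriv_pairRight_le [LinearOrder ι] (h : IsBump r C φ)
    (hw : ContDiff ℝ ∞ w) (α : {i // p i} → ℕ) (z : EuclideanSpace ℝ {i // p i}) :
    ‖partialDeriv α (pairRight p φ w) z‖ ≤
      C (∑ i, α i) * ∫ v in Metric.closedBall 0 r, ‖w v‖ := by
  have h0 : ∀ z : EuclideanSpace ℝ {i // p i}, ∀ v ∉ Metric.closedBall 0 r,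
      φ (glue p z v) * w v = 0 := fun z v hv => by rw [h.glue_eq_zero p z hv, zero_mul]
  have e := partialDeriv_integral_of_compact (μ := volume) (h.contDiff_uncurry p hw)
    (isCompact_closedBall 0 r) h0 α z
  change partialDeriv α (fun z => ∫ v, φ (glue p z v) * w v) z = _ at e
  change ‖partialDeriv α (fun z => ∫ v, φ (glue p z v) * w v) z‖ ≤ _
  have hsm : ∀ v, ContDiff ℝ ∞ fun z => φ (glue p z v) := fun v =>
    h.smooth.comp ((contDiff_glue p).comp (contDiff_id.prodMk contDiff_const))
  have hle : ∀ v, ‖partialDeriv α (fun z => φ (glue p z v) * w v) z‖ ≤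
      (Metric.closedBall 0 r).indicator (fun v => C (∑ i, α i) * ‖w v‖) v := by
    intro v
    by_cases hv : v ∈ Metric.closedBall 0 r
    · rw [Set.indicator_of_mem hv, partialDeriv_mul_const (hsm v).contDiffAt, norm_mul]
      gcongr
      exact (norm_partialDeriv_le _ _ _).trans
        ((norm_iteratedFDeriv_comp_glue_le p h.smooth v _ z).trans (h.bound _ _))
    · rw [Set.indicator_of_notMem hv]
      have : (fun z => φ (glue p z v) * w v) = fun _ => 0 := funext fun z => h0 z v hv
      rw [this, partialDeriv]
      simp [iteratedFDeriv_fun_zero]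
  have hwi : IntegrableOn (fun v => ‖w v‖) (Metric.closedBall 0 r) :=
    ContinuousOn.integrableOn_compact (isCompact_closedBall _ _) hw.continuous.norm.continuousOn
  have hms : MeasurableSet (Metric.closedBall (0 : EuclideanSpace ℝ {i // ¬ p i}) r) :=
    Metric.isClosed_closedBall.measurableSet
  rw [e]
  refine (norm_integral_le_of_norm_le ?_ (Filter.Eventually.of_forall hle)).trans ?_
  · exact (integrable_indicator_iff hms).2 (hwi.const_mul _)
  · rw [integral_indicator hms, integral_const_mul]

end

end PartialPairing

section BestGain

variable {𝕜 : Type*} [RCLike 𝕜] {ι : Type} [Fintype ι]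

/-- The constant in the estimates of pairings of bumps with test functions. -/
def gainConst (ι : Type) [Fintype ι] (r : ℝ) : ℝ :=
  (1 + |r|) * volume.real (Metric.closedBall (0 : EuclideanSpace ℝ ι) r) + slabConst ι r

theorem gainConst_nonneg (r : ℝ) : 0 ≤ gainConst ι r :=
  add_nonneg (by positivity) (slabConst_nonneg r)

theorem TestBound.setIntegral_le_const {ψ : EuclideanSpace ℝ ι → 𝕜} {b : ℝ} (hψ : TestBound ψ b)
    (c : ι → ℝ) (r : ℝ) :
    ∫ y in Metric.closedBall (0 : EuclideanSpace ℝ ι) r, ‖ψ (diag c y)‖ ≤ gainConst ι r * b := by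
  have hb : 0 ≤ b := (norm_nonneg _).trans (hψ.norm_le 0)
  have h1 := norm_setIntegral_le_of_norm_le_const (μ := volume)
    (s := Metric.closedBall (0 : EuclideanSpace ℝ ι) r) (f := fun y => ‖ψ (diag c y)‖)
    (isCompact_closedBall _ _).measure_lt_top
    (fun y _ => by rw [norm_norm]; exact hψ.norm_le _)
  refine (le_abs_self _).trans (h1.trans ?_)
  have h2 := slabConst_nonneg (ι := ι) r
  have h3 : 0 ≤ volume.real (Metric.closedBall (0 : EuclideanSpace ℝ ι) r) := measureReal_nonneg
  rw [mul_comm]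
  gcongr
  unfold gainConst
  nlinarith [abs_nonneg r, mul_nonneg (abs_nonneg r) h3]

/-- After subtracting, if useful, the restriction to the subspace where the coordinates in `e`
vanish, the mass of a dilated test function on a ball decays with the distance between the scale
of the test function in these coordinates and `1`. -/
theorem TestBound.setIntegral_le_decay {ψ : EuclideanSpace ℝ ι → 𝕜} {b : ℝ} (hψ : TestBound ψ b)
    {d t : ι → ℝ} (ht : ∀ i, 0 < t i) {ε : ℝ} (hε0 : 0 ≤ ε) (hε : ∀ i, ε ≤ d i) (e : ι → Prop)
    [DecidablePred e] {τ : ℝ} (hτ : ∀ i, e i → t i = τ) (he : ∃ i, e i) (r : ℝ) :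
    (∫ y in Metric.closedBall (0 : EuclideanSpace ℝ ι) r, ‖ψ (diag (fun i => t i ^ d i) y)‖ ≤
      gainConst ι r * b * decay ε τ) ∨
    (∫ y in Metric.closedBall (0 : EuclideanSpace ℝ ι) r,
      ‖ψ (diag (fun i => t i ^ d i) y) - ψ (diag (fun i => t i ^ d i) (killCoords e y))‖ ≤
      gainConst ι r * b * decay ε τ) := by
  obtain ⟨s, hs⟩ := he
  have hτ0 : 0 < τ := hτ s hs ▸ ht s
  have hb : 0 ≤ b := (norm_nonneg _).trans (hψ.norm_le 0)
  have hv : 0 ≤ volume.real (Metric.closedBall (0 : EuclideanSpace ℝ ι) r) := measureReal_nonneg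
  rcases le_total 1 τ with h1 | h1
  · left
    have hd : decay ε τ = τ ^ (-ε) :=
      min_eq_right (Real.rpow_le_rpow_of_exponent_le h1 (by linarith))
    have := hψ.setIntegral_le ht hε (r := r) (s := s) (by rw [hτ s hs]; exact h1)
    rw [hτ s hs, ← hd] at this
    refine this.trans ?_
    have := decay_nonneg (ε := ε) hτ0
    gcongr
    unfold gainConst
    nlinarith [abs_nonneg r, mul_nonneg (abs_nonneg r) hv]
  · right
    have hd : decay ε τ = τ ^ ε :=
      min_eq_left (Real.rpow_le_rpow_of_exponent_ge hτ0 h1 (by linarith))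
    have h2 := norm_setIntegral_le_of_norm_le_const (μ := volume) (C := b * τ ^ ε * |r|)
      (s := Metric.closedBall (0 : EuclideanSpace ℝ ι) r) (f := fun y =>
        ‖ψ (diag (fun i => t i ^ d i) y) - ψ (diag (fun i => t i ^ d i) (killCoords e y))‖)
      (isCompact_closedBall _ _).measure_lt_top
      (fun y hy => by
        rw [norm_norm]
        refine (hψ.sub_kill_le hε e hτ hτ0 h1 y).trans ?_
        have : ‖y‖ ≤ |r| := (by simpa using hy : ‖y‖ ≤ r).trans (le_abs_self r)
        gcongr)
    refine (le_abs_self _).trans (h2.trans ?_)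
    rw [hd]
    have h3 : 0 ≤ τ ^ ε := Real.rpow_nonneg hτ0.le _
    have h4 := slabConst_nonneg (ι := ι) r
    calc _ = (|r| * volume.real (Metric.closedBall (0 : EuclideanSpace ℝ ι) r)) * (b * τ ^ ε) := by
          ring
      _ ≤ gainConst ι r * (b * τ ^ ε) := by
          gcongr
          unfold gainConst
          nlinarith
      _ = _ := by ring

/-- A bound by each single factor `decay ε` yields a bound by the product of the factors
`decay (ε / n)`: the best of the gains is at least their geometric mean. -/
theorem le_mul_prod_decay {Θ : Type*} (s : Finset Θ) {X A : ℝ} (hX : 0 ≤ X) (hXA : X ≤ A)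
    {τ : Θ → ℝ} (hτ : ∀ l ∈ s, 0 < τ l) {ε : ℝ} (h : ∀ l ∈ s, X ≤ A * decay ε (τ l)) {n : ℕ}
    (hn : s.card ≤ n) (hn0 : 0 < n) : X ≤ A * ∏ l ∈ s, decay (ε / n) (τ l) := by
  rcases (hX.trans hXA).eq_or_lt with hA | hA
  · rw [← hA] at hXA ⊢
    simpa using hXA
  · have h1 := le_prod_rpow_of_forall_le s (a := X / A) (by positivity) ((div_le_one hA).2 hXA)
      (g := fun l => decay ε (τ l)) (fun l hl => (div_le_iff₀' hA).2 (h l hl)) hn hn0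
    rw [div_le_iff₀' hA] at h1
    refine h1.trans (le_of_eq ?_)
    congr 1
    refine Finset.prod_congr rfl fun l hl => ?_
    rw [decay_rpow (hτ l hl) (by positivity), mul_one_div]

end BestGain

/-! ### Sums of dyadic bumps with cancellation -/

section RestrictGlue

variable {𝕜 : Type*} [RCLike 𝕜] {N : ℕ} (p : Fin N → Prop) [DecidablePred p]

theorem restrict_apply (x : EuclideanSpace ℝ (Fin N)) (i : {i // p i}) :
    restrict p x i = x i.1 := rfl

theorem restrict_glue_left (u : EuclideanSpace ℝ {i // p i}) (v : EuclideanSpace ℝ {i // ¬ p i}) :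
    restrict p (glue p u v) = u := by
  ext i; simp [restrict_apply, glue_apply, i.2]

theorem restrict_glue_right (u : EuclideanSpace ℝ {i // p i})
    (v : EuclideanSpace ℝ {i // ¬ p i}) : restrict (fun i => ¬ p i) (glue p u v) = v := by
  ext i; simp [restrict_apply, glue_apply, i.2]

theorem glue_restrict (x : EuclideanSpace ℝ (Fin N)) :
    glue p (restrict p x) (restrict (fun i => ¬ p i) x) = x := by
  ext i; by_cases h : p i <;> simp [restrict_apply, glue_apply, h]

/-- Cancellation in the coordinates `e`: the function is orthogonal to the smooth functions which
do not depend on these coordinates. -/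
def CancelsIn (e : Finset (Fin N)) (φ : EuclideanSpace ℝ (Fin N) → 𝕜) : Prop :=
  ∀ f : EuclideanSpace ℝ (Fin N) → 𝕜, ContDiff ℝ ∞ f →
    (∀ x, f (killCoords (· ∈ e) x) = f x) → ∫ x, φ x * f x = 0

variable {r : ℝ} {C : ℕ → ℝ} {φ : EuclideanSpace ℝ (Fin N) → 𝕜}

/-- Cancellation survives the pairing in part of the variables: testing the pairing against
functions of the remaining variables amounts to testing `φ` against products, which do not depend on
the coordinates in `e`. -/
theorem CancelsIn.pairRight_eq_zero {e : Finset (Fin N)} (hφ : IsBump r C φ)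
    (hc : CancelsIn e φ) (he : ∀ i ∈ e, ¬ p i) {w : EuclideanSpace ℝ {i // ¬ p i} → 𝕜}
    (hw : ContDiff ℝ ∞ w)
    (hwe : ∀ v, w (killCoords (fun i : {i // ¬ p i} => i.1 ∈ e) v) = w v)
    (z : EuclideanSpace ℝ {i // p i}) : pairRight p φ w z = 0 := by
  have hcont : Continuous (pairRight p φ w) := (hφ.contDiff_pairRight p hw).continuous
  have h0 : ∀ᵐ z, pairRight p φ w z = 0 := by
    refine ae_eq_zero_of_integral_contDiff_smul_eq_zero hcont.locallyIntegrable fun g hg _ => ?_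
    have hf : ContDiff ℝ ∞ fun x => ((g (restrict p x) : ℝ) : 𝕜) *
        w (restrict (fun i => ¬ p i) x) :=
      ((RCLike.ofRealCLM (K := 𝕜)).contDiff.comp
        (hg.comp (restrict p).contDiff : ContDiff ℝ ∞ fun x => g (restrict p x))).mul
        (hw.comp (restrict (fun i => ¬ p i)).contDiff)
    have h1 := hc _ hf (by
      intro x
      have e1 : restrict p (killCoords (· ∈ e) x) = restrict p x := by
        ext i
        have : i.1 ∉ e := fun hi => he _ hi i.2
        simp [restrict_apply, killCoords, this]
      have e2 : restrict (fun i => ¬ p i) (killCoords (· ∈ e) x) =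
          killCoords (fun i : {i // ¬ p i} => i.1 ∈ e) (restrict (fun i => ¬ p i) x) := by
        ext i
        simp [restrict_apply, killCoords]
      rw [e1, e2, hwe])
    have hint : Integrable fun x => φ x * (((g (restrict p x) : ℝ) : 𝕜) *
        w (restrict (fun i => ¬ p i) x)) :=
      (hφ.smooth.continuous.mul hf.continuous).integrable_of_hasCompactSupport
        hφ.hasCompactSupport.mul_right
    rw [integral_glue p hint] at h1
    rw [← h1]
    refine integral_congr_ae (Filter.Eventually.of_forall fun u => ?_)
    simp only [restrict_glue_left, restrict_glue_right]
    rw [pairRight, RCLike.real_smul_eq_coe_mul, ← integral_const_mul]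
    refine integral_congr_ae (Filter.Eventually.of_forall fun v => ?_)
    dsimp only
    ring
  exact congrFun ((hcont.ae_eq_iff_eq volume continuous_const).1 h0) z

end RestrictGlue

section TestFunctions

variable {𝕜 : Type*} [RCLike 𝕜] {ι : Type} [Fintype ι]

theorem testBound_schwartz (f : 𝓢(EuclideanSpace ℝ ι, 𝕜)) :
    TestBound f (2 ^ 2 * ((Finset.Iic (2, 1)).sup fun m => SchwartzMap.seminorm 𝕜 m.1 m.2) f) := by
  have h0 : ∀ x, (1 + ‖x‖) ^ 2 * ‖f x‖ ≤
      2 ^ 2 * ((Finset.Iic (2, 1)).sup fun m => SchwartzMap.seminorm 𝕜 m.1 m.2) f := by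
    intro x
    have := SchwartzMap.one_add_le_sup_seminorm_apply (𝕜 := 𝕜) (m := (2, 1)) (k := 2) (n := 0)
      le_rfl zero_le_one f x
    rwa [norm_iteratedFDeriv_zero] at this
  refine ⟨f.smooth ⊤, fun x => ?_, fun x => ?_, fun x s => ?_⟩
  · refine le_trans ?_ (h0 x)
    nlinarith [norm_nonneg x, norm_nonneg (f x), mul_nonneg (norm_nonneg x) (norm_nonneg (f x)),
      mul_nonneg (mul_nonneg (norm_nonneg x) (norm_nonneg x)) (norm_nonneg (f x))]
  · have := SchwartzMap.one_add_le_sup_seminorm_apply (𝕜 := 𝕜) (m := (2, 1)) (k := 0) (n := 1)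
      (Nat.zero_le _) le_rfl f x
    rwa [norm_iteratedFDeriv_one, pow_zero, one_mul] at this
  · have hs : 0 < 1 + |x s| := by positivity
    rw [Real.rpow_neg hs.le, ← div_eq_mul_inv, le_div_iff₀ (by positivity), mul_comm]
    refine le_trans ?_ (h0 x)
    have h2 : |x s| ≤ ‖x‖ := PiLp.norm_apply_le x s
    have e : (1 + |x s|) ^ (2 : ℝ) = (1 + |x s|) ^ 2 := Real.rpow_two _
    rw [e]
    gcongr

/-- The test function bounds in terms of a `C¹` norm and the radius of the support. -/
theorem testBound_of_compact [LinearOrder ι] (ψ : 𝓢(EuclideanSpace ℝ ι, 𝕜)) {r b : ℝ}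
    (hr : tsupport ψ ⊆ Metric.closedBall 0 r) (hb : CmNormLE 1 ψ b) :
    TestBound ψ (((1 + |r|) ^ 2 + Fintype.card ι) * b) := by
  have h0 : ∀ x, ‖ψ x‖ ≤ b := fun x => by
    have := hb 0 (by simp) x
    rwa [partialDeriv_zero] at this
  have hb0 : 0 ≤ b := (norm_nonneg _).trans (h0 0)
  have h1 : (1 : ℝ) ≤ (1 + |r|) ^ 2 + Fintype.card ι := by
    have : (0 : ℝ) ≤ Fintype.card ι := Nat.cast_nonneg _
    nlinarith [abs_nonneg r]
  refine ⟨ψ.smooth ⊤, fun x => (h0 x).trans (by nlinarith), fun x => ?_, fun x s => ?_⟩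
  · rw [← norm_iteratedFDeriv_one (𝕜 := ℝ)]
    have := norm_iteratedFDeriv_le_of_partialDeriv isOpen_univ (ψ.smooth ⊤).contDiffOn
      (Set.mem_univ x) (m := 1) hb0 (fun α hα => hb α hα.le x)
    refine this.trans ?_
    rw [pow_one]
    gcongr
    nlinarith [abs_nonneg r]
  · by_cases hx : ψ x = 0
    · rw [hx, norm_zero]; positivity
    · have hs : 0 < 1 + |x s| := by positivity
      rw [Real.rpow_neg hs.le, ← div_eq_mul_inv, le_div_iff₀ (by positivity), mul_comm]
      have h2 : |x s| ≤ |r| := by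
        refine (PiLp.norm_apply_le x s).trans (le_trans ?_ (le_abs_self r))
        simpa using hr (subset_tsupport _ hx)
      have e : (1 + |x s|) ^ (2 : ℝ) = (1 + |x s|) ^ 2 := Real.rpow_two _
      rw [e]
      have : (0 : ℝ) ≤ Fintype.card ι := Nat.cast_nonneg _
      calc (1 + |x s|) ^ 2 * ‖ψ x‖ ≤ (1 + |r|) ^ 2 * b := by gcongr; exact h0 x
        _ ≤ _ := by nlinarith

end TestFunctions

section FlagSeries

variable {𝕜 : Type*} [RCLike 𝕜] {N : ℕ}

theorem exists_index_eq (B : Composition N) (l : Fin B.length) : ∃ s, B.index s = l :=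
  ⟨B.embedding l ⟨0, B.one_le_blocksFun l⟩, B.index_embedding _ _⟩

/-- The dyadic dilate of `f` with a scale for each coordinate. -/
def dyad {ι : Type} [Fintype ι] (d : ι → ℝ) (σ : ι → ℤ) (f : EuclideanSpace ℝ ι → 𝕜)
    (x : EuclideanSpace ℝ ι) : 𝕜 :=
  ((∏ i, (2 : ℝ) ^ (-(d i * (σ i : ℝ))) : ℝ) : 𝕜) *
    f (diag (fun i => (2 : ℝ) ^ (-(d i * (σ i : ℝ)))) x)

theorem dyadic_eq_dyad (d : Fin N → ℝ) (A : Composition N) (I : Fin A.length → ℤ)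
    (f : EuclideanSpace ℝ (Fin N) → 𝕜) : dyadic d A I f = dyad d (fun i => I (A.index i)) f := by
  funext x
  unfold dyadic dyad
  congr 2
  rw [← Real.rpow_sum_of_pos two_pos, Finset.sum_neg_distrib]
  congr 2
  rw [← Finset.sum_fiberwise (Finset.univ : Finset (Fin N)) A.index]
  refine Finset.sum_congr rfl fun l _ => ?_
  rw [Finset.sum_mul]
  refine Finset.sum_congr rfl fun s hs => ?_
  simp only [(Finset.mem_filter.1 hs).2]

theorem integral_dyad_mul {ι : Type} [Fintype ι] (d : ι → ℝ) (σ : ι → ℤ)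
    (φ f : EuclideanSpace ℝ ι → 𝕜) :
    ∫ x, dyad d σ φ x * f x = ∫ y, φ y * f (diag (fun i => (2 : ℝ) ^ (d i * (σ i : ℝ))) y) := by
  rw [integral_comp_diag (fun i => (2 : ℝ) ^ (d i * (σ i : ℝ))) fun i => by positivity]
  rw [← integral_smul]
  refine integral_congr_ae (Filter.Eventually.of_forall fun y => ?_)
  dsimp only [dyad]
  have e1 : diag (fun i => (2 : ℝ) ^ (-(d i * (σ i : ℝ))))
      (diag (fun i => (2 : ℝ) ^ (d i * (σ i : ℝ))) y) = y := by
    rw [diag_diag]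
    convert diag_one_apply y using 3
    funext i
    rw [← Real.rpow_add two_pos]; simp
  have e2 : (∏ i, (2 : ℝ) ^ (d i * (σ i : ℝ))) * ∏ i, (2 : ℝ) ^ (-(d i * (σ i : ℝ))) = 1 := by
    rw [← Finset.prod_mul_distrib]
    refine Finset.prod_eq_one fun i _ => ?_
    rw [← Real.rpow_add two_pos]; simp
  rw [e1, RCLike.real_smul_eq_coe_mul, ← mul_assoc, ← mul_assoc, ← RCLike.ofReal_mul, e2]
  simp

/-- A family of bumps `φ a` with increasing scales `sc a` in the factors of `B`. In each factor
`l ∈ 𝓔` the bumps cancel in the nonempty set of coordinates `e l` of this factor, and the scales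
in these factors determine the index `a`. -/
structure FlagSeries (B : Composition N) {Λ : Type} (sc : Λ → Fin B.length → ℤ)
    (𝓔 : Finset (Fin B.length)) (e : Fin B.length → Finset (Fin N)) (r : ℝ) (C : ℕ → ℝ)
    (φ : Λ → EuclideanSpace ℝ (Fin N) → 𝕜) : Prop where
  mono : ∀ a, Monotone (sc a)
  inj : ∀ a a', (∀ l ∈ 𝓔, sc a l = sc a' l) → a = a'
  mem : ∀ l, ∀ s ∈ e l, B.index s = l
  nonempty : ∀ l ∈ 𝓔, (e l).Nonempty
  bump : ∀ a, IsBump r C (φ a)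
  cancels : ∀ a, ∀ l ∈ 𝓔, CancelsIn (e l) (φ a)

variable {d : Fin N → ℝ} {B : Composition N} {Λ : Type} {sc : Λ → Fin B.length → ℤ}
  {𝓔 : Finset (Fin B.length)} {e : Fin B.length → Finset (Fin N)} {r : ℝ} {C : ℕ → ℝ}
  {φ : Λ → EuclideanSpace ℝ (Fin N) → 𝕜}

theorem rpow_dil (t : ℤ) (a : ℝ) : ((2 : ℝ) ^ (t : ℝ)) ^ a = (2 : ℝ) ^ (a * (t : ℝ)) := by
  rw [← Real.rpow_mul two_pos.le, mul_comm]

/-- The pairing of a test function with a member of the series has a gain for every factor in `𝓔`: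
at small scales from the cancellation of the bump, at large scales from the decay of the test
function. -/
theorem FlagSeries.norm_integral_le (h : FlagSeries B sc 𝓔 e r C φ) {ε : ℝ} (hε : 0 ≤ ε)
    (hd : ∀ i, ε ≤ d i) (hB : 0 < B.length) {f : EuclideanSpace ℝ (Fin N) → 𝕜} {b : ℝ}
    (hf : TestBound f b) (a : Λ) :
    ‖∫ x, dyad d (fun i => sc a (B.index i)) (φ a) x * f x‖ ≤
      C 0 * (gainConst (Fin N) r * b) *
        ∏ l ∈ 𝓔, decay (ε / B.length) ((2 : ℝ) ^ (sc a l : ℝ)) := by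
  have hC := (h.bump a).nonneg 0
  have hms : MeasurableSet (Metric.closedBall (0 : EuclideanSpace ℝ (Fin N)) r) :=
    Metric.isClosed_closedBall.measurableSet
  rw [integral_dyad_mul]
  set t : Fin N → ℝ := fun i => (2 : ℝ) ^ (sc a (B.index i) : ℝ) with ht
  have ht0 : ∀ i, 0 < t i := fun i => by positivity
  have et : (fun i => (2 : ℝ) ^ (d i * (sc a (B.index i) : ℝ))) = fun i => t i ^ d i := by
    funext i; rw [ht, rpow_dil]
  rw [et]
  have key : ∀ w : EuclideanSpace ℝ (Fin N) → 𝕜, Continuous w →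
      ‖∫ y, φ a y * w y‖ ≤ C 0 * ∫ y in Metric.closedBall 0 r, ‖w y‖ := by
    intro w hw
    have hwi : IntegrableOn (fun v => ‖w v‖) (Metric.closedBall 0 r) :=
      ContinuousOn.integrableOn_compact (isCompact_closedBall _ _) hw.norm.continuousOn
    refine (norm_integral_le_of_norm_le (g := (Metric.closedBall 0 r).indicator
      fun y => C 0 * ‖w y‖) ((integrable_indicator_iff hms).2 (hwi.const_mul _))
      (Filter.Eventually.of_forall fun y => ?_)).trans ?_
    · by_cases hy : φ a y = 0
      · rw [hy, zero_mul, norm_zero]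
        exact Set.indicator_nonneg (fun _ _ => by positivity) _
      · rw [Set.indicator_of_mem (by simpa using (h.bump a).supp y hy), norm_mul]
        gcongr
        exact (h.bump a).norm_le y
    · rw [integral_indicator hms, integral_const_mul]
  have hcw : Continuous fun y => f (diag (fun i => t i ^ d i) y) :=
    hf.smooth.continuous.comp (diag _).continuous
  refine le_mul_prod_decay 𝓔 (norm_nonneg _) ?_ (fun l _ => by positivity) (ε := ε) ?_
    ((Finset.card_le_univ _).trans (by simp)) hB
  · refine (key _ hcw).trans ?_
    gcongr
    exact hf.setIntegral_le_const _ r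
  · intro l hl
    -- The gain from a single factor. In the second case the restriction of the test function
    -- may be subtracted because the bump is orthogonal to it.
    obtain ⟨s, hs⟩ := h.nonempty l hl
    have hτ : ∀ i, i ∈ e l → t i = (2 : ℝ) ^ (sc a l : ℝ) := fun i hi => by
      simp only [ht, h.mem l i hi]
    rw [mul_assoc (C 0)]
    rcases hf.setIntegral_le_decay ht0 hε hd (· ∈ e l) hτ ⟨s, hs⟩ r with h1 | h1
    · exact (key _ hcw).trans (mul_le_mul_of_nonneg_left h1 hC)
    · have hs2 : ContDiff ℝ ∞ fun y =>
          f (diag (fun i => t i ^ d i) (killCoords (· ∈ e l) y)) :=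
        hf.smooth.comp ((diag (fun i => t i ^ d i)).contDiff.comp (killCoords (· ∈ e l)).contDiff)
      have h0 := h.cancels a l hl _ hs2 (fun x => by
        congr 2
        rw [killCoords, diag_diag]
        congr 2
        funext i; split_ifs <;> simp)
      have e1 : ∫ y, φ a y * f (diag (fun i => t i ^ d i) y) =
          ∫ y, φ a y * (f (diag (fun i => t i ^ d i) y) -
            f (diag (fun i => t i ^ d i) (killCoords (· ∈ e l) y))) := by
        simp only [mul_sub]
        rw [integral_sub, h0, sub_zero]
        · exact ((h.bump a).smooth.continuous.mul hcw).integrable_of_hasCompactSupport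
            (h.bump a).hasCompactSupport.mul_right
        · exact ((h.bump a).smooth.continuous.mul hs2.continuous).integrable_of_hasCompactSupport
            (h.bump a).hasCompactSupport.mul_right
      rw [e1]
      exact (key _ (hcw.sub hs2.continuous)).trans (mul_le_mul_of_nonneg_left h1 hC)

/-- The gains are summable around any centre, because the scales in the factors in `𝓔` determine the
index. -/
theorem FlagSeries.exists_sum_decay_le (h : FlagSeries B sc 𝓔 e r C φ) {ε : ℝ} (hε : 0 < ε) :
    ∃ Γ : ℝ, 0 < Γ ∧ ∀ x : Fin B.length → ℝ, (∀ l, 0 < x l) → ∀ F : Finset Λ,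
      ∑ a ∈ F, ∏ l ∈ 𝓔, decay ε ((2 : ℝ) ^ (sc a l : ℝ) * x l) ≤ Γ := by
  obtain ⟨Γ, hΓ, H⟩ := exists_sum_prod_decay_le (Θ := {l // l ∈ 𝓔}) hε
  refine ⟨Γ, hΓ, fun x hx F => ?_⟩
  have := H (fun a (l : {l // l ∈ 𝓔}) => sc a l.1)
    (fun a a' haa => h.inj a a' fun l hl => congrFun haa ⟨l, hl⟩) (fun l => x l.1)
    (fun l => hx l.1) F
  refine le_trans (le_of_eq ?_) this
  refine Finset.sum_congr rfl fun a _ => ?_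
  exact (Finset.prod_coe_sort 𝓔 fun l => decay ε ((2 : ℝ) ^ (sc a l : ℝ) * x l)).symm

/-- The series of dyadic bumps converges unconditionally to a tempered distribution. -/
theorem FlagSeries.exists_sum (h : FlagSeries B sc 𝓔 e r C φ) (hd : ∀ i, 0 < d i)
    (hB : 0 < B.length) :
    ∃ T : 𝓢(EuclideanSpace ℝ (Fin N), 𝕜) →L[𝕜] 𝕜, ∀ f : 𝓢(EuclideanSpace ℝ (Fin N), 𝕜),
      HasSum (fun a => ∫ x, dyad d (fun i => sc a (B.index i)) (φ a) x * f x) (T f) := by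
  obtain ⟨ε, hε, hεd⟩ := exists_pos_forall_le d hd
  have hε' : 0 < ε / B.length := div_pos hε (by exact_mod_cast hB)
  obtain ⟨Γ, hΓ, hsum⟩ := h.exists_sum_decay_le hε'
  have hs1 : ∀ F : Finset Λ, ∑ a ∈ F, ∏ l ∈ 𝓔, decay (ε / B.length) ((2 : ℝ) ^ (sc a l : ℝ)) ≤ Γ :=
    fun F => by simpa using hsum (fun _ => 1) (fun _ => one_pos) F
  have hnn : ∀ a, 0 ≤ ∏ l ∈ 𝓔, decay (ε / B.length) ((2 : ℝ) ^ (sc a l : ℝ)) := fun a =>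
    Finset.prod_nonneg fun l _ => decay_nonneg (by positivity)
  have hS := summable_of_sum_le hnn hs1
  have hle := fun (f : 𝓢(EuclideanSpace ℝ (Fin N), 𝕜)) (a : Λ) =>
    h.norm_integral_le hε.le hεd hB (testBound_schwartz f) a
  have hSf : ∀ f : 𝓢(EuclideanSpace ℝ (Fin N), 𝕜),
      Summable fun a => ∫ x, dyad d (fun i => sc a (B.index i)) (φ a) x * f x := fun f =>
    Summable.of_norm_bounded (hS.mul_left _) (hle f)
  have hint : ∀ (f : 𝓢(EuclideanSpace ℝ (Fin N), 𝕜)) (a : Λ),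
      Integrable fun y => φ a y * f (diag (fun i => (2 : ℝ) ^ (d i * (sc a (B.index i) : ℝ))) y) :=
    fun f a => ((h.bump a).smooth.continuous.mul
      (f.continuous.comp (diag _).continuous)).integrable_of_hasCompactSupport
      (h.bump a).hasCompactSupport.mul_right
  refine ⟨SchwartzMap.mkCLMtoNormedSpace
    (fun f => ∑' a, ∫ x, dyad d (fun i => sc a (B.index i)) (φ a) x * f x) ?_ ?_ ?_,
    fun f => (hSf f).hasSum⟩
  · intro f g
    rw [← (hSf f).tsum_add (hSf g)]
    refine tsum_congr fun a => ?_
    rw [integral_dyad_mul, integral_dyad_mul, integral_dyad_mul]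
    simp only [add_apply, mul_add]
    exact integral_add (hint f a) (hint g a)
  · intro c f
    rw [RingHom.id_apply, smul_eq_mul, ← tsum_mul_left]
    refine tsum_congr fun a => ?_
    rw [← integral_const_mul]
    refine integral_congr_ae (Filter.Eventually.of_forall fun y => ?_)
    simp only [smul_apply, smul_eq_mul]
    ring
  · cases isEmpty_or_nonempty Λ
    · exact ⟨∅, 0, le_rfl, fun f => by simp⟩
    obtain ⟨a₀⟩ := ‹Nonempty Λ›
    have hC := (h.bump a₀).nonneg 0
    refine ⟨Finset.Iic (2, 1), C 0 * (gainConst (Fin N) r * 2 ^ 2) * Γ, ?_, fun f => ?_⟩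
    · have := gainConst_nonneg (ι := Fin N) r
      positivity
    · refine (tsum_of_norm_bounded (hS.mul_left _).hasSum (hle f)).trans ?_
      rw [tsum_mul_left]
      have h1 : ∑' a, ∏ l ∈ 𝓔, decay (ε / B.length) ((2 : ℝ) ^ (sc a l : ℝ)) ≤ Γ :=
        hS.tsum_le_of_sum_le hs1
      have h2 : 0 ≤ ((Finset.Iic (2, 1)).sup (schwartzSeminormFamily 𝕜
          (EuclideanSpace ℝ (Fin N)) 𝕜)) f := apply_nonneg _ _
      have h3 := gainConst_nonneg (ι := Fin N) r
      calc _ ≤ C 0 * (gainConst (Fin N) r * (2 ^ 2 * ((Finset.Iic (2, 1)).sup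
            (schwartzSeminormFamily 𝕜 (EuclideanSpace ℝ (Fin N)) 𝕜)) f)) * Γ := by
            refine mul_le_mul le_rfl h1 (tsum_nonneg hnn) ?_
            positivity
        _ = _ := by ring

end FlagSeries

/-! ### The flag property of series of dyadic bumps -/

section DyadSeries

theorem prod_le_prod_of_subset_of_le_one {κ : Type*} [DecidableEq κ] {s t : Finset κ} (hst : s ⊆ t)
    {f : κ → ℝ} (h0 : ∀ i, 0 ≤ f i) (h1 : ∀ i, f i ≤ 1) : ∏ i ∈ t, f i ≤ ∏ i ∈ s, f i := by
  rw [← Finset.prod_sdiff hst]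
  exact mul_le_of_le_one_left (Finset.prod_nonneg fun i _ => h0 i)
    (Finset.prod_le_one (fun i _ => h0 i) fun i _ => h1 i)

variable {𝕜 : Type*} [RCLike 𝕜] {ι : Type} [Fintype ι] {n : ℕ}

theorem prod_dyad_scale [LinearOrder ι] (d : ι → ℝ) (π : ι → Fin n) {L : Finset (Fin n)}
    (hπ : ∀ i, π i ∈ L) (s : Fin n → ℤ) (α : ι → ℕ) :
    (∏ i, (2 : ℝ) ^ (-(d i * (s (π i) : ℝ)))) *
        ∏ i, ((2 : ℝ) ^ (-(d i * (s (π i) : ℝ)))) ^ α i =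
      ∏ l ∈ L, ((2 : ℝ) ^ (s l : ℝ)) ^ (-blockExponent d π α l) := by
  rw [← Finset.prod_mul_distrib,
    ← Finset.prod_fiberwise_of_maps_to (t := L) (g := π) fun i _ => hπ i]
  refine Finset.prod_congr rfl fun l _ => ?_
  rw [blockExponent, ← Finset.sum_add_distrib, ← Finset.sum_neg_distrib,
    Real.rpow_sum_of_pos (by positivity)]
  refine Finset.prod_congr rfl fun i hi => ?_
  rw [(Finset.mem_filter.1 hi).2, ← Real.rpow_mul_natCast two_pos.le, ← Real.rpow_add two_pos,
    ← Real.rpow_mul two_pos.le]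
  congr 1; ring

theorem contDiff_dyad (d : ι → ℝ) (σ : ι → ℤ) {g : EuclideanSpace ℝ ι → 𝕜}
    (hg : ContDiff ℝ ∞ g) : ContDiff ℝ ∞ (dyad d σ g) :=
  contDiff_const.mul (hg.comp (diag fun i => (2 : ℝ) ^ (-(d i * (σ i : ℝ)))).contDiff)

theorem norm_partialDeriv_dyad [LinearOrder ι] (d : ι → ℝ) (π : ι → Fin n) {L : Finset (Fin n)}
    (hπ : ∀ i, π i ∈ L) (s : Fin n → ℤ) {g : EuclideanSpace ℝ ι → 𝕜}
    {x : EuclideanSpace ℝ ι}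
    (hg : ContDiffAt ℝ ∞ g (diag (fun i => (2 : ℝ) ^ (-(d i * (s (π i) : ℝ)))) x)) (α : ι → ℕ) :
    ‖partialDeriv α (dyad d (fun i => s (π i)) g) x‖ =
      ‖partialDeriv α g (diag (fun i => (2 : ℝ) ^ (-(d i * (s (π i) : ℝ)))) x)‖ *
        ∏ l ∈ L, ((2 : ℝ) ^ (s l : ℝ)) ^ (-blockExponent d π α l) := by
  have e : dyad d (fun i => s (π i)) g = fun x =>
      g (diag (fun i => (2 : ℝ) ^ (-(d i * (s (π i) : ℝ)))) x) *
        ((∏ i, (2 : ℝ) ^ (-(d i * (s (π i) : ℝ))) : ℝ) : 𝕜) := by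
    funext x; rw [dyad, mul_comm]
  rw [e, partialDeriv_mul_const
    (g := fun y => g (diag (fun i => (2 : ℝ) ^ (-(d i * (s (π i) : ℝ)))) y))
    (hg.comp x (diag fun i => (2 : ℝ) ^ (-(d i * (s (π i) : ℝ)))).contDiff.contDiffAt),
    partialDeriv_comp_diag _
    fun i => by positivity, norm_mul, norm_mul, RCLike.norm_ofReal, RCLike.norm_ofReal,
    abs_of_nonneg (Finset.prod_nonneg fun i _ => by positivity),
    abs_of_nonneg (Finset.prod_nonneg fun i _ => by positivity), ← prod_dyad_scale d π hπ s α]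
  ring

theorem abs_le_of_dyad_ne_zero {d : ι → ℝ} {ε r : ℝ} (hε : 0 < ε) (hd : ∀ i, ε ≤ d i) (σ : ι → ℤ)
    {g : EuclideanSpace ℝ ι → 𝕜} (hg : ∀ z, g z ≠ 0 → ‖z‖ ≤ r) {x : EuclideanSpace ℝ ι}
    (hx : dyad d σ g x ≠ 0) (s : ι) :
    |x s| ≤ ((1 + |r|) ^ (1 / ε) * (2 : ℝ) ^ (σ s : ℝ)) ^ d s := by
  have h1 := hg _ (right_ne_zero_of_mul hx)
  have h2 := (PiLp.norm_apply_le (diag (fun i => (2 : ℝ) ^ (-(d i * (σ i : ℝ)))) x) s).trans h1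
  rw [diag_apply, Real.norm_eq_abs, abs_mul, abs_of_pos (Real.rpow_pos_of_pos two_pos _),
    Real.rpow_neg two_pos.le, inv_mul_le_iff₀ (by positivity), mul_comm] at h2
  have hr1 : 1 ≤ 1 + |r| := by linarith [abs_nonneg r]
  rw [Real.mul_rpow (by positivity) (by positivity), rpow_dil, ← Real.rpow_mul (by positivity)]
  refine h2.trans (mul_le_mul_of_nonneg_right ?_ (by positivity))
  calc r ≤ (1 + |r|) ^ (1 : ℝ) := by rw [Real.rpow_one]; linarith [le_abs_self r]
    _ ≤ _ := Real.rpow_le_rpow_of_exponent_le hr1 (by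
      rw [one_div, inv_mul_eq_div, le_div_iff₀ hε, one_mul]; exact hd s)

/-- Dyadic dilates of functions supported in a fixed ball form an adapted series. -/
theorem adaptedSeries_dyad [LinearOrder ι] {d : ι → ℝ} {π : ι → Fin n} {L : Finset (Fin n)}
    {Λ : Type} {sc : Λ → Fin n → ℤ} {γ : Λ → ℝ} {ε δ r Γ : ℝ} {g : Λ → EuclideanSpace ℝ ι → 𝕜}
    (hε : 0 < ε) (hd : ∀ i, ε ≤ d i) (hδ : 0 < δ) (hδε : δ ≤ ε)
    (hL : ∀ l ∈ L, ∃ i, π i = l)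
    (hγ : ∀ a, 0 ≤ γ a) (hmono : ∀ a, Monotone (sc a)) (hg : ∀ a, ContDiff ℝ ∞ (g a))
    (hgs : ∀ a z, g a z ≠ 0 → ‖z‖ ≤ r)
    (hsum : ∀ ν : Fin n → ℝ, (∀ l ∈ L, 0 < ν l) → ∀ F : Finset Λ,
      ∑ a ∈ F, γ a * ∏ l ∈ L, decay δ ((2 : ℝ) ^ (sc a l : ℝ) * ν l) ≤ Γ) :
    AdaptedSeries d π L sc γ δ ((1 + |r|) ^ (1 / ε)) Γ
      fun a => dyad d (fun i => sc a (π i)) (g a) where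
  dpos i := hε.trans_le (hd i)
  εpos := hδ
  cpos := Real.rpow_pos_of_pos (by positivity) _
  εle l hl := by
    obtain ⟨i, hi⟩ := hL l hl
    exact (hδε.trans (hd i)).trans (Finset.single_le_sum (f := d)
      (fun j _ => (hε.trans_le (hd j)).le) (by simpa using hi))
  γnonneg := hγ
  mono a l _ l' _ h := hmono a h
  smooth a := contDiff_dyad d _ (hg a)
  supp a x hx s := abs_le_of_dyad_ne_zero hε hd _ (hgs a) hx s
  sum := hsum

theorem seriesBound_dyad [LinearOrder ι] {d : ι → ℝ} {π : ι → Fin n} {L : Finset (Fin n)}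
    {Λ : Type} {sc : Λ → Fin n → ℤ} {γ : Λ → ℝ} {g : Λ → EuclideanSpace ℝ ι → 𝕜}
    (hπ : ∀ i, π i ∈ L) (hg : ∀ a, ContDiff ℝ ∞ (g a)) {α : ι → ℕ} {X : ℝ}
    (hX : ∀ a z, ‖partialDeriv α (g a) z‖ ≤ X * γ a) :
    SeriesBound d π L sc γ (fun a => dyad d (fun i => sc a (π i)) (g a)) α X := by
  intro a x
  rw [norm_partialDeriv_dyad d π hπ (sc a) (hg a).contDiffAt, ← mul_assoc]
  exact mul_le_mul_of_nonneg_right (hX a _) (Finset.prod_nonneg fun l _ => by positivity)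

end DyadSeries

section FlagProperty

variable {𝕜 : Type*} [RCLike 𝕜] {N : ℕ} {d : Fin N → ℝ}

/-- Pairing a dyadic bump with a tensor product amounts to pairing a dyadic bump in part of the
variables with the first factor. -/
theorem integral_dyad_mul_tensor (σ : Fin N → ℤ) (p : Fin N → Prop) [DecidablePred p] {r : ℝ}
    {C : ℕ → ℝ} {φ : EuclideanSpace ℝ (Fin N) → 𝕜} (hφ : IsBump r C φ)
    (f : 𝓢(EuclideanSpace ℝ {i // p i}, 𝕜)) (g : 𝓢(EuclideanSpace ℝ {i // ¬ p i}, 𝕜)) :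
    ∫ x, dyad d σ φ x * tensor p f g x =
      ∫ u, dyad (fun i => d i.1) (fun i => σ i.1) (pairRight p φ fun v =>
        g (diag (fun i => (2 : ℝ) ^ (d i.1 * (σ i.1 : ℝ))) v)) u * f u := by
  rw [integral_dyad_mul, integral_dyad_mul]
  have hint : Integrable fun y => φ y *
      tensor p f g (diag (fun i => (2 : ℝ) ^ (d i * (σ i : ℝ))) y) :=
    (hφ.smooth.continuous.mul ((tensor p f g).continuous.comp
      (diag _).continuous)).integrable_of_hasCompactSupport hφ.hasCompactSupport.mul_right
  rw [integral_glue p hint]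
  refine integral_congr_ae (Filter.Eventually.of_forall fun u => ?_)
  dsimp only
  rw [pairRight, ← integral_mul_const]
  refine integral_congr_ae (Filter.Eventually.of_forall fun v => ?_)
  have e1 : restrict p (diag (fun i => (2 : ℝ) ^ (d i * (σ i : ℝ))) (glue p u v)) =
      diag (fun i : {i // p i} => (2 : ℝ) ^ (d i.1 * (σ i.1 : ℝ))) u := by
    ext i; simp [restrict_apply, glue_apply, i.2]
  have e2 : restrict (fun i => ¬ p i) (diag (fun i => (2 : ℝ) ^ (d i * (σ i : ℝ))) (glue p u v)) =
      diag (fun i : {i // ¬ p i} => (2 : ℝ) ^ (d i.1 * (σ i.1 : ℝ))) v := by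
    ext i; simp [restrict_apply, glue_apply, i.2]
  change φ (glue p u v) * (f (restrict p _) * g (restrict (fun i => ¬ p i) _)) = _
  rw [e1, e2]
  ring

variable {B : Composition N} {Λ : Type} {sc : Λ → Fin B.length → ℤ}
  {𝓔 : Finset (Fin B.length)} {e : Fin B.length → Finset (Fin N)} {r : ℝ} {C : ℕ → ℝ}
  {φ : Λ → EuclideanSpace ℝ (Fin N) → 𝕜}

/-- Pairing a member of the series with a dilated test function of the factors not in `L` leaves a
function of the factors in `L` whose derivatives have a gain for every factor in `𝓔 \ L`, for the
same reason as in `FlagSeries.norm_integral_le`. -/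
theorem FlagSeries.norm_partialDeriv_pairRight_le (h : FlagSeries B sc 𝓔 e r C φ) {ε : ℝ}
    (hε : 0 ≤ ε) (hd : ∀ i, ε ≤ d i) (hB : 0 < B.length) (L : Finset (Fin B.length))
    {ψ : EuclideanSpace ℝ {i // ¬ InBlocks B L i} → 𝕜} {b : ℝ} (hψ : TestBound ψ b)
    {R : Fin B.length → ℝ} (hR : ∀ l, 0 < R l) (α : {i // InBlocks B L i} → ℕ) (a : Λ)
    (z : EuclideanSpace ℝ {i // InBlocks B L i}) :
    ‖partialDeriv α (pairRight (InBlocks B L) (φ a) fun v =>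
        ψ (diag (fun i => (R (B.index i.1) * (2 : ℝ) ^ (sc a (B.index i.1) : ℝ)) ^ d i.1) v)) z‖ ≤
      C (∑ i, α i) * (gainConst {i // ¬ InBlocks B L i} r * b) *
        ∏ l ∈ 𝓔 \ L, decay (ε / B.length) ((2 : ℝ) ^ (sc a l : ℝ) * R l) := by
  have hC := (h.bump a).nonneg (∑ i, α i)
  set t : {i // ¬ InBlocks B L i} → ℝ :=
    fun i => R (B.index i.1) * (2 : ℝ) ^ (sc a (B.index i.1) : ℝ) with ht
  have ht0 : ∀ i, 0 < t i := fun i => mul_pos (hR _) (by positivity)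
  have hcw : ContDiff ℝ ∞ fun v => ψ (diag (fun i => t i ^ d i.1) v) :=
    hψ.smooth.comp (diag fun i : {i // ¬ InBlocks B L i} => t i ^ d i.1).contDiff
  have key := fun {w} (hw : ContDiff ℝ ∞ w) =>
    (h.bump a).norm_partialDeriv_pairRight_le (InBlocks B L) (w := w) hw α z
  refine le_mul_prod_decay (𝓔 \ L) (norm_nonneg _) ?_
    (fun l _ => mul_pos (by positivity) (hR l)) (ε := ε) ?_
    ((Finset.card_le_univ _).trans (by simp)) hB
  · refine (key hcw).trans ?_
    gcongr
    exact hψ.setIntegral_le_const _ r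
  · intro l hl
    rw [Finset.mem_sdiff] at hl
    obtain ⟨s, hs⟩ := h.nonempty l hl.1
    have hns : ∀ i ∈ e l, ¬ InBlocks B L i := fun i hi => by
      rw [InBlocks, h.mem l i hi]; exact hl.2
    have hτ : ∀ i : {i // ¬ InBlocks B L i}, i.1 ∈ e l → t i = (2 : ℝ) ^ (sc a l : ℝ) * R l :=
      fun i hi => by simp only [ht, h.mem l i.1 hi, mul_comm]
    rw [mul_assoc (C _)]
    rcases hψ.setIntegral_le_decay ht0 hε (fun i => hd i.1)
      (fun i : {i // ¬ InBlocks B L i} => i.1 ∈ e l) hτ ⟨⟨s, hns s hs⟩, hs⟩ r with h1 | h1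
    · exact (key hcw).trans (mul_le_mul_of_nonneg_left h1 hC)
    · have hs2 : ContDiff ℝ ∞ fun v => ψ (diag (fun i => t i ^ d i.1)
          (killCoords (fun i : {i // ¬ InBlocks B L i} => i.1 ∈ e l) v)) :=
        hcw.comp (killCoords fun i : {i // ¬ InBlocks B L i} => i.1 ∈ e l).contDiff
      have h0 : ∀ z, pairRight (InBlocks B L) (φ a) (fun v => ψ (diag (fun i => t i ^ d i.1)
          (killCoords (fun i : {i // ¬ InBlocks B L i} => i.1 ∈ e l) v))) z = 0 :=
        (h.cancels a l hl.1).pairRight_eq_zero _ (h.bump a) hns hs2 (fun x => by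
          congr 2
          rw [killCoords, diag_diag]
          congr 2
          funext i; split_ifs <;> simp)
      have e1 : (pairRight (InBlocks B L) (φ a) fun v => ψ (diag (fun i => t i ^ d i.1) v)) =
          pairRight (InBlocks B L) (φ a) fun v => ψ (diag (fun i => t i ^ d i.1) v) -
            ψ (diag (fun i => t i ^ d i.1)
              (killCoords (fun i : {i // ¬ InBlocks B L i} => i.1 ∈ e l) v)) := by
        funext z
        rw [← sub_zero (pairRight _ _ _ z), ← h0 z]
        simp only [pairRight, mul_sub]
        have hcφ : HasCompactSupport fun v => φ a (glue (InBlocks B L) z v) :=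
          HasCompactSupport.intro (isCompact_closedBall 0 r)
            fun v hv => (h.bump a).glue_eq_zero _ z hv
        have hφc : Continuous fun v => φ a (glue (InBlocks B L) z v) :=
          (h.bump a).smooth.continuous.comp
            ((contDiff_glue (InBlocks B L)).continuous.comp (Continuous.prodMk_right z))
        rw [integral_sub]
        · exact (hφc.mul hcw.continuous).integrable_of_hasCompactSupport hcφ.mul_right
        · exact (hφc.mul hs2.continuous).integrable_of_hasCompactSupport hcφ.mul_right
      rw [e1]
      exact (key (hcw.sub hs2)).trans (mul_le_mul_of_nonneg_left h1 hC)

/-- The sum of a series of dyadic bumps with cancellation is a flag kernel. The partial pairings in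
the cancellation conditions are sums of adapted series again: the gains from the paired factors
become the weights of the members, and they complete the gains needed for the summation. -/
theorem FlagSeries.isFlagKernel [Countable Λ] (h : FlagSeries B sc 𝓔 e r C φ)
    (hd : ∀ i, 0 < d i) (hB : 0 < B.length) (hC : ∀ m, 0 ≤ C m)
    {T : 𝓢(EuclideanSpace ℝ (Fin N), 𝕜) →L[𝕜] 𝕜}
    (hT : ∀ f : 𝓢(EuclideanSpace ℝ (Fin N), 𝕜),
      HasSum (fun a => ∫ x, dyad d (fun i => sc a (B.index i)) (φ a) x * f x) (T f)) :
    IsFlagKernel d B T := by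
  obtain ⟨ε, hε, hεd⟩ := exists_pos_forall_le d hd
  have hB' : (1 : ℝ) ≤ B.length := by exact_mod_cast hB
  have hδ : 0 < ε / B.length := div_pos hε (by linarith)
  have hδε : ε / B.length ≤ ε := div_le_self hε.le hB'
  obtain ⟨Γ, hΓ, hsum⟩ := h.exists_sum_decay_le hδ
  set δ := ε / B.length with hδdef
  set c : ℝ := (1 + |r|) ^ (1 / ε) with hc
  have hc0 : 0 < c := Real.rpow_pos_of_pos (by positivity) _
  refine ⟨{ size := fun α => seriesConst d B.index Finset.univ δ c α * Γ * C (∑ i, α i)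
            cancel := fun L α ρ => seriesConst (fun i : {i // InBlocks B L i} => d i.1)
              (label B L) L δ c α * Γ * (C (∑ i, α i) * (gainConst {i // ¬ InBlocks B L i} r *
                ((1 + |ρ|) ^ 2 + Fintype.card {i // ¬ InBlocks B L i})))
            order := fun _ _ _ => 1 }, ?_, ?_⟩
  · have hser : AdaptedSeries d B.index Finset.univ sc (fun _ => 1) δ c Γ
        fun a => dyad d (fun i => sc a (B.index i)) (φ a) := by
      refine adaptedSeries_dyad hε hεd hδ hδε
        (fun l _ => exists_index_eq B l) (fun _ => zero_le_one) h.mono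
        (fun a => (h.bump a).smooth) (fun a => (h.bump a).supp) fun ν hν F => ?_
      refine le_trans (Finset.sum_le_sum fun a _ => ?_) (hsum ν (fun l => hν l (by simp)) F)
      rw [one_mul]
      refine prod_le_prod_of_subset_of_le_one (Finset.subset_univ _) ?_ ?_
      · exact fun l => decay_nonneg (mul_pos (by positivity) (hν l (by simp)))
      · exact fun l => decay_le_one hδ.le (mul_pos (by positivity) (hν l (by simp)))
    have hbd : ∀ α, SeriesBound d B.index Finset.univ sc (fun _ => 1)
        (fun a => dyad d (fun i => sc a (B.index i)) (φ a)) α (C (∑ i, α i)) := fun α =>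
      seriesBound_dyad (fun _ => Finset.mem_univ _) (fun a => (h.bump a).smooth) fun a z => by
        rw [mul_one]; exact (norm_partialDeriv_le _ _ _).trans ((h.bump a).bound _ _)
    have hB0 : ∀ α, ∃ X : ℝ, 0 ≤ X ∧ SeriesBound d B.index Finset.univ sc (fun _ => 1)
        (fun a => dyad d (fun i => sc a (B.index i)) (φ a)) α X := fun α => ⟨_, hC _, hbd α⟩
    refine ⟨_, ⟨hser.contDiffOn_tsum hB0, fun f hfc hfs => ?_⟩, fun α x hx =>
      hser.norm_partialDeriv_tsum_le hB0 (hC _) (hbd α) hx⟩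
    exact (hT f).unique (hser.hasSum_integral (hB0 0) f.continuous hfc hfs)
  · intro L ψ hψ R hR
    set w : Λ → EuclideanSpace ℝ {i // ¬ InBlocks B L i} → 𝕜 := fun a v =>
      ψ (diag (fun i => (R (B.index i.1) * (2 : ℝ) ^ (sc a (B.index i.1) : ℝ)) ^ d i.1) v) with hw
    have hwc : ∀ a, ContDiff ℝ ∞ (w a) := fun a => (ψ.smooth ⊤).comp
      (diag fun i : {i // ¬ InBlocks B L i} =>
        (R (B.index i.1) * (2 : ℝ) ^ (sc a (B.index i.1) : ℝ)) ^ d i.1).contDiff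
    set g : Λ → EuclideanSpace ℝ {i // InBlocks B L i} → 𝕜 := fun a =>
      pairRight (InBlocks B L) (φ a) (w a) with hg
    have hgc : ∀ a, ContDiff ℝ ∞ (g a) := fun a => (h.bump a).contDiff_pairRight _ (hwc a)
    set γ : Λ → ℝ := fun a => ∏ l ∈ 𝓔 \ L, decay δ ((2 : ℝ) ^ (sc a l : ℝ) * R l) with hγ
    have hser : AdaptedSeries (fun i : {i // InBlocks B L i} => d i.1) (label B L) L sc γ δ c Γ
        fun a => dyad (fun i => d i.1) (fun i => sc a (label B L i)) (g a) := by
      refine adaptedSeries_dyad hε (fun i => hεd i.1) hδ hδε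
        (fun l hl => ?_) (fun a => ?_) h.mono hgc (fun a z hz => ?_) fun ν hν F => ?_
      · obtain ⟨i, hi⟩ := exists_index_eq B l
        exact ⟨⟨i, by rw [InBlocks, hi]; exact hl⟩, hi⟩
      · exact Finset.prod_nonneg fun l _ => decay_nonneg (mul_pos (by positivity) (hR l))
      · by_contra hr
        refine hz ?_
        have : ∀ v, φ a (glue (InBlocks B L) z v) = 0 := fun v => by
          by_contra hne
          exact hr ((norm_le_norm_glue_left _ z v).trans ((h.bump a).supp _ hne))
        simp [hg, pairRight, this]
      -- In the paired factors the centre of the summation is determined by `R`.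
      · set ν' : Fin B.length → ℝ := fun l => if l ∈ L then ν l else R l with hν'
        have hν0 : ∀ l, 0 < ν' l := fun l => by
          simp only [hν']; split_ifs with hl
          exacts [hν l hl, hR l]
        refine le_trans (Finset.sum_le_sum fun a _ => ?_) (hsum ν' hν0 F)
        have e1 : γ a = ∏ l ∈ 𝓔 \ L, decay δ ((2 : ℝ) ^ (sc a l : ℝ) * ν' l) :=
          Finset.prod_congr rfl fun l hl => by
            simp only [hν', if_neg (Finset.mem_sdiff.1 hl).2]
        have e2 : ∏ l ∈ L, decay δ ((2 : ℝ) ^ (sc a l : ℝ) * ν l) =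
            ∏ l ∈ L, decay δ ((2 : ℝ) ^ (sc a l : ℝ) * ν' l) :=
          Finset.prod_congr rfl fun l hl => by simp only [hν', if_pos hl]
        have hnn : ∀ l, 0 ≤ decay δ ((2 : ℝ) ^ (sc a l : ℝ) * ν' l) := fun l =>
          decay_nonneg (mul_pos (by positivity) (hν0 l))
        rw [e1, e2, ← Finset.prod_union Finset.sdiff_disjoint]
        refine prod_le_prod_of_subset_of_le_one ?_ hnn fun l =>
          decay_le_one hδ.le (mul_pos (by positivity) (hν0 l))
        exact fun l hl => by by_cases hlL : l ∈ L <;> simp [hl, hlL]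
    have hbd : ∀ {b : ℝ}, TestBound ψ b → ∀ α, SeriesBound (fun i : {i // InBlocks B L i} => d i.1)
        (label B L) L sc γ (fun a => dyad (fun i => d i.1) (fun i => sc a (label B L i)) (g a)) α
        (C (∑ i, α i) * (gainConst {i // ¬ InBlocks B L i} r * b)) := fun hb α =>
      seriesBound_dyad (fun i => i.2) hgc fun a z =>
        h.norm_partialDeriv_pairRight_le hε.le hεd hB L hb hR α a z
    have hgn := gainConst_nonneg (ι := {i // ¬ InBlocks B L i}) r
    have hB0 : ∀ α, ∃ X, 0 ≤ X ∧ SeriesBound (fun i : {i // InBlocks B L i} => d i.1)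
        (label B L) L sc γ (fun a => dyad (fun i => d i.1) (fun i => sc a (label B L i)) (g a))
        α X :=
      fun α => ⟨_, by have := hC (∑ i, α i); positivity, hbd (testBound_schwartz ψ) α⟩
    refine ⟨_, ⟨hser.contDiffOn_tsum hB0, fun f hfc hfs => ?_⟩, fun α ρ b hρ hb x hx => ?_⟩
    · have h1 := hser.hasSum_integral (hB0 0) f.continuous hfc hfs
      have h2 := hT (tensor (InBlocks B L) f (dilateTest d B L R hR ψ))
      refine h2.unique ?_
      convert h1 using 2 with a
      rw [integral_dyad_mul_tensor _ _ (h.bump a)]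
      refine integral_congr_ae (Filter.Eventually.of_forall fun u => ?_)
      dsimp only
      congr 2
      simp only [hg, hw]
      congr 1
      funext v
      change ψ (diag _ (diag _ v)) = _
      rw [diag_diag]
      congr 3
      funext i
      rw [Real.mul_rpow (hR _).le (by positivity), rpow_dil]
    · have hb' := testBound_of_compact ψ hρ hb
      have hb0 : 0 ≤ b := (norm_nonneg _).trans (hb 0 (by simp) 0)
      refine (hser.norm_partialDeriv_tsum_le hB0 ?_ (hbd hb' α) hx).trans (le_of_eq ?_)
      · have := hC (∑ i, α i); positivity
      · ring

end FlagProperty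

section Sums

variable {𝕜 : Type*} [RCLike 𝕜]

theorem integrable_mul_of_tsupport_subset {ι : Type} [Fintype ι] {U : Set (EuclideanSpace ℝ ι)}
    {K f : EuclideanSpace ℝ ι → 𝕜} (hK : ContinuousOn K U) (hf : Continuous f)
    (hfc : HasCompactSupport f) (hfs : tsupport f ⊆ U) : Integrable fun x => K x * f x := by
  refine (integrableOn_iff_integrable_of_support_subset (s := tsupport f) fun x hx => ?_).1 ?_
  · exact subset_tsupport _ (right_ne_zero_of_mul hx)
  · exact ((hK.mono hfs).mul hf.continuousOn).integrableOn_compact hfc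

theorem CmNormLE.mono {ι : Type*} [Fintype ι] [LinearOrder ι] {m m' : ℕ}
    {f : EuclideanSpace ℝ ι → 𝕜} {b : ℝ} (h : CmNormLE m' f b) (hm : m ≤ m') : CmNormLE m f b :=
  fun α hα => h α (hα.trans hm)

theorem partialDeriv_add_of_mem {ι : Type} [Fintype ι] [LinearOrder ι]
    {U : Set (EuclideanSpace ℝ ι)} (hU : IsOpen U) {K₁ K₂ : EuclideanSpace ℝ ι → 𝕜}
    (h₁ : ContDiffOn ℝ ∞ K₁ U) (h₂ : ContDiffOn ℝ ∞ K₂ U) (α : ι → ℕ) {x : EuclideanSpace ℝ ι}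
    (hx : x ∈ U) :
    partialDeriv α (fun x => K₁ x + K₂ x) x = partialDeriv α K₁ x + partialDeriv α K₂ x := by
  have e := iteratedFDeriv_add_apply (i := (coordList α).length)
    ((h₁.contDiffAt (hU.mem_nhds hx)).of_le (by exact_mod_cast le_top))
    ((h₂.contDiffAt (hU.mem_nhds hx)).of_le (by exact_mod_cast le_top))
  rw [partialDeriv, partialDeriv, partialDeriv, ← add_apply, ← e]
  rfl

variable {N : ℕ} {d : Fin N → ℝ} {B : Composition N}

theorem IsGivenBy.add {ι : Type} [Fintype ι] [LinearOrder ι] {n : ℕ} {π : ι → Fin n}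
    {L : Finset (Fin n)} {T₁ T₂ : 𝓢(EuclideanSpace ℝ ι, 𝕜) → 𝕜} {K₁ K₂ : EuclideanSpace ℝ ι → 𝕜}
    (h₁ : IsGivenBy π L T₁ K₁) (h₂ : IsGivenBy π L T₂ K₂) :
    IsGivenBy π L (fun f => T₁ f + T₂ f) fun x => K₁ x + K₂ x := by
  refine ⟨h₁.1.add h₂.1, fun f hfc hfs => ?_⟩
  dsimp only
  rw [h₁.2 f hfc hfs, h₂.2 f hfc hfs, ← integral_add
    (integrable_mul_of_tsupport_subset h₁.1.continuousOn f.continuous hfc hfs)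
    (integrable_mul_of_tsupport_subset h₂.1.continuousOn f.continuous hfc hfs)]
  simp only [add_mul]

theorem IsFlagKernel.zero : IsFlagKernel d B (0 : 𝓢(EuclideanSpace ℝ (Fin N), 𝕜) →L[𝕜] 𝕜) := by
  have h0 : ∀ {ι : Type} [Fintype ι] [LinearOrder ι] (α : ι → ℕ) (x : EuclideanSpace ℝ ι),
      partialDeriv α (fun _ => (0 : 𝕜)) x = 0 := fun α x => by
    rw [partialDeriv]; simp [iteratedFDeriv_fun_zero]
  refine ⟨⟨fun _ => 0, fun _ _ _ => 0, fun _ _ _ => 0⟩, ⟨fun _ => 0, ⟨contDiffOn_const, ?_⟩, ?_⟩,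
    fun L ψ _ R hR => ⟨fun _ => 0, ⟨contDiffOn_const, ?_⟩, ?_⟩⟩
  · intro f _ _; simp
  · intro α x _; simp [h0]
  · intro f _ _; simp [sharp]
  · intro α r b _ _ x _; simp [h0]

theorem IsFlagKernel.add {T₁ T₂ : 𝓢(EuclideanSpace ℝ (Fin N), 𝕜) →L[𝕜] 𝕜}
    (h₁ : IsFlagKernel d B T₁) (h₂ : IsFlagKernel d B T₂) : IsFlagKernel d B (T₁ + T₂) := by
  obtain ⟨c₁, ⟨K₁, hK₁, hb₁⟩, hc₁⟩ := h₁
  obtain ⟨c₂, ⟨K₂, hK₂, hb₂⟩, hc₂⟩ := h₂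
  refine ⟨⟨fun α => c₁.size α + c₂.size α, fun L α r => c₁.cancel L α r + c₂.cancel L α r,
    fun L α r => max (c₁.order L α r) (c₂.order L α r)⟩, ⟨_, hK₁.add hK₂, fun α x hx => ?_⟩,
    fun L ψ hψ R hR => ?_⟩
  · rw [partialDeriv_add_of_mem (isOpen_offFirst _ _) hK₁.1 hK₂.1 α hx, add_mul]
    exact (norm_add_le _ _).trans (add_le_add (hb₁ α x hx) (hb₂ α x hx))
  · obtain ⟨K₁, hK₁, hb₁⟩ := hc₁ L ψ hψ R hR
    obtain ⟨K₂, hK₂, hb₂⟩ := hc₂ L ψ hψ R hR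
    refine ⟨_, hK₁.add hK₂, fun α r b hr hb x hx => ?_⟩
    rw [partialDeriv_add_of_mem (isOpen_offFirst _ _) hK₁.1 hK₂.1 α hx, add_mul, add_mul]
    exact (norm_add_le _ _).trans (add_le_add
      (hb₁ α r b hr (hb.mono (le_max_left _ _)) x hx)
      (hb₂ α r b hr (hb.mono (le_max_right _ _)) x hx))

theorem IsFlagKernel.sum {κ : Type*} (s : Finset κ)
    {T : κ → 𝓢(EuclideanSpace ℝ (Fin N), 𝕜) →L[𝕜] 𝕜} (h : ∀ j ∈ s, IsFlagKernel d B (T j)) :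
    IsFlagKernel d B (∑ j ∈ s, T j) := by
  classical
  induction s using Finset.induction_on with
  | empty => simpa using IsFlagKernel.zero
  | insert j s hj ih =>
    rw [Finset.sum_insert hj]
    exact (h j (Finset.mem_insert_self j s)).add
      (ih fun i hi => h i (Finset.mem_insert_of_mem hi))

end Sums

/-! ### Telescoping expansions -/

section Telescoping

open Filter Topology

/-- The types of factors occurring in the telescoping expansion. With `H k i` and `R k i` the
truncation and the averaging at scale `i` in the factor `k` and `E k i = H k i - R k i`, they stand
for `E k i - E k (i - 1)`, `E k (i - 1)`, `R k i`, `H k i - H k (i - 1)` and `H k (i - 1)`. -/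
inductive Pat
  | diff | prev | avg | ring | core
  deriving DecidableEq

instance : Fintype Pat :=
  ⟨{.diff, .prev, .avg, .ring, .core}, fun t => by cases t <;> simp⟩

variable {𝓐 : Type*} [CommRing 𝓐] (H R : ℕ → ℤ → 𝓐)

/-- The factor of a given type in the factor `k` at scale `i`. -/
def letter : Pat → ℕ → ℤ → 𝓐
  | .diff, k, i => (H k i - R k i) - (H k (i - 1) - R k (i - 1))
  | .prev, k, i => H k (i - 1) - R k (i - 1)
  | .avg, k, i => R k i
  | .ring, k, i => H k i - H k (i - 1)
  | .core, k, i => H k (i - 1)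

/-- The product of the truncations at scale `i` in the first `k` factors (for `true`), and its
increment from the scale `i - 1` (for `false`). -/
def truncation (k : ℕ) : Bool → ℤ → 𝓐
  | true, i => ∏ l ∈ Finset.range k, H l i
  | false, i => ∏ l ∈ Finset.range k, H l i - ∏ l ∈ Finset.range k, H l (i - 1)

/-- The index set of the terms in the expansion of `truncation H k s m`. The truncation in `k + 1`
factors is its average in the last factor plus `corrected H R k m`, and the latter is the sum of its
increments at the scales `i ≤ m`; an increment falls on the last factor (first summand) or on the
others (second summand), and so does the increment of the truncation. -/
def Path : ℕ → Bool → ℤ → Type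
  | 0, true, _ => Unit
  | 0, false, _ => Empty
  | k + 1, true, m => Path k true m ⊕ (Σ i : {i : ℤ // i ≤ m}, (Path k true i ⊕ Path k false i))
  | k + 1, false, m => Path k true m ⊕ Path k false m

/-- The types of the factors of a term of the expansion. -/
def Path.pat : (k : ℕ) → (s : Bool) → (m : ℤ) → Path k s m → ℕ → Pat
  | 0, _, _, _ => fun _ => .diff
  | k + 1, true, m, .inl w => Function.update (Path.pat k true m w) k .avg
  | k + 1, true, _, .inr ⟨i, .inl w⟩ => Function.update (Path.pat k true i w) k .diff
  | k + 1, true, _, .inr ⟨i, .inr w⟩ => Function.update (Path.pat k false i w) k .prev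
  | k + 1, false, m, .inl w => Function.update (Path.pat k true m w) k .ring
  | k + 1, false, m, .inr w => Function.update (Path.pat k false m w) k .core

/-- The scales of the factors of a term of the expansion. -/
def Path.scale : (k : ℕ) → (s : Bool) → (m : ℤ) → Path k s m → ℕ → ℤ
  | 0, _, _, _ => fun _ => 0
  | k + 1, true, m, .inl w => Function.update (Path.scale k true m w) k m
  | k + 1, true, _, .inr ⟨i, .inl w⟩ => Function.update (Path.scale k true i w) k i
  | k + 1, true, _, .inr ⟨i, .inr w⟩ => Function.update (Path.scale k false i w) k i
  | k + 1, false, m, .inl w => Function.update (Path.scale k true m w) k m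
  | k + 1, false, m, .inr w => Function.update (Path.scale k false m w) k m

/-- A product of factors of types `q l` at scales `S l`, for the factors `l` with `a ≤ l < b`. -/
def letterProd (a b : ℕ) (q : ℕ → Pat) (S : ℕ → ℤ) : 𝓐 :=
  ∏ l ∈ Finset.Ico a b, letter H R (q l) l (S l)

variable {H R}

theorem letterProd_update_top {k : ℕ} (q : ℕ → Pat) (S : ℕ → ℤ) (t : Pat) (i : ℤ) :
    letterProd H R 0 (k + 1) (Function.update q k t) (Function.update S k i) =
      letterProd H R 0 k q S * letter H R t k i := by
  rw [letterProd, Finset.prod_Ico_succ_top (Nat.zero_le _), Function.update_self,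
    Function.update_self]
  congr 1
  refine Finset.prod_congr rfl fun l hl => ?_
  have : l ≠ k := (Finset.mem_Ico.1 hl).2.ne
  rw [Function.update_of_ne this, Function.update_of_ne this]

theorem letterProd_update_bot {k n : ℕ} (hk : k < n) (q : ℕ → Pat) (S : ℕ → ℤ) (t : Pat) (i : ℤ) :
    letterProd H R k n (Function.update q k t) (Function.update S k i) =
      letter H R t k i * letterProd H R (k + 1) n q S := by
  rw [letterProd, Finset.prod_eq_prod_Ico_succ_bot hk, Function.update_self, Function.update_self]
  congr 1
  refine Finset.prod_congr rfl fun l hl => ?_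
  have : l ≠ k := by have := (Finset.mem_Ico.1 hl).1; omega
  rw [Function.update_of_ne this, Function.update_of_ne this]

theorem hasSum_of_eq {ι M : Type*} [AddCommMonoid M] [TopologicalSpace M] {f g : ι → M}
    {a : M} (h : HasSum f a) (e : ∀ i, g i = f i) : HasSum g a := by
  rwa [funext e]

/-- The intervals `(-M, M]` exhaust the integers. -/
theorem tendsto_Ioc_neg : Tendsto (fun M : ℕ => Finset.Ioc (-(M : ℤ)) M) atTop atTop := by
  refine tendsto_atTop_finset_of_monotone ?_ ?_
  · intro a b hab
    have : (a : ℤ) ≤ b := by exact_mod_cast hab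
    exact Finset.Ioc_subset_Ioc (by omega) this
  · intro x
    exact ⟨x.natAbs + 1, by rw [Finset.mem_Ioc]; omega⟩

theorem sum_Ioc_int_sub {M : Type*} [AddCommGroup M] (F : ℤ → M) {a b : ℤ} (hab : a ≤ b) :
    ∑ i ∈ Finset.Ioc a b, (F i - F (i - 1)) = F b - F a := by
  induction b, hab using Int.leInduction with
  | base => simp
  | succ b hab ih =>
    have : Finset.Ioc a (b + 1) = insert (b + 1) (Finset.Ioc a b) := by
      ext x; simp only [Finset.mem_insert, Finset.mem_Ioc]; omega
    rw [this, Finset.sum_insert (by simp), ih]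
    simp

variable {𝕜 : Type*} [RCLike 𝕜]

theorem HasSum.eq_of_telescoping {F : ℤ → 𝕜} {A B : 𝕜} (h : HasSum (fun i => F i - F (i - 1)) A)
    (h0 : Tendsto F atBot (𝓝 0)) (h1 : Tendsto F atTop (𝓝 B)) : A = B := by
  have e1 := h.comp tendsto_Ioc_neg
  have e2 : Tendsto (fun M : ℕ => F M - F (-(M : ℤ))) atTop (𝓝 (B - 0)) :=
    (h1.comp tendsto_natCast_atTop_atTop).sub
      (h0.comp (tendsto_neg_atTop_atBot.comp tendsto_natCast_atTop_atTop))
  rw [sub_zero] at e2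
  refine tendsto_nhds_unique (e1.congr fun M => ?_) e2
  exact sum_Ioc_int_sub F (by omega)

theorem HasSum.eq_of_telescoping_Iic {F : ℤ → 𝕜} {A : 𝕜} {m : ℤ}
    (h : HasSum (fun i : {i : ℤ // i ≤ m} => F i - F (i - 1)) A)
    (h0 : Tendsto F atBot (𝓝 0)) : A = F m := by
  refine HasSum.eq_of_telescoping (F := fun i => F (min i m)) ?_ ?_ ?_
  · have := (hasSum_subtype_iff_indicator (f := fun i => F i - F (i - 1)) (s := {i | i ≤ m})).1 h
    convert this using 2 with i
    by_cases hi : i ≤ m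
    · rw [Set.indicator_of_mem (by exact hi), min_eq_left hi, min_eq_left (by omega)]
    · rw [Set.indicator_of_notMem (by exact hi), min_eq_right (by omega), min_eq_right (by omega),
        sub_self]
  · refine h0.congr' ?_
    filter_upwards [eventually_le_atBot m] with i hi
    rw [min_eq_left hi]
  · refine tendsto_const_nhds.congr' ?_
    filter_upwards [eventually_ge_atTop m] with i hi
    rw [min_eq_right hi]

/-- The truncation minus its average in the last factor. -/
def corrected (H R : ℕ → ℤ → 𝓐) (k : ℕ) (m : ℤ) : 𝓐 :=
  truncation H k true m * (H k m - R k m)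

theorem corrected_sub (k : ℕ) (m : ℤ) :
    corrected H R k m - corrected H R k (m - 1) =
      truncation H k true m * letter H R .diff k m +
        truncation H k false m * letter H R .prev k m := by
  simp only [corrected, truncation, letter]; ring

theorem truncation_succ_true (k : ℕ) (m : ℤ) :
    truncation H (k + 1) true m = truncation H k true m * R k m + corrected H R k m := by
  simp only [corrected, truncation, Finset.prod_range_succ]; ring

theorem truncation_succ_false (k : ℕ) (m : ℤ) :
    truncation H (k + 1) false m = truncation H k true m * letter H R .ring k m +
      truncation H k false m * letter H R .core k m := by
  simp only [truncation, letter, Finset.prod_range_succ]; ring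

variable (Λ : 𝓐 →+ 𝕜) (n : ℕ)

/-- The value of a term of the expansion, multiplied by a product of factors of later indices. -/
def termValue (H R : ℕ → ℤ → 𝓐) (k : ℕ) (s : Bool) (m : ℤ) (g : 𝓐) (w : Path k s m) : 𝕜 :=
  Λ (letterProd H R 0 k (Path.pat k s m w) (Path.scale k s m w) * g)

/-- The part of the expansion that sums to the increment of `corrected H R k` at the scale `i`. -/
def incrementValue (H R : ℕ → ℤ → 𝓐) (k : ℕ) (g : 𝓐) (i : ℤ) :
    Path k true i ⊕ Path k false i → 𝕜 :=
  Sum.elim (termValue Λ H R k true i (letter H R .diff k i * g))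
    (termValue Λ H R k false i (letter H R .prev k i * g))

theorem hasSum_incrementValue {k : ℕ} {g : 𝓐} {i : ℤ}
    (ih : ∀ (s : Bool) (t : Pat), Summable (termValue Λ H R k s i (letter H R t k i * g)) →
      HasSum (termValue Λ H R k s i (letter H R t k i * g))
        (Λ (truncation H k s i * (letter H R t k i * g))))
    (hs : Summable (incrementValue Λ H R k g i)) :
    HasSum (incrementValue Λ H R k g i)
      (Λ (corrected H R k i * g) - Λ (corrected H R k (i - 1) * g)) := by
  have h1 := ih true .diff (hs.comp_injective Sum.inl_injective)
  have h2 := ih false .prev (hs.comp_injective Sum.inr_injective)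
  have h3 : HasSum (incrementValue Λ H R k g i) _ := HasSum.sum h1 h2
  rwa [← map_add, ← mul_assoc, ← mul_assoc, ← add_mul, ← corrected_sub, sub_mul, map_sub] at h3

/-- The expansion of a truncation, under the assumption that it converges unconditionally. -/
theorem hasSum_termValue
    (hlim : ∀ k < n, ∀ q S, Tendsto (fun m => Λ (corrected H R k m * letterProd H R (k + 1) n q S))
      atBot (𝓝 0)) (k : ℕ) (hk : k ≤ n) (s : Bool) (m : ℤ) (q : ℕ → Pat) (S : ℕ → ℤ)
    (hs : Summable (termValue Λ H R k s m (letterProd H R k n q S))) :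
    HasSum (termValue Λ H R k s m (letterProd H R k n q S))
      (Λ (truncation H k s m * letterProd H R k n q S)) := by
  induction k generalizing s m q S with
  | zero =>
    cases s with
    | true =>
      let _ : Unique (Path 0 true m) := inferInstanceAs (Unique Unit)
      have := hasSum_unique (termValue Λ H R 0 true m (letterProd H R 0 n q S))
      convert this using 1
      simp [termValue, letterProd, truncation]
    | false =>
      have _ : IsEmpty (Path 0 false m) := inferInstanceAs (IsEmpty Empty)
      have e : Λ (truncation H 0 false m * letterProd H R 0 n q S) = 0 := by
        simp [truncation]
      rw [e]
      exact hasSum_empty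
  | succ k ih =>
    have hk' : k < n := hk
    have hexp : ∀ (s : Bool) (i : ℤ) (t : Pat),
        Summable (termValue Λ H R k s i (letter H R t k i * letterProd H R (k + 1) n q S)) →
        HasSum (termValue Λ H R k s i (letter H R t k i * letterProd H R (k + 1) n q S))
          (Λ (truncation H k s i * (letter H R t k i * letterProd H R (k + 1) n q S))) := by
      intro s i t hs
      rw [← letterProd_update_bot hk' q S t i] at hs ⊢
      exact ih hk'.le s i _ _ hs
    have ev : ∀ (s : Bool) (i : ℤ) (t : Pat) (w : Path k s i),
        Λ (letterProd H R 0 (k + 1) (Function.update (Path.pat k s i w) k t)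
          (Function.update (Path.scale k s i w) k i) * letterProd H R (k + 1) n q S) =
        termValue Λ H R k s i (letter H R t k i * letterProd H R (k + 1) n q S) w := by
      intro s i t w
      rw [letterProd_update_top, termValue, mul_assoc]
    cases s with
    | false =>
      have e : truncation H (k + 1) false m * letterProd H R (k + 1) n q S =
          truncation H k true m * (letter H R .ring k m * letterProd H R (k + 1) n q S) +
          truncation H k false m * (letter H R .core k m * letterProd H R (k + 1) n q S) := by
        rw [truncation_succ_false]; ring
      rw [e, map_add]
      have h1 := hexp true m .ring (by
        have := hs.comp_injective (i := (Sum.inl : Path k true m → Path (k + 1) false m))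
          Sum.inl_injective
        exact this.congr fun w => ev true m .ring w)
      have h2 := hexp false m .core (by
        have := hs.comp_injective (i := (Sum.inr : Path k false m → Path (k + 1) false m))
          Sum.inr_injective
        exact this.congr fun w => ev false m .core w)
      exact HasSum.sum (f := (termValue Λ H R (k + 1) false m (letterProd H R (k + 1) n q S) :
        Path k true m ⊕ Path k false m → 𝕜))
        (hasSum_of_eq h1 fun w => ev true m .ring w) (hasSum_of_eq h2 fun w => ev false m .core w)
    | true =>
      have e : truncation H (k + 1) true m * letterProd H R (k + 1) n q S =
          truncation H k true m * (letter H R .avg k m * letterProd H R (k + 1) n q S) +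
          corrected H R k m * letterProd H R (k + 1) n q S := by
        rw [truncation_succ_true, letter]; ring
      rw [e, map_add]
      have h1 := hexp true m .avg (by
        have := hs.comp_injective (i := (Sum.inl : Path k true m → Path (k + 1) true m))
          Sum.inl_injective
        exact this.congr fun w => ev true m .avg w)
      have hs2 : Summable fun w : Σ i : {i : ℤ // i ≤ m}, (Path k true i ⊕ Path k false i) =>
          incrementValue Λ H R k (letterProd H R (k + 1) n q S) w.1 w.2 := by
        have := hs.comp_injective (i := (Sum.inr :
          (Σ i : {i : ℤ // i ≤ m}, (Path k true i ⊕ Path k false i)) → Path (k + 1) true m))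
          Sum.inr_injective
        refine this.congr fun w => ?_
        obtain ⟨i, w | w⟩ := w
        · exact ev true i .diff w
        · exact ev false i .prev w
      have h2 := hs2.hasSum
      have h4 : ∀ i : {i : ℤ // i ≤ m}, HasSum
          (incrementValue Λ H R k (letterProd H R (k + 1) n q S) i.1)
          (Λ (corrected H R k i.1 * letterProd H R (k + 1) n q S) -
            Λ (corrected H R k (i.1 - 1) * letterProd H R (k + 1) n q S)) := fun i =>
        hasSum_incrementValue Λ (fun s t => hexp s i.1 t)
          (hs2.comp_injective (i := fun w : Path k true i.1 ⊕ Path k false i.1 =>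
            (⟨i, w⟩ : Σ i : {i : ℤ // i ≤ m}, (Path k true i ⊕ Path k false i)))
            (sigma_mk_injective (β := fun i : {i : ℤ // i ≤ m} => Path k true i ⊕ Path k false i)))
      have h3 := HasSum.sigma h2 h4
      -- The sums over the increments at the scales `i ≤ m` telescope to `corrected H R k m`.
      rw [HasSum.eq_of_telescoping_Iic
        (F := fun i => Λ (corrected H R k i * letterProd H R (k + 1) n q S)) h3
        (hlim k hk' q S)] at h2
      exact HasSum.sum (f := (termValue Λ H R (k + 1) true m (letterProd H R (k + 1) n q S) :
        Path k true m ⊕ (Σ i : {i : ℤ // i ≤ m}, (Path k true i ⊕ Path k false i)) → 𝕜))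
        (hasSum_of_eq h1 fun w => ev true m .avg w) (hasSum_of_eq h2 fun w => by
          obtain ⟨i, w | w⟩ := w
          · exact ev true i .diff w
          · exact ev false i .prev w)

/-- The index set of the terms in the expansion of the identity. -/
def FullPath (k : ℕ) : Type := Σ i : ℤ, (Path k true i ⊕ Path k false i)

/-- The types of the factors of a term of the expansion of the identity. -/
def FullPath.pat (k : ℕ) : FullPath k → ℕ → Pat
  | ⟨i, .inl w⟩ => Function.update (Path.pat k true i w) k .diff
  | ⟨i, .inr w⟩ => Function.update (Path.pat k false i w) k .prev

/-- The scales of the factors of a term of the expansion of the identity. -/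
def FullPath.scale (k : ℕ) : FullPath k → ℕ → ℤ
  | ⟨i, .inl w⟩ => Function.update (Path.scale k true i w) k i
  | ⟨i, .inr w⟩ => Function.update (Path.scale k false i w) k i

/-- The expansion of the identity: if `corrected H R k m` tends to the identity at large scales and
the corrected terms vanish at small scales, then the value `B` of the identity is the sum of the
terms. -/
theorem hasSum_fullPath {k : ℕ} {B : 𝕜}
    (hlim : ∀ j < k + 1, ∀ q S,
      Tendsto (fun m => Λ (corrected H R j m * letterProd H R (j + 1) (k + 1) q S)) atBot (𝓝 0))
    (htop : Tendsto (fun m => Λ (corrected H R k m)) atTop (𝓝 B))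
    (hs : Summable fun w : FullPath k =>
      Λ (letterProd H R 0 (k + 1) (FullPath.pat k w) (FullPath.scale k w))) :
    HasSum (fun w : FullPath k =>
      Λ (letterProd H R 0 (k + 1) (FullPath.pat k w) (FullPath.scale k w))) B := by
  have e1 : ∀ q S, letterProd H R (k + 1) (k + 1) q S = 1 := fun q S => by simp [letterProd]
  have ev : ∀ w : FullPath k,
      Λ (letterProd H R 0 (k + 1) (FullPath.pat k w) (FullPath.scale k w)) =
        incrementValue Λ H R k 1 w.1 w.2 := by
    rintro ⟨i, w | w⟩
    · simp only [FullPath.pat, FullPath.scale, letterProd_update_top, incrementValue, Sum.elim_inl,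
        termValue, mul_one]
    · simp only [FullPath.pat, FullPath.scale, letterProd_update_top, incrementValue, Sum.elim_inr,
        termValue, mul_one]
  have hs2 : Summable fun w : Σ i : ℤ, (Path k true i ⊕ Path k false i) =>
      incrementValue Λ H R k 1 w.1 w.2 := hs.congr ev
  have h2 := hs2.hasSum
  have h4 : ∀ i : ℤ, HasSum (incrementValue Λ H R k 1 i)
      (Λ (corrected H R k i) - Λ (corrected H R k (i - 1))) := fun i => by
    have := hasSum_incrementValue (H := H) (R := R) Λ (k := k) (g := 1) (i := i) (fun s t hs => by
      have e2 := letterProd_update_bot (H := H) (R := R) (Nat.lt_succ_self k)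
        (fun _ => Pat.diff) (fun _ => 0) t i
      rw [e1] at e2
      rw [← e2] at hs ⊢
      exact hasSum_termValue Λ (k + 1) hlim k (Nat.le_succ k) s i _ _ hs)
      (hs2.comp_injective (i := fun w : Path k true i ⊕ Path k false i =>
        (⟨i, w⟩ : Σ i : ℤ, (Path k true i ⊕ Path k false i)))
        (sigma_mk_injective (β := fun i : ℤ => Path k true i ⊕ Path k false i)))
    simpa only [mul_one] using this
  have h3 := HasSum.sigma h2 h4
  have h0 := hlim k (Nat.lt_succ_self k) (fun _ => .diff) fun _ => 0
  simp only [e1, mul_one] at h0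
  rw [HasSum.eq_of_telescoping (F := fun i => Λ (corrected H R k i)) h3 h0 htop] at h2
  exact hasSum_of_eq h2 ev

end Telescoping

section PathCombinatorics

/-- The properties of the types `p` and the scales `I` of the factors of a term in the expansion
of a truncation at scale `m`: the scales increase, a factor which is not of the form
`E k i - E k (i - 1)` or `E k (i - 1)` has the same scale as its successor, and factors involving
the scale `i - 1` only come after a factor `H l i - H l (i - 1)`. -/
structure ValidPattern (k : ℕ) (s : Bool) (m : ℤ) (p : ℕ → Pat) (I : ℕ → ℤ) : Prop where
  le : ∀ j < k, I j ≤ m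
  mono : ∀ j l, j ≤ l → l < k → I j ≤ I l
  ring_of_false : s = false → ∃ l < k, p l = .ring ∧ I l = m
  joined : ∀ j < k, p j ≠ .diff → p j ≠ .prev → I j = if j + 1 < k then I (j + 1) else m
  inner : ∀ j < k, p j = .prev ∨ p j = .core → ∃ l < j, p l = .ring ∧ I l = I j

/-- Appending a factor `k` of type `t` at scale `i`: at scale `i` the first `k` factors come from a
truncation or, for `s = false`, from the increment of one. -/
theorem ValidPattern.update {k : ℕ} {s : Bool} {i : ℤ} {p : ℕ → Pat} {I : ℕ → ℤ}
    (h : ValidPattern k s i p I) (t : Pat) {s' : Bool} {m' : ℤ} (hi : i ≤ m')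
    (h1 : t = .prev ∨ t = .core → s = false) (h2 : s' = false → m' = i ∧ (t = .ring ∨ t = .core))
    (h3 : t ≠ .diff → t ≠ .prev → m' = i) :
    ValidPattern (k + 1) s' m' (Function.update p k t) (Function.update I k i) := by
  have up : ∀ j < k, Function.update p k t j = p j := fun j hj =>
    Function.update_of_ne hj.ne _ _
  have uI : ∀ j < k, Function.update I k i j = I j := fun j hj =>
    Function.update_of_ne hj.ne _ _
  refine ⟨fun j hj => ?_, fun j l hjl hl => ?_, fun hs => ?_, fun j hj ha hb => ?_,
    fun j hj hp => ?_⟩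
  · rcases Nat.lt_succ_iff_lt_or_eq.1 hj with hj | rfl
    · rw [uI j hj]; exact (h.le j hj).trans hi
    · rw [Function.update_self]; exact hi
  · rcases Nat.lt_succ_iff_lt_or_eq.1 hl with hl | rfl
    · rw [uI l hl, uI j (by omega)]; exact h.mono j l hjl hl
    · rw [Function.update_self]
      rcases hjl.lt_or_eq with hj | rfl
      · rw [uI j hj]; exact h.le j hj
      · rw [Function.update_self]
  · obtain ⟨rfl, ht | ht⟩ := h2 hs
    · exact ⟨k, Nat.lt_succ_self k, by rw [Function.update_self, ht], Function.update_self _ _ _⟩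
    · obtain ⟨l, hl, e1, e2⟩ := h.ring_of_false (h1 (Or.inr ht))
      exact ⟨l, hl.trans (Nat.lt_succ_self k), by rw [up l hl, e1], by rw [uI l hl, e2]⟩
  · rcases Nat.lt_succ_iff_lt_or_eq.1 hj with hj' | rfl
    · rw [up j hj'] at ha hb
      rw [uI j hj', if_pos (by omega), h.joined j hj' ha hb]
      split_ifs with h4
      · rw [uI _ h4]
      · rw [show j + 1 = k by omega, Function.update_self]
    · rw [Function.update_self] at ha hb
      rw [Function.update_self, if_neg (by omega), h3 ha hb]
  · rcases Nat.lt_succ_iff_lt_or_eq.1 hj with hj' | rfl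
    · rw [up j hj'] at hp
      obtain ⟨l, hl, e1, e2⟩ := h.inner j hj' hp
      exact ⟨l, hl, by rw [up l (hl.trans hj'), e1], by rw [uI l (hl.trans hj'), uI j hj', e2]⟩
    · rw [Function.update_self] at hp
      obtain ⟨l, hl, e1, e2⟩ := h.ring_of_false (h1 hp)
      exact ⟨l, hl, by rw [up l hl, e1], by rw [uI l hl, e2, Function.update_self]⟩

theorem Path.valid : ∀ (k : ℕ) (s : Bool) (m : ℤ) (w : Path k s m),
    ValidPattern k s m (Path.pat k s m w) (Path.scale k s m w)
  | 0, true, m, _ => ⟨fun j hj => absurd hj (by omega), fun j l _ hl => absurd hl (by omega),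
      fun h => by simp at h, fun j hj => absurd hj (by omega), fun j hj => absurd hj (by omega)⟩
  | 0, false, _, w => nomatch (w : Empty)
  | k + 1, true, m, .inl w => (Path.valid k true m w).update .avg le_rfl
      (by simp) (by simp) (fun _ _ => rfl)
  | k + 1, true, m, .inr ⟨i, .inl w⟩ => (Path.valid k true i w).update .diff i.2
      (by simp) (by simp) (by simp)
  | k + 1, true, m, .inr ⟨i, .inr w⟩ => (Path.valid k false i w).update .prev i.2
      (fun _ => rfl) (by simp) (by simp)
  | k + 1, false, m, .inl w => (Path.valid k true m w).update .ring le_rfl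
      (by simp) (by simp) (fun _ _ => rfl)
  | k + 1, false, m, .inr w => (Path.valid k false m w).update .core le_rfl
      (fun _ => rfl) (by simp) (fun _ _ => rfl)

theorem FullPath.valid {k : ℕ} (w : FullPath k) :
    ∃ m, ValidPattern (k + 1) true m (FullPath.pat k w) (FullPath.scale k w) := by
  obtain ⟨i, w | w⟩ := w
  · exact ⟨i, (Path.valid k true i w).update .diff le_rfl (by simp) (by simp) (by simp)⟩
  · exact ⟨i, (Path.valid k false i w).update .prev le_rfl (by simp) (by simp) (by simp)⟩

theorem FullPath.pat_last {k : ℕ} (w : FullPath k) :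
    FullPath.pat k w k = .diff ∨ FullPath.pat k w k = .prev := by
  obtain ⟨i, w | w⟩ := w
  · exact Or.inl (Function.update_self _ _ _)
  · exact Or.inr (Function.update_self _ _ _)

theorem of_update_eq {β : Type*} {k : ℕ} {f g : ℕ → β} {a b : β}
    (h : ∀ j < k + 1, Function.update f k a j = Function.update g k b j) :
    a = b ∧ ∀ j < k, f j = g j := by
  refine ⟨by simpa using h k (Nat.lt_succ_self k), fun j hj => ?_⟩
  have := h j (by omega)
  rwa [Function.update_of_ne hj.ne, Function.update_of_ne hj.ne] at this

/-- A term of the expansion is determined by the types and the scales of its factors. -/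
theorem Path.ext : ∀ (k : ℕ) (s : Bool) (m : ℤ) (w w' : Path k s m),
    (∀ j < k, Path.pat k s m w j = Path.pat k s m w' j) →
    (∀ j < k, Path.scale k s m w j = Path.scale k s m w' j) → w = w'
  | 0, true, _, _, _, _, _ => Subsingleton.elim (α := Unit) _ _
  | 0, false, _, w, _, _, _ => nomatch (w : Empty)
  | k + 1, true, m, .inl w, .inl w', hp, hI =>
    congrArg Sum.inl (Path.ext k true m w w' (of_update_eq hp).2 (of_update_eq hI).2)
  | k + 1, true, m, .inl w, .inr ⟨i, .inl w'⟩, hp, _ => by simpa using (of_update_eq hp).1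
  | k + 1, true, m, .inl w, .inr ⟨i, .inr w'⟩, hp, _ => by simpa using (of_update_eq hp).1
  | k + 1, true, m, .inr ⟨i, .inl w⟩, .inl w', hp, _ => by simpa using (of_update_eq hp).1
  | k + 1, true, m, .inr ⟨i, .inr w⟩, .inl w', hp, _ => by simpa using (of_update_eq hp).1
  | k + 1, true, m, .inr ⟨i, .inl w⟩, .inr ⟨i', .inr w'⟩, hp, _ => by
    simpa using (of_update_eq hp).1
  | k + 1, true, m, .inr ⟨i, .inr w⟩, .inr ⟨i', .inl w'⟩, hp, _ => by
    simpa using (of_update_eq hp).1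
  | k + 1, true, m, .inr ⟨i, .inl w⟩, .inr ⟨i', .inl w'⟩, hp, hI => by
    obtain rfl : i = i' := Subtype.ext (of_update_eq hI).1
    rw [Path.ext k true i w w' (of_update_eq hp).2 (of_update_eq hI).2]
  | k + 1, true, m, .inr ⟨i, .inr w⟩, .inr ⟨i', .inr w'⟩, hp, hI => by
    obtain rfl : i = i' := Subtype.ext (of_update_eq hI).1
    rw [Path.ext k false i w w' (of_update_eq hp).2 (of_update_eq hI).2]
  | k + 1, false, m, .inl w, .inl w', hp, hI =>
    congrArg Sum.inl (Path.ext k true m w w' (of_update_eq hp).2 (of_update_eq hI).2)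
  | k + 1, false, m, .inr w, .inr w', hp, hI =>
    congrArg Sum.inr (Path.ext k false m w w' (of_update_eq hp).2 (of_update_eq hI).2)
  | k + 1, false, m, .inl w, .inr w', hp, _ => by simpa using (of_update_eq hp).1
  | k + 1, false, m, .inr w, .inl w', hp, _ => by simpa using (of_update_eq hp).1

theorem FullPath.ext {k : ℕ} {w w' : FullPath k}
    (hp : ∀ j < k + 1, FullPath.pat k w j = FullPath.pat k w' j)
    (hI : ∀ j < k + 1, FullPath.scale k w j = FullPath.scale k w' j) : w = w' := by
  obtain ⟨i, w | w⟩ := w <;> obtain ⟨i', w' | w'⟩ := w'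
  · obtain rfl : i = i' := (of_update_eq hI).1
    rw [Path.ext k true i w w' (of_update_eq hp).2 (of_update_eq hI).2]
  · simpa using (of_update_eq hp).1
  · simpa using (of_update_eq hp).1
  · obtain rfl : i = i' := (of_update_eq hI).1
    rw [Path.ext k false i w w' (of_update_eq hp).2 (of_update_eq hI).2]

/-- The scales of a term are determined by the scales of the factors `E k i - E k (i - 1)` and
`E k (i - 1)`. -/
theorem FullPath.scale_eq {k : ℕ} {w w' : FullPath k}
    (hp : ∀ j < k + 1, FullPath.pat k w j = FullPath.pat k w' j)
    (hI : ∀ j < k + 1, FullPath.pat k w j = .diff ∨ FullPath.pat k w j = .prev →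
      FullPath.scale k w j = FullPath.scale k w' j) {j : ℕ} (hj : j < k + 1) :
    FullPath.scale k w j = FullPath.scale k w' j := by
  obtain ⟨m, hv⟩ := w.valid
  obtain ⟨m', hv'⟩ := w'.valid
  obtain ⟨a, ha⟩ : ∃ a, j + a = k := ⟨k - j, by omega⟩
  induction a generalizing j with
  | zero =>
    obtain rfl : j = k := by omega
    exact hI j hj w.pat_last
  | succ a ih =>
    by_cases h : FullPath.pat k w j = .diff ∨ FullPath.pat k w j = .prev
    · exact hI j hj h
    · rw [not_or] at h
      have h' := h
      rw [hp j hj] at h'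
      rw [hv.joined j hj h.1 h.2, hv'.joined j hj h'.1 h'.2, if_pos (by omega), if_pos (by omega)]
      exact ih (by omega) (by omega)

end PathCombinatorics

/-! ### Truncation and averaging operators -/

section Pairing

variable {𝕜 : Type*} [RCLike 𝕜] {N : ℕ}

open Classical in
/-- The value of a tempered distribution on a smooth compactly supported function
(and zero on other functions). -/
def pairing (T : 𝓢(EuclideanSpace ℝ (Fin N), 𝕜) →L[𝕜] 𝕜) (g : EuclideanSpace ℝ (Fin N) → 𝕜) : 𝕜 :=
  if h : HasCompactSupport g ∧ ContDiff ℝ ∞ g then T (h.1.toSchwartzMap h.2) else 0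

variable {T : 𝓢(EuclideanSpace ℝ (Fin N), 𝕜) →L[𝕜] 𝕜}

theorem pairing_coe (f : 𝓢(EuclideanSpace ℝ (Fin N), 𝕜)) (hf : HasCompactSupport f) :
    pairing T f = T f := by
  rw [pairing, dif_pos ⟨hf, f.smooth ⊤⟩]
  congr 1

theorem pairing_sum {κ : Type*} (s : Finset κ) (a : κ → 𝕜) (g : κ → EuclideanSpace ℝ (Fin N) → 𝕜)
    (hc : ∀ j, HasCompactSupport (g j)) (hs : ∀ j, ContDiff ℝ ∞ (g j)) :
    pairing T (fun x => ∑ j ∈ s, a j * g j x) = ∑ j ∈ s, a j * pairing T (g j) := by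
  have e : (fun x => ∑ j ∈ s, a j * g j x) =
      ⇑(∑ j ∈ s, a j • (hc j).toSchwartzMap (hs j)) := by
    funext x
    rw [sum_apply]
    rfl
  have hcs : HasCompactSupport ⇑(∑ j ∈ s, a j • (hc j).toSchwartzMap (hs j)) := by
    rw [← e]
    classical
    induction s using Finset.induction_on with
    | empty => simp only [Finset.sum_empty]; exact HasCompactSupport.zero
    | insert j s hj ih =>
      simp only [Finset.sum_insert hj]
      exact HasCompactSupport.add ((hc j).mul_left (f := fun _ => a j)) (ih (by
        funext x
        rw [sum_apply]
        rfl))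
  rw [e, pairing_coe _ hcs, map_sum]
  refine Finset.sum_congr rfl fun j _ => ?_
  rw [map_smul, smul_eq_mul, ← pairing_coe _ (hc j)]
  rfl

end Pairing

section Density

variable {𝕜 : Type*} [RCLike 𝕜] {ι : Type} [Fintype ι]

theorem norm_le_card_mul {r : ℝ} {x : EuclideanSpace ℝ ι} (h : ∀ i, |x i| ≤ r) :
    ‖x‖ ≤ Fintype.card ι * r := by
  rcases isEmpty_or_nonempty ι with hι | ⟨⟨i₀⟩⟩
  · rw [Subsingleton.elim x 0]; simp
  have : Nonempty ι := ⟨i₀⟩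
  have hr : 0 ≤ r := (abs_nonneg _).trans (h i₀)
  refine abs_le_of_sq_le_sq' ?_ (by positivity) |>.2
  rw [EuclideanSpace.norm_sq_eq]
  calc ∑ i, ‖x i‖ ^ 2 ≤ ∑ _i : ι, r ^ 2 := Finset.sum_le_sum fun i _ => by
        rw [Real.norm_eq_abs]; gcongr; exact h i
    _ = Fintype.card ι * r ^ 2 := by simp
    _ ≤ (Fintype.card ι * r) ^ 2 := by
      rw [mul_pow]
      gcongr
      have : (1 : ℝ) ≤ Fintype.card ι := by exact_mod_cast Fintype.card_pos
      nlinarith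

theorem hasCompactSupport_of_abs_le {g : EuclideanSpace ℝ ι → 𝕜} {r : ℝ}
    (h : ∀ x, g x ≠ 0 → ∀ i, |x i| ≤ r) : HasCompactSupport g :=
  HasCompactSupport.intro (isCompact_closedBall 0 (Fintype.card ι * r)) fun x hx => by
    by_contra hne
    exact hx (by simpa using norm_le_card_mul (h x hne))

/-- Smooth densities on the line of integral one, supported in an interval. -/
structure IsDensity (r : ℝ) (θ : ι → ℝ → 𝕜) : Prop where
  smooth : ∀ i, ContDiff ℝ ∞ (θ i)
  supp : ∀ i t, θ i t ≠ 0 → |t| ≤ r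
  integral : ∀ i, ∫ t, θ i t = 1

/-- The product of densities of the coordinates. -/
def density (θ : ι → ℝ → 𝕜) (y : EuclideanSpace ℝ ι) : 𝕜 := ∏ i, θ i (y i)

variable {r : ℝ} {θ : ι → ℝ → 𝕜}

theorem IsDensity.contDiff (h : IsDensity r θ) : ContDiff ℝ ∞ (density θ) :=
  contDiff_prod fun i _ => (h.smooth i).comp (by fun_prop)

theorem IsDensity.abs_le (h : IsDensity r θ) {y : EuclideanSpace ℝ ι} (hy : density θ y ≠ 0)
    (i : ι) : |y i| ≤ r :=
  h.supp i _ (Finset.prod_ne_zero_iff.1 hy i (Finset.mem_univ i))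

theorem IsDensity.hasCompactSupport (h : IsDensity r θ) : HasCompactSupport (density θ) :=
  hasCompactSupport_of_abs_le fun _ hx => h.abs_le hx

theorem IsDensity.integral_density (h : IsDensity r θ) : ∫ y, density θ y = 1 := by
  have e := (PiLp.volume_preserving_toLp ι).integral_comp
    (MeasurableEquiv.toLp 2 (ι → ℝ)).measurableEmbedding (density θ)
  rw [← e]
  change ∫ y : ι → ℝ, ∏ i, θ i (y i) = 1
  rw [integral_fintype_prod_volume_eq_prod]
  exact Finset.prod_eq_one fun i _ => h.integral i

theorem IsDensity.restrict (h : IsDensity r θ) (p : ι → Prop) :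
    IsDensity r fun i : {i // p i} => θ i.1 :=
  ⟨fun i => h.smooth i.1, fun i => h.supp i.1, fun i => h.integral i.1⟩

theorem density_glue (p : ι → Prop) [DecidablePred p] (u : EuclideanSpace ℝ {i // p i})
    (v : EuclideanSpace ℝ {i // ¬ p i}) :
    density θ (glue p u v) =
      density (fun i : {i // p i} => θ i.1) u * density (fun i : {i // ¬ p i} => θ i.1) v := by
  rw [density, ← Fintype.prod_subtype_mul_prod_subtype p]
  congr 1
  · refine Finset.prod_congr rfl fun i _ => ?_
    rw [glue_apply, dif_pos i.2]
  · refine Finset.prod_congr rfl fun i _ => ?_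
    rw [glue_apply, dif_neg i.2]

end Density

section WordOp

variable {𝕜 : Type*} [RCLike 𝕜] {N : ℕ}

/-- The point with the coordinates of `x` at the places satisfying `p` and those of `z` at the
other places. -/
def mix (p : Fin N → Prop) [DecidablePred p] (x z : EuclideanSpace ℝ (Fin N)) :
    EuclideanSpace ℝ (Fin N) :=
  glue p (restrict p x) (restrict (fun i => ¬ p i) z)

theorem mix_apply (p : Fin N → Prop) [DecidablePred p] (x z : EuclideanSpace ℝ (Fin N))
    (i : Fin N) : mix p x z i = if p i then x i else z i := by
  by_cases h : p i <;> simp [mix, glue_apply, restrict_apply, h]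

theorem contDiff_mix (p : Fin N → Prop) [DecidablePred p] {P : Type*} [NormedAddCommGroup P]
    [NormedSpace ℝ P] {f g : P → EuclideanSpace ℝ (Fin N)} (hf : ContDiff ℝ ∞ f)
    (hg : ContDiff ℝ ∞ g) : ContDiff ℝ ∞ fun q => mix p (f q) (g q) :=
  (contDiff_glue p).comp (((restrict p).contDiff.comp hf).prodMk
    ((restrict fun i => ¬ p i).contDiff.comp hg))

/-- A smooth function of the component `x_k`, supported in a bounded set. -/
structure IsCutoff (A : Composition N) (r : ℝ) (k : Fin A.length)
    (c : EuclideanSpace ℝ (Fin N) → 𝕜) : Prop where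
  smooth : ContDiff ℝ ∞ c
  congr : ∀ x y, (∀ s, A.index s = k → x s = y s) → c x = c y
  supp : ∀ x, c x ≠ 0 → ∀ s, A.index s = k → |x s| ≤ r

/-- Multiplication by the functions `c k` rescaled by `2 ^ σ`, composed with averaging in the
factors not in `L` against the densities `θ` rescaled by `2 ^ σ`. -/
def wordOp (d : Fin N → ℝ) (A : Composition N) (θ : Fin N → ℝ → 𝕜)
    (c : Fin A.length → EuclideanSpace ℝ (Fin N) → 𝕜) (L : Finset (Fin A.length)) (σ : Fin N → ℤ)
    (f : EuclideanSpace ℝ (Fin N) → 𝕜) (x : EuclideanSpace ℝ (Fin N)) : 𝕜 :=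
  (∏ k, c k (diag (fun i => (2 : ℝ) ^ (-(d i * (σ i : ℝ)))) x)) *
    ∫ y, density θ y * f (mix (InBlocks A L) x (diag (fun i => (2 : ℝ) ^ (d i * (σ i : ℝ))) y))

variable {d : Fin N → ℝ} {A : Composition N} {θ : Fin N → ℝ → 𝕜} {r : ℝ}
  {c : Fin A.length → EuclideanSpace ℝ (Fin N) → 𝕜} {L : Finset (Fin A.length)} {σ : Fin N → ℤ}
  {f : EuclideanSpace ℝ (Fin N) → 𝕜}

/-- Averages against the densities depend smoothly on parameters. -/
theorem IsDensity.contDiff_average (hθ : IsDensity r θ) (hf : ContDiff ℝ ∞ f) {P : Type}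
    [NormedAddCommGroup P] [NormedSpace ℝ P] [FiniteDimensional ℝ P]
    {F : P × EuclideanSpace ℝ (Fin N) → EuclideanSpace ℝ (Fin N)} (hF : ContDiff ℝ ∞ F) :
    ContDiff ℝ ∞ fun q => ∫ y, density θ y * f (F (q, y)) := by
  refine contDiff_integral_of_compact (g := fun q y => density θ y * f (F (q, y))) ?_
    hθ.hasCompactSupport fun q y hy => ?_
  · exact (hθ.contDiff.comp contDiff_snd).mul (hf.comp hF)
  · rw [image_eq_zero_of_notMem_tsupport hy, zero_mul]

theorem contDiff_wordOp (hθ : IsDensity r θ) (hc : ∀ k, IsCutoff A r k (c k))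
    (hf : ContDiff ℝ ∞ f) : ContDiff ℝ ∞ (wordOp d A θ c L σ f) := by
  refine (contDiff_prod fun k _ => (hc k).smooth.comp
    (diag fun i => (2 : ℝ) ^ (-(d i * (σ i : ℝ)))).contDiff).mul ?_
  refine hθ.contDiff_average hf (F := fun q => mix (InBlocks A L) q.1
    (diag (fun i => (2 : ℝ) ^ (d i * (σ i : ℝ))) q.2)) ?_
  exact contDiff_mix _ contDiff_fst
    ((diag fun i => (2 : ℝ) ^ (d i * (σ i : ℝ))).contDiff.comp contDiff_snd)

theorem abs_le_of_wordOp_ne_zero (hc : ∀ k, IsCutoff A r k (c k)) {x : EuclideanSpace ℝ (Fin N)}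
    (hx : wordOp d A θ c L σ f x ≠ 0) (s : Fin N) :
    |x s| ≤ (2 : ℝ) ^ (d s * (σ s : ℝ)) * r := by
  have h1 := Finset.prod_ne_zero_iff.1 (left_ne_zero_of_mul hx) (A.index s) (Finset.mem_univ _)
  have h2 := (hc _).supp _ h1 s rfl
  rwa [diag_apply, abs_mul, abs_of_pos (Real.rpow_pos_of_pos two_pos _),
    Real.rpow_neg two_pos.le, inv_mul_le_iff₀ (by positivity)] at h2

theorem hasCompactSupport_wordOp (hc : ∀ k, IsCutoff A r k (c k)) :
    HasCompactSupport (wordOp d A θ c L σ f) := by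
  refine hasCompactSupport_of_abs_le (r := ∑ s, |(2 : ℝ) ^ (d s * (σ s : ℝ)) * r|) fun x hx s => ?_
  refine (abs_le_of_wordOp_ne_zero hc hx s).trans ((le_abs_self _).trans ?_)
  exact Finset.single_le_sum (f := fun s => |(2 : ℝ) ^ (d s * (σ s : ℝ)) * r|)
    (fun _ _ => abs_nonneg _) (Finset.mem_univ s)

end WordOp

/-! ### Representation by bumps -/

section BumpProducts

variable {𝕜 : Type*} [RCLike 𝕜] {ι : Type} [Fintype ι]

theorem exists_iteratedFDeriv_le {g : EuclideanSpace ℝ ι → 𝕜} (hg : ContDiff ℝ ∞ g)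
    (hc : HasCompactSupport g) : ∃ G : ℕ → ℝ, ∀ m x, ‖iteratedFDeriv ℝ m g x‖ ≤ G m := by
  refine ⟨fun m => SchwartzMap.seminorm 𝕜 0 m (hc.toSchwartzMap hg), fun m x => ?_⟩
  have := SchwartzMap.le_seminorm 𝕜 0 m (hc.toSchwartzMap hg) x
  rwa [pow_zero, one_mul] at this

theorem exists_cmNormLE [LinearOrder ι] (ψ : 𝓢(EuclideanSpace ℝ ι, 𝕜)) (m : ℕ) :
    ∃ b, CmNormLE m ψ b := by
  refine ⟨∑ j ∈ Finset.range (m + 1), SchwartzMap.seminorm 𝕜 0 j ψ, fun α hα x => ?_⟩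
  refine (norm_partialDeriv_le α _ x).trans ?_
  have := SchwartzMap.le_seminorm 𝕜 0 (∑ i, α i) ψ x
  rw [pow_zero, one_mul] at this
  exact this.trans (Finset.single_le_sum (f := fun j => SchwartzMap.seminorm 𝕜 0 j ψ)
    (fun _ _ => apply_nonneg _ _) (Finset.mem_range.2 (by omega)))

/-- Multiplying a fixed compactly supported function by functions with given bounds on its support
gives bumps with uniform constants. -/
theorem exists_isBump_mul {g : EuclideanSpace ℝ ι → 𝕜} (hg : ContDiff ℝ ∞ g) {r : ℝ}
    (hr : ∀ x, g x ≠ 0 → ‖x‖ ≤ r) {B : ℕ → ℝ} (hB : ∀ m, 0 ≤ B m) :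
    ∃ C : ℕ → ℝ, (∀ m, 0 ≤ C m) ∧ ∀ U : Set (EuclideanSpace ℝ ι), IsOpen U → tsupport g ⊆ U →
      ∀ κ : EuclideanSpace ℝ ι → 𝕜, ContDiffOn ℝ ∞ κ U →
        (∀ m, ∀ x ∈ tsupport g, ‖iteratedFDeriv ℝ m κ x‖ ≤ B m) →
        IsBump r C fun x => g x * κ x := by
  have hc : HasCompactSupport g :=
    HasCompactSupport.intro (isCompact_closedBall (0 : EuclideanSpace ℝ ι) r) fun x hx => by
      by_contra hne
      exact hx (by simpa using hr x hne)
  obtain ⟨G, hG⟩ := exists_iteratedFDeriv_le hg hc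
  have hG0 : ∀ m, 0 ≤ G m := fun m => (norm_nonneg _).trans (hG m 0)
  have hC0 : ∀ m, 0 ≤ ∑ j ∈ Finset.range (m + 1), (m.choose j : ℝ) * G j * B (m - j) := fun m =>
    Finset.sum_nonneg fun j _ => mul_nonneg (mul_nonneg (Nat.cast_nonneg _) (hG0 _)) (hB _)
  refine ⟨_, hC0, fun U hU hgU κ hκ hb => ⟨?_, fun x hx => hr x (left_ne_zero_of_mul hx), ?_⟩⟩
  · rw [contDiff_iff_contDiffAt]
    intro x
    by_cases hx : x ∈ tsupport g
    · exact hg.contDiffAt.mul (hκ.contDiffAt (hU.mem_nhds (hgU hx)))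
    · have h0 : (fun x => g x * κ x) =ᶠ[nhds x] fun _ => 0 := by
        filter_upwards [(isClosed_tsupport g).isOpen_compl.mem_nhds hx] with y hy
        rw [image_eq_zero_of_notMem_tsupport hy, zero_mul]
      exact contDiffAt_const.congr_of_eventuallyEq h0
  · intro m x
    by_cases hx : x ∈ tsupport g
    · have hxU := hgU hx
      have h1 := norm_iteratedFDerivWithin_mul_le (n := m) (N := ∞) hg.contDiffOn hκ hU.uniqueDiffOn
        hxU (by exact_mod_cast le_top)
      rw [iteratedFDerivWithin_of_isOpen m hU hxU] at h1
      refine h1.trans (Finset.sum_le_sum fun j _ => ?_)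
      rw [iteratedFDerivWithin_of_isOpen j hU hxU, iteratedFDerivWithin_of_isOpen _ hU hxU]
      gcongr
      · exact mul_nonneg (Nat.cast_nonneg _) (hG0 j)
      · exact hG j x
      · exact hb _ x hx
    · have h0 : (fun x => g x * κ x) =ᶠ[nhds x] fun _ => 0 := by
        filter_upwards [(isClosed_tsupport g).isOpen_compl.mem_nhds hx] with y hy
        rw [image_eq_zero_of_notMem_tsupport hy, zero_mul]
      rw [(h0.iteratedFDeriv ℝ m).eq_of_nhds]
      simpa [iteratedFDeriv_fun_zero] using hC0 m

end BumpProducts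

section WordRepresentation

variable {𝕜 : Type*} [RCLike 𝕜] {N : ℕ} {d : Fin N → ℝ} {A : Composition N}
  {θ : Fin N → ℝ → 𝕜} {r : ℝ} {c : Fin A.length → EuclideanSpace ℝ (Fin N) → 𝕜}
  {L : Finset (Fin A.length)}

theorem norm_iteratedFDeriv_comp_restrict_le (p : Fin N → Prop) [DecidablePred p]
    {U : Set (EuclideanSpace ℝ {i // p i})} (hU : IsOpen U)
    {κ : EuclideanSpace ℝ {i // p i} → 𝕜} (hκ : ContDiffOn ℝ ∞ κ U) (m : ℕ)
    {x : EuclideanSpace ℝ (Fin N)} (hx : restrict p x ∈ U) :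
    ‖iteratedFDeriv ℝ m (fun x => κ (restrict p x)) x‖ ≤
      ‖iteratedFDeriv ℝ m κ (restrict p x)‖ := by
  have hV : IsOpen (restrict p ⁻¹' U) := hU.preimage (restrict p).continuous
  have h := (restrict p).iteratedFDerivWithin_comp_right hκ hU.uniqueDiffOn hV.uniqueDiffOn hx
    (i := m) (by exact_mod_cast le_top)
  rw [iteratedFDerivWithin_of_isOpen m hV hx, iteratedFDerivWithin_of_isOpen m hU hx] at h
  change ‖iteratedFDeriv ℝ m (κ ∘ ⇑(restrict p)) x‖ ≤ _
  rw [h]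
  refine ((iteratedFDeriv ℝ m κ (restrict p x)).norm_compContinuousLinearMap_le _).trans ?_
  have h1 : ‖restrict p‖ ≤ 1 := ContinuousLinearMap.opNorm_le_bound _ zero_le_one fun y => by
    rw [one_mul]
    conv_rhs => rw [← glue_restrict p y]
    exact norm_le_norm_glue_left p _ _
  rw [Finset.prod_const]
  exact mul_le_of_le_one_right (norm_nonneg _) (pow_le_one₀ (norm_nonneg _) h1)

/-- The rescaled kernel is bounded where each factor `l` is preceded by a factor `l'`, of at least
the same scale, in which some coordinate is bounded below: there the partial norms dominate the
scales. -/
theorem norm_partialDeriv_rescaled_le {ι : Type} [Fintype ι] [LinearOrder ι] {n : ℕ} {d : ι → ℝ}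
    (hd : ∀ i, 0 < d i) {π : ι → Fin n} {L : Finset (Fin n)} (hπ : ∀ i, π i ∈ L) {δ : ℝ}
    (hδ : 0 < δ) (J : Fin n → ℤ) {K : EuclideanSpace ℝ ι → 𝕜} (hK : ContDiffOn ℝ ∞ K (offFirst π L))
    {α : ι → ℕ} {b : ℝ} (hb : ∀ x ∈ offFirst π L, ‖partialDeriv α K x‖ ≤ b * flagWeight d π L α x)
    (hb0 : 0 ≤ b) {u : EuclideanSpace ℝ ι} (hu : u ∈ offFirst π L)
    (hcov : ∀ l ∈ L, ∃ l' ∈ L, l' ≤ l ∧ J l ≤ J l' ∧ ∃ s, π s = l' ∧ δ ^ d s ≤ |u s|) :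
    ‖partialDeriv α (dyad d (fun i => -J (π i)) K) u‖ ≤
      b * ∏ l ∈ L, δ ^ (-blockExponent d π α l) := by
  set D : EuclideanSpace ℝ ι := diag (fun i => (2 : ℝ) ^ (-(d i * (((-J (π i) : ℤ)) : ℝ)))) u
    with hD
  have hDL : D ∈ offFirst π L := by
    intro k hk hkl
    obtain ⟨s, hs, hus⟩ := hu k hk hkl
    exact ⟨s, hs, mul_ne_zero (Real.rpow_pos_of_pos two_pos _).ne' hus⟩
  have h1 := norm_partialDeriv_dyad d π hπ (fun l => -J l) (x := u)
    (hK.contDiffAt ((isOpen_offFirst π L).mem_nhds hDL)) α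
  rw [h1]
  have h2 := hb D hDL
  rw [flagWeight_eq] at h2
  refine (mul_le_mul_of_nonneg_right h2 (Finset.prod_nonneg fun l _ => by positivity)).trans ?_
  rw [mul_assoc, ← Finset.prod_mul_distrib]
  refine mul_le_mul_of_nonneg_left (Finset.prod_le_prod (fun l hl => ?_) fun l hl => ?_) hb0
  · exact mul_nonneg (Real.rpow_nonneg (partialNorm_pos hd hl hDL).le _) (by positivity)
  · obtain ⟨l', hl', hle, hJ, s, hs, hus⟩ := hcov l hl
    have h3 : (2 : ℝ) ^ (J l : ℝ) * δ ≤ partialNorm d π L l D := by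
      have h4 : blockNorm d π l' D ≤ partialNorm d π L l D :=
        Finset.single_le_sum (f := fun l' => blockNorm d π l' D)
          (fun l' _ => blockNorm_nonneg d π l' D) (Finset.mem_filter.2 ⟨hl', hle⟩)
      have h5 : |D s| ≤ blockNorm d π l' D ^ d s :=
        (blockNorm_le_iff hd π l' D (blockNorm_nonneg _ _ _ _)).1 le_rfl s hs
      have h6 : ((2 : ℝ) ^ (J l' : ℝ) * δ) ^ d s ≤ |D s| := by
        rw [hD, diag_apply, abs_mul, abs_of_pos (Real.rpow_pos_of_pos two_pos _), hs,
          Real.mul_rpow (by positivity) hδ.le, rpow_dil]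
        push_cast
        rw [mul_neg, neg_neg]
        gcongr
      have h7 : (2 : ℝ) ^ (J l' : ℝ) * δ ≤ blockNorm d π l' D :=
        (Real.rpow_le_rpow_iff (by positivity) (blockNorm_nonneg _ _ _ _) (hd s)).1 (h6.trans h5)
      have h8 : (2 : ℝ) ^ (J l : ℝ) ≤ (2 : ℝ) ^ (J l' : ℝ) :=
        Real.rpow_le_rpow_of_exponent_le one_le_two (by exact_mod_cast hJ)
      calc (2 : ℝ) ^ (J l : ℝ) * δ ≤ (2 : ℝ) ^ (J l' : ℝ) * δ := by gcongr
        _ ≤ _ := h7.trans h4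
    have he : 0 ≤ blockExponent d π α l :=
      le_blockExponent hd (Finset.sum_nonneg fun s _ => (hd s).le) α
    calc partialNorm d π L l D ^ (-blockExponent d π α l) *
          ((2 : ℝ) ^ (((-J l : ℤ)) : ℝ)) ^ (-blockExponent d π α l)
        ≤ ((2 : ℝ) ^ (J l : ℝ) * δ) ^ (-blockExponent d π α l) *
          ((2 : ℝ) ^ (((-J l : ℤ)) : ℝ)) ^ (-blockExponent d π α l) := by
          refine mul_le_mul_of_nonneg_right ?_ (by positivity)
          exact Real.rpow_le_rpow_of_nonpos (by positivity) h3 (by linarith)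
      _ = δ ^ (-blockExponent d π α l) := by
        rw [← Real.mul_rpow (by positivity) (by positivity)]
        congr 1
        push_cast
        rw [Real.rpow_neg two_pos.le]
        have : (2 : ℝ) ^ (J l : ℝ) ≠ 0 := (Real.rpow_pos_of_pos two_pos _).ne'
        field_simp

end WordRepresentation

section WordPairing

variable {𝕜 : Type*} [RCLike 𝕜] {N : ℕ} {d : Fin N → ℝ} {A : Composition N}
  {θ : Fin N → ℝ → 𝕜} {r : ℝ} {c : Fin A.length → EuclideanSpace ℝ (Fin N) → 𝕜}
  {L : Finset (Fin A.length)}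

/-- The product of the cutoffs in the factors in `L`. -/
def innerCutoff (A : Composition N) (c : Fin A.length → EuclideanSpace ℝ (Fin N) → 𝕜)
    (L : Finset (Fin A.length)) (u : EuclideanSpace ℝ {i // InBlocks A L i}) : 𝕜 :=
  ∏ l ∈ L, c l (glue (InBlocks A L) u 0)

/-- The product of the cutoffs in the factors not in `L`. -/
def outerCutoff (A : Composition N) (c : Fin A.length → EuclideanSpace ℝ (Fin N) → 𝕜)
    (L : Finset (Fin A.length)) (v : EuclideanSpace ℝ {i // ¬ InBlocks A L i}) : 𝕜 :=
  ∏ l ∈ Lᶜ, c l (glue (InBlocks A L) 0 v)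

theorem prod_cutoff_glue (hc : ∀ k, IsCutoff A r k (c k))
    (u : EuclideanSpace ℝ {i // InBlocks A L i}) (v : EuclideanSpace ℝ {i // ¬ InBlocks A L i}) :
    ∏ k, c k (glue (InBlocks A L) u v) = innerCutoff A c L u * outerCutoff A c L v := by
  rw [← Finset.prod_mul_prod_compl L, innerCutoff, outerCutoff]
  congr 1
  · refine Finset.prod_congr rfl fun l hl => (hc l).congr _ _ fun s hs => ?_
    have : InBlocks A L s := by rw [InBlocks, hs]; exact hl
    simp [glue_apply, this]
  · refine Finset.prod_congr rfl fun l hl => (hc l).congr _ _ fun s hs => ?_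
    have : ¬ InBlocks A L s := by rw [InBlocks, hs]; exact Finset.mem_compl.1 hl
    simp [glue_apply, this]

theorem prod_cutoff_glue_left (hc : ∀ k, IsCutoff A r k (c k))
    (u : EuclideanSpace ℝ {i // InBlocks A L i}) (v : EuclideanSpace ℝ {i // ¬ InBlocks A L i}) :
    ∏ k ∈ L, c k (glue (InBlocks A L) u v) = innerCutoff A c L u := by
  refine Finset.prod_congr rfl fun l hl => (hc l).congr _ _ fun s hs => ?_
  have : InBlocks A L s := by rw [InBlocks, hs]; exact hl
  simp [glue_apply, this]

theorem contDiff_innerCutoff (hc : ∀ k, IsCutoff A r k (c k)) :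
    ContDiff ℝ ∞ (innerCutoff A c L) :=
  contDiff_prod fun k _ => (hc k).smooth.comp
    ((contDiff_glue (InBlocks A L)).comp (contDiff_id.prodMk contDiff_const))

theorem contDiff_outerCutoff (hc : ∀ k, IsCutoff A r k (c k)) :
    ContDiff ℝ ∞ (outerCutoff A c L) :=
  contDiff_prod fun k _ => (hc k).smooth.comp
    ((contDiff_glue (InBlocks A L)).comp (contDiff_const.prodMk contDiff_id))

theorem abs_le_of_innerCutoff (hc : ∀ k, IsCutoff A r k (c k))
    {u : EuclideanSpace ℝ {i // InBlocks A L i}} (hu : innerCutoff A c L u ≠ 0)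
    (s : {i // InBlocks A L i}) : |u s| ≤ r := by
  have h := (hc (A.index s.1)).supp _ (Finset.prod_ne_zero_iff.1 hu _ s.2) s.1 rfl
  rwa [glue_apply, dif_pos s.2] at h

theorem abs_le_of_outerCutoff (hc : ∀ k, IsCutoff A r k (c k))
    {v : EuclideanSpace ℝ {i // ¬ InBlocks A L i}} (hv : outerCutoff A c L v ≠ 0)
    (s : {i // ¬ InBlocks A L i}) : |v s| ≤ r := by
  have h := (hc (A.index s.1)).supp _
    (Finset.prod_ne_zero_iff.1 hv _ (Finset.mem_compl.2 s.2)) s.1 rfl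
  rwa [glue_apply, dif_neg s.2] at h

/-- The test function formed by the cutoffs in the factors not in `L`. -/
def outerTest (hc : ∀ k, IsCutoff A r k (c k)) (L : Finset (Fin A.length)) :
    𝓢(EuclideanSpace ℝ {i // ¬ InBlocks A L i}, 𝕜) :=
  (hasCompactSupport_of_abs_le fun _ hv => abs_le_of_outerCutoff (L := L) hc hv).toSchwartzMap
    (contDiff_outerCutoff hc)

/-- The part of `wordOp` depending on the variables of the factors in `L`. -/
def innerOp (d : Fin N → ℝ) (A : Composition N) (θ : Fin N → ℝ → 𝕜)
    (c : Fin A.length → EuclideanSpace ℝ (Fin N) → 𝕜) (L : Finset (Fin A.length)) (σ : Fin N → ℤ)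
    (f : EuclideanSpace ℝ (Fin N) → 𝕜) (u : EuclideanSpace ℝ {i // InBlocks A L i}) : 𝕜 :=
  innerCutoff A c L (diag (fun i => (2 : ℝ) ^ (-(d i.1 * (σ i.1 : ℝ)))) u) *
    ∫ y, density θ y * f (mix (InBlocks A L) (glue (InBlocks A L) u 0)
      (diag (fun i => (2 : ℝ) ^ (d i * (σ i : ℝ))) y))

variable {σ : Fin N → ℤ} {f : EuclideanSpace ℝ (Fin N) → 𝕜}

theorem diag_glue (p : Fin N → Prop) [DecidablePred p] (a : Fin N → ℝ)
    (u : EuclideanSpace ℝ {i // p i}) (v : EuclideanSpace ℝ {i // ¬ p i}) :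
    diag a (glue p u v) = glue p (diag (fun i => a i.1) u) (diag (fun i => a i.1) v) := by
  ext i; by_cases h : p i <;> simp [glue_apply, h]

theorem wordOp_glue (hc : ∀ k, IsCutoff A r k (c k)) (u : EuclideanSpace ℝ {i // InBlocks A L i})
    (v : EuclideanSpace ℝ {i // ¬ InBlocks A L i}) :
    wordOp d A θ c L σ f (glue (InBlocks A L) u v) = innerOp d A θ c L σ f u *
      outerCutoff A c L (diag (fun i => (2 : ℝ) ^ (-(d i.1 * (σ i.1 : ℝ)))) v) := by
  rw [wordOp, diag_glue, prod_cutoff_glue hc, innerOp, mul_right_comm]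
  simp only [mix, restrict_glue_left]

theorem contDiff_innerOp (hθ : IsDensity r θ) (hc : ∀ k, IsCutoff A r k (c k))
    (hf : ContDiff ℝ ∞ f) : ContDiff ℝ ∞ (innerOp d A θ c L σ f) := by
  refine ((contDiff_innerCutoff hc).comp (diag fun i : {i // InBlocks A L i} =>
    (2 : ℝ) ^ (-(d i.1 * (σ i.1 : ℝ)))).contDiff).mul ?_
  refine hθ.contDiff_average hf (F := fun q => mix (InBlocks A L) (glue (InBlocks A L) q.1 0)
    (diag (fun i => (2 : ℝ) ^ (d i * (σ i : ℝ))) q.2)) ?_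
  exact contDiff_mix _ ((contDiff_glue (InBlocks A L)).comp (contDiff_fst.prodMk contDiff_const))
    ((diag fun i => (2 : ℝ) ^ (d i * (σ i : ℝ))).contDiff.comp contDiff_snd)

theorem hasCompactSupport_innerOp (hc : ∀ k, IsCutoff A r k (c k)) :
    HasCompactSupport (innerOp d A θ c L σ f) := by
  refine hasCompactSupport_of_abs_le (r := ∑ s, |(2 : ℝ) ^ (d s * (σ s : ℝ)) * r|) fun x hx s => ?_
  have h2 := abs_le_of_innerCutoff hc (left_ne_zero_of_mul hx) s
  rw [diag_apply, abs_mul, abs_of_pos (Real.rpow_pos_of_pos two_pos _),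
    Real.rpow_neg two_pos.le, inv_mul_le_iff₀ (by positivity)] at h2
  refine h2.trans ((le_abs_self _).trans ?_)
  exact Finset.single_le_sum (f := fun s => |(2 : ℝ) ^ (d s * (σ s : ℝ)) * r|)
    (fun _ _ => abs_nonneg _) (Finset.mem_univ s.1)

/-- After rescaling by the scales of the word, `innerOp` becomes a cutoff times an average over the
variables of the factors not in `L`; the average over the other variables is trivial. -/
theorem innerOp_rescale (hθ : IsDensity r θ) (hf : ContDiff ℝ ∞ f)
    (u : EuclideanSpace ℝ {i // InBlocks A L i}) :
    innerOp d A θ c L σ f (diag (fun i => (2 : ℝ) ^ (d i.1 * (σ i.1 : ℝ))) u) =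
      innerCutoff A c L u * ∫ v, density (fun i : {i // ¬ InBlocks A L i} => θ i.1) v *
        f (diag (fun i => (2 : ℝ) ^ (d i * (σ i : ℝ))) (glue (InBlocks A L) u v)) := by
  rw [innerOp]
  congr 1
  · rw [diag_diag]
    congr 1
    convert diag_one_apply u using 3
    funext i
    rw [← Real.rpow_add two_pos]; simp
  · have hint : Integrable fun y => density θ y * f (mix (InBlocks A L) (glue (InBlocks A L)
        (diag (fun i => (2 : ℝ) ^ (d i.1 * (σ i.1 : ℝ))) u) 0)
        (diag (fun i => (2 : ℝ) ^ (d i * (σ i : ℝ))) y)) := by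
      refine (hθ.contDiff.continuous.mul ?_).integrable_of_hasCompactSupport
        hθ.hasCompactSupport.mul_right
      exact hf.continuous.comp (contDiff_mix _ contDiff_const
        (diag fun i => (2 : ℝ) ^ (d i * (σ i : ℝ))).contDiff).continuous
    rw [integral_glue (InBlocks A L) hint]
    have e : ∀ (a : EuclideanSpace ℝ {i // InBlocks A L i})
        (v : EuclideanSpace ℝ {i // ¬ InBlocks A L i}),
        density θ (glue (InBlocks A L) a v) * f (mix (InBlocks A L) (glue (InBlocks A L)
          (diag (fun i => (2 : ℝ) ^ (d i.1 * (σ i.1 : ℝ))) u) 0)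
          (diag (fun i => (2 : ℝ) ^ (d i * (σ i : ℝ))) (glue (InBlocks A L) a v))) =
        density (fun i : {i // InBlocks A L i} => θ i.1) a *
          (density (fun i : {i // ¬ InBlocks A L i} => θ i.1) v *
            f (diag (fun i => (2 : ℝ) ^ (d i * (σ i : ℝ))) (glue (InBlocks A L) u v))) := by
      intro a v
      rw [density_glue, mul_assoc, diag_glue, diag_glue, mix, restrict_glue_left,
        restrict_glue_right]
    simp only [e, integral_const_mul, integral_mul_const]
    rw [(hθ.restrict (InBlocks A L)).integral_density, one_mul]

/-- The value of a distribution on the image of a function under `wordOp`, in terms of the function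
which represents the distribution after pairing in the factors not in `L`. -/
theorem pairing_wordOp {T : 𝓢(EuclideanSpace ℝ (Fin N), 𝕜) →L[𝕜] 𝕜} (hθ : IsDensity r θ)
    (hc : ∀ k, IsCutoff A r k (c k)) (J : Fin A.length → ℤ) (hf : ContDiff ℝ ∞ f)
    {K : EuclideanSpace ℝ {i // InBlocks A L i} → 𝕜}
    (hK : IsGivenBy (label A L) L (sharp d A L T (outerTest hc L)
      (fun k => (2 : ℝ) ^ (-(J k : ℝ))) fun _ => Real.rpow_pos_of_pos two_pos _) K)
    (hs : tsupport (innerCutoff A c L) ⊆ offFirst (label A L) L)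
    (hφ : ContDiff ℝ ∞ fun x => ((∏ k ∈ L, c k x) *
      density (fun i : {i // ¬ InBlocks A L i} => θ i.1) (restrict (fun i => ¬ InBlocks A L i) x)) *
      dyad (fun i => d i.1) (fun i => -J (label A L i)) K (restrict (InBlocks A L) x))
    (hφc : HasCompactSupport fun x => ((∏ k ∈ L, c k x) *
      density (fun i : {i // ¬ InBlocks A L i} => θ i.1) (restrict (fun i => ¬ InBlocks A L i) x)) *
      dyad (fun i => d i.1) (fun i => -J (label A L i)) K (restrict (InBlocks A L) x)) :
    pairing T (wordOp d A θ c L (fun i => J (A.index i)) f) =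
      ∫ x, dyad d (fun i => J (A.index i)) (fun x => ((∏ k ∈ L, c k x) *
        density (fun i : {i // ¬ InBlocks A L i} => θ i.1)
          (restrict (fun i => ¬ InBlocks A L i) x)) *
        dyad (fun i => d i.1) (fun i => -J (label A L i)) K (restrict (InBlocks A L) x)) x *
        f x := by
  set σ : Fin N → ℤ := fun i => J (A.index i) with hσ
  have hFc := hasCompactSupport_innerOp (d := d) (θ := θ) (L := L) (σ := σ) (f := f) hc
  have hFs := contDiff_innerOp (d := d) (L := L) (σ := σ) hθ hc hf
  set F := hFc.toSchwartzMap hFs with hF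
  -- The image of `f` under `wordOp` is the tensor product of a function of the variables in `L`
  -- and of a dilated test function, so that the cancellation condition applies.
  have e1 : wordOp d A θ c L σ f = ⇑(tensor (InBlocks A L) F (dilateTest d A L
      (fun k => (2 : ℝ) ^ (-(J k : ℝ))) (fun _ => Real.rpow_pos_of_pos two_pos _)
      (outerTest hc L))) := by
    funext x
    conv_lhs => rw [← glue_restrict (InBlocks A L) x, wordOp_glue hc]
    change _ = F (restrict (InBlocks A L) x) *
      outerTest hc L (diag _ (restrict (fun i => ¬ InBlocks A L i) x))
    congr 1
    change _ = outerCutoff A c L _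
    congr 3
    funext i
    rw [← Real.rpow_mul two_pos.le]
    congr 1
    simp only [hσ]
    ring
  have hcs : HasCompactSupport (wordOp d A θ c L σ f) := hasCompactSupport_wordOp hc
  have hFsupp : tsupport F ⊆ offFirst (label A L) L := by
    have h1 : tsupport F ⊆ diag (fun i => (2 : ℝ) ^ (-(d i.1 * (σ i.1 : ℝ)))) ⁻¹'
        tsupport (innerCutoff A c L) := by
      refine closure_minimal (fun u hu => ?_)
        ((isClosed_tsupport _).preimage (ContinuousLinearMap.continuous _))
      exact subset_tsupport _ (left_ne_zero_of_mul (show innerOp d A θ c L σ f u ≠ 0 from hu))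
    intro u hu k hk hkl
    obtain ⟨s, hs1, hs2⟩ := hs (h1 hu) k hk hkl
    exact ⟨s, hs1, right_ne_zero_of_mul hs2⟩
  rw [e1] at hcs ⊢
  rw [pairing_coe _ hcs]
  change sharp d A L T (outerTest hc L) _ _ F = _
  rw [hK.2 F hFc hFsupp, integral_dyad_mul]
  have hint : Integrable fun x => ((∏ k ∈ L, c k x) *
      density (fun i : {i // ¬ InBlocks A L i} => θ i.1) (restrict (fun i => ¬ InBlocks A L i) x)) *
      dyad (fun i => d i.1) (fun i => -J (label A L i)) K (restrict (InBlocks A L) x) *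
      f (diag (fun i => (2 : ℝ) ^ (d i * (σ i : ℝ))) x) :=
    (hφ.continuous.mul (hf.continuous.comp (diag fun i =>
      (2 : ℝ) ^ (d i * (σ i : ℝ))).continuous)).integrable_of_hasCompactSupport hφc.mul_right
  rw [integral_glue (InBlocks A L) hint, integral_comp_diag (fun i : {i // InBlocks A L i} =>
    (2 : ℝ) ^ (d i.1 * (σ i.1 : ℝ))) (fun i => by positivity), ← integral_smul]
  refine integral_congr_ae (Filter.Eventually.of_forall fun u => ?_)
  dsimp only
  have e2 : F (diag (fun i => (2 : ℝ) ^ (d i.1 * (σ i.1 : ℝ))) u) = _ :=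
    innerOp_rescale (A := A) (L := L) (c := c) hθ hf u
  rw [e2, RCLike.real_smul_eq_coe_mul]
  simp only [restrict_glue_left, restrict_glue_right, prod_cutoff_glue_left hc]
  have e3 : dyad (fun i : {i // InBlocks A L i} => d i.1) (fun i => -J (label A L i)) K u =
      ((∏ i : {i // InBlocks A L i}, (2 : ℝ) ^ (d i.1 * (σ i.1 : ℝ)) : ℝ) : 𝕜) *
        K (diag (fun i => (2 : ℝ) ^ (d i.1 * (σ i.1 : ℝ))) u) := by
    have e4 : (fun i : {i // InBlocks A L i} =>
        (2 : ℝ) ^ (-(d i.1 * ((-J (label A L i) : ℤ) : ℝ)))) =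
        fun i => (2 : ℝ) ^ (d i.1 * (σ i.1 : ℝ)) := by
      funext i
      congr 1
      push_cast
      rw [mul_neg, neg_neg]; rfl
    rw [dyad]
    rw [e4]
  simp only [e3, mul_assoc, integral_const_mul]
  rw [← integral_const_mul, ← integral_const_mul]
  rw [← integral_const_mul, ← integral_const_mul]
  refine integral_congr_ae (Filter.Eventually.of_forall fun v => ?_)
  dsimp only
  ring

theorem flagWeight_nonneg {ι : Type} [Fintype ι] [LinearOrder ι] {n : ℕ} {d : ι → ℝ}
    (hd : ∀ i, 0 < d i) {π : ι → Fin n} {L : Finset (Fin n)} (α : ι → ℕ) {x : EuclideanSpace ℝ ι}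
    (hx : x ∈ offFirst π L) : 0 ≤ flagWeight d π L α x := by
  rw [flagWeight_eq]
  exact Finset.prod_nonneg fun l hl => Real.rpow_nonneg (partialNorm_pos hd hl hx).le _

/-- A flag kernel acts on the image of `wordOp` as a dyadic bump, with bounds independent of the
scales. Each factor in `L` has to be preceded by a factor in `L` (possibly itself) of at least the
same scale whose cutoff vanishes near zero, so that the kernel provided by the cancellation
condition for the cutoffs of the factors not in `L` is smooth and bounded, after rescaling, on the
support of the cutoffs. -/
theorem exists_bump_wordOp (hd : ∀ i, 0 < d i) (hθ : IsDensity r θ)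
    (hc : ∀ k, IsCutoff A r k (c k)) {δ : ℝ} (hδ : 0 < δ) (S : Finset (Fin A.length))
    (hring : ∀ k ∈ S, ∀ x, c k x ≠ 0 → ∃ s, A.index s = k ∧ δ ^ d s ≤ |x s|)
    (hmin : ∀ k ∈ L, (∀ l ∈ L, k ≤ l) → k ∈ S) (cst : FlagConstants A) :
    ∃ C : ℕ → ℝ, (∀ m, 0 ≤ C m) ∧ ∀ T : 𝓢(EuclideanSpace ℝ (Fin N), 𝕜) →L[𝕜] 𝕜,
      IsFlagKernelWith d A cst T → ∀ J : Fin A.length → ℤ,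
      (∀ l ∈ L, ∃ l' ∈ L, l' ∈ S ∧ l' ≤ l ∧ J l ≤ J l') →
      ∃ φ : EuclideanSpace ℝ (Fin N) → 𝕜, IsBump (N * r) C φ ∧
        (∀ x, φ x ≠ 0 → (∀ l ∈ L, c l x ≠ 0) ∧ ∀ i, A.index i ∉ L → θ i (x i) ≠ 0) ∧
        ∀ f, ContDiff ℝ ∞ f → pairing T (wordOp d A θ c L (fun i => J (A.index i)) f) =
          ∫ x, dyad d (fun i => J (A.index i)) φ x * f x := by
  set g : EuclideanSpace ℝ (Fin N) → 𝕜 := fun x => (∏ k ∈ L, c k x) *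
    density (fun i : {i // ¬ InBlocks A L i} => θ i.1)
      (restrict (fun i => ¬ InBlocks A L i) x) with hg
  have hgs : ContDiff ℝ ∞ g := (contDiff_prod fun k _ => (hc k).smooth).mul
    ((hθ.restrict fun i => ¬ InBlocks A L i).contDiff.comp
      (restrict fun i => ¬ InBlocks A L i).contDiff)
  have hg1 : ∀ x, g x ≠ 0 → (∀ l ∈ L, c l x ≠ 0) ∧ ∀ i, A.index i ∉ L → θ i (x i) ≠ 0 := by
    intro x hx
    refine ⟨Finset.prod_ne_zero_iff.1 (left_ne_zero_of_mul hx), fun i hi => ?_⟩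
    exact Finset.prod_ne_zero_iff.1 (right_ne_zero_of_mul hx) ⟨i, hi⟩ (Finset.mem_univ _)
  have hgr : ∀ x, g x ≠ 0 → ‖x‖ ≤ N * r := by
    intro x hx
    have := norm_le_card_mul (x := x) (r := r) fun i => by
      by_cases hi : A.index i ∈ L
      · exact (hc _).supp x ((hg1 x hx).1 _ hi) i rfl
      · exact hθ.supp i _ ((hg1 x hx).2 i hi)
    rwa [Fintype.card_fin] at this
  set ψ := outerTest hc L with hψ
  choose b hb using fun m => exists_cmNormLE ψ m
  have hb0 : ∀ m, 0 ≤ b m := fun m => (norm_nonneg _).trans (hb m 0 (by simp) 0)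
  have hψc : HasCompactSupport ψ :=
    hasCompactSupport_of_abs_le fun _ hv => abs_le_of_outerCutoff (L := L) hc hv
  obtain ⟨R, hR⟩ : ∃ R, tsupport ψ ⊆ Metric.closedBall 0 R := hψc.isBounded.subset_closedBall 0
  set β : ({i // InBlocks A L i} → ℕ) → ℝ := fun α =>
    |cst.cancel L α R| * b (cst.order L α R) with hβ
  have hβ0 : ∀ α, 0 ≤ β α := fun α => mul_nonneg (abs_nonneg _) (hb0 _)
  set γ : ({i // InBlocks A L i} → ℕ) → ℝ := fun α =>
    β α * ∏ l ∈ L, δ ^ (-blockExponent (fun i : {i // InBlocks A L i} => d i.1) (label A L) α l)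
    with hγ
  have hγ0 : ∀ α, 0 ≤ γ α := fun α =>
    mul_nonneg (hβ0 α) (Finset.prod_nonneg fun l _ => by positivity)
  set B : ℕ → ℝ := fun m => (Fintype.card {i // InBlocks A L i} : ℝ) ^ m *
    ∑ α ∈ Finset.piAntidiag (Finset.univ : Finset {i // InBlocks A L i}) m, γ α with hB
  obtain ⟨C, hC0, hC⟩ := exists_isBump_mul hgs hgr (B := B)
    fun m => mul_nonneg (by positivity) (Finset.sum_nonneg fun α _ => hγ0 α)
  refine ⟨C, hC0, fun T hT J hcov => ?_⟩
  obtain ⟨K, hK, hKb⟩ := hT.cancellation L ψ hψc (fun k => (2 : ℝ) ^ (-(J k : ℝ)))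
    fun _ => Real.rpow_pos_of_pos two_pos _
  have hSclosed : ∀ k, IsClosed {x : EuclideanSpace ℝ (Fin N) |
      ∃ s, A.index s = k ∧ δ ^ d s ≤ |x s|} := fun k => by
    have : {x : EuclideanSpace ℝ (Fin N) | ∃ s, A.index s = k ∧ δ ^ d s ≤ |x s|} =
        ⋃ s ∈ {s | A.index s = k}, {x | δ ^ d s ≤ |x s|} := by ext x; simp
    rw [this]
    exact (Set.toFinite _).isClosed_biUnion fun s _ =>
      isClosed_le continuous_const (by fun_prop)
  have hsg : ∀ x ∈ tsupport g, ∀ k ∈ L, k ∈ S → ∃ s, A.index s = k ∧ δ ^ d s ≤ |x s| :=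
    fun x hx k hk hkS => closure_minimal (s := Function.support g)
      (fun y hy => hring k hkS y ((hg1 y hy).1 k hk)) (hSclosed k) hx
  have hpos : ∀ s, 0 < δ ^ d s := fun s => Real.rpow_pos_of_pos hδ _
  have hsi : tsupport (innerCutoff A c L) ⊆ offFirst (label A L) L := by
    intro u hu k hk hkl
    have hcl : IsClosed ((fun u => glue (InBlocks A L) u 0) ⁻¹' {x : EuclideanSpace ℝ (Fin N) |
        ∃ s, A.index s = k ∧ δ ^ d s ≤ |x s|}) :=
      (hSclosed k).preimage ((contDiff_glue (InBlocks A L)).continuous.comp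
        (Continuous.prodMk_left 0))
    obtain ⟨s, hs, hus⟩ := closure_minimal (s := Function.support (innerCutoff A c L))
      (fun y hy => hring k (hmin k hk hkl) _ (Finset.prod_ne_zero_iff.1 hy k hk)) hcl hu
    have hsL : InBlocks A L s := by rw [InBlocks, hs]; exact hk
    rw [glue_apply, dif_pos hsL] at hus
    exact ⟨⟨s, hsL⟩, hs, abs_pos.1 ((hpos s).trans_le hus)⟩
  have hmem : ∀ x ∈ tsupport g, restrict (InBlocks A L) x ∈ offFirst (label A L) L := by
    intro x hx k hk hkl
    obtain ⟨s, hs, hxs⟩ := hsg x hx k hk (hmin k hk hkl)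
    exact ⟨⟨s, by rw [InBlocks, hs]; exact hk⟩, hs, abs_pos.1 ((hpos s).trans_le hxs)⟩
  have hUopen := isOpen_offFirst (label A L) L
  set κ := dyad (fun i : {i // InBlocks A L i} => d i.1) (fun i => -J (label A L i)) K with hκ
  have hκs : ContDiffOn ℝ ∞ κ (offFirst (label A L) L) := by
    refine contDiffOn_const.mul (hK.1.comp (ContinuousLinearMap.contDiff _).contDiffOn ?_)
    intro u hu k hk hkl
    obtain ⟨s, hs, hus⟩ := hu k hk hkl
    exact ⟨s, hs, mul_ne_zero (Real.rpow_pos_of_pos two_pos _).ne' hus⟩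
  have hKβ : ∀ α, ∀ u ∈ offFirst (label A L) L, ‖partialDeriv α K u‖ ≤
      β α * flagWeight (fun i : {i // InBlocks A L i} => d i.1) (label A L) L α u := by
    intro α u hu
    refine (hKb α R _ hR (hb _) u hu).trans ?_
    have hw := flagWeight_nonneg (fun i : {i // InBlocks A L i} => hd i.1) α hu
    exact mul_le_mul_of_nonneg_right (mul_le_mul_of_nonneg_right (le_abs_self _) (hb0 _)) hw
  have hκb : ∀ m, ∀ x ∈ tsupport g,
      ‖iteratedFDeriv ℝ m (fun x => κ (restrict (InBlocks A L) x)) x‖ ≤ B m := by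
    intro m x hx
    refine (norm_iteratedFDeriv_comp_restrict_le _ hUopen hκs m (hmem x hx)).trans ?_
    refine norm_iteratedFDeriv_le_of_partialDeriv hUopen hκs (hmem x hx)
      (Finset.sum_nonneg fun α _ => hγ0 α) fun α hα => ?_
    refine le_trans ?_ (Finset.single_le_sum (fun α _ => hγ0 α)
      (Finset.mem_piAntidiag.2 ⟨hα, fun i _ => Finset.mem_univ i⟩))
    have hcov' : ∀ l ∈ L, ∃ l' ∈ L, l' ≤ l ∧ J l ≤ J l' ∧
        ∃ s : {i // InBlocks A L i}, label A L s = l' ∧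
          δ ^ d s.1 ≤ |restrict (InBlocks A L) x s| := fun l hl => by
      obtain ⟨l', hl', hlS, hle, hJ⟩ := hcov l hl
      obtain ⟨s, hs, hxs⟩ := hsg x hx l' hl' hlS
      have hsL : InBlocks A L s := by rw [InBlocks, hs]; exact hl'
      refine ⟨l', hl', hle, hJ, ⟨s, hsL⟩, ?_, ?_⟩
      · rw [label]; exact hs
      · rw [restrict_apply]; exact hxs
    exact norm_partialDeriv_rescaled_le (d := fun i : {i // InBlocks A L i} => d i.1)
      (π := label A L) (fun i => hd i.1) (fun i => i.2) hδ J hK.1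
      (hKβ α) (hβ0 α) (hmem x hx) hcov'
  have hbump := hC _ (hUopen.preimage (restrict (InBlocks A L)).continuous) hmem
    (fun x => κ (restrict (InBlocks A L) x))
    (hκs.comp (restrict (InBlocks A L)).contDiff.contDiffOn fun x hx => hx) hκb
  exact ⟨_, hbump, fun x hx => hg1 x (left_ne_zero_of_mul hx), fun f hf =>
    pairing_wordOp hθ hc J hf hK hsi hbump.smooth hbump.hasCompactSupport⟩

end WordPairing

/-! ### Words of truncations and averages -/

section WordAlgebra

variable {𝕜 : Type*} [RCLike 𝕜] {n : ℕ}

/-- The exponents of the product of the variables `(k, w k)`. -/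
def wordExponent (w : Fin n → Bool × ℤ) : (Fin n × Bool × ℤ) →₀ ℕ :=
  ∑ k, Finsupp.single (k, w k) 1

theorem wordExponent_apply (w : Fin n → Bool × ℤ) (k : Fin n) (b : Bool × ℤ) :
    wordExponent w (k, b) = if w k = b then 1 else 0 := by
  rw [wordExponent, Finsupp.finsetSum_apply, Finset.sum_eq_single k]
  · simp [Finsupp.single_apply]
  · intro j _ hj
    rw [Finsupp.single_apply, if_neg]
    intro h; exact hj (congrArg Prod.fst h)
  · intro h; exact absurd (Finset.mem_univ k) h

theorem wordExponent_injective : Function.Injective (wordExponent (n := n)) := by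
  intro w w' h
  funext k
  have := DFunLike.congr_fun h (k, w' k)
  rw [wordExponent_apply, wordExponent_apply, if_pos rfl] at this
  by_contra hne
  simp [hne] at this

/-- The linear functional on polynomials in the variables `(k, b, i)` which has the value `V w` on
the product of the variables `(k, w k)`, and vanishes on the other monomials. -/
def wordFunctional (V : (Fin n → Bool × ℤ) → 𝕜) :
    MvPolynomial (Fin n × Bool × ℤ) 𝕜 →ₗ[𝕜] 𝕜 :=
  (MvPolynomial.basisMonomials (Fin n × Bool × ℤ) 𝕜).constr 𝕜 (Function.extend wordExponent V 0)

variable (V : (Fin n → Bool × ℤ) → 𝕜)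

theorem wordFunctional_prod (w : Fin n → Bool × ℤ) :
    wordFunctional V (∏ k, MvPolynomial.X (k, w k)) = V w := by
  have e : (∏ k, MvPolynomial.X (k, w k) : MvPolynomial (Fin n × Bool × ℤ) 𝕜) =
      MvPolynomial.basisMonomials (Fin n × Bool × ℤ) 𝕜 (wordExponent w) := by
    rw [MvPolynomial.coe_basisMonomials, wordExponent]
    exact (MvPolynomial.monomial_sum_one _ _).symm
  rw [e, wordFunctional, Module.Basis.constr_basis, wordExponent_injective.extend_apply]

theorem wordFunctional_prod_sum {κ : Type} [Fintype κ] (c : Fin n → κ → 𝕜)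
    (w : Fin n → κ → Bool × ℤ) :
    wordFunctional V (∏ k, ∑ a, MvPolynomial.C (c k a) * MvPolynomial.X (k, w k a)) =
      ∑ a : Fin n → κ, (∏ k, c k (a k)) * V fun k => w k (a k) := by
  classical
  rw [Finset.prod_univ_sum, Fintype.piFinset_univ, map_sum]
  refine Finset.sum_congr rfl fun a _ => ?_
  rw [Finset.prod_mul_distrib, ← map_prod, MvPolynomial.C_mul', map_smul, wordFunctional_prod,
    smul_eq_mul]

/-- The variables of the word algebra: truncations (for `false`) and averages (for `true`). -/
def wordVar (b : Bool) (k : ℕ) (i : ℤ) : MvPolynomial (Fin n × Bool × ℤ) 𝕜 :=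
  if h : k < n then MvPolynomial.X (⟨k, h⟩, b, i) else 1

/-- The scale of a variable: `i`, or `i - 1` if the index is shifted. -/
def shifted (i : ℤ) : Bool → ℤ
  | false => i
  | true => i - 1

/-- The coefficients of the factors of each type with respect to the variables. -/
def patCoef : Pat → Bool × Bool → 𝕜
  | .diff, (false, false) => 1
  | .diff, (true, false) => -1
  | .diff, (false, true) => -1
  | .diff, (true, true) => 1
  | .prev, (false, true) => 1
  | .prev, (true, true) => -1
  | .avg, (true, false) => 1
  | .ring, (false, false) => 1
  | .ring, (false, true) => -1
  | .core, (false, true) => 1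
  | _, _ => 0

theorem letter_eq_sum (t : Pat) (k : Fin n) (i : ℤ) :
    letter (wordVar (𝕜 := 𝕜) (n := n) false) (wordVar true) t k i =
      ∑ a : Bool × Bool, MvPolynomial.C (patCoef t a) *
        MvPolynomial.X (k, a.1, shifted i a.2) := by
  rw [Fintype.sum_prod_type]
  cases t <;> simp [letter, wordVar, patCoef, shifted] <;> ring

theorem letterProd_eq_prod {𝓐 : Type*} [CommRing 𝓐] (H R : ℕ → ℤ → 𝓐) (q : ℕ → Pat) (S : ℕ → ℤ) :
    letterProd H R 0 n q S = ∏ k : Fin n, letter H R (q k) k (S k) := by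
  rw [letterProd, ← Finset.range_eq_Ico, Finset.prod_range]

/-- The product of the factors of types `p k` at scales `S k`, in the word algebra. -/
def wordTerm (𝕜 : Type*) [RCLike 𝕜] {n : ℕ} (p : Fin n → Pat) (S : Fin n → ℤ) :
    MvPolynomial (Fin n × Bool × ℤ) 𝕜 :=
  ∏ k : Fin n, letter (wordVar false) (wordVar true) (p k) k (S k)

/-- The word chosen by `a` from the factors at the scales `S`. -/
def chosenWord (S : Fin n → ℤ) (a : Fin n → Bool × Bool) (k : Fin n) : Bool × ℤ :=
  ((a k).1, shifted (S k) (a k).2)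

theorem wordFunctional_wordTerm (p : Fin n → Pat) (S : Fin n → ℤ) :
    wordFunctional V (wordTerm 𝕜 p S) =
      ∑ a : Fin n → Bool × Bool, (∏ k, patCoef (p k) (a k)) * V (chosenWord S a) := by
  simp only [wordTerm, letter_eq_sum]
  exact wordFunctional_prod_sum V _ _

/-- Exchange truncation and average in the factor `k`. -/
def flipAt (k : Fin n) (a : Fin n → Bool × Bool) : Fin n → Bool × Bool :=
  Function.update a k (!(a k).1, (a k).2)

theorem flipAt_involutive (k : Fin n) : Function.Involutive (flipAt k) := fun a => by
  simp [flipAt]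

theorem patCoef_flip {t : Pat} (ht : t = .diff ∨ t = .prev) (a : Bool × Bool) :
    patCoef t (!a.1, a.2) = -patCoef (𝕜 := 𝕜) t a := by
  obtain ⟨a, b⟩ := a
  rcases ht with rfl | rfl <;> cases a <;> cases b <;> simp [patCoef]

theorem prod_patCoef_flipAt {p : Fin n → Pat} {k : Fin n} (hk : p k = .diff ∨ p k = .prev)
    (a : Fin n → Bool × Bool) :
    ∏ l, patCoef (p l) (flipAt k a l) = -∏ l, patCoef (𝕜 := 𝕜) (p l) (a l) := by
  rw [← Finset.mul_prod_erase _ _ (Finset.mem_univ k),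
    ← Finset.mul_prod_erase _ (fun l => patCoef (p l) (a l)) (Finset.mem_univ k), ← neg_mul]
  congr 1
  · rw [flipAt, Function.update_self, patCoef_flip hk]
  · refine Finset.prod_congr rfl fun l hl => ?_
    rw [flipAt, Function.update_of_ne (Finset.ne_of_mem_erase hl)]

/-- Pairing the terms which differ by the exchange of truncation and average in a factor. -/
theorem two_mul_wordFunctional_wordTerm {p : Fin n → Pat} (S : Fin n → ℤ) {k : Fin n}
    (hk : p k = .diff ∨ p k = .prev) :
    2 * wordFunctional V (wordTerm 𝕜 p S) =
      ∑ a : Fin n → Bool × Bool, (∏ k, patCoef (p k) (a k)) *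
        (V (chosenWord S a) - V (chosenWord S (flipAt k a))) := by
  have e : ∑ a : Fin n → Bool × Bool, (∏ k, patCoef (p k) (a k)) * V (chosenWord S a) =
      ∑ a : Fin n → Bool × Bool, -((∏ k, patCoef (p k) (a k)) *
        V (chosenWord S (flipAt k a))) := by
    refine Fintype.sum_equiv (flipAt_involutive k).toPerm _ _ fun a => ?_
    change _ = -((∏ l, patCoef (p l) (flipAt k a l)) *
      V (chosenWord S (flipAt k (flipAt k a))))
    rw [prod_patCoef_flipAt hk, flipAt_involutive k a]
    ring
  rw [two_mul, wordFunctional_wordTerm]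
  nth_rewrite 2 [e]
  rw [← Finset.sum_add_distrib]
  exact Finset.sum_congr rfl fun a _ => by ring

end WordAlgebra

/-! ### Limits of rescaled pairings -/

section Parameters

variable {𝕜 : Type*} [RCLike 𝕜] {Y E F : Type*} [NormedAddCommGroup Y] [NormedSpace ℝ Y]
  [NormedAddCommGroup E] [NormedSpace ℝ E] [NormedAddCommGroup F] [NormedSpace ℝ F]

theorem dirDeriv_prodMk {g : Y × E → F} (hg : ContDiff ℝ ∞ g) (l : List E) (y : Y) (x : E) :
    dirDeriv l (fun x => g (y, x)) x = dirDeriv (l.map fun v => ((0 : Y), v)) g (y, x) := by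
  induction l generalizing x with
  | nil => rfl
  | cons v l ih =>
    simp only [List.map_cons, dirDeriv]
    rw [funext fun x => ih x]
    have h1 : DifferentiableAt ℝ (dirDeriv (l.map fun v => ((0 : Y), v)) g) (y, x) :=
      ((contDiff_dirDeriv hg _).differentiable (by simp)) _
    have h2 := h1.hasFDerivAt.comp x (hasFDerivAt_prodMk_right y x)
    have h3 : fderiv ℝ (fun x => dirDeriv (l.map fun v => ((0 : Y), v)) g (y, x)) x = _ := h2.fderiv
    rw [h3]
    simp

theorem continuous_partialDeriv_param {ι : Type*} [Fintype ι] [LinearOrder ι]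
    {g : Y × EuclideanSpace ℝ ι → 𝕜} (hg : ContDiff ℝ ∞ g) (α : ι → ℕ) :
    Continuous fun q : Y × EuclideanSpace ℝ ι => partialDeriv α (fun x => g (q.1, x)) q.2 := by
  have h : ∀ q : Y × EuclideanSpace ℝ ι, partialDeriv α (fun x => g (q.1, x)) q.2 =
      dirDeriv (((coordList α).map fun i => EuclideanSpace.single i (1 : ℝ)).map
        fun v => ((0 : Y), v)) g q := fun q => by
    rw [partialDeriv_eq_dirDeriv isOpen_univ (f := fun x => g (q.1, x))
      (hg.comp (contDiff_prodMk_right q.1)).contDiffOn α (Set.mem_univ _)]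
    exact dirDeriv_prodMk hg _ _ _
  rw [funext h]
  exact (contDiff_dirDeriv hg _).continuous

end Parameters

section RescaledPairing

variable {𝕜 : Type*} [RCLike 𝕜] {N : ℕ} {d : Fin N → ℝ} {A : Composition N}

/-- The cancellation condition in all the variables: the pairings with the dilates of a test
function are uniformly bounded. -/
theorem exists_norm_pairing_le (d : Fin N → ℝ) (cst : FlagConstants A) (r : ℝ) :
    ∃ (C : ℝ) (p : ℕ), 0 ≤ C ∧ ∀ T : 𝓢(EuclideanSpace ℝ (Fin N), 𝕜) →L[𝕜] 𝕜,
      IsFlagKernelWith d A cst T → ∀ R : Fin A.length → ℝ, (∀ k, 0 < R k) →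
      ∀ g : EuclideanSpace ℝ (Fin N) → 𝕜, ContDiff ℝ ∞ g → (∀ x, g x ≠ 0 → ‖x‖ ≤ r) →
      ∀ b, CmNormLE p g b →
        ‖pairing T (fun x => g (diag (fun i => R (A.index i) ^ d i) x))‖ ≤ C * b := by
  -- For `L = ∅` the remaining space is a point, so the partial pairing is a number. The map `ℓ`
  -- identifies the space of all variables with its copy indexed by the complement of `∅`.
  set P : Fin N → Prop := InBlocks A ∅ with hP
  have hPf : ∀ i, ¬ P i := fun i => by simp [hP]
  have hemp : IsEmpty {i // P i} := ⟨fun i => hPf _ i.2⟩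
  let ℓ : EuclideanSpace ℝ {i // ¬ P i} →L[ℝ] EuclideanSpace ℝ (Fin N) :=
    LinearMap.toContinuousLinearMap
      { toFun := fun v => glue P 0 v
        map_add' := fun x y => by ext i; simp [glue_apply, hPf]
        map_smul' := fun a x => by ext i; simp [glue_apply, hPf] }
  have hℓ : ∀ v, ℓ v = glue P 0 v := fun _ => rfl
  have hℓn : ∀ v i, ℓ v i.1 = v i := fun v i => by rw [hℓ, glue_apply, dif_neg i.2]
  have hnorm : ∀ v, ‖ℓ v‖ = ‖v‖ := by
    intro v
    have h : ‖ℓ v‖ ^ 2 = ‖v‖ ^ 2 := by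
      rw [EuclideanSpace.norm_sq_eq, EuclideanSpace.norm_sq_eq,
        ← Fintype.sum_subtype_add_sum_subtype P fun i => ‖ℓ v i‖ ^ 2]
      simp [hℓn]
    exact (pow_left_inj₀ (norm_nonneg _) (norm_nonneg _) two_ne_zero).1 h
  set p := cst.order ∅ 0 r with hp
  set M : ℝ := (1 + N) ^ p * (1 + ‖ℓ‖) ^ p with hM
  refine ⟨|cst.cancel ∅ 0 r| * M * volume.real (Set.univ : Set (EuclideanSpace ℝ {i // P i})), p,
    by positivity, fun T hT R hR g hg hgr b hb => ?_⟩
  have hb0 : 0 ≤ b := (norm_nonneg _).trans (hb 0 (by simp) 0)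
  have hψs : ContDiff ℝ ∞ fun v => g (ℓ v) := hg.comp ℓ.contDiff
  have hψr : ∀ v, v ∉ Metric.closedBall (0 : EuclideanSpace ℝ {i // ¬ P i}) r → g (ℓ v) = 0 := by
    intro v hv
    by_contra hne
    exact hv (by simpa [← hnorm] using hgr _ hne)
  have hψc : HasCompactSupport fun v => g (ℓ v) :=
    HasCompactSupport.intro (isCompact_closedBall _ _) hψr
  set ψ := hψc.toSchwartzMap hψs with hψ
  have hψa : ∀ v, ψ v = g (ℓ v) := fun _ => rfl
  have hsupp : tsupport ψ ⊆ Metric.closedBall 0 r :=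
    closure_minimal (fun v hv => by_contra fun h => hv (hψr v h)) Metric.isClosed_closedBall
  have hm : CmNormLE p ψ (M * b) := by
    intro α hα v
    refine (norm_partialDeriv_le α ψ v).trans ?_
    have e : iteratedFDeriv ℝ (∑ i, α i) ψ v =
        (iteratedFDeriv ℝ (∑ i, α i) g (ℓ v)).compContinuousLinearMap fun _ => ℓ :=
      ℓ.iteratedFDeriv_comp_right hg v (by exact_mod_cast le_top)
    have h1 := (iteratedFDeriv ℝ (∑ i, α i) g (ℓ v)).norm_compContinuousLinearMap_le fun _ => ℓ
    rw [Finset.prod_const, Finset.card_univ, Fintype.card_fin] at h1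
    have h2 : ‖iteratedFDeriv ℝ (∑ i, α i) g (ℓ v)‖ ≤ (N : ℝ) ^ (∑ i, α i) * b := by
      have := norm_iteratedFDeriv_le_of_partialDeriv isOpen_univ hg.contDiffOn (Set.mem_univ (ℓ v))
        hb0 (m := ∑ i, α i) fun β hβ => hb β (hβ.trans_le hα) _
      rwa [Fintype.card_fin] at this
    have h3 : (N : ℝ) ^ (∑ i, α i) ≤ (1 + N) ^ p :=
      (pow_le_pow_left₀ (by positivity) (by linarith) _).trans
        (pow_le_pow_right₀ (by linarith [(Nat.cast_nonneg N : (0 : ℝ) ≤ N)]) hα)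
    have h4 : ‖ℓ‖ ^ (∑ i, α i) ≤ (1 + ‖ℓ‖) ^ p :=
      (pow_le_pow_left₀ (by positivity) (by linarith) _).trans
        (pow_le_pow_right₀ (by linarith [norm_nonneg ℓ]) hα)
    rw [e]
    calc _ ≤ (N : ℝ) ^ (∑ i, α i) * b * ‖ℓ‖ ^ (∑ i, α i) := h1.trans (by gcongr)
      _ ≤ (1 + N) ^ p * b * (1 + ‖ℓ‖) ^ p := by gcongr
      _ = M * b := by rw [hM]; ring
  obtain ⟨K, ⟨-, hK⟩, hKb⟩ := hT.cancellation ∅ ψ hψc R hR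
  have h1s : HasCompactSupport fun _ : EuclideanSpace ℝ {i // P i} => (1 : 𝕜) :=
    HasCompactSupport.of_compactSpace _
  set φ : 𝓢(EuclideanSpace ℝ {i // P i}, 𝕜) := h1s.toSchwartzMap contDiff_const with hφ
  have hφa : ∀ u, φ u = 1 := fun _ => rfl
  have huniv : offFirst (label A ∅) (∅ : Finset (Fin A.length)) = Set.univ :=
    Set.eq_univ_of_forall fun x k hk => absurd hk (Finset.notMem_empty k)
  have e1 := hK φ h1s (by rw [huniv]; exact Set.subset_univ _)
  have e2 : sharp d A ∅ T ψ R hR φ =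
      pairing T (fun x => g (diag (fun i => R (A.index i) ^ d i) x)) := by
    have e3 : ⇑(tensor (InBlocks A ∅) φ (dilateTest d A ∅ R hR ψ)) =
        fun x => g (diag (fun i => R (A.index i) ^ d i) x) := by
      funext x
      change φ (restrict P x) * ψ (diag (fun i : {i // ¬ P i} => R (A.index i.1) ^ d i.1)
        (restrict (fun i => ¬ P i) x)) = _
      rw [hφa, one_mul, hψa, hℓ]
      refine congrArg g ?_
      ext i
      simp [glue_apply, hPf, restrict_apply]
    rw [sharp, ← e3, pairing_coe]
    rw [e3]
    refine HasCompactSupport.comp_homeomorph (f := g) ?_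
      (diagEquiv (fun i => R (A.index i) ^ d i)
        fun i => (Real.rpow_pos_of_pos (hR _) _).ne').toHomeomorph
    exact HasCompactSupport.intro (isCompact_closedBall 0 r) fun x hx => by
      by_contra hne
      exact hx (by simpa using hgr _ hne)
  rw [← e2, e1]
  have hKx : ∀ x, ‖K x * φ x‖ ≤ |cst.cancel ∅ 0 r| * (M * b) := by
    intro x
    have := hKb 0 r (M * b) hsupp hm x (by rw [huniv]; exact Set.mem_univ _)
    rw [partialDeriv_zero, flagWeight, Finset.prod_empty, mul_one] at this
    rw [hφa, mul_one]
    exact this.trans (mul_le_mul_of_nonneg_right (le_abs_self _) (by positivity))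
  refine (norm_integral_le_of_norm_le_const (Filter.Eventually.of_forall hKx)).trans (le_of_eq ?_)
  ring

open Filter Topology

/-- The pairings with dilates of test functions tend to zero when the test functions do. -/
theorem tendsto_pairing_rescaled {cst : FlagConstants A}
    {T : 𝓢(EuclideanSpace ℝ (Fin N), 𝕜) →L[𝕜] 𝕜} (hT : IsFlagKernelWith d A cst T)
    {Y : Type*} [NormedAddCommGroup Y] [NormedSpace ℝ Y] {g : Y × EuclideanSpace ℝ (Fin N) → 𝕜}
    (hg : ContDiff ℝ ∞ g) {r : ℝ} (hr : ∀ q, g q ≠ 0 → ‖q.2‖ ≤ r) {y₀ : Y} (h0 : ∀ x, g (y₀, x) = 0)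
    {β : Type*} {l : Filter β} {y : β → Y} (hy : Tendsto y l (𝓝 y₀))
    {R : β → Fin A.length → ℝ} (hR : ∀ m k, 0 < R m k) :
    Tendsto (fun m => pairing T fun x => g (y m, diag (fun i => R m (A.index i) ^ d i) x)) l
      (𝓝 0) := by
  obtain ⟨C, p, hC, hT'⟩ := exists_norm_pairing_le (𝕜 := 𝕜) d cst r
  -- By compactness of the supports, `g (y, ·)` tends to zero with all its derivatives.
  have key : ∀ ε > 0, ∀ᶠ y in 𝓝 y₀, CmNormLE p (fun x => g (y, x)) ε := by
    intro ε hε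
    have hfin : {α : Fin N → ℕ | ∑ i, α i ≤ p}.Finite := by
      refine (Set.Finite.pi' fun _ : Fin N => Set.finite_Iic p).subset fun α hα i => ?_
      exact (Finset.single_le_sum (fun _ _ => Nat.zero_le _) (Finset.mem_univ i)).trans hα
    have h1 : ∀ α : Fin N → ℕ, ∀ᶠ y in 𝓝 y₀,
        ∀ x, ‖partialDeriv α (fun x => g (y, x)) x‖ ≤ ε := by
      intro α
      have hcont := continuous_partialDeriv_param hg α
      have hz : ∀ x, partialDeriv α (fun x => g (y₀, x)) x = 0 := by
        intro x
        have : (fun x => g (y₀, x)) = fun _ => (0 : 𝕜) := funext h0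
        rw [partialDeriv, this, iteratedFDeriv_fun_zero]
        rfl
      have h2 : ∀ᶠ y in 𝓝 y₀, ∀ x ∈ Metric.closedBall (0 : EuclideanSpace ℝ (Fin N)) r,
          ‖partialDeriv α (fun x => g (y, x)) x‖ < ε := by
        refine (isCompact_closedBall _ _).eventually_forall_of_forall_eventually fun x _ => ?_
        refine (hcont.norm.tendsto (y₀, x)).eventually_lt_const ?_
        simpa [hz] using hε
      filter_upwards [h2] with y h x
      by_cases hx : x ∈ Metric.closedBall (0 : EuclideanSpace ℝ (Fin N)) r
      · exact (h x hx).le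
      · refine (norm_partialDeriv_le α _ x).trans ?_
        have : x ∉ tsupport fun x => g (y, x) := fun hx' => hx
          (closure_minimal (fun z hz => by simpa using hr (y, z) hz) Metric.isClosed_closedBall hx')
        rw [image_eq_zero_of_notMem_tsupport (fun h => this (tsupport_iteratedFDeriv_subset _ h))]
        simpa using hε.le
    filter_upwards [hfin.eventually_all.2 fun α _ => h1 α] with y h α hα x using h α hα x
  rw [Metric.tendsto_nhds]
  intro ε hε
  filter_upwards [hy (key (ε / (C + 1)) (by positivity))] with m hm
  rw [dist_zero_right]
  refine (hT' T hT (R m) (hR m) _ (hg.comp (contDiff_prodMk_right (y m)))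
    (fun x hx => hr (y m, x) hx) _ hm).trans_lt ?_
  rw [← mul_div_assoc, div_lt_iff₀ (by positivity)]
  nlinarith

end RescaledPairing

/-! ### The values of words -/

section WordValue

variable {𝕜 : Type*} [RCLike 𝕜] {N : ℕ}

/-- The difference of a cutoff and its contraction by the factor `2`. -/
def ringCutoff (d : Fin N → ℝ) (c : EuclideanSpace ℝ (Fin N) → 𝕜) (x : EuclideanSpace ℝ (Fin N)) :
    𝕜 :=
  c x - c (diag (fun i => (2 : ℝ) ^ d i) x)

/-- A system of cutoffs `η k`, equal to one near zero, and of averaging densities `θ i` supported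
away from zero. The set `Γ k` contains the supports of the functions of the factor `k` by which the
bumps of the decomposition are localized. -/
structure IsCutoffSystem (d : Fin N → ℝ) (A : Composition N)
    (η : Fin A.length → EuclideanSpace ℝ (Fin N) → 𝕜) (θ : Fin N → ℝ → 𝕜) (r δ : ℝ)
    (Γ : Fin A.length → Set (EuclideanSpace ℝ (Fin N))) : Prop where
  dpos : ∀ i, 0 < d i
  δpos : 0 < δ
  cutoff : ∀ k, IsCutoff A r k (η k)
  one : ∀ k x, (∀ s, A.index s = k → |x s| ≤ δ ^ d s) → η k x = 1
  isDensity : IsDensity r θ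
  away : ∀ i t, θ i t ≠ 0 → δ ≤ |t|
  ring_mem : ∀ k x, ringCutoff d (η k) x ≠ 0 → x ∈ Γ k
  core_mem : ∀ k x, k.val ≠ 0 → η k (diag (fun i => (2 : ℝ) ^ d i) x) ≠ 0 → x ∈ Γ k
  avg_mem : ∀ k x, (∀ i, A.index i = k → θ i (x i) ≠ 0) → x ∈ Γ k
  avg_mem' : ∀ k x, (∀ i, A.index i = k → θ i ((2 : ℝ) ^ d i * x i) ≠ 0) → x ∈ Γ k

/-- The value of a distribution on the image of `f` under the product of truncations (for `false`)
and averages (for `true`) at the scales given by a word. -/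
def wordValue (d : Fin N → ℝ) (A : Composition N)
    (η : Fin A.length → EuclideanSpace ℝ (Fin N) → 𝕜) (θ : Fin N → ℝ → 𝕜)
    (T : 𝓢(EuclideanSpace ℝ (Fin N), 𝕜) →L[𝕜] 𝕜) (f : EuclideanSpace ℝ (Fin N) → 𝕜)
    (w : Fin A.length → Bool × ℤ) : 𝕜 :=
  pairing T (wordOp d A θ η (Finset.univ.filter fun k => (w k).1 = false)
    (fun i => (w (A.index i)).2) f)

variable {d : Fin N → ℝ} {A : Composition N} {η : Fin A.length → EuclideanSpace ℝ (Fin N) → 𝕜}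
  {θ : Fin N → ℝ → 𝕜} {r δ : ℝ} {Γ : Fin A.length → Set (EuclideanSpace ℝ (Fin N))}
  {T : 𝓢(EuclideanSpace ℝ (Fin N), 𝕜) →L[𝕜] 𝕜} {f : EuclideanSpace ℝ (Fin N) → 𝕜}

/-- Truncations and averages in a factor agree on functions which do not depend on its variables. -/
theorem wordValue_congr {k : Fin A.length}
    (hf : ∀ x y : EuclideanSpace ℝ (Fin N), (∀ i, A.index i ≠ k → x i = y i) → f x = f y)
    {w w' : Fin A.length → Bool × ℤ} (h1 : ∀ j, j ≠ k → (w j).1 = (w' j).1)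
    (h2 : ∀ j, (w j).2 = (w' j).2) :
    wordValue d A η θ T f w = wordValue d A η θ T f w' := by
  unfold wordValue
  congr 1
  funext x
  simp only [wordOp, h2]
  congr 1
  refine integral_congr_ae (Filter.Eventually.of_forall fun y => ?_)
  refine congrArg (density θ y * ·) (hf _ _ fun i hi => ?_)
  simp [mix_apply, InBlocks, h1 _ hi]

/-- A term with a factor of type `diff` or `prev` vanishes on functions which do not depend on the
variables of this factor: its summands cancel in pairs. -/
theorem wordFunctional_eq_zero_of_indep {p : Fin A.length → Pat} (S : Fin A.length → ℤ)
    {k : Fin A.length} (hk : p k = .diff ∨ p k = .prev)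
    (hf : ∀ x y : EuclideanSpace ℝ (Fin N), (∀ i, A.index i ≠ k → x i = y i) → f x = f y) :
    wordFunctional (wordValue d A η θ T f) (wordTerm 𝕜 p S) = 0 := by
  have h := two_mul_wordFunctional_wordTerm (wordValue d A η θ T f) S hk
  rw [Finset.sum_eq_zero fun a _ => ?_] at h
  · simpa using h
  · rw [wordValue_congr hf (w' := chosenWord S (flipAt k a)) (fun j hj => ?_) fun j => ?_, sub_self,
      mul_zero]
    · simp [chosenWord, flipAt, Function.update_of_ne hj]
    · by_cases hj : j = k
      · subst hj; simp [chosenWord, flipAt]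
      · simp [chosenWord, flipAt, Function.update_of_ne hj]

/-- A function which represents a term of the expansion has cancellation in the factors of types
`diff` and `prev`. -/
theorem cancelsIn_of_represents {p : Fin A.length → Pat} {S : Fin A.length → ℤ}
    {φ : EuclideanSpace ℝ (Fin N) → 𝕜}
    (h : ∀ f : EuclideanSpace ℝ (Fin N) → 𝕜, ContDiff ℝ ∞ f →
      wordFunctional (wordValue d A η θ T f) (wordTerm 𝕜 p S) =
        ∫ x, dyad d (fun i => S (A.index i)) φ x * f x)
    {k : Fin A.length} (hk : p k = .diff ∨ p k = .prev) :
    CancelsIn (Finset.univ.filter fun i => A.index i = k) φ := by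
  intro f hf hfk
  set g : EuclideanSpace ℝ (Fin N) → 𝕜 := fun x =>
    f (diag (fun i => (2 : ℝ) ^ (-(d i * (S (A.index i) : ℝ)))) x) with hg
  have h1 := h g (hf.comp (diag fun i => (2 : ℝ) ^ (-(d i * (S (A.index i) : ℝ)))).contDiff)
  rw [integral_dyad_mul, wordFunctional_eq_zero_of_indep S hk fun x y hxy => ?_] at h1
  · rw [h1]
    refine integral_congr_ae (Filter.Eventually.of_forall fun y => ?_)
    refine congrArg (φ y * f ·) ?_
    ext i
    rw [diag_apply, diag_apply, ← mul_assoc, ← Real.rpow_add two_pos]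
    simp
  · rw [hg]
    dsimp only
    rw [← hfk, ← hfk (diag _ y)]
    congr 1
    ext i
    by_cases hi : A.index i = k
    · simp [killCoords, hi]
    · simp [killCoords, hi, hxy i hi]

/-! ### Limits of the values of words -/

open Filter Topology

theorem pairing_sub {g₁ g₂ : EuclideanSpace ℝ (Fin N) → 𝕜} (hc₁ : HasCompactSupport g₁)
    (hs₁ : ContDiff ℝ ∞ g₁) (hc₂ : HasCompactSupport g₂) (hs₂ : ContDiff ℝ ∞ g₂) :
    pairing T (fun x => g₁ x - g₂ x) = pairing T g₁ - pairing T g₂ := by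
  have h := pairing_sum (T := T) (Finset.univ : Finset Bool) (fun b => if b then -1 else 1)
    (fun b => if b then g₂ else g₁) (by rintro (_ | _) <;> simp [hc₁, hc₂])
    (by rintro (_ | _) <;> simp [hs₁, hs₂])
  simp only [Fintype.sum_bool, if_true, Bool.false_eq_true, if_false] at h
  have e : (fun x => -1 * g₂ x + 1 * g₁ x) = fun x => g₁ x - g₂ x := by funext x; ring
  rw [e] at h
  rw [h]
  ring

theorem tendsto_two_rpow_atBot {a : ℝ} (ha : 0 < a) :
    Tendsto (fun m : ℤ => (2 : ℝ) ^ (a * (m : ℝ))) atBot (𝓝 0) := by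
  have h1 : Tendsto (fun m : ℤ => a * (m : ℝ)) atBot atBot :=
    (tendsto_intCast_atBot_iff.2 tendsto_id).const_mul_atBot ha
  exact (tendsto_rpow_atBot_of_base_gt_one 2 one_lt_two).comp h1

/-- Consider two words which differ by the exchange of truncation and average in the factor `j`,
with the scale `m` in the factors up to `j` and fixed scales in the others. The difference of their
values tends to zero as `m` tends to `-∞`: after rescaling it is the pairing with a test function
which depends smoothly on the dilation factors of the coordinates, and which vanishes in the limit,
where the coordinates of the factor `j` are multiplied by zero. -/
theorem IsCutoffSystem.tendsto_wordValue_sub (h : IsCutoffSystem d A η θ r δ Γ)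
    {cst : FlagConstants A} (hT : IsFlagKernelWith d A cst T) (hf : ContDiff ℝ ∞ f)
    {w w' : ℤ → Fin A.length → Bool × ℤ} {b b' : Fin A.length → Bool} {j : Fin A.length}
    {v : Fin A.length → ℤ}
    (hw : ∀ m k, w m k = (b k, if k ≤ j then m else v k))
    (hw' : ∀ m k, w' m k = (b' k, if k ≤ j then m else v k)) (hb : ∀ k, k ≠ j → b k = b' k) :
    Tendsto (fun m => wordValue d A η θ T f (w m) - wordValue d A η θ T f (w' m)) atBot (𝓝 0) := by
  set L : Finset (Fin A.length) := Finset.univ.filter fun k => b k = false with hL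
  set L' : Finset (Fin A.length) := Finset.univ.filter fun k => b' k = false with hL'
  set σ : ℤ → Fin A.length → ℤ := fun m k => if k ≤ j then m else v k with hσ
  -- The test function, as a function of the dilation factors and of the point.
  set g : (Fin N → ℝ) × EuclideanSpace ℝ (Fin N) → 𝕜 := fun q => (∏ k, η k q.2) *
    ((∫ y, density θ y * f (WithLp.toLp 2 fun i => q.1 i * mix (InBlocks A L) q.2 y i)) -
      ∫ y, density θ y * f (WithLp.toLp 2 fun i => q.1 i * mix (InBlocks A L') q.2 y i)) with hg
  have hsm : ∀ L : Finset (Fin A.length), ContDiff ℝ ∞ fun q : (Fin N → ℝ) ×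
      EuclideanSpace ℝ (Fin N) => ∫ y, density θ y *
        f (WithLp.toLp 2 fun i => q.1 i * mix (InBlocks A L) q.2 y i) := by
    intro L
    refine h.isDensity.contDiff_average hf (F := fun q : ((Fin N → ℝ) × EuclideanSpace ℝ (Fin N)) ×
      EuclideanSpace ℝ (Fin N) =>
        WithLp.toLp 2 fun i => q.1.1 i * mix (InBlocks A L) q.1.2 q.2 i) ?_
    refine contDiff_euclidean.2 fun i => ?_
    change ContDiff ℝ ∞ fun q : ((Fin N → ℝ) × EuclideanSpace ℝ (Fin N)) ×
      EuclideanSpace ℝ (Fin N) => q.1.1 i * mix (InBlocks A L) q.1.2 q.2 i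
    exact (contDiff_pi.1 (contDiff_fst.comp contDiff_fst) i).mul
      (contDiff_euclidean.1 (contDiff_mix (InBlocks A L) (contDiff_snd.comp contDiff_fst)
        contDiff_snd) i)
  have hgs : ContDiff ℝ ∞ g :=
    (contDiff_prod fun k _ => (h.cutoff k).smooth.comp contDiff_snd).mul ((hsm L).sub (hsm L'))
  have hgr : ∀ q, g q ≠ 0 → ‖q.2‖ ≤ Fintype.card (Fin N) * r := fun q hq =>
    norm_le_card_mul fun i => (h.cutoff (A.index i)).supp _
      (Finset.prod_ne_zero_iff.1 (left_ne_zero_of_mul hq) _ (Finset.mem_univ _)) i rfl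
  -- The dilation factors and their limit.
  set D : ℤ → Fin N → ℝ := fun m i => (2 : ℝ) ^ (d i * (σ m (A.index i) : ℝ)) with hD
  set D₀ : Fin N → ℝ := fun i =>
    if A.index i ≤ j then 0 else (2 : ℝ) ^ (d i * (v (A.index i) : ℝ)) with hD₀
  have hDlim : Tendsto D atBot (𝓝 D₀) := by
    refine tendsto_pi_nhds.2 fun i => ?_
    by_cases hi : A.index i ≤ j
    · simp only [hD, hD₀, hσ, hi, if_true]
      exact tendsto_two_rpow_atBot (h.dpos i)
    · simp only [hD, hD₀, hσ, hi, if_false]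
      exact tendsto_const_nhds
  -- The words differ only in the factor `j`, whose coordinates are multiplied by zero.
  have h0 : ∀ x, g (D₀, x) = 0 := by
    intro x
    have : ∀ y, (WithLp.toLp 2 fun i => D₀ i * mix (InBlocks A L) x y i :
        EuclideanSpace ℝ (Fin N)) = WithLp.toLp 2 fun i => D₀ i * mix (InBlocks A L') x y i := by
      intro y
      ext i
      by_cases hi : A.index i = j
      · simp [hD₀, hi]
      · simp [mix_apply, InBlocks, hL, hL', hb _ hi]
    simp only [hg, this, sub_self, mul_zero]
  have key := tendsto_pairing_rescaled hT hgs hgr h0 hDlim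
    (R := fun m k => (2 : ℝ) ^ (((-σ m k : ℤ)) : ℝ)) fun m k => by positivity
  refine key.congr fun m => ?_
  have hs := fun L => contDiff_wordOp (d := d) (L := L) (σ := fun i => σ m (A.index i)) h.isDensity
    h.cutoff hf
  have hc := fun L => hasCompactSupport_wordOp (d := d) (θ := θ) (L := L)
    (σ := fun i => σ m (A.index i)) (f := f) h.cutoff
  have e1 : wordValue d A η θ T f (w m) =
      pairing T (wordOp d A θ η L (fun i => σ m (A.index i)) f) := by
    simp only [wordValue, hw, hL, hσ]
  have e2 : wordValue d A η θ T f (w' m) =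
      pairing T (wordOp d A θ η L' (fun i => σ m (A.index i)) f) := by
    simp only [wordValue, hw', hL', hσ]
  rw [e1, e2, ← pairing_sub (hc L) (hs L) (hc L') (hs L')]
  congr 1
  funext x
  have e3 : ∀ i, ((2 : ℝ) ^ (((-σ m (A.index i) : ℤ)) : ℝ)) ^ d i =
      (2 : ℝ) ^ (-(d i * (σ m (A.index i) : ℝ))) := fun i => by
    rw [rpow_dil]; push_cast; rw [mul_neg]
  have e4 : ∀ (L : Finset (Fin A.length)) (y : EuclideanSpace ℝ (Fin N)),
      (WithLp.toLp 2 fun i => D m i * mix (InBlocks A L)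
        (diag (fun i => (2 : ℝ) ^ (-(d i * (σ m (A.index i) : ℝ)))) x) y i :
        EuclideanSpace ℝ (Fin N)) = mix (InBlocks A L) x (diag (D m) y) := by
    intro L y
    ext i
    change D m i * _ = _
    rw [mix_apply, mix_apply]
    split_ifs
    · rw [diag_apply, hD, ← mul_assoc, ← Real.rpow_add two_pos]; simp
    · rw [diag_apply]
  simp only [e3, hg, wordOp, e4, mul_sub]
  rfl

/-- A corrected truncation at scale `m` is a product of factors of types `core` and `prev` at scale
`m + 1`. -/
theorem corrected_mul_letterProd (p : Fin A.length → Pat) (j : Fin A.length) (m : ℤ)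
    (S : Fin A.length → ℤ) (q : ℕ → Pat) (S' : ℕ → ℤ) (hq : ∀ k : Fin A.length, j < k → q k = p k)
    (hS : ∀ k : Fin A.length, j < k → S' k = S k) (hp : ∀ k < j, p k = .core) (hj : p j = .prev) :
    corrected (wordVar (𝕜 := 𝕜) (n := A.length) false) (wordVar true) j m *
        letterProd (wordVar false) (wordVar true) (j + 1) A.length q S' =
      wordTerm 𝕜 p (fun k => if k ≤ j then m + 1 else S k) := by
  set F : ℕ → MvPolynomial (Fin A.length × Bool × ℤ) 𝕜 := fun k =>
    if hk : k < A.length then letter (wordVar false) (wordVar true) (p ⟨k, hk⟩) k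
      (if k ≤ j then m + 1 else S ⟨k, hk⟩) else 1 with hF
  have e : wordTerm 𝕜 p (fun k => if k ≤ j then m + 1 else S k) =
      ∏ k ∈ Finset.range A.length, F k := by
    rw [Finset.prod_range]
    refine Finset.prod_congr rfl fun k _ => ?_
    rw [hF]
    dsimp only
    rw [dif_pos k.2]
    rfl
  rw [e, Finset.range_eq_Ico, ← Finset.prod_Ico_consecutive F (Nat.zero_le _) j.2,
    ← Finset.range_eq_Ico, Finset.prod_range_succ, corrected, truncation, letterProd]
  congr 1
  · congr 1
    · refine Finset.prod_congr rfl fun k hk => ?_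
      rw [Finset.mem_range] at hk
      have hk' : k < A.length := hk.trans j.2
      rw [hF]
      dsimp only
      rw [dif_pos hk', if_pos hk.le, hp ⟨k, hk'⟩ hk]
      simp [letter]
    · rw [hF]
      dsimp only
      rw [dif_pos j.2, if_pos le_rfl, hj]
      simp [letter]
  · refine Finset.prod_congr rfl fun k hk => ?_
    rw [Finset.mem_Ico] at hk
    have hjk : j < (⟨k, hk.2⟩ : Fin A.length) := hk.1
    rw [hF]
    dsimp only
    rw [dif_pos hk.2, if_neg (by have := hk.1; omega), ← hq ⟨k, hk.2⟩ hjk, ← hS ⟨k, hk.2⟩ hjk]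

/-- The terms of the expansion in which a factor is corrected vanish at small scales. -/
theorem IsCutoffSystem.tendsto_corrected (h : IsCutoffSystem d A η θ r δ Γ)
    {cst : FlagConstants A} (hT : IsFlagKernelWith d A cst T) (hf : ContDiff ℝ ∞ f)
    {j : ℕ} (hj : j < A.length) (q : ℕ → Pat) (S : ℕ → ℤ) :
    Tendsto (fun m => wordFunctional (wordValue d A η θ T f)
      (corrected (wordVar false) (wordVar true) j m *
        letterProd (wordVar false) (wordVar true) (j + 1) A.length q S)) atBot (𝓝 0) := by
  set j' : Fin A.length := ⟨j, hj⟩ with hj'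
  set p : Fin A.length → Pat := fun k => if k < j' then .core else if k = j' then .prev else q k
    with hp
  have hpj : p j' = .prev := by simp [hp]
  have e := fun m => corrected_mul_letterProd (𝕜 := 𝕜) p j' m (fun k => S k) q S
    (fun k hk => by simp [hp, hk.not_gt, hk.ne']) (fun _ _ => rfl)
    (fun k hk => by simp [hp, hk]) hpj
  have key : Tendsto (fun m => 2 * wordFunctional (wordValue d A η θ T f)
      (wordTerm 𝕜 p (fun k => if k ≤ j' then m + 1 else S k))) atBot (𝓝 0) := by
    have h2 := fun m => two_mul_wordFunctional_wordTerm (wordValue d A η θ T f)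
      (fun k => if k ≤ j' then m + 1 else S k) (Or.inr hpj : p j' = .diff ∨ p j' = .prev)
    simp only [h2]
    rw [show (0 : 𝕜) = ∑ a : Fin A.length → Bool × Bool, (∏ k, patCoef (p k) (a k)) * 0 by simp]
    refine tendsto_finsetSum _ fun a _ => ?_
    by_cases ha : ∏ k, patCoef (𝕜 := 𝕜) (p k) (a k) = 0
    · simp [ha]
    refine Tendsto.const_mul _ ?_
    -- In the factors up to `j'`, the summands with nonzero coefficient only involve the variables
    -- at the previous scale, which is `m`.
    have ha' : ∀ k ≤ j', (a k).2 = true := by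
      intro k hk
      have hne := Finset.prod_ne_zero_iff.1 ha k (Finset.mem_univ k)
      have hpk : p k = .core ∨ p k = .prev := by
        rcases hk.lt_or_eq with hk | rfl
        · exact Or.inl (by simp [hp, hk])
        · exact Or.inr hpj
      rcases hpk with hpk | hpk <;> rw [hpk] at hne <;> revert hne <;>
        rcases a k with ⟨_ | _, _ | _⟩ <;> simp [patCoef]
    refine h.tendsto_wordValue_sub hT hf (b := fun k => (a k).1) (j := j')
      (b' := fun k => (flipAt j' a k).1) (v := fun k => shifted (S k) (a k).2) (fun m k => ?_)
      (fun m k => ?_) fun k hk => ?_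
    · simp only [chosenWord]
      split_ifs with hk
      · rw [ha' k hk, shifted, add_sub_cancel_right]
      · rfl
    · have hs : (flipAt j' a k).2 = (a k).2 := by
        by_cases hkj : k = j'
        · rw [hkj]; simp [flipAt]
        · simp [flipAt, Function.update_of_ne hkj]
      simp only [chosenWord]
      rw [hs]
      split_ifs with hk
      · rw [ha' k hk, shifted, add_sub_cancel_right]
      · rfl
    · simp [flipAt, Function.update_of_ne hk]
  have key2 := key.const_mul (2⁻¹ : 𝕜)
  rw [mul_zero] at key2
  refine key2.congr fun m => ?_
  rw [inv_mul_cancel_left₀ two_ne_zero]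
  exact congrArg _ (e m).symm

/-- In the last factor, the corrected truncation is the difference of the words with truncations in
all factors and with an average in the last factor. -/
theorem corrected_eq_sub {k : ℕ} (hk : k + 1 = A.length) (m : ℤ) :
    corrected (wordVar (𝕜 := 𝕜) (n := A.length) false) (wordVar true) k m =
      (∏ l : Fin A.length, MvPolynomial.X (l, false, m)) -
        ∏ l : Fin A.length, MvPolynomial.X (l, decide (l.val = k), m) := by
  have h1 : ∀ F : ℕ → MvPolynomial (Fin A.length × Bool × ℤ) 𝕜,
      ∏ l : Fin A.length, F l = (∏ l ∈ Finset.range k, F l) * F k := fun F => by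
    rw [← Finset.prod_range_succ, hk, Finset.prod_range]
  have e1 := h1 fun l => wordVar false l m
  have e2 := h1 fun l => wordVar (decide (l = k)) l m
  have e3 : ∏ l ∈ Finset.range k, wordVar (𝕜 := 𝕜) (n := A.length) (decide (l = k)) l m =
      ∏ l ∈ Finset.range k, wordVar false l m :=
    Finset.prod_congr rfl fun l hl => by
      rw [decide_eq_false (Finset.mem_range.1 hl).ne]
  rw [e3, decide_eq_true rfl] at e2
  have e4 : ∀ (b : Bool) (l : Fin A.length), wordVar (𝕜 := 𝕜) b l.val m =
      MvPolynomial.X (l, b, m) := fun b l => by simp [wordVar]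
  simp only [e4] at e1 e2
  rw [corrected, truncation, mul_sub, e1, e2]

/-- At large scales the truncation in all factors acts as the identity, and the average in the last
factor vanishes. -/
theorem IsCutoffSystem.tendsto_corrected_top (h : IsCutoffSystem d A η θ r δ Γ)
    {f : 𝓢(EuclideanSpace ℝ (Fin N), 𝕜)} (hf : HasCompactSupport f) {k : ℕ}
    (hk : k + 1 = A.length) :
    Tendsto (fun m => wordFunctional (wordValue d A η θ T f)
      (corrected (wordVar false) (wordVar true) k m)) atTop (𝓝 (T f)) := by
  obtain ⟨R, hR⟩ : ∃ R, ∀ x, f x ≠ 0 → ‖x‖ ≤ R := by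
    obtain ⟨R, hR⟩ := hf.isBounded.subset_closedBall 0
    exact ⟨R, fun x hx => by simpa using hR (subset_tsupport _ hx)⟩
  have hcoord : ∀ x : EuclideanSpace ℝ (Fin N), f x ≠ 0 → ∀ i, |x i| ≤ R := fun x hx i =>
    ((EuclideanSpace.norm_eq x ▸ Real.le_sqrt_of_sq_le (by
      rw [← Real.norm_eq_abs]
      exact Finset.single_le_sum (f := fun i => ‖x i‖ ^ 2) (fun _ _ => by positivity)
        (Finset.mem_univ i)) : |x i| ≤ ‖x‖)).trans (hR x hx)
  -- At these scales the dilated cutoffs equal one on the support of `f`, and the dilated densities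
  -- live outside the support of `f`.
  have hbig : ∀ᶠ m : ℤ in atTop, ∀ i, R < (2 : ℝ) ^ (d i * (m : ℝ)) * min δ (δ ^ d i) := by
    refine eventually_all.2 fun i => ?_
    have h1 : Tendsto (fun m : ℤ => (2 : ℝ) ^ (d i * (m : ℝ))) atTop atTop :=
      (tendsto_rpow_atTop_of_base_gt_one 2 one_lt_two).comp
        ((tendsto_intCast_atTop_atTop).const_mul_atTop (h.dpos i))
    exact (h1.atTop_mul_const (lt_min h.δpos (Real.rpow_pos_of_pos h.δpos _))).eventually_gt_atTop R
  refine tendsto_const_nhds.congr' ?_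
  filter_upwards [hbig] with m hm
  rw [corrected_eq_sub hk, map_sub,
    wordFunctional_prod _ fun _ => (false, m),
    wordFunctional_prod _ fun l => (decide (l.val = k), m)]
  have e1 : wordValue d A η θ T f (fun _ => (false, m)) = T f := by
    rw [wordValue, ← pairing_coe f hf]
    congr 1
    funext x
    have hx : ∀ y, mix (InBlocks A Finset.univ) x y = x := by
      intro y; ext i; simp [mix_apply, InBlocks]
    simp only [Finset.filter_true]
    simp only [wordOp, hx]
    rw [integral_mul_const, h.isDensity.integral_density, one_mul]
    by_cases hfx : f x = 0
    · rw [hfx, mul_zero]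
    rw [Finset.prod_eq_one fun k _ => h.one k _ fun s _ => ?_, one_mul]
    rw [diag_apply, abs_mul, abs_of_pos (by positivity), Real.rpow_neg two_pos.le,
      inv_mul_le_iff₀ (by positivity)]
    refine (hcoord x hfx s).trans ((hm s).le.trans ?_)
    gcongr
    exact min_le_right _ _
  have e2 : wordValue d A η θ T f (fun l => (decide (l.val = k), m)) = 0 := by
    have e3 : wordOp d A θ η (Finset.univ.filter fun l : Fin A.length => decide (l.val = k) = false)
        (fun _ => m) f = fun _ => 0 := by
      funext x
      rw [wordOp, integral_eq_zero_of_ae (Filter.Eventually.of_forall fun y => ?_), mul_zero]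
      obtain ⟨s, hs⟩ := exists_index_eq A ⟨k, by omega⟩
      by_contra hne
      have hy := Finset.prod_ne_zero_iff.1 (left_ne_zero_of_mul hne) s (Finset.mem_univ s)
      have hy2 := hcoord _ (right_ne_zero_of_mul hne) s
      rw [mix_apply, if_neg (by simp [InBlocks, hs]), diag_apply, abs_mul,
        abs_of_pos (by positivity)] at hy2
      have := h.away s _ hy
      have h3 : (2 : ℝ) ^ (d s * (m : ℝ)) * min δ (δ ^ d s) ≤
          (2 : ℝ) ^ (d s * (m : ℝ)) * |y s| := by
        gcongr
        exact (min_le_left _ _).trans this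
      linarith [hm s]
    rw [wordValue, e3]
    have := pairing_sum (T := T) (∅ : Finset Unit) (fun _ => 0) (fun _ => f) (fun _ => hf)
      fun _ => f.smooth ⊤
    simpa using this
  rw [e1, e2, sub_zero]

end WordValue

/-! ### Operations on bumps -/

section BumpOperations

variable {𝕜 : Type*} [RCLike 𝕜] {ι : Type} [Fintype ι] {r : ℝ} {C : ℕ → ℝ}
  {φ : EuclideanSpace ℝ ι → 𝕜}

theorem IsBump.const_mul (h : IsBump r C φ) (a : 𝕜) :
    IsBump r (fun m => ‖a‖ * C m) fun x => a * φ x := by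
  refine ⟨contDiff_const.mul h.smooth, fun x hx => h.supp x (right_ne_zero_of_mul hx),
    fun m x => ?_⟩
  have : (fun x => a * φ x) = a • φ := rfl
  rw [this, iteratedFDeriv_const_smul_apply (h.smooth.contDiffAt.of_le (by exact_mod_cast le_top)),
    norm_smul]
  gcongr
  exact h.bound m x

theorem IsBump.sum {κ : Type*} (s : Finset κ) {C : κ → ℕ → ℝ} {φ : κ → EuclideanSpace ℝ ι → 𝕜}
    (h : ∀ j, IsBump r (C j) (φ j)) : IsBump r (fun m => ∑ j ∈ s, C j m)
      fun x => ∑ j ∈ s, φ j x := by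
  refine ⟨ContDiff.sum fun j _ => (h j).smooth, fun x hx => ?_, fun m x => ?_⟩
  · obtain ⟨j, -, hj⟩ := Finset.exists_ne_zero_of_sum_ne_zero hx
    exact (h j).supp x hj
  · rw [iteratedFDeriv_fun_sum_apply fun j _ =>
      (h j).smooth.contDiffAt.of_le (by exact_mod_cast le_top)]
    exact (norm_sum_le _ _).trans (Finset.sum_le_sum fun j _ => (h j).bound m x)

theorem IsBump.integrable_mul (h : IsBump r C φ) {f : EuclideanSpace ℝ ι → 𝕜}
    (hf : Continuous f) : Integrable fun x => φ x * f x :=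
  (h.smooth.continuous.mul hf).integrable_of_hasCompactSupport h.hasCompactSupport.mul_right

theorem dyad_dyad (d : ι → ℝ) (σ τ : ι → ℤ) (φ : EuclideanSpace ℝ ι → 𝕜) :
    dyad d σ (dyad d τ φ) = dyad d (fun i => σ i + τ i) φ := by
  funext x
  have e : ∀ i, (2 : ℝ) ^ (-(d i * (((σ i + τ i : ℤ)) : ℝ))) =
      (2 : ℝ) ^ (-(d i * (τ i : ℝ))) * (2 : ℝ) ^ (-(d i * (σ i : ℝ))) := fun i => by
    rw [← Real.rpow_add two_pos]; push_cast; ring_nf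
  simp only [dyad, diag_diag, e, Finset.prod_mul_distrib]
  push_cast
  ring

/-- Contracting a bump by a bounded amount yields a bump, with comparable bounds. -/
theorem exists_isBump_dyad (d : ι → ℝ) (hd : ∀ i, 0 < d i) {τ : ι → ℤ} (hτ : ∀ i, τ i ≤ 0)
    (r : ℝ) {C : ℕ → ℝ} (hC : ∀ m, 0 ≤ C m) :
    ∃ C' : ℕ → ℝ, (∀ m, 0 ≤ C' m) ∧ ∀ φ : EuclideanSpace ℝ ι → 𝕜, IsBump r C φ →
      IsBump r C' (dyad d τ φ) := by
  set D := diag (fun i => (2 : ℝ) ^ (-(d i * (τ i : ℝ)))) with hD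
  set P : ℝ := ∏ i, (2 : ℝ) ^ (-(d i * (τ i : ℝ))) with hP
  have hP0 : 0 ≤ P := Finset.prod_nonneg fun i _ => by positivity
  refine ⟨fun m => ‖(P : 𝕜)‖ * (C m * ‖D‖ ^ m), fun m => by have := hC m; positivity, fun φ h => ?_⟩
  have hb : IsBump r (fun m => C m * ‖D‖ ^ m) fun x => φ (D x) := by
    refine ⟨h.smooth.comp D.contDiff, fun x hx => ?_, fun m x => ?_⟩
    · refine le_trans ?_ (h.supp _ hx)
      rw [EuclideanSpace.norm_eq, EuclideanSpace.norm_eq]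
      refine Real.sqrt_le_sqrt (Finset.sum_le_sum fun i _ => ?_)
      rw [hD, diag_apply, norm_mul]
      gcongr
      refine le_mul_of_one_le_left (norm_nonneg _) ?_
      rw [Real.norm_of_nonneg (by positivity)]
      refine Real.one_le_rpow one_le_two ?_
      have : (τ i : ℝ) ≤ 0 := by exact_mod_cast hτ i
      nlinarith [hd i]
    · have e : iteratedFDeriv ℝ m (fun x => φ (D x)) x =
          (iteratedFDeriv ℝ m φ (D x)).compContinuousLinearMap fun _ => D :=
        D.iteratedFDeriv_comp_right h.smooth x (by exact_mod_cast le_top)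
      have h1 := (iteratedFDeriv ℝ m φ (D x)).norm_compContinuousLinearMap_le fun _ => D
      rw [Finset.prod_const, Finset.card_univ, Fintype.card_fin] at h1
      rw [e]
      refine h1.trans ?_
      gcongr
      exact h.bound m _
  exact hb.const_mul _

end BumpOperations

/-! ### Bumps representing the terms of the expansion -/

section Pieces

variable {𝕜 : Type*} [RCLike 𝕜]

/-- The types of the elementary factors: increments of truncations, truncations at the previous
scale, and averages at the scale and at the previous scale. -/
inductive Piece
  | ring | core | avg | avgPrev
  deriving DecidableEq

instance : Fintype Piece :=
  ⟨{.ring, .core, .avg, .avgPrev}, fun t => by cases t <;> simp⟩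

theorem Piece.sum_eq {M : Type*} [AddCommMonoid M] (F : Piece → M) :
    ∑ t, F t = F .ring + (F .core + (F .avg + F .avgPrev)) := by
  change ∑ t ∈ ({.ring, .core, .avg, .avgPrev} : Finset Piece), F t = _
  simp

/-- Whether the factor is an average. -/
def Piece.averaged : Piece → Bool
  | .avg => true
  | .avgPrev => true
  | _ => false

/-- Whether the factor lives at the previous scale. -/
def Piece.back : Piece → Bool
  | .core => true
  | .avgPrev => true
  | _ => false

/-- The coefficients of the factors of the expansion with respect to the elementary factors. -/
def pieceCoef : Pat → Piece → 𝕜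
  | .diff, .ring => 1
  | .diff, .avg => -1
  | .diff, .avgPrev => 1
  | .prev, .core => 1
  | .prev, .avgPrev => -1
  | .avg, .avg => 1
  | .ring, .ring => 1
  | .core, .core => 1
  | _, _ => 0

/-- The coefficients of the elementary factors with respect to the variables at the scale
(for `false`) and at the previous scale (for `true`). -/
def pieceShift : Piece → Bool → 𝕜
  | .ring, false => 1
  | .ring, true => -1
  | .core, true => 1
  | .avg, false => 1
  | .avgPrev, true => 1
  | _, _ => 0

variable {n : ℕ}

/-- The elementary factors in the word algebra. -/
def pieceVar (t : Piece) (k : Fin n) (i : ℤ) : MvPolynomial (Fin n × Bool × ℤ) 𝕜 :=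
  ∑ b : Bool, MvPolynomial.C (pieceShift t b) * MvPolynomial.X (k, t.averaged, shifted i b)

theorem letter_eq_sum_piece (p : Pat) (k : Fin n) (i : ℤ) :
    letter (wordVar (𝕜 := 𝕜) (n := n) false) (wordVar true) p k i =
      ∑ t, MvPolynomial.C (pieceCoef p t) * pieceVar t k i := by
  rw [Piece.sum_eq]
  cases p <;> simp [letter, wordVar, pieceVar, pieceCoef, pieceShift, shifted, Piece.averaged] <;>
    ring

theorem wordFunctional_wordTerm_piece (V : (Fin n → Bool × ℤ) → 𝕜) (p : Fin n → Pat)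
    (S : Fin n → ℤ) :
    wordFunctional V (wordTerm 𝕜 p S) = ∑ β : Fin n → Piece, (∏ k, pieceCoef (p k) (β k)) *
      wordFunctional V (∏ k, pieceVar (β k) k (S k)) := by
  simp only [wordTerm, letter_eq_sum_piece]
  rw [Finset.prod_univ_sum, Fintype.piFinset_univ, map_sum]
  refine Finset.sum_congr rfl fun β _ => ?_
  rw [Finset.prod_mul_distrib, ← map_prod, MvPolynomial.C_mul', map_smul, smul_eq_mul]

variable {N : ℕ} {d : Fin N → ℝ} {A : Composition N}
  {η : Fin A.length → EuclideanSpace ℝ (Fin N) → 𝕜}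
  {θ : Fin N → ℝ → 𝕜} {r δ : ℝ} {Γ : Fin A.length → Set (EuclideanSpace ℝ (Fin N))}
  {T : 𝓢(EuclideanSpace ℝ (Fin N), 𝕜) →L[𝕜] 𝕜} {f : EuclideanSpace ℝ (Fin N) → 𝕜}

/-- The cutoff belonging to an elementary factor. -/
def pieceCutoff (d : Fin N → ℝ) (c : EuclideanSpace ℝ (Fin N) → 𝕜) :
    Piece → EuclideanSpace ℝ (Fin N) → 𝕜
  | .ring => ringCutoff d c
  | _ => c

theorem one_le_two_rpow (h : ∀ i, 0 < d i) (i : Fin N) : (1 : ℝ) ≤ 2 ^ d i :=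
  Real.one_le_rpow one_le_two (h i).le

theorem IsCutoffSystem.isCutoff_piece (h : IsCutoffSystem d A η θ r δ Γ) (t : Piece)
    (k : Fin A.length) : IsCutoff A r k (pieceCutoff d (η k) t) := by
  have hk := h.cutoff k
  cases t
  case ring =>
    refine ⟨hk.smooth.sub (hk.smooth.comp (diag fun i => (2 : ℝ) ^ d i).contDiff),
      fun x y hxy => ?_, fun x hx s hs => ?_⟩
    · simp only [pieceCutoff, ringCutoff]
      rw [hk.congr x y hxy, hk.congr (diag (fun i => (2 : ℝ) ^ d i) x)
        (diag (fun i => (2 : ℝ) ^ d i) y) fun s hs => by simp [hxy s hs]]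
    · by_cases hx1 : η k x = 0
      · have hx2 : η k (diag (fun i => (2 : ℝ) ^ d i) x) ≠ 0 := by
          intro h0; apply hx; simp [pieceCutoff, ringCutoff, hx1, h0]
        have := hk.supp _ hx2 s hs
        rw [diag_apply, abs_mul, abs_of_pos (by positivity)] at this
        nlinarith [one_le_two_rpow h.dpos s, abs_nonneg (x s)]
      · exact hk.supp x hx1 s hs
  all_goals exact hk

theorem IsCutoffSystem.le_abs_of_ring (h : IsCutoffSystem d A η θ r δ Γ) (k : Fin A.length)
    (x : EuclideanSpace ℝ (Fin N)) (hx : ringCutoff d (η k) x ≠ 0) :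
    ∃ s, A.index s = k ∧ (δ / 2) ^ d s ≤ |x s| := by
  by_contra hne
  push Not at hne
  have hs : ∀ s, A.index s = k → |(2 : ℝ) ^ d s * x s| ≤ δ ^ d s := by
    intro s hs
    have := (hne s hs).le
    rw [Real.div_rpow h.δpos.le two_pos.le, le_div_iff₀ (by positivity)] at this
    rw [abs_mul, abs_of_pos (by positivity)]
    linarith
  apply hx
  rw [ringCutoff, h.one k x fun s hs' => ?_,
    h.one k _ fun s hs' => by rw [diag_apply]; exact hs s hs',
    sub_self]
  refine le_trans ?_ (hs s hs')
  rw [abs_mul, abs_of_pos (Real.rpow_pos_of_pos two_pos (d s))]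
  exact le_mul_of_one_le_left (abs_nonneg _) (one_le_two_rpow h.dpos s)

/-- The scales of elementary factors. -/
def pieceScale (β : Fin n → Piece) (S : Fin n → ℤ) (k : Fin n) : ℤ := shifted (S k) (β k).back

/-- The rescaled cutoff of an elementary factor, at the scale of this factor, is the combination of
the rescaled cutoffs prescribed by `pieceShift`. -/
theorem IsCutoffSystem.sum_cutoff (h : IsCutoffSystem d A η θ r δ Γ) (β : Fin A.length → Piece)
    (S : Fin A.length → ℤ) (k : Fin A.length) (x : EuclideanSpace ℝ (Fin N)) :
    ∑ b : Bool, pieceShift (β k) b * η k (diag (fun i => (2 : ℝ) ^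
      (-(d i * (shifted (S k) b : ℝ)))) x) =
    pieceCutoff d (η k) (β k) (diag (fun i => (2 : ℝ) ^
      (-(d i * (pieceScale β S (A.index i) : ℝ)))) x) := by
  have hc := (h.cutoff k).congr
  have e1 : ∀ b, (β k).back = b → η k (diag (fun i => (2 : ℝ) ^
      (-(d i * (pieceScale β S (A.index i) : ℝ)))) x) =
      η k (diag (fun i => (2 : ℝ) ^ (-(d i * (shifted (S k) b : ℝ)))) x) := fun b hb =>
    hc _ _ fun s hs => by simp [pieceScale, hs, hb]
  rw [Fintype.sum_bool]
  cases hβ : β k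
  case ring =>
    have e2 : η k (diag (fun i => (2 : ℝ) ^ d i) (diag (fun i => (2 : ℝ) ^
        (-(d i * (pieceScale β S (A.index i) : ℝ)))) x)) =
        η k (diag (fun i => (2 : ℝ) ^ (-(d i * (shifted (S k) true : ℝ)))) x) :=
      hc _ _ fun s hs => by
        rw [diag_diag, diag_apply, diag_apply, ← Real.rpow_add two_pos]
        simp only [pieceScale, hs, hβ, Piece.back, shifted]
        push_cast
        ring_nf
    rw [pieceCutoff, ringCutoff, e2, e1 false (by rw [hβ]; rfl)]
    simp [pieceShift]
    ring
  case core => rw [pieceCutoff, e1 true (by rw [hβ]; rfl)]; simp [pieceShift]; simp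
  case avg => rw [pieceCutoff, e1 false (by rw [hβ]; rfl)]; simp [pieceShift]; simp
  case avgPrev => rw [pieceCutoff, e1 true (by rw [hβ]; rfl)]; simp [pieceShift]; simp

/-- The value of a product of elementary factors. -/
theorem IsCutoffSystem.wordFunctional_piece (h : IsCutoffSystem d A η θ r δ Γ)
    (hf : ContDiff ℝ ∞ f) (β : Fin A.length → Piece) (S : Fin A.length → ℤ) :
    wordFunctional (wordValue d A η θ T f) (∏ k, pieceVar (β k) k (S k)) =
      pairing T (wordOp d A θ (fun k => pieceCutoff d (η k) (β k))
        (Finset.univ.filter fun k => (β k).averaged = false)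
        (fun i => pieceScale β S (A.index i)) f) := by
  set L : Finset (Fin A.length) := Finset.univ.filter fun k => (β k).averaged = false with hL
  have e1 := wordFunctional_prod_sum (wordValue d A η θ T f) (fun k b => pieceShift (β k) b)
    fun k b => ((β k).averaged, shifted (S k) b)
  simp only [pieceVar]
  rw [e1]
  have e2 : ∀ b : Fin A.length → Bool, wordValue d A η θ T f
      (fun k => ((β k).averaged, shifted (S k) (b k))) =
      pairing T (wordOp d A θ η L (fun i => shifted (S (A.index i)) (b (A.index i))) f) :=
    fun b => rfl
  simp only [e2]
  rw [← pairing_sum Finset.univ (fun b : Fin A.length → Bool => ∏ k, pieceShift (β k) (b k))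
    (fun b => wordOp d A θ η L (fun i => shifted (S (A.index i)) (b (A.index i))) f)
    (fun b => hasCompactSupport_wordOp h.cutoff) fun b => contDiff_wordOp h.isDensity h.cutoff hf]
  congr 1
  funext x
  set Φ := ∫ y, density θ y * f (mix (InBlocks A L) x
    (diag (fun i => (2 : ℝ) ^ (d i * (pieceScale β S (A.index i) : ℝ))) y)) with hΦ
  have e3 : ∀ b : Fin A.length → Bool, (∏ k, pieceShift (𝕜 := 𝕜) (β k) (b k)) *
      wordOp d A θ η L (fun i => shifted (S (A.index i)) (b (A.index i))) f x =
      (∏ k, pieceShift (β k) (b k) * η k (diag (fun i => (2 : ℝ) ^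
        (-(d i * (shifted (S k) (b k) : ℝ)))) x)) * Φ := by
    intro b
    by_cases hb : ∏ k, pieceShift (𝕜 := 𝕜) (β k) (b k) = 0
    · rw [Finset.prod_mul_distrib, hb]; simp
    have e4 : ∀ k, η k (diag (fun i => (2 : ℝ) ^
        (-(d i * (shifted (S (A.index i)) (b (A.index i)) : ℝ)))) x) =
        η k (diag (fun i => (2 : ℝ) ^ (-(d i * (shifted (S k) (b k) : ℝ)))) x) := fun k =>
      (h.cutoff k).congr _ _ fun s hs => by simp [hs]
    rw [wordOp, Finset.prod_mul_distrib, mul_assoc]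
    simp only [e4]
    congr 2
    refine integral_congr_ae (Filter.Eventually.of_forall fun y => ?_)
    refine congrArg (density θ y * f ·) ?_
    ext i
    rw [mix_apply, mix_apply]
    split_ifs with hi
    · rfl
    have hne := Finset.prod_ne_zero_iff.1 hb (A.index i) (Finset.mem_univ _)
    have hav : (β (A.index i)).averaged = true := by simpa [InBlocks, hL] using hi
    have : b (A.index i) = (β (A.index i)).back := by
      revert hne hav
      cases β (A.index i) <;> cases b (A.index i) <;> simp [pieceShift, Piece.averaged, Piece.back]
    rw [diag_apply, diag_apply, this, pieceScale]
  simp only [e3]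
  rw [← Finset.sum_mul, wordOp]
  congr 1
  have e5 := Finset.prod_univ_sum (fun _ : Fin A.length => (Finset.univ : Finset Bool))
    fun k b => pieceShift (β k) b * η k (diag (fun i => (2 : ℝ) ^
      (-(d i * (shifted (S k) b : ℝ)))) x)
  rw [Fintype.piFinset_univ] at e5
  rw [← e5]
  exact Finset.prod_congr rfl fun k _ => h.sum_cutoff β S k x

/-- The products of elementary factors act on flag kernels as dyadic bumps, with bounds independent
of the scales. -/
theorem IsCutoffSystem.exists_pieceBump (h : IsCutoffSystem d A η θ r δ Γ) (cst : FlagConstants A)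
    (β : Fin A.length → Piece) (hβ : ∀ k, β k = .core → ∃ l < k, β l = .ring) :
    ∃ C : ℕ → ℝ, (∀ m, 0 ≤ C m) ∧ ∀ T : 𝓢(EuclideanSpace ℝ (Fin N), 𝕜) →L[𝕜] 𝕜,
      IsFlagKernelWith d A cst T → ∀ S : Fin A.length → ℤ,
      (∀ k, β k = .core → ∃ l < k, β l = .ring ∧ S l = S k) →
      ∃ φ : EuclideanSpace ℝ (Fin N) → 𝕜, IsBump (N * r) C φ ∧
        (∀ x, φ x ≠ 0 → ∀ k, x ∈ Γ k) ∧
        ∀ f, ContDiff ℝ ∞ f →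
          wordFunctional (wordValue d A η θ T f) (∏ k, pieceVar (β k) k (S k)) =
            ∫ x, dyad d (fun i => S (A.index i)) φ x * f x := by
  set L : Finset (Fin A.length) := Finset.univ.filter fun k => (β k).averaged = false with hL
  set R : Finset (Fin A.length) := Finset.univ.filter fun k => β k = .ring with hR
  have hLR : ∀ k ∈ L, k ∈ R ∨ β k = .core := by
    intro k hk
    have : (β k).averaged = false := by simpa [hL] using hk
    cases hβk : β k <;> simp_all [Piece.averaged]
  have hmem : ∀ k, k ∈ L ↔ (β k).averaged = false := fun k => by simp [hL]
  have hRL : ∀ k, β k = .ring → k ∈ L ∧ k ∈ R := fun k hk =>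
    ⟨(hmem k).2 (by rw [hk]; rfl), by simp [hR, hk]⟩
  obtain ⟨C, hC, H⟩ := exists_bump_wordOp (𝕜 := 𝕜) h.dpos h.isDensity
    (c := fun k => pieceCutoff d (η k) (β k)) (fun k => h.isCutoff_piece (β k) k)
    (δ := δ / 2) (half_pos h.δpos) (L := L) R
    (fun k hk x hx => h.le_abs_of_ring k x (by
      have : β k = .ring := by simpa [hR] using hk
      rwa [this] at hx))
    (fun k hk hmin => (hLR k hk).resolve_right fun hc => by
      obtain ⟨l, hlk, hl⟩ := hβ k hc
      exact absurd (hmin l (hRL l hl).1) hlk.not_ge) cst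
  -- The factors at the previous scale are contracted, in order to present the bump at the
  -- scales `S`.
  set τ : Fin N → ℤ := fun i => if (β (A.index i)).back then -1 else 0 with hτ
  obtain ⟨C', hC', H'⟩ := exists_isBump_dyad (𝕜 := 𝕜) d h.dpos (τ := τ)
    (fun i => by simp only [hτ]; split_ifs <;> simp) (N * r) hC
  refine ⟨C', hC', fun T hT S hS => ?_⟩
  obtain ⟨φ, hφ, hsupp, hrep⟩ := H T hT (pieceScale β S) fun l hl => by
    rcases hLR l hl with hl' | hl'
    · exact ⟨l, hl, hl', le_rfl, le_rfl⟩
    · obtain ⟨l', hlt, hr, hs⟩ := hS l hl'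
      refine ⟨l', (hRL l' hr).1, (hRL l' hr).2, hlt.le, ?_⟩
      simp [pieceScale, hl', hr, Piece.back, shifted, hs]
  have hscale : ∀ i, S (A.index i) + τ i = pieceScale β S (A.index i) := fun i => by
    simp only [hτ, pieceScale]
    cases (β (A.index i)).back <;> simp [shifted, sub_eq_add_neg]
  refine ⟨dyad d τ φ, H' φ hφ, fun x hx k => ?_, fun f hf => ?_⟩
  · obtain ⟨h1, h2⟩ := hsupp _ (right_ne_zero_of_mul hx)
    set y := diag (fun i => (2 : ℝ) ^ (-(d i * (τ i : ℝ)))) x with hy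
    have hy0 : ∀ i, (β (A.index i)).back = false → y i = x i := fun i hi => by
      simp [hy, hτ, hi]
    have hy1 : ∀ i, (β (A.index i)).back = true → y i = (2 : ℝ) ^ d i * x i := fun i hi => by
      simp [hy, hτ, hi]
    cases hk : β k
    case ring =>
      have h3 := h1 k (hRL k hk).1
      rw [(h.isCutoff_piece (β k) k).congr y x fun s hs => hy0 s (by rw [hs, hk]; rfl), hk] at h3
      exact h.ring_mem k x h3
    case core =>
      have h3 := h1 k ((hmem k).2 (by rw [hk]; rfl))
      rw [hk] at h3
      have h4 : η k y ≠ 0 := h3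
      rw [(h.cutoff k).congr y (diag (fun i => (2 : ℝ) ^ d i) x) fun s hs => by
        rw [hy1 s (by rw [hs, hk]; rfl), diag_apply]] at h4
      obtain ⟨l, hl, -⟩ := hβ k hk
      exact h.core_mem k x (by have : l.val < k.val := hl; omega) h4
    case avg =>
      refine h.avg_mem k x fun i hi => ?_
      rw [← hy0 i (by rw [hi, hk]; rfl)]
      exact h2 i (by rw [hmem, hi, hk]; simp [Piece.averaged])
    case avgPrev =>
      refine h.avg_mem' k x fun i hi => ?_
      rw [← hy1 i (by rw [hi, hk]; rfl)]
      exact h2 i (by rw [hmem, hi, hk]; simp [Piece.averaged])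
  · rw [h.wordFunctional_piece hf, hrep f hf, dyad_dyad]
    simp only [hscale]

/-- The terms of the expansion are represented by dyadic bumps with cancellation, with bounds
independent of the scales. -/
theorem IsCutoffSystem.exists_patternBump (h : IsCutoffSystem d A η θ r δ Γ) (cst : FlagConstants A)
    (p : Fin A.length → Pat) (hp : ∀ k, p k = .prev ∨ p k = .core → ∃ l < k, p l = .ring) :
    ∃ C : ℕ → ℝ, (∀ m, 0 ≤ C m) ∧ ∀ T : 𝓢(EuclideanSpace ℝ (Fin N), 𝕜) →L[𝕜] 𝕜,
      IsFlagKernelWith d A cst T → ∀ S : Fin A.length → ℤ,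
      (∀ k, p k = .prev ∨ p k = .core → ∃ l < k, p l = .ring ∧ S l = S k) →
      ∃ φ : EuclideanSpace ℝ (Fin N) → 𝕜, IsBump (N * r) C φ ∧
        (∀ x, φ x ≠ 0 → ∀ k, x ∈ Γ k) ∧
        (∀ k, p k = .diff ∨ p k = .prev → CancelsIn (Finset.univ.filter fun i => A.index i = k) φ) ∧
        ∀ f, ContDiff ℝ ∞ f → wordFunctional (wordValue d A η θ T f) (wordTerm 𝕜 p S) =
          ∫ x, dyad d (fun i => S (A.index i)) φ x * f x := by
  have key : ∀ β : Fin A.length → Piece, ∃ C : ℕ → ℝ, (∀ m, 0 ≤ C m) ∧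
      ∀ T : 𝓢(EuclideanSpace ℝ (Fin N), 𝕜) →L[𝕜] 𝕜,
      IsFlagKernelWith d A cst T → ∀ S : Fin A.length → ℤ,
      (∀ k, p k = .prev ∨ p k = .core → ∃ l < k, p l = .ring ∧ S l = S k) →
      ∃ φ : EuclideanSpace ℝ (Fin N) → 𝕜, IsBump (N * r) C φ ∧ (∀ x, φ x ≠ 0 → ∀ k, x ∈ Γ k) ∧
        ∀ f, ContDiff ℝ ∞ f → (∏ k, pieceCoef (p k) (β k)) *
          wordFunctional (wordValue d A η θ T f) (∏ k, pieceVar (β k) k (S k)) =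
            ∫ x, dyad d (fun i => S (A.index i)) φ x * f x := by
    intro β
    -- Combinations of elementary factors which do not occur are represented by zero.
    by_cases hβ : ∏ k, pieceCoef (𝕜 := 𝕜) (p k) (β k) = 0
    · refine ⟨0, fun _ => le_rfl, fun T _ S _ => ⟨0, ⟨contDiff_const, fun x hx => absurd rfl hx,
        fun m x => ?_⟩, fun x hx => absurd rfl hx, fun f _ => ?_⟩⟩
      · have : iteratedFDeriv ℝ m (0 : EuclideanSpace ℝ (Fin N) → 𝕜) = 0 := iteratedFDeriv_fun_zero
        rw [this]; simp
      · simp [hβ, dyad]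
    · have hne := fun k => Finset.prod_ne_zero_iff.1 hβ k (Finset.mem_univ k)
      have h1 : ∀ k, β k = .core → p k = .prev ∨ p k = .core := by
        intro k hk
        have := hne k
        rw [hk] at this
        revert this
        cases p k <;> simp [pieceCoef]
      have h2 : ∀ k, p k = .ring → β k = .ring := by
        intro k hk
        have := hne k
        rw [hk] at this
        revert this
        cases β k <;> simp [pieceCoef]
      obtain ⟨C, hC, H⟩ := h.exists_pieceBump cst β fun k hk => by
        obtain ⟨l, hl, hr⟩ := hp k (h1 k hk)
        exact ⟨l, hl, h2 l hr⟩
      refine ⟨fun m => ‖∏ k, pieceCoef (𝕜 := 𝕜) (p k) (β k)‖ * C m,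
        fun m => mul_nonneg (norm_nonneg _) (hC m), fun T hT S hS => ?_⟩
      obtain ⟨φ, hφ, hs, hr⟩ := H T hT S fun k hk => by
        obtain ⟨l, hl, hr, hs⟩ := hS k (h1 k hk)
        exact ⟨l, hl, h2 l hr, hs⟩
      refine ⟨_, hφ.const_mul _, fun x hx => hs x (right_ne_zero_of_mul hx), fun f hf => ?_⟩
      rw [hr f hf, integral_dyad_mul, integral_dyad_mul, ← integral_const_mul]
      simp only [mul_assoc]
  choose C hC H using key
  refine ⟨fun m => ∑ β, C β m, fun m => Finset.sum_nonneg fun β _ => hC β m, fun T hT S hS => ?_⟩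
  choose φ hφ hs hr using fun β => H β T hT S hS
  have hrep : ∀ f, ContDiff ℝ ∞ f → wordFunctional (wordValue d A η θ T f) (wordTerm 𝕜 p S) =
      ∫ x, dyad d (fun i => S (A.index i)) (fun x => ∑ β, φ β x) x * f x := by
    intro f hf
    rw [wordFunctional_wordTerm_piece, integral_dyad_mul]
    simp only [Finset.sum_mul]
    rw [integral_finsetSum Finset.univ fun β _ => (hφ β).integrable_mul
      (f := fun y => f (diag (fun i => (2 : ℝ) ^ (d i * (S (A.index i) : ℝ))) y))
      (hf.continuous.comp (diag fun i => (2 : ℝ) ^ (d i * (S (A.index i) : ℝ))).continuous)]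
    refine Finset.sum_congr rfl fun β _ => ?_
    rw [hr β f hf, integral_dyad_mul]
  refine ⟨_, IsBump.sum Finset.univ hφ, fun x hx => ?_, fun k hk => cancelsIn_of_represents hrep hk,
    hrep⟩
  obtain ⟨β, -, hβ⟩ := Finset.exists_ne_zero_of_sum_ne_zero hx
  exact hs β x hβ

end Pieces

/-! ### Existence of cutoffs -/

section CutoffExistence

open Filter Topology

variable {N : ℕ} {d : Fin N → ℝ} {ρ : EuclideanSpace ℝ (Fin N) → ℝ}

theorem abs_apply_le_norm {ι : Type*} [Fintype ι] (x : EuclideanSpace ℝ ι) (i : ι) :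
    |x i| ≤ ‖x‖ := by
  rw [← Real.norm_eq_abs]
  exact PiLp.norm_apply_le x i

/-- The balls of a homogeneous norm are bounded. -/
theorem IsSmoothHomogeneousNorm.exists_norm_le (hρ : IsSmoothHomogeneousNorm d ρ)
    (hd : ∀ i, 0 < d i) (b : ℝ) (hb : 0 < b) : ∃ R : ℝ, 0 < R ∧ ∀ x, ρ x ≤ b → ‖x‖ ≤ R := by
  rcases isEmpty_or_nonempty (Fin N) with hN | ⟨⟨i₀⟩⟩
  · exact ⟨1, one_pos, fun x _ => by rw [Subsingleton.elim x 0]; simp⟩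
  have hne : (Metric.sphere (0 : EuclideanSpace ℝ (Fin N)) 1).Nonempty :=
    ⟨EuclideanSpace.single i₀ 1, by simp⟩
  obtain ⟨z, hz, hmin⟩ := (isCompact_sphere (0 : EuclideanSpace ℝ (Fin N)) 1).exists_isMinOn hne
    hρ.continuous.continuousOn
  have hz0 : z ≠ 0 := by
    rintro rfl
    simp at hz
  have hm : 0 < ρ z := lt_of_le_of_ne (hρ.nonneg z) fun h => hz0 ((hρ.eq_zero_iff z).1 h.symm)
  set c := ρ z / b with hc
  have hc0 : 0 < c := div_pos hm hb
  set R := N * ∑ i, (c ^ d i)⁻¹ with hR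
  refine ⟨1 + R, by positivity, fun x hx => ?_⟩
  rcases le_or_gt ‖x‖ 1 with h1 | h1
  · have : 0 ≤ R := by positivity
    linarith
  -- along the orbit of `x` there is a point of the unit sphere
  have hcont : ContinuousOn (fun t : ℝ => ‖dilate d t x‖) (Set.Icc 0 1) := by
    refine Continuous.continuousOn (continuous_norm.comp ?_)
    refine (PiLp.continuous_toLp 2 _).comp (continuous_pi fun i => ?_)
    exact (Real.continuous_rpow_const (hd i).le).mul continuous_const
  have h01 : (1 : ℝ) ∈ Set.Icc ‖dilate d 0 x‖ ‖dilate d 1 x‖ := by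
    have e0 : dilate d 0 x = 0 := by ext i; simp [dilate, Real.zero_rpow (hd i).ne']
    have e1 : dilate d 1 x = x := by ext i; simp [dilate]
    rw [e0, e1, norm_zero]
    exact ⟨zero_le_one, h1.le⟩
  obtain ⟨t, ht, htx⟩ := intermediate_value_Icc zero_le_one hcont h01
  have ht0 : 0 < t := lt_of_le_of_ne ht.1 fun h => by
    have e0 : dilate d 0 x = 0 := by ext i; simp [dilate, Real.zero_rpow (hd i).ne']
    subst h
    simp [e0] at htx
  have hle : ρ z ≤ t * ρ x := by
    rw [← hρ.homogeneous t ht0]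
    exact hmin (by simpa using htx)
  have hct : c ≤ t := by
    rw [hc, div_le_iff₀ hb]
    exact hle.trans (by gcongr)
  have hxi : ∀ i, |x i| ≤ ∑ i, (c ^ d i)⁻¹ := by
    intro i
    have h2 := abs_apply_le_norm (dilate d t x) i
    replace htx : ‖dilate d t x‖ = 1 := htx
    rw [htx] at h2
    have h3 : t ^ d i * |x i| ≤ 1 := by
      rwa [dilate, abs_mul, abs_of_pos (Real.rpow_pos_of_pos ht0 _)] at h2
    have h4 : c ^ d i * |x i| ≤ 1 := le_trans (by gcongr; exact (hd i).le) h3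
    have h5 : |x i| ≤ (c ^ d i)⁻¹ := by
      rw [← one_div, le_div_iff₀ (by positivity)]
      linarith
    exact h5.trans (Finset.single_le_sum (f := fun i => (c ^ d i)⁻¹) (fun _ _ => by positivity)
      (Finset.mem_univ i))
  have := norm_le_card_mul hxi
  rw [Fintype.card_fin] at this
  linarith

variable {A : Composition N}

theorem firstBlock_eq_diag (x : EuclideanSpace ℝ (Fin N)) :
    firstBlock A x = diag (fun i => if (A.index i).val = 0 then 1 else 0) x := by
  ext i
  rw [diag_apply]
  change (if (A.index i).val = 0 then x i else 0) = _
  split_ifs <;> simp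

theorem firstBlock_apply (x : EuclideanSpace ℝ (Fin N)) (i : Fin N) :
    firstBlock A x i = if (A.index i).val = 0 then x i else 0 := rfl

theorem firstBlock_dilate (t : ℝ) (x : EuclideanSpace ℝ (Fin N)) :
    firstBlock A (dilate d t x) = dilate d t (firstBlock A x) := by
  ext i
  change (if (A.index i).val = 0 then t ^ d i * x i else 0) =
    t ^ d i * (if (A.index i).val = 0 then x i else 0)
  split_ifs <;> simp

theorem dilate_eq_diag (t : ℝ) (x : EuclideanSpace ℝ (Fin N)) :
    dilate d t x = diag (fun i => t ^ d i) x := rfl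

theorem continuous_firstBlock : Continuous (firstBlock A) := by
  rw [show firstBlock A = _ from funext firstBlock_eq_diag]
  exact (diag _).continuous

theorem contDiff_firstBlock : ContDiff ℝ ∞ (firstBlock A) := by
  rw [show firstBlock A = _ from funext firstBlock_eq_diag]
  exact (diag fun i => if (A.index i).val = 0 then (1 : ℝ) else 0).contDiff

variable (𝕜 : Type*) [RCLike 𝕜]

/-- The cutoff in the first factor: a function of the homogeneous norm of the first component. -/
def firstCutoff (ρ : EuclideanSpace ℝ (Fin N) → ℝ) (A : Composition N)
    (x : EuclideanSpace ℝ (Fin N)) : 𝕜 :=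
  ((Real.smoothTransition (2 - 4 * ρ (firstBlock A x)) : ℝ) : 𝕜)

theorem firstCutoff_eq_one {x : EuclideanSpace ℝ (Fin N)} (h : ρ (firstBlock A x) ≤ 1 / 4) :
    firstCutoff 𝕜 ρ A x = 1 := by
  rw [firstCutoff, Real.smoothTransition.one_of_one_le (by linarith), RCLike.ofReal_one]

theorem firstCutoff_eq_zero {x : EuclideanSpace ℝ (Fin N)} (h : 1 / 2 ≤ ρ (firstBlock A x)) :
    firstCutoff 𝕜 ρ A x = 0 := by
  rw [firstCutoff, Real.smoothTransition.zero_of_nonpos (by linarith), RCLike.ofReal_zero]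

theorem contDiff_firstCutoff (hρ : IsSmoothHomogeneousNorm d ρ) :
    ContDiff ℝ ∞ (firstCutoff 𝕜 ρ A) := by
  refine contDiff_iff_contDiffAt.2 fun x => ?_
  by_cases hx : firstBlock A x = 0
  · have hlt : ∀ᶠ y in 𝓝 x, ρ (firstBlock A y) < 1 / 4 := by
      refine ((hρ.continuous.comp continuous_firstBlock).tendsto x).eventually_lt_const ?_
      rw [Function.comp_apply, hx, (hρ.eq_zero_iff 0).2 rfl]
      norm_num
    refine (contDiffAt_const (c := (1 : 𝕜))).congr_of_eventuallyEq ?_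
    filter_upwards [hlt] with y hy using firstCutoff_eq_one 𝕜 hy.le
  · have h1 : ContDiffAt ℝ ∞ ρ (firstBlock A x) :=
      hρ.smooth.contDiffAt (isOpen_compl_singleton.mem_nhds hx)
    have h2 : ContDiffAt ℝ ∞ (fun y => ρ (firstBlock A y)) x :=
      h1.comp x contDiff_firstBlock.contDiffAt
    exact (RCLike.ofRealCLM (K := 𝕜)).contDiff.contDiffAt.comp x
      (Real.smoothTransition.contDiff.contDiffAt.comp x
        (contDiffAt_const.sub (contDiffAt_const.mul h2)))

theorem exists_isDensity (x₀ : Fin N → ℝ) {ε : ℝ} (hε : 0 < ε) :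
    ∃ θ : Fin N → ℝ → 𝕜, (∀ i, ContDiff ℝ ∞ (θ i)) ∧ (∀ i t, θ i t ≠ 0 → |t - x₀ i| ≤ ε) ∧
      ∀ i, ∫ t, θ i t = 1 := by
  set b : ∀ i, ContDiffBump (x₀ i) := fun i => ⟨ε / 2, ε, half_pos hε, half_lt_self hε⟩ with hb
  refine ⟨fun i t => (((b i).normed volume t : ℝ) : 𝕜), fun i =>
    (RCLike.ofRealCLM (K := 𝕜)).contDiff.comp (b i).contDiff_normed, fun i t ht => ?_, fun i => ?_⟩
  · have h1 : (b i).normed volume t ≠ 0 := fun h => ht (by dsimp only; rw [h, RCLike.ofReal_zero])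
    have h2 : t ∈ Function.support ((b i).normed volume) := h1
    rw [(b i).support_normed_eq, Metric.mem_ball, Real.dist_eq] at h2
    exact h2.le
  · rw [integral_ofReal, (b i).integral_normed, RCLike.ofReal_one]

/-- A cutoff in the coordinates of a factor. -/
def boxCutoff (A : Composition N) (b : ContDiffBump (0 : ℝ)) (k : Fin A.length)
    (x : EuclideanSpace ℝ (Fin N)) : 𝕜 :=
  ∏ s with A.index s = k, ((b (x s) : ℝ) : 𝕜)

theorem isCutoff_boxCutoff (b : ContDiffBump (0 : ℝ)) {r : ℝ} (hr : b.rOut ≤ r) (k : Fin A.length) :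
    IsCutoff A r k (boxCutoff 𝕜 A b k) := by
  refine ⟨contDiff_prod fun s _ => (RCLike.ofRealCLM (K := 𝕜)).contDiff.comp
    (b.contDiff.comp (contDiff_euclidean.1 contDiff_id s)), fun x y hxy => ?_, fun x hx s hs => ?_⟩
  · refine Finset.prod_congr rfl fun s hs => ?_
    rw [hxy s (Finset.mem_filter.1 hs).2]
  · have h1 := Finset.prod_ne_zero_iff.1 hx s (Finset.mem_filter.2 ⟨Finset.mem_univ _, hs⟩)
    have h2 : x s ∈ Function.support b := fun h => h1 (by rw [h, RCLike.ofReal_zero])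
    rw [b.support_eq, Metric.mem_ball, Real.dist_eq, sub_zero] at h2
    exact h2.le.trans hr

theorem boxCutoff_eq_one (b : ContDiffBump (0 : ℝ)) {k : Fin A.length}
    {x : EuclideanSpace ℝ (Fin N)} (h : ∀ s, A.index s = k → |x s| ≤ b.rIn) :
    boxCutoff 𝕜 A b k x = 1 := by
  refine Finset.prod_eq_one fun s hs => ?_
  rw [b.one_of_mem_closedBall, RCLike.ofReal_one]
  rw [Metric.mem_closedBall, Real.dist_eq, sub_zero]
  exact h s (Finset.mem_filter.1 hs).2

/-- There are cutoffs such that the bumps they localize are supported in the unit ball of the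
homogeneous norm, and away from the vanishing set of the first component. -/
theorem IsSmoothHomogeneousNorm.exists_cutoffSystem (hρ : IsSmoothHomogeneousNorm d ρ)
    (hd : ∀ i, 0 < d i) (hN : 0 < N) (A : Composition N) :
    ∃ (η : Fin A.length → EuclideanSpace ℝ (Fin N) → 𝕜) (θ : Fin N → ℝ → 𝕜) (r δ : ℝ)
      (Γ : Fin A.length → Set (EuclideanSpace ℝ (Fin N))), IsCutoffSystem d A η θ r δ Γ ∧
      ∀ x, (∀ k, x ∈ Γ k) → ρ x ≤ 1 ∧ 1 / 8 ≤ ρ (firstBlock A x) := by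
  classical
  have hlen : 0 < A.length := A.length_pos_of_pos hN
  obtain ⟨s₀, hs₀⟩ := exists_index_eq A ⟨0, hlen⟩
  obtain ⟨R, hR0, hR⟩ := hρ.exists_norm_le hd (1 / 2) (by norm_num)
  -- the size of the components other than the first
  obtain ⟨r₁, hr₁0, hr₁⟩ : ∃ r₁ : ℝ, 0 < r₁ ∧ ∀ x, ρ (firstBlock A x) ≤ 1 / 2 →
      (∀ s, (A.index s).val ≠ 0 → |x s| ≤ r₁) → ρ x ≤ 1 := by
    have hK : IsCompact {x | ρ x ≤ 1 / 2} :=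
      (isCompact_closedBall (0 : EuclideanSpace ℝ (Fin N)) R).of_isClosed_subset
        (isClosed_le hρ.continuous continuous_const) fun x hx => by simpa using hR x hx
    obtain ⟨ε, hε, hsub⟩ := hK.exists_thickening_subset_open
      (isOpen_lt hρ.continuous continuous_const : IsOpen {x | ρ x < 1})
      fun x (hx : ρ x ≤ 1 / 2) => show ρ x < 1 by linarith
    refine ⟨ε / (N + 1), by positivity, fun x hx hs => ?_⟩
    have hdist : ‖x - firstBlock A x‖ < ε := by
      have := norm_le_card_mul (x := x - firstBlock A x) (r := ε / (N + 1)) fun i => by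
        rw [PiLp.sub_apply, firstBlock_apply]
        split_ifs with hi
        · rw [sub_self, abs_zero]; positivity
        · rw [sub_zero]; exact hs i hi
      rw [Fintype.card_fin] at this
      refine this.trans_lt ?_
      rw [← mul_div_assoc, div_lt_iff₀ (by positivity)]
      nlinarith
    have : x ∈ Metric.thickening ε {x | ρ x ≤ 1 / 2} :=
      Metric.mem_thickening_iff.2 ⟨firstBlock A x, hx, by rwa [dist_eq_norm]⟩
    exact (hsub this).le
  -- the centre of the averages: the homogeneous norm of its first component is `3 / 8`
  set u : EuclideanSpace ℝ (Fin N) := WithLp.toLp 2 fun _ => 1 with hu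
  have ha : 0 < ρ (firstBlock A u) := by
    refine lt_of_le_of_ne (hρ.nonneg _) fun h => ?_
    have h1 := (hρ.eq_zero_iff _).1 h.symm
    have h2 : firstBlock A u s₀ = 0 := by rw [h1]; rfl
    rw [firstBlock_apply, hs₀, if_pos rfl] at h2
    exact one_ne_zero h2
  set t : ℝ := 3 / 8 / ρ (firstBlock A u) with ht
  have ht0 : 0 < t := by positivity
  set x₀ : Fin N → ℝ := fun i => if (A.index i).val = 0 then t ^ d i else r₁ / 2 with hx₀
  have hx₀0 : ∀ i, 0 < x₀ i := fun i => by
    simp only [hx₀]; split_ifs <;> positivity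
  have hx₀ρ : ρ (dilate d t (firstBlock A u)) = 3 / 8 := by
    rw [hρ.homogeneous t ht0, ht]
    field_simp
  obtain ⟨ε₀, hε₀, hε₀ρ⟩ := Metric.continuousAt_iff.1
    (hρ.continuous.continuousAt (x := dilate d t (firstBlock A u))) (1 / 8) (by norm_num)
  obtain ⟨m₀, hm₀, hm₀x⟩ := exists_pos_forall_le x₀ hx₀0
  set ε : ℝ := min (m₀ / 2) (ε₀ / (N + 1)) with hε
  have hε0 : 0 < ε := by positivity
  have hεx : ∀ i, ε ≤ x₀ i / 2 := fun i => (min_le_left _ _).trans (by linarith [hm₀x i])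
  obtain ⟨θ, hθs, hθx, hθi⟩ := exists_isDensity 𝕜 x₀ hε0
  have hθρ : ∀ x : EuclideanSpace ℝ (Fin N), (∀ i, (A.index i).val = 0 → θ i (x i) ≠ 0) →
      1 / 4 ≤ ρ (firstBlock A x) ∧ ρ (firstBlock A x) ≤ 1 / 2 := by
    intro x hx
    have hdist : dist (firstBlock A x) (dilate d t (firstBlock A u)) < ε₀ := by
      rw [dist_eq_norm]
      have := norm_le_card_mul (x := firstBlock A x - dilate d t (firstBlock A u)) (r := ε)
        fun i => by
          rw [PiLp.sub_apply, ← firstBlock_dilate, firstBlock_apply, firstBlock_apply]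
          split_ifs with hi
          · have := hθx i _ (hx i hi)
            simpa [hx₀, hi, dilate, hu] using this
          · rw [sub_self, abs_zero]; exact hε0.le
      rw [Fintype.card_fin] at this
      refine this.trans_lt ?_
      have h2 : ε ≤ ε₀ / (N + 1) := min_le_right _ _
      rw [le_div_iff₀ (by positivity)] at h2
      nlinarith
    have := hε₀ρ hdist
    rw [Real.dist_eq, hx₀ρ, abs_lt] at this
    constructor <;> linarith [this.1, this.2]
  -- the region where the cutoffs are equal to one
  obtain ⟨ε₁, hε₁, hε₁ρ⟩ := Metric.continuousAt_iff.1
    (hρ.continuous.continuousAt (x := 0)) (1 / 4) (by norm_num)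
  have hρ0 : ρ 0 = 0 := (hρ.eq_zero_iff 0).2 rfl
  obtain ⟨δ, hδ0, hδε, hδ⟩ : ∃ δ : ℝ, 0 < δ ∧ δ ≤ ε ∧
      ∀ s, δ ^ d s ≤ min (r₁ / 2) (ε₁ / (N + 1)) := by
    have h1 : ∀ s, ∀ᶠ δ : ℝ in 𝓝[>] 0, δ ^ d s < min (r₁ / 2) (ε₁ / (N + 1)) := fun s => by
      have := (Real.continuousAt_rpow_const 0 (d s) (Or.inr (hd s).le)).tendsto
      rw [Real.zero_rpow (hd s).ne'] at this
      exact (this.mono_left nhdsWithin_le_nhds).eventually_lt_const (by positivity)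
    have h2 : ∀ᶠ δ : ℝ in 𝓝[>] 0, δ < ε :=
      (tendsto_id.mono_left nhdsWithin_le_nhds).eventually_lt_const hε0
    obtain ⟨δ, ⟨h3, h4⟩, h5⟩ := ((eventually_all.2 h1).and h2 |>.and self_mem_nhdsWithin).exists
    exact ⟨δ, h5, h4.le, fun s => (h3 s).le⟩
  let b : ContDiffBump (0 : ℝ) := ⟨r₁ / 2, r₁, half_pos hr₁0, half_lt_self hr₁0⟩
  set r : ℝ := R + r₁ + ∑ i, x₀ i + ε with hr
  have hsum0 : 0 ≤ ∑ i, x₀ i := Finset.sum_nonneg fun i _ => (hx₀0 i).le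
  set η : Fin A.length → EuclideanSpace ℝ (Fin N) → 𝕜 := fun k =>
    if k.val = 0 then firstCutoff 𝕜 ρ A else boxCutoff 𝕜 A b k with hη
  set Γ : Fin A.length → Set (EuclideanSpace ℝ (Fin N)) := fun k =>
    {x | if k.val = 0 then 1 / 8 ≤ ρ (firstBlock A x) ∧ ρ (firstBlock A x) ≤ 1 / 2
      else ∀ s, A.index s = k → |x s| ≤ r₁} with hΓ
  have hbox : ∀ k (x : EuclideanSpace ℝ (Fin N)), boxCutoff 𝕜 A b k x ≠ 0 →
      ∀ s, A.index s = k → |x s| ≤ r₁ := fun k => (isCutoff_boxCutoff 𝕜 b le_rfl k).supp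
  have htwo : ∀ x : EuclideanSpace ℝ (Fin N),
      ρ (firstBlock A (diag (fun i => (2 : ℝ) ^ d i) x)) = 2 * ρ (firstBlock A x) := fun x => by
    rw [← dilate_eq_diag, firstBlock_dilate, hρ.homogeneous 2 two_pos]
  have hshrink : ∀ (x : EuclideanSpace ℝ (Fin N)) s,
      |(2 : ℝ) ^ d s * x s| ≤ r₁ → |x s| ≤ r₁ := fun x s h => by
    refine le_trans ?_ h
    rw [abs_mul, abs_of_pos (Real.rpow_pos_of_pos two_pos (d s))]
    exact le_mul_of_one_le_left (abs_nonneg _) (one_le_two_rpow hd s)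
  have hθr : ∀ i t, θ i t ≠ 0 → t ≤ x₀ i + ε ∧ x₀ i - ε ≤ t := fun i t h => by
    have := abs_le.1 (hθx i t h)
    constructor <;> linarith [this.1, this.2]
  refine ⟨η, θ, r, δ, Γ, ⟨hd, hδ0, fun k => ?_, fun k x hx => ?_, ⟨hθs, fun i t h => ?_, hθi⟩,
    fun i t h => ?_, fun k x hx => ?_, fun k x hk hx => ?_, fun k x hx => ?_, fun k x hx => ?_⟩,
    fun x hx => ?_⟩
  · by_cases hk : k.val = 0
    · simp only [hη, hk, if_true]
      refine ⟨contDiff_firstCutoff 𝕜 hρ, fun x y hxy => ?_, fun x hx s hs => ?_⟩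
      · have : firstBlock A x = firstBlock A y := by
          ext s
          rw [firstBlock_apply, firstBlock_apply]
          split_ifs with hs
          · exact hxy s (Fin.ext (hs.trans hk.symm))
          · rfl
        rw [firstCutoff, firstCutoff, this]
      · have h1 : ρ (firstBlock A x) ≤ 1 / 2 := by
          by_contra h
          exact hx (firstCutoff_eq_zero 𝕜 (not_le.1 h).le)
        have h2 := (abs_apply_le_norm _ s).trans (hR _ h1)
        rw [firstBlock_apply, if_pos (by rw [hs]; exact hk)] at h2
        linarith
    · simp only [hη, hk, if_false]
      exact isCutoff_boxCutoff 𝕜 b (show r₁ ≤ r by linarith) k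
  · by_cases hk : k.val = 0
    · simp only [hη, hk, if_true]
      refine firstCutoff_eq_one 𝕜 ?_
      have h1 := norm_le_card_mul (x := firstBlock A x) (r := ε₁ / (N + 1)) fun s => by
        rw [firstBlock_apply]
        split_ifs with hs
        · exact (hx s (Fin.ext (hs.trans hk.symm))).trans ((hδ s).trans (min_le_right _ _))
        · rw [abs_zero]; positivity
      rw [Fintype.card_fin] at h1
      have h2 : dist (firstBlock A x) 0 < ε₁ := by
        rw [dist_zero_right]
        refine h1.trans_lt ?_
        rw [← mul_div_assoc, div_lt_iff₀ (by positivity)]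
        nlinarith
      have h3 := hε₁ρ h2
      rw [hρ0, Real.dist_eq, sub_zero, abs_lt] at h3
      exact h3.2.le
    · simp only [hη, hk, if_false]
      exact boxCutoff_eq_one 𝕜 b fun s hs => (hx s hs).trans ((hδ s).trans (min_le_left _ _))
  · have h1 := hθr i t h
    have h2 := Finset.single_le_sum (f := x₀) (fun i _ => (hx₀0 i).le) (Finset.mem_univ i)
    have h3 := hεx i
    have h4 := hx₀0 i
    rw [abs_le]
    constructor <;> linarith [h1.1, h1.2]
  · have h1 := hθr i t h
    have h3 := hεx i
    exact le_trans (by linarith [h1.2]) (le_abs_self t)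
  · by_cases hk : k.val = 0
    · simp only [hη, hk, if_true, ringCutoff] at hx
      simp only [hΓ, hk, if_true, Set.mem_ofPred_eq]
      constructor
      · by_contra h
        rw [not_le] at h
        apply hx
        rw [firstCutoff_eq_one 𝕜 (by linarith), firstCutoff_eq_one 𝕜 (by rw [htwo]; linarith),
          sub_self]
      · by_contra h
        rw [not_le] at h
        apply hx
        rw [firstCutoff_eq_zero 𝕜 h.le, firstCutoff_eq_zero 𝕜 (by rw [htwo]; linarith), sub_self]
    · simp only [hη, hk, if_false, ringCutoff] at hx
      simp only [hΓ, hk, if_false, Set.mem_ofPred_eq]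
      intro s hs
      by_cases h1 : boxCutoff 𝕜 A b k x = 0
      · rw [h1, zero_sub, neg_ne_zero] at hx
        exact hshrink x s (by simpa using hbox k _ hx s hs)
      · exact hbox k x h1 s hs
  · simp only [hη, hk, if_false] at hx
    simp only [hΓ, hk, if_false, Set.mem_ofPred_eq]
    exact fun s hs => hshrink x s (by simpa using hbox k _ hx s hs)
  · by_cases hk : k.val = 0
    · simp only [hΓ, hk, if_true, Set.mem_ofPred_eq]
      have := hθρ x fun i hi => hx i (Fin.ext (hi.trans hk.symm))
      exact ⟨by linarith [this.1], this.2⟩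
    · simp only [hΓ, hk, if_false, Set.mem_ofPred_eq]
      intro s hs
      have h1 := hθr s _ (hx s hs)
      have h2 := hεx s
      have h3 : x₀ s = r₁ / 2 := by simp [hx₀, hs, hk]
      rw [abs_le]
      constructor <;> linarith [h1.1, h1.2]
  · by_cases hk : k.val = 0
    · simp only [hΓ, hk, if_true, Set.mem_ofPred_eq]
      have := hθρ (diag (fun i => (2 : ℝ) ^ d i) x) fun i hi => by
        rw [diag_apply]; exact hx i (Fin.ext (hi.trans hk.symm))
      rw [htwo] at this
      constructor <;> linarith [this.1, this.2]
    · simp only [hΓ, hk, if_false, Set.mem_ofPred_eq]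
      intro s hs
      have h1 := hθr s _ (hx s hs)
      have h2 := hεx s
      have h3 : x₀ s = r₁ / 2 := by simp [hx₀, hs, hk]
      refine hshrink x s ?_
      rw [abs_le]
      constructor <;> linarith [h1.1, h1.2]
  · have h0 := hx ⟨0, hlen⟩
    simp only [hΓ, if_true, Set.mem_ofPred_eq] at h0
    refine ⟨hr₁ x h0.2 fun s hs => ?_, h0.1⟩
    have h1 := hx (A.index s)
    simp only [hΓ, hs, if_false, Set.mem_ofPred_eq] at h1
    exact h1 s rfl

end CutoffExistence

/-! ### Density of test functions -/

section Density

open Filter Topology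

variable {𝕜 : Type*} [RCLike 𝕜] {ι : Type} [Fintype ι]

/-- Tempered distributions are determined by their values on test functions. -/
theorem ext_of_hasCompactSupport {T T' : 𝓢(EuclideanSpace ℝ ι, 𝕜) →L[𝕜] 𝕜}
    (h : ∀ f : 𝓢(EuclideanSpace ℝ ι, 𝕜), HasCompactSupport f → T f = T' f) : T = T' := by
  ext f
  let χ : ContDiffBump (0 : EuclideanSpace ℝ ι) := ⟨1, 2, one_pos, one_lt_two⟩
  set χ' : EuclideanSpace ℝ ι → 𝕜 := fun x => ((χ x : ℝ) : 𝕜) with hχ'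
  have hχs : ContDiff ℝ ∞ χ' := (RCLike.ofRealCLM (K := 𝕜)).contDiff.comp χ.contDiff
  have hχc : HasCompactSupport χ' :=
    χ.hasCompactSupport.comp_left (g := fun t : ℝ => (t : 𝕜)) (by simp)
  obtain ⟨B, hB⟩ := exists_iteratedFDeriv_le hχs hχc
  have hB0 : ∀ j, 0 ≤ B j := fun j => (norm_nonneg _).trans (hB j 0)
  -- With `D m` the multiplication by `1 / (m + 1)`, the function `f` is the limit of the products
  -- `χ' (D m x) * f x`. The error `g (D m x) * f x` vanishes unless `‖x‖ ≥ m + 1`, so it is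
  -- `O(1 / m)` at the cost of one power of `‖x‖`.
  set g : EuclideanSpace ℝ ι → 𝕜 := fun x => 1 - χ' x with hg
  have hgs : ContDiff ℝ ∞ g := contDiff_const.sub hχs
  have hgb : ∀ j x, ‖iteratedFDeriv ℝ j g x‖ ≤ 1 + B j := by
    intro j x
    have e : iteratedFDeriv ℝ j g x =
        iteratedFDeriv ℝ j (fun _ => (1 : 𝕜)) x - iteratedFDeriv ℝ j χ' x :=
      iteratedFDeriv_sub_apply contDiffAt_const
        (hχs.contDiffAt.of_le (by exact_mod_cast le_top))
    rw [e]
    refine (norm_sub_le _ _).trans (add_le_add ?_ (hB j x))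
    rcases Nat.eq_zero_or_pos j with rfl | hj
    · rw [norm_iteratedFDeriv_zero, norm_one]
    · rw [iteratedFDeriv_const_of_ne hj.ne']
      simp
  have hg0 : ∀ x, ‖x‖ < 1 → g x = 0 := by
    intro x hx
    rw [hg]
    dsimp only
    rw [hχ']
    dsimp only
    rw [χ.one_of_mem_closedBall (by simpa using hx.le), RCLike.ofReal_one, sub_self]
  set D : ℕ → EuclideanSpace ℝ ι →L[ℝ] EuclideanSpace ℝ ι := fun m =>
    ((m + 1 : ℝ)⁻¹) • ContinuousLinearMap.id ℝ _ with hD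
  have hDx : ∀ m x, D m x = ((m + 1 : ℝ)⁻¹) • x := fun _ _ => rfl
  have hDn : ∀ m x, ‖D m x‖ = ‖x‖ / (m + 1) := fun m x => by
    rw [hDx, norm_smul, norm_inv, Real.norm_of_nonneg (by positivity), inv_mul_eq_div]
  have hD1 : ∀ m, ‖D m‖ ≤ 1 := fun m => (D m).opNorm_le_bound zero_le_one fun x => by
    rw [hDn, one_mul]
    exact div_le_self (norm_nonneg _) (by linarith [(Nat.cast_nonneg m : (0 : ℝ) ≤ m)])
  have hgm : ∀ m j x, ‖iteratedFDeriv ℝ j (fun x => g (D m x)) x‖ ≤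
      (1 + B j) * (‖x‖ / (m + 1)) := by
    intro m j x
    have hj := hB0 j
    rcases lt_or_ge (‖x‖ / (m + 1)) 1 with hlt | hge
    · have hz : (fun x => g (D m x)) =ᶠ[𝓝 x] fun _ => 0 := by
        have hcont : Continuous fun x => ‖D m x‖ := (D m).continuous.norm
        filter_upwards [(hcont.tendsto x).eventually_lt_const (by rw [hDn]; exact hlt)] with y hy
          using hg0 _ hy
      rw [(hz.iteratedFDeriv ℝ j).eq_of_nhds, iteratedFDeriv_fun_zero]
      simp only [Pi.zero_apply, norm_zero]
      positivity
    · have e : iteratedFDeriv ℝ j (fun x => g (D m x)) x =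
          (iteratedFDeriv ℝ j g (D m x)).compContinuousLinearMap fun _ => D m :=
        (D m).iteratedFDeriv_comp_right hgs x (by exact_mod_cast le_top)
      have h1 := (iteratedFDeriv ℝ j g (D m x)).norm_compContinuousLinearMap_le fun _ => D m
      rw [Finset.prod_const, Finset.card_univ, Fintype.card_fin] at h1
      rw [e]
      calc _ ≤ ‖iteratedFDeriv ℝ j g (D m x)‖ * ‖D m‖ ^ j := h1
        _ ≤ (1 + B j) * 1 := by
          gcongr
          · exact hgb j _
          · exact pow_le_one₀ (norm_nonneg _) (hD1 m)
        _ ≤ _ := by gcongr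
  have hfc : ∀ m : ℕ, HasCompactSupport fun x => χ' (D m x) * f x := fun m => by
    refine HasCompactSupport.mul_right ?_
    refine HasCompactSupport.intro (isCompact_closedBall 0 (2 * (m + 1))) fun x hx => ?_
    have h2 : χ (D m x) = 0 := χ.zero_of_le_dist (by
      rw [dist_zero_right, hDn, le_div_iff₀ (by positivity)]
      rw [Metric.mem_closedBall, dist_zero_right, not_le] at hx
      exact hx.le)
    simp [hχ', h2]
  have hfs : ∀ m : ℕ, ContDiff ℝ ∞ fun x => χ' (D m x) * f x := fun m =>
    (hχs.comp (D m).contDiff).mul (f.smooth ⊤)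
  set F : ℕ → 𝓢(EuclideanSpace ℝ ι, 𝕜) := fun m => (hfc m).toSchwartzMap (hfs m) with hF
  have hlim : Tendsto F atTop (𝓝 f) := by
    rw [(schwartz_withSeminorms 𝕜 (EuclideanSpace ℝ ι) 𝕜).tendsto_nhds]
    rintro ⟨k, n⟩ ε hε
    set M : ℝ := ∑ j ∈ Finset.range (n + 1), (n.choose j : ℝ) * (1 + B j) *
      SchwartzMap.seminorm 𝕜 (k + 1) (n - j) f with hM
    have hM0 : 0 ≤ M := Finset.sum_nonneg fun j _ => by have := hB0 j; positivity
    have hle : ∀ m, SchwartzMap.seminorm 𝕜 k n (f - F m) ≤ M / (m + 1) := by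
      intro m
      refine SchwartzMap.seminorm_le_bound 𝕜 k n _ (by positivity) fun x => ?_
      have e : ⇑(f - F m) = fun x => g (D m x) * f x := by
        funext x
        change f x - χ' (D m x) * f x = _
        rw [hg]
        ring
      rw [e]
      have h1 := norm_iteratedFDeriv_mul_le (n := n) (hgs.comp (D m).contDiff) (f.smooth ⊤) x
        (by exact_mod_cast le_top)
      refine (mul_le_mul_of_nonneg_left h1 (by positivity)).trans ?_
      rw [Finset.mul_sum, hM, Finset.sum_div]
      refine Finset.sum_le_sum fun j _ => ?_
      have h2 := hgm m j x
      have h3 := SchwartzMap.le_seminorm 𝕜 (k + 1) (n - j) f x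
      have hj := hB0 j
      calc _ ≤ ‖x‖ ^ k * ((n.choose j : ℝ) * ((1 + B j) * (‖x‖ / (m + 1))) *
              ‖iteratedFDeriv ℝ (n - j) f x‖) := by gcongr; exact h2
        _ = (n.choose j : ℝ) * (1 + B j) * (‖x‖ ^ (k + 1) * ‖iteratedFDeriv ℝ (n - j) f x‖) /
              (m + 1) := by rw [pow_succ]; ring
        _ ≤ _ := by gcongr
    have h0 : Tendsto (fun m : ℕ => M / ((m : ℝ) + 1)) atTop (𝓝 0) :=
      tendsto_const_nhds.div_atTop (tendsto_atTop_add_const_right _ _ tendsto_natCast_atTop_atTop)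
    filter_upwards [h0.eventually_lt_const hε] with m hm
    rw [← map_neg_eq_map, neg_sub]
    exact (hle m).trans_lt hm
  have h1 := (T.continuous.tendsto f).comp hlim
  have h2 := (T'.continuous.tendsto f).comp hlim
  refine tendsto_nhds_unique h1 (h2.congr fun m => ?_)
  exact (h (F m) (hfc m)).symm

end Density

section StrongCancellation

variable {𝕜 : Type*} [RCLike 𝕜] {N : ℕ} {A : Composition N} {r : ℝ} {C : ℕ → ℝ}
  {φ : EuclideanSpace ℝ (Fin N) → 𝕜}

/-- Cancellation in the variables of every factor is strong cancellation. -/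
theorem strongCancellation_of_cancelsIn (hφ : IsBump r C φ)
    (h : ∀ k, CancelsIn (Finset.univ.filter fun i => A.index i = k) φ) :
    StrongCancellation A φ := by
  intro k x
  let p : Fin N → Prop := fun i => A.index i ≠ k
  have h1 := (h k).pairRight_eq_zero (p := p) hφ (fun i hi => by simpa [p] using hi)
    (w := fun _ => 1) contDiff_const (fun _ => rfl) (restrict p x)
  simp only [pairRight, mul_one] at h1
  let e : {i // ¬ p i} ≃ {i // A.index i = k} := Equiv.subtypeEquivRight fun i => not_not
  have h2 := (volume_measurePreserving_piCongrLeft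
    (fun _ : {i // A.index i = k} => ℝ) e).integral_comp'
    (fun y => φ (replaceBlock A k x y))
  have h3 := (PiLp.volume_preserving_toLp {i // ¬ p i}).integral_comp
    (MeasurableEquiv.toLp 2 ({i // ¬ p i} → ℝ)).measurableEmbedding
    fun v => φ (glue p (restrict p x) v)
  rw [← h2, ← h1, ← h3]
  refine integral_congr_ae (Filter.Eventually.of_forall fun v => congrArg φ ?_)
  ext i
  by_cases hi : A.index i = k
  · have h4 : (replaceBlock A k x (MeasurableEquiv.piCongrLeft
        (fun _ : {i // A.index i = k} => ℝ) e v)) i =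
        MeasurableEquiv.piCongrLeft (fun _ : {i // A.index i = k} => ℝ) e v ⟨i, hi⟩ := by
      simp [replaceBlock, hi]
    have h5 : ¬ p i := fun h => h hi
    rw [h4, glue_apply, dif_neg h5]
    exact Equiv.piCongrLeft_apply_apply (fun _ : {i // A.index i = k} => ℝ) e v ⟨i, h5⟩
  · have h5 : p i := hi
    rw [glue_apply, dif_pos h5]
    simp [replaceBlock, hi, restrict_apply]

end StrongCancellation

/-! ### Merging two consecutive factors -/

section Merge

/-- The list with its entries of indices `j` and `j + 1` replaced by their sum. -/
def mergeList : ℕ → List ℕ → List ℕ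
  | 0, a :: b :: l => (a + b) :: l
  | j + 1, a :: l => a :: mergeList j l
  | _, l => l

theorem length_mergeList : ∀ (j : ℕ) (l : List ℕ), j + 1 < l.length →
    (mergeList j l).length + 1 = l.length
  | 0, a :: b :: l, _ => by simp [mergeList]
  | 0, [a], h => by simp at h
  | 0, [], h => by simp at h
  | j + 1, [], h => by simp at h
  | j + 1, a :: l, h => by
    have := length_mergeList j l (by simpa using h)
    simp [mergeList, this]

theorem pos_of_mem_mergeList : ∀ (j : ℕ) (l : List ℕ), (∀ i ∈ l, 0 < i) →
    ∀ i ∈ mergeList j l, 0 < i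
  | 0, a :: b :: l, h => by
    simp only [mergeList, List.mem_cons, forall_eq_or_imp] at h ⊢
    exact ⟨by omega, h.2.2⟩
  | 0, [a], h => by simpa [mergeList] using h
  | 0, [], h => by simp [mergeList]
  | j + 1, [], h => by simp [mergeList]
  | j + 1, a :: l, h => by
    simp only [mergeList, List.mem_cons, forall_eq_or_imp] at h ⊢
    exact ⟨h.1, pos_of_mem_mergeList j l h.2⟩

/-- The first `m` entries of the merged list have the same sum as the first `m` or `m + 1` entries
of the original list. -/
theorem sum_take_mergeList : ∀ (j : ℕ) (l : List ℕ) (m : ℕ), j + 1 < l.length →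
    ((mergeList j l).take m).sum = (l.take (if m ≤ j then m else m + 1)).sum
  | 0, a :: b :: l, 0, _ => by simp
  | 0, a :: b :: l, m + 1, _ => by simp [mergeList, add_assoc]
  | 0, [a], _, h => by simp at h
  | 0, [], _, h => by simp at h
  | j + 1, [], _, h => by simp at h
  | j + 1, a :: l, 0, h => by simp
  | j + 1, a :: l, m + 1, h => by
    have := sum_take_mergeList j l m (by simpa using h)
    by_cases hm : m ≤ j
    · simp [mergeList, this, hm]
    · simp [mergeList, this, hm]

variable {N : ℕ}

/-- The composition `A` with its parts of indices `j` and `j + 1` merged. -/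
def merge (A : Composition N) (j : ℕ) (hj : j + 1 < A.length) : Composition N where
  blocks := mergeList j A.blocks
  blocks_pos := fun {i} hi => pos_of_mem_mergeList j A.blocks (fun _ h => A.blocks_pos h) i hi
  blocks_sum := by
    have h := sum_take_mergeList j A.blocks A.length hj
    rw [List.take_of_length_le (by
      have := length_mergeList j A.blocks hj
      have h2 := A.blocks_length
      omega), if_neg (by omega), List.take_of_length_le (by
      have h2 := A.blocks_length
      omega)] at h
    rw [h, A.blocks_sum]

variable (A : Composition N) (j : ℕ) (hj : j + 1 < A.length)

theorem length_merge : (merge A j hj).length + 1 = A.length :=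
  length_mergeList j A.blocks hj

theorem sizeUpTo_merge (m : ℕ) :
    (merge A j hj).sizeUpTo m = A.sizeUpTo (if m ≤ j then m else m + 1) :=
  sum_take_mergeList j A.blocks m hj

theorem index_eq_of_sizeUpTo {B : Composition N} {i : Fin N} {k : Fin B.length}
    (h1 : B.sizeUpTo k ≤ i) (h2 : (i : ℕ) < B.sizeUpTo (k + 1)) : B.index i = k := by
  have h3 := B.sizeUpTo_index_le i
  have h4 : (i : ℕ) < B.sizeUpTo ((B.index i : ℕ) + 1) := B.lt_sizeUpTo_index_succ i
  rcases lt_trichotomy (B.index i : ℕ) k with h | h | h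
  · have := B.monotone_sizeUpTo (show (B.index i : ℕ) + 1 ≤ k from h)
    omega
  · exact Fin.ext h
  · have := B.monotone_sizeUpTo (show (k : ℕ) + 1 ≤ B.index i from h)
    omega

/-- The factor of the merged decomposition containing a given factor. -/
def mergeFactor (k : Fin A.length) : Fin (merge A j hj).length :=
  ⟨if (k : ℕ) ≤ j then k else k - 1, by
    have h1 := length_merge A j hj
    have h2 := k.2
    split_ifs <;> omega⟩

theorem index_merge (i : Fin N) : (merge A j hj).index i = mergeFactor A j hj (A.index i) := by
  have h3 := A.sizeUpTo_index_le i
  have h4 : (i : ℕ) < A.sizeUpTo ((A.index i : ℕ) + 1) := A.lt_sizeUpTo_index_succ i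
  apply index_eq_of_sizeUpTo
  · rw [sizeUpTo_merge]
    refine (A.monotone_sizeUpTo ?_).trans h3
    simp only [mergeFactor]
    split_ifs <;> omega
  · rw [sizeUpTo_merge]
    refine h4.trans_le (A.monotone_sizeUpTo ?_)
    simp only [mergeFactor]
    split_ifs <;> omega

theorem sizeUpTo_eq_sum (m : ℕ) (hm : m ≤ A.length) :
    A.sizeUpTo m = ∑ i ∈ Finset.univ.filter fun i : Fin A.length => (i : ℕ) < m, A.blocksFun i := by
  induction m with
  | zero => simp
  | succ m ih =>
    have e : (Finset.univ.filter fun i : Fin A.length => (i : ℕ) < m + 1) =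
        insert ⟨m, hm⟩ (Finset.univ.filter fun i : Fin A.length => (i : ℕ) < m) := by
      ext i
      simp [Fin.ext_iff]
      omega
    rw [e, Finset.sum_insert (by simp), ← ih (by omega), add_comm (A.blocksFun _)]
    exact A.sizeUpTo_succ' ⟨m, hm⟩

/-- The flag of the merged decomposition is strictly coarser. -/
theorem strictlyCoarser_merge : StrictlyCoarser (merge A j hj) A := by
  have hl := length_merge A j hj
  refine ⟨⟨fun m => ⟨if (m : ℕ) ≤ j then m else m + 1, ?_⟩, ?_, ?_, ?_, ?_⟩, fun h => ?_⟩
  · have := m.2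
    split_ifs <;> omega
  · intro m m' h
    simp only [Fin.lt_def] at h ⊢
    split_ifs <;> omega
  · simp
  · ext
    simp only [Fin.val_last]
    split_ifs <;> omega
  · intro k
    have hk := k.2
    have h1 := (merge A j hj).sizeUpTo_succ' k
    rw [sizeUpTo_merge, sizeUpTo_merge] at h1
    rw [sizeUpTo_eq_sum A _ (by split_ifs <;> omega),
      sizeUpTo_eq_sum A _ (by split_ifs <;> omega)] at h1
    simp only [Fin.le_def, Fin.lt_def, Fin.val_castSucc, Fin.val_succ]
    have hle : (if (k : ℕ) ≤ j then (k : ℕ) else k + 1) ≤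
        (if (k : ℕ) + 1 ≤ j then (k : ℕ) + 1 else k + 1 + 1) := by split_ifs <;> omega
    generalize (if (k : ℕ) ≤ j then (k : ℕ) else k + 1) = u at *
    generalize (if (k : ℕ) + 1 ≤ j then (k : ℕ) + 1 else k + 1 + 1) = v at *
    rw [← Finset.sum_filter_add_sum_filter_not (s := Finset.univ.filter
      fun i : Fin A.length => (i : ℕ) < v) (fun i => (i : ℕ) < u), Finset.filter_filter,
      Finset.filter_filter] at h1
    have e1 : (Finset.univ.filter fun i : Fin A.length => (i : ℕ) < v ∧ (i : ℕ) < u) =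
        Finset.univ.filter fun i : Fin A.length => (i : ℕ) < u :=
      Finset.filter_congr fun i _ => by omega
    have e2 : (Finset.univ.filter fun i : Fin A.length => (i : ℕ) < v ∧ ¬ (i : ℕ) < u) =
        Finset.univ.filter fun i : Fin A.length => u ≤ (i : ℕ) ∧ (i : ℕ) < v :=
      Finset.filter_congr fun i _ => by omega
    rw [e1, e2] at h1
    omega
  · have := congrArg Composition.length h
    omega

end Merge

/-! ### Regrouping the terms of the expansion -/

section Regroup

variable {𝕜 : Type*} [RCLike 𝕜] {N : ℕ} {A : Composition N}

/-- The terms of the expansion of the identity whose factors have prescribed types. -/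
abbrev PatTerm (A : Composition N) (p : Fin A.length → Pat) : Type :=
  {w : FullPath (A.length - 1) // ∀ k : Fin A.length, FullPath.pat (A.length - 1) w k = p k}

/-- The scales of a term of the expansion. -/
def PatTerm.scale {p : Fin A.length → Pat} (a : PatTerm A p) (k : Fin A.length) : ℤ :=
  FullPath.scale (A.length - 1) a.1 k

/-- The factors of types `diff` and `prev`, which carry cancellation. -/
def Pat.IsEnd (p : Pat) : Prop := p = .diff ∨ p = .prev

instance : DecidablePred Pat.IsEnd := fun p => inferInstanceAs (Decidable (p = .diff ∨ p = .prev))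

variable {p : Fin A.length → Pat}

instance (k : ℕ) : Countable (FullPath k) :=
  Function.Injective.countable
    (f := fun w (j : Fin (k + 1)) => (FullPath.pat k w j, FullPath.scale k w j)) fun _ _ h =>
    FullPath.ext (fun j hj => congrArg Prod.fst (congrFun h ⟨j, hj⟩))
      fun j hj => congrArg Prod.snd (congrFun h ⟨j, hj⟩)

theorem PatTerm.ext_of_isEnd (hA : 0 < A.length) {a a' : PatTerm A p}
    (h : ∀ k, (p k).IsEnd → a.scale k = a'.scale k) : a = a' := by
  have hk : ∀ k < A.length - 1 + 1, k < A.length := fun k hk => by omega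
  have hp : ∀ k < A.length - 1 + 1,
      FullPath.pat (A.length - 1) a.1 k = FullPath.pat (A.length - 1) a'.1 k := fun k hk' =>
    (a.2 ⟨k, hk k hk'⟩).trans (a'.2 ⟨k, hk k hk'⟩).symm
  refine Subtype.ext (FullPath.ext hp fun k hk' => FullPath.scale_eq hp (fun k hk' hpk => ?_) hk')
  refine h ⟨k, hk k hk'⟩ ?_
  rw [← a.2 ⟨k, hk k hk'⟩]
  exact hpk

/-- The terms with factors of prescribed types form a series adapted to a decomposition whose
factors are unions of factors of `A`, provided the scales are constant on these unions and each
union contains at most one factor carrying cancellation. -/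
theorem flagSeries_patTerm (hA : 0 < A.length) {B : Composition N}
    (π : Fin A.length → Fin B.length) (ℓ : Fin B.length → Fin A.length) (hℓ : Monotone ℓ)
    (hπ : ∀ i, B.index i = π (A.index i))
    (hinj : ∀ k k', (p k).IsEnd → (p k').IsEnd → π k = π k' → k = k')
    (hs : ∀ (a : PatTerm A p) k, a.scale (ℓ (π k)) = a.scale k) {r : ℝ} {C : ℕ → ℝ}
    {φ : PatTerm A p → EuclideanSpace ℝ (Fin N) → 𝕜} (hφ : ∀ a, IsBump r C (φ a))
    (hc : ∀ a k, (p k).IsEnd → CancelsIn (Finset.univ.filter fun i => A.index i = k) (φ a)) :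
    FlagSeries B (fun (a : PatTerm A p) l => a.scale (ℓ l))
      ((Finset.univ.filter fun k => (p k).IsEnd).image π)
      (fun l => Finset.univ.filter fun i => π (A.index i) = l ∧ (p (A.index i)).IsEnd) r C φ where
  mono a l l' h := by
    obtain ⟨m, hv⟩ := a.1.valid
    exact hv.mono _ _ (hℓ h) (by have := (ℓ l').2; omega)
  inj a a' h := by
    refine PatTerm.ext_of_isEnd hA fun k hk => ?_
    have := h (π k) (Finset.mem_image_of_mem _ (by simpa using hk))
    rwa [hs, hs] at this
  mem l s h := by
    rw [hπ]
    exact (Finset.mem_filter.1 h).2.1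
  nonempty l hl := by
    obtain ⟨k, hk, rfl⟩ := Finset.mem_image.1 hl
    obtain ⟨i, rfl⟩ := exists_index_eq A k
    exact ⟨i, by simpa using hk⟩
  bump := hφ
  cancels a l hl := by
    obtain ⟨k, hk, rfl⟩ := Finset.mem_image.1 hl
    have hk' := (Finset.mem_filter.1 hk).2
    convert hc a k hk' using 1
    ext i
    simp only [Finset.mem_filter, Finset.mem_univ, true_and]
    refine ⟨fun h => hinj _ _ h.2 hk' h.1, ?_⟩
    rintro rfl
    exact ⟨rfl, hk'⟩

/-- A factor of the merged decomposition contains the factor with this label of `A`. -/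
def mergeRep (A : Composition N) (j : ℕ) (hj : j + 1 < A.length)
    (l : Fin (merge A j hj).length) : Fin A.length :=
  ⟨if (l : ℕ) ≤ j then l else l + 1, by
    have h1 := length_merge A j hj
    have h2 := l.2
    split_ifs <;> omega⟩

/-- If the factor `j` carries no cancellation then it has the same scale as its successor, so the
terms form a series adapted to the decomposition in which these two factors are merged. -/
theorem flagSeries_merge {j : ℕ} (hj : j + 1 < A.length)
    (hpj : ¬ (p ⟨j, by omega⟩).IsEnd) {r : ℝ} {C : ℕ → ℝ}
    {φ : PatTerm A p → EuclideanSpace ℝ (Fin N) → 𝕜} (hφ : ∀ a, IsBump r C (φ a))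
    (hc : ∀ a k, (p k).IsEnd → CancelsIn (Finset.univ.filter fun i => A.index i = k) (φ a)) :
    (∀ (a : PatTerm A p) i, a.scale (mergeRep A j hj ((merge A j hj).index i)) =
      a.scale (A.index i)) ∧
    ∃ 𝓔 e, FlagSeries (merge A j hj)
      (fun (a : PatTerm A p) l => a.scale (mergeRep A j hj l)) 𝓔 e r C φ := by
  have hs : ∀ (a : PatTerm A p) k,
      a.scale (mergeRep A j hj (mergeFactor A j hj k)) = a.scale k := by
    intro a k
    by_cases hk : (k : ℕ) = j + 1
    · obtain ⟨m, hv⟩ := a.1.valid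
      have hpj' := hpj
      rw [← a.2, Pat.IsEnd, not_or] at hpj'
      have h1 := hv.joined j (by omega) hpj'.1 hpj'.2
      rw [if_pos (by omega), ← hk] at h1
      have h2 : (mergeRep A j hj (mergeFactor A j hj k) : ℕ) = j := by
        simp [mergeRep, mergeFactor, hk]
      rw [PatTerm.scale, h2]
      exact h1
    · congr 1
      ext
      simp only [mergeRep, mergeFactor]
      split_ifs <;> omega
  refine ⟨fun a i => by rw [index_merge, hs], _, _,
    flagSeries_patTerm (by omega) (mergeFactor A j hj) (mergeRep A j hj) (fun l l' h => ?_)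
      (index_merge A j hj) (fun k k' hk hk' h => ?_) hs hφ hc⟩
  · simp only [Fin.le_def, mergeRep] at h ⊢
    split_ifs <;> omega
  · have h1 : (k : ℕ) ≠ j := fun e => hpj (by convert hk; exact e.symm)
    have h2 : (k' : ℕ) ≠ j := fun e => hpj (by convert hk'; exact e.symm)
    simp only [mergeFactor, Fin.mk.injEq] at h
    ext
    split_ifs at h <;> omega

/-- A term with a factor carrying no cancellation has such a factor that is not the last one. -/
theorem PatTerm.exists_not_isEnd (hA : 0 < A.length) (a : PatTerm A p)
    (hp : p ≠ fun _ => .diff) :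
    ∃ (j : ℕ) (hj : j + 1 < A.length), ¬ (p ⟨j, by omega⟩).IsEnd := by
  obtain ⟨m, hv⟩ := a.1.valid
  have key : ∃ k : Fin A.length, ¬ (p k).IsEnd := by
    obtain ⟨k, hk⟩ := Function.ne_iff.1 hp
    by_cases h : (p k).IsEnd
    · have hprev : p k = .prev := h.resolve_left hk
      obtain ⟨l, hl, h1, -⟩ := hv.inner k (by omega) (Or.inl ((a.2 k).trans hprev))
      refine ⟨⟨l, hl.trans k.2⟩, ?_⟩
      rw [← a.2]
      simp only [h1]
      simp [Pat.IsEnd]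
    · exact ⟨k, h⟩
  obtain ⟨k, hk⟩ := key
  refine ⟨k, ?_, hk⟩
  by_contra hlt
  have hk1 : (k : ℕ) = A.length - 1 := by omega
  apply hk
  rw [← a.2, hk1]
  exact a.1.pat_last

end Regroup

/-! ### The decomposition -/

theorem hasSum_of_hasSum_fiber {α β E : Type*} [Fintype β] [AddCommMonoid E] [TopologicalSpace E]
    [ContinuousAdd E] (π : α → β) {P : β → α → Prop} (hP : ∀ a b, P b a ↔ π a = b) {g : α → E}
    {s : β → E} (h : ∀ b, HasSum (fun a : {a // P b a} => g a.1) (s b)) :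
    HasSum g (∑ b, s b) := by
  classical
  have h2 := hasSum_sum fun b (_ : b ∈ (Finset.univ : Finset β)) =>
    (hasSum_subtype_iff_indicator (f := g) (s := {a | P b a})).1 (h b)
  refine hasSum_of_eq h2 fun a => ?_
  simp only [Set.indicator_apply, Set.mem_ofPred_eq, hP]
  simp

section Decomposition

variable {𝕜 : Type*} [RCLike 𝕜] {N : ℕ} {d : Fin N → ℝ} {A : Composition N}
  {η : Fin A.length → EuclideanSpace ℝ (Fin N) → 𝕜} {θ : Fin N → ℝ → 𝕜} {r δ : ℝ}
  {Γ : Fin A.length → Set (EuclideanSpace ℝ (Fin N))}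

/-- The value of `T` on the image of `f` under a term of the expansion of the identity. -/
def termVal (d : Fin N → ℝ) (A : Composition N) (η : Fin A.length → EuclideanSpace ℝ (Fin N) → 𝕜)
    (θ : Fin N → ℝ → 𝕜) (T : 𝓢(EuclideanSpace ℝ (Fin N), 𝕜) →L[𝕜] 𝕜)
    (f : EuclideanSpace ℝ (Fin N) → 𝕜) (w : FullPath (A.length - 1)) : 𝕜 :=
  wordFunctional (wordValue d A η θ T f) (letterProd (wordVar false) (wordVar true) 0 A.length
    (FullPath.pat (A.length - 1) w) (FullPath.scale (A.length - 1) w))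

/-- The terms of the expansion with prescribed types are integrals against dilated bumps, bounded
in terms of the flag kernel constants. -/
theorem IsCutoffSystem.exists_termBump (h : IsCutoffSystem d A η θ r δ Γ) (cst : FlagConstants A)
    (p : Fin A.length → Pat) :
    ∃ C : ℕ → ℝ, (∀ m, 0 ≤ C m) ∧ ∀ T : 𝓢(EuclideanSpace ℝ (Fin N), 𝕜) →L[𝕜] 𝕜,
      IsFlagKernelWith d A cst T → ∃ φ : PatTerm A p → EuclideanSpace ℝ (Fin N) → 𝕜,
        (∀ a, IsBump (N * r) C (φ a)) ∧ (∀ a x, φ a x ≠ 0 → ∀ k, x ∈ Γ k) ∧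
        (∀ a k, (p k).IsEnd → CancelsIn (Finset.univ.filter fun i => A.index i = k) (φ a)) ∧
        ∀ a : PatTerm A p, ∀ f, ContDiff ℝ ∞ f → termVal d A η θ T f a.1 =
          ∫ x, dyad d (fun i => a.scale (A.index i)) (φ a) x * f x := by
  have hin : ∀ a : PatTerm A p, ∀ k, p k = .prev ∨ p k = .core →
      ∃ l < k, p l = .ring ∧ a.scale l = a.scale k := by
    intro a k hk
    obtain ⟨m, hv⟩ := a.1.valid
    rw [← a.2] at hk
    obtain ⟨l, hl, h1, h2⟩ := hv.inner k (by omega) hk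
    exact ⟨⟨l, hl.trans k.2⟩, hl, (a.2 ⟨l, hl.trans k.2⟩).symm.trans h1, h2⟩
  by_cases hp : ∀ k, p k = .prev ∨ p k = .core → ∃ l < k, p l = .ring
  · obtain ⟨C, hC, H⟩ := h.exists_patternBump cst p hp
    refine ⟨C, hC, fun T hT => ?_⟩
    choose φ h1 h2 h3 h4 using fun a : PatTerm A p => H T hT a.scale (hin a)
    refine ⟨φ, h1, h2, h3, fun a f hf => ?_⟩
    rw [← h4 a f hf, termVal, letterProd_eq_prod, wordTerm]
    congr 1
    exact Finset.prod_congr rfl fun k _ => by rw [a.2]; rfl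
  · have hE : PatTerm A p → False := fun a => hp fun k hk => by
      obtain ⟨l, hl, h1, -⟩ := hin a k hk
      exact ⟨l, hl, h1⟩
    exact ⟨0, fun _ => le_rfl, fun T _ => ⟨fun _ => 0, fun a => (hE a).elim, fun a => (hE a).elim,
      fun a => (hE a).elim, fun a => (hE a).elim⟩⟩

/-- The terms whose factors all are differences `E k i - E k (i - 1)` form a series. -/
theorem flagSeries_diff (hA : 0 < A.length) {C : ℕ → ℝ}
    {φ : PatTerm A (fun _ => Pat.diff) → EuclideanSpace ℝ (Fin N) → 𝕜}
    (hφ : ∀ a, IsBump r C (φ a))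
    (hc : ∀ a k, CancelsIn (Finset.univ.filter fun i => A.index i = k) (φ a)) :
    ∃ 𝓔 e, FlagSeries A (fun (a : PatTerm A fun _ => Pat.diff) l => a.scale l) 𝓔 e r C φ :=
  ⟨_, _, flagSeries_patTerm hA id id monotone_id (fun _ => rfl) (fun _ _ _ _ h => h)
    (fun _ _ => rfl) hφ fun a k _ => hc a k⟩

/-- The sum of the terms with prescribed types, not all of them differences, is a flag kernel
adapted to a decomposition with two consecutive factors merged, or zero. -/
theorem exists_sum_patTerm (hd : ∀ i, 0 < d i) (hA : 0 < A.length) {p : Fin A.length → Pat}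
    {C : ℕ → ℝ} (hC : ∀ m, 0 ≤ C m) {φ : PatTerm A p → EuclideanSpace ℝ (Fin N) → 𝕜}
    (hφ : ∀ a, IsBump r C (φ a))
    (hc : ∀ a k, (p k).IsEnd → CancelsIn (Finset.univ.filter fun i => A.index i = k) (φ a)) :
    ∃ S : 𝓢(EuclideanSpace ℝ (Fin N), 𝕜) →L[𝕜] 𝕜,
      (∀ f : 𝓢(EuclideanSpace ℝ (Fin N), 𝕜), HasSum
        (fun a : PatTerm A p => ∫ x, dyad d (fun i => a.scale (A.index i)) (φ a) x * f x) (S f)) ∧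
      (p ≠ (fun _ => .diff) →
        ∃ j : Fin A.length, (∃ hj : (j : ℕ) + 1 < A.length, IsFlagKernel d (merge A j hj) S) ∨
          S = 0) := by
  rcases isEmpty_or_nonempty (PatTerm A p) with hE | ⟨⟨a₀⟩⟩
  · exact ⟨0, fun f => hasSum_empty, fun _ => ⟨⟨0, hA⟩, Or.inr rfl⟩⟩
  by_cases hp : p = fun _ => .diff
  · subst hp
    obtain ⟨𝓔, e, hs⟩ := flagSeries_diff hA hφ fun a k => hc a k (Or.inl rfl)
    obtain ⟨S, hS⟩ := hs.exists_sum hd hA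
    exact ⟨S, hS, fun h => absurd rfl h⟩
  · obtain ⟨j, hj, hpj⟩ := a₀.exists_not_isEnd hA hp
    obtain ⟨h1, 𝓔, e, hs⟩ := flagSeries_merge hj hpj hφ hc
    have hB : 0 < (merge A j hj).length := by
      have := length_merge A j hj
      omega
    obtain ⟨S, hS⟩ := hs.exists_sum hd hB
    refine ⟨S, fun f => ?_, fun _ => ⟨⟨j, by omega⟩, Or.inl ⟨hj, hs.isFlagKernel hd hB hC hS⟩⟩⟩
    simpa only [h1] using hS f

/-- A flag kernel is the sum over all types of the sums of the terms with these types. -/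
theorem IsCutoffSystem.eq_sum (h : IsCutoffSystem d A η θ r δ Γ) (hA : 0 < A.length)
    {cst : FlagConstants A} {T : 𝓢(EuclideanSpace ℝ (Fin N), 𝕜) →L[𝕜] 𝕜}
    (hT : IsFlagKernelWith d A cst T)
    {S : (Fin A.length → Pat) → 𝓢(EuclideanSpace ℝ (Fin N), 𝕜) →L[𝕜] 𝕜}
    (hS : ∀ p, ∀ f : 𝓢(EuclideanSpace ℝ (Fin N), 𝕜),
      HasSum (fun a : PatTerm A p => termVal d A η θ T f a.1) (S p f)) :
    T = ∑ p, S p := by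
  refine ext_of_hasCompactSupport fun f hf => ?_
  have h1 : HasSum (termVal d A η θ T f) (∑ p, S p f) := by
    refine hasSum_of_hasSum_fiber (fun w (k : Fin A.length) => FullPath.pat (A.length - 1) w k)
      (P := fun p w => ∀ k : Fin A.length, FullPath.pat (A.length - 1) w k = p k)
      (fun w p => funext_iff.symm) fun p => hS p f
  have hk : A.length - 1 + 1 = A.length := by omega
  have h3 := hasSum_fullPath (H := wordVar (𝕜 := 𝕜) (n := A.length) false) (R := wordVar true)
    (wordFunctional (wordValue d A η θ T f)).toAddMonoidHom (k := A.length - 1) (B := T f)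
    (fun j hj q S' => by
      have := h.tendsto_corrected hT (f.smooth ⊤) (j := j) (by omega) q S'
      rw [hk]
      exact this)
    (h.tendsto_corrected_top hf hk)
    (by rw [hk]; exact h1.summable)
  rw [hk] at h3
  have h4 : T f = ∑ p, S p f := h3.unique h1
  rw [h4, sum_apply]

/-- The series of the terms whose factors all are differences, indexed by increasing tuples of
integers. The tuples which do not arise from a term contribute zero. -/
theorem exists_dyadic_series {ρ : EuclideanSpace ℝ (Fin N) → ℝ}
    (hρ : IsSmoothHomogeneousNorm d ρ) (hA : 0 < A.length)
    (hΓ : ∀ x, (∀ k, x ∈ Γ k) → ρ x ≤ 1 ∧ 1 / 8 ≤ ρ (firstBlock A x))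
    {C : ℕ → ℝ} (hC : ∀ m, 0 ≤ C m)
    {φ : PatTerm A (fun _ => Pat.diff) → EuclideanSpace ℝ (Fin N) → 𝕜}
    (hφ : ∀ a, IsBump r C (φ a)) (hφΓ : ∀ a x, φ a x ≠ 0 → ∀ k, x ∈ Γ k)
    (hc : ∀ a k, CancelsIn (Finset.univ.filter fun i => A.index i = k) (φ a))
    {S : 𝓢(EuclideanSpace ℝ (Fin N), 𝕜) →L[𝕜] 𝕜}
    (hS : ∀ f : 𝓢(EuclideanSpace ℝ (Fin N), 𝕜), HasSum (fun a : PatTerm A fun _ => Pat.diff =>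
      ∫ x, dyad d (fun i => a.scale (A.index i)) (φ a) x * f x) (S f)) :
    ∃ φ : IncreasingIndex A.length → EuclideanSpace ℝ (Fin N) → 𝕜,
      (∀ I, ContDiff ℝ ∞ (φ I) ∧ HasCompactSupport (φ I)) ∧
      (∀ f : 𝓢(EuclideanSpace ℝ (Fin N), 𝕜),
        HasSum (fun I => ∫ x, dyadic d A I.1 (φ I) x * f x) (S f)) ∧
      (∀ I, tsupport (φ I) ⊆ {x | ρ x ≤ 1}) ∧
      (∀ I m, CmNormLE m (φ I) (1 + ∑ i ∈ Finset.range (m + 1), C i)) ∧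
      (∀ I, StrongCancellation A (φ I)) ∧
      (∀ I x, ρ (firstBlock A x) < 1 / 8 → φ I x = 0) := by
  -- For differences in all factors a term is determined by its scales.
  let idx : PatTerm A (fun _ => Pat.diff) → IncreasingIndex A.length := fun a =>
    ⟨a.scale, fun l l' hl => by
      obtain ⟨m, hv⟩ := a.1.valid
      exact hv.mono _ _ hl (by omega)⟩
  have hidx : Function.Injective idx := fun a a' h =>
    PatTerm.ext_of_isEnd hA fun k _ => congrFun (congrArg Subtype.val h) k
  let ψ : IncreasingIndex A.length → EuclideanSpace ℝ (Fin N) → 𝕜 := Function.extend idx φ 0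
  have hψ : ∀ a, ψ (idx a) = φ a := fun a => hidx.extend_apply _ _ a
  have hψ0 : ∀ I, I ∉ Set.range idx → ψ I = 0 := fun I hI =>
    Function.extend_apply' _ _ _ hI
  have hz : IsBump r C (0 : EuclideanSpace ℝ (Fin N) → 𝕜) := by
    refine ⟨contDiff_const, fun x hx => absurd rfl hx, fun m x => ?_⟩
    have : iteratedFDeriv ℝ m (0 : EuclideanSpace ℝ (Fin N) → 𝕜) = 0 := iteratedFDeriv_fun_zero
    rw [this]
    simpa using hC m
  have hb : ∀ I, IsBump r C (ψ I) := fun I => by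
    by_cases hI : I ∈ Set.range idx
    · obtain ⟨a, rfl⟩ := hI
      rw [hψ]
      exact hφ a
    · rw [hψ0 I hI]
      exact hz
  have hψΓ : ∀ I x, ψ I x ≠ 0 → ∀ k, x ∈ Γ k := fun I x hx => by
    by_cases hI : I ∈ Set.range idx
    · obtain ⟨a, rfl⟩ := hI
      rw [hψ] at hx
      exact hφΓ a x hx
    · rw [hψ0 I hI] at hx
      exact absurd rfl hx
  refine ⟨ψ, fun I => ⟨(hb I).smooth, (hb I).hasCompactSupport⟩, fun f => ?_, fun I => ?_,
    fun I m α hα x => ?_, fun I => ?_, fun I x hx => ?_⟩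
  · refine (hidx.hasSum_iff fun I hI => ?_).1 (hasSum_of_eq (hS f) fun a => ?_)
    · simp [hψ0 I hI, dyadic]
    · simp only [Function.comp_apply, hψ, dyadic_eq_dyad]
      rfl
  · refine closure_minimal (fun x hx => (hΓ x (hψΓ I x hx)).1) ?_
    exact isClosed_le hρ.continuous continuous_const
  · refine (norm_partialDeriv_le α _ x).trans (((hb I).bound _ x).trans ?_)
    have := Finset.single_le_sum (f := C) (s := Finset.range (m + 1)) (fun i _ => hC i)
      (Finset.mem_range.2 (Nat.lt_succ_of_le hα))
    linarith
  · by_cases hI : I ∈ Set.range idx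
    · obtain ⟨a, rfl⟩ := hI
      rw [hψ]
      exact strongCancellation_of_cancelsIn (hφ a) (hc a)
    · rw [hψ0 I hI]
      intro k x
      simp
  · by_contra hne
    exact absurd hx (not_lt.2 (hΓ x (hψΓ I x hne)).2)

end Decomposition

end FlagKernel

end

theorem mainTheorem3 {𝕜 : Type*} [RCLike 𝕜] (N : ℕ) (hN : 0 < N)
    (d : Fin N → ℝ) (hd : ∀ i, 0 < d i) (hd_mono : Monotone d)
    (ρ : EuclideanSpace ℝ (Fin N) → ℝ) (hρ : FlagKernel.IsSmoothHomogeneousNorm d ρ)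
    (A : Composition N) (c : FlagKernel.FlagConstants A) :
    ∃ C : ℕ → ℝ, (∀ m, 0 < C m) ∧
      ∀ K : SchwartzMap (EuclideanSpace ℝ (Fin N)) 𝕜 →L[𝕜] 𝕜,
        FlagKernel.IsFlagKernelWith d A c K →
        ∃ (K₀ : SchwartzMap (EuclideanSpace ℝ (Fin N)) 𝕜 →L[𝕜] 𝕜)
          (K' : Fin A.length → (SchwartzMap (EuclideanSpace ℝ (Fin N)) 𝕜 →L[𝕜] 𝕜)),
          K = K₀ + ∑ j, K' j ∧
          (∃ φ : FlagKernel.IncreasingIndex A.length → EuclideanSpace ℝ (Fin N) → 𝕜,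
            (∀ I, ContDiff ℝ ∞ (φ I) ∧ HasCompactSupport (φ I)) ∧
            (∀ f : SchwartzMap (EuclideanSpace ℝ (Fin N)) 𝕜,
              HasSum (fun I => ∫ x, FlagKernel.dyadic d A I.1 (φ I) x * f x) (K₀ f)) ∧
            (∀ I, tsupport (φ I) ⊆ {x | ρ x ≤ 1}) ∧
            (∀ I m, FlagKernel.CmNormLE m (φ I) (C m)) ∧
            (∀ I, FlagKernel.StrongCancellation A (φ I)) ∧
            (∀ I x, ρ (FlagKernel.firstBlock A x) < 1 / 8 → φ I x = 0)) ∧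
          ∀ j, (∃ B : Composition N,
              FlagKernel.StrictlyCoarser B A ∧ FlagKernel.IsFlagKernel d B (K' j)) ∨
            (A.length = 1 ∧ K' j = 0) := by
  open FlagKernel in
  have hA : 0 < A.length := Composition.length_pos_of_pos A hN
  obtain ⟨η, θ, r, δ, Γ, h, hΓ⟩ := hρ.exists_cutoffSystem 𝕜 hd hN A
  choose C hC HC using fun p : Fin A.length → Pat => h.exists_termBump c p
  refine ⟨fun m => 1 + ∑ i ∈ Finset.range (m + 1), C (fun _ => .diff) i, fun m =>
    add_pos_of_pos_of_nonneg one_pos (Finset.sum_nonneg fun i _ => hC _ i), fun K hK => ?_⟩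
  choose φ hφ hφΓ hφc hφv using fun p => HC p K hK
  choose S hS hS' using fun p => exists_sum_patTerm hd hA (hC p) (hφ p) (hφc p)
  have hsum : K = ∑ p, S p := h.eq_sum hA hK fun p f =>
    hasSum_of_eq (hS p f) fun a => hφv p a f (f.smooth ⊤)
  -- `J p` is a factor of the pattern `p` which can be merged with its successor.
  have hJ : ∀ p, ∃ j : Fin A.length, p ≠ (fun _ => .diff) →
      (∃ hj : (j : ℕ) + 1 < A.length, IsFlagKernel d (merge A j hj) (S p)) ∨ S p = 0 := by
    intro p
    by_cases hp : p = fun _ => .diff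
    · exact ⟨⟨0, hA⟩, fun h => absurd hp h⟩
    · obtain ⟨j, hj⟩ := hS' p hp
      exact ⟨j, fun _ => hj⟩
  choose J hJ using hJ
  refine ⟨S fun _ => .diff, fun j => ∑ p with p ≠ (fun _ => .diff) ∧ J p = j, S p, ?_,
    exists_dyadic_series hρ hA hΓ (hC _) (hφ _) (hφΓ _) (fun a k => hφc _ a k (Or.inl rfl)) (hS _),
    fun j => ?_⟩
  · rw [hsum, ← Finset.sum_filter_add_sum_filter_not Finset.univ fun p => p = fun _ => .diff]
    congr 1
    · simp [Finset.filter_eq']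
    · rw [← Finset.sum_fiberwise _ J]
      exact Finset.sum_congr rfl fun j _ => by rw [Finset.filter_filter]
  · beta_reduce
    by_cases hj : (j : ℕ) + 1 < A.length
    · refine Or.inl ⟨merge A j hj, strictlyCoarser_merge A j hj, IsFlagKernel.sum _ fun p hp => ?_⟩
      obtain ⟨-, h1, rfl⟩ := Finset.mem_filter.1 hp
      rcases hJ p h1 with ⟨_, h2⟩ | h2
      · exact h2
      · rw [h2]
        exact IsFlagKernel.zero
    · -- The last factor always carries cancellation, so only zero sums are assigned to it.
      have h0 : ∑ p with p ≠ (fun _ => Pat.diff) ∧ J p = j, S p = 0 := by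
        refine Finset.sum_eq_zero fun p hp => ?_
        obtain ⟨-, h1, rfl⟩ := Finset.mem_filter.1 hp
        exact (hJ p h1).resolve_left fun ⟨h2, _⟩ => hj h2
      rw [h0]
      -- Zero is a flag kernel for any coarser decomposition, if there is one.
      by_cases h1 : 0 + 1 < A.length
      · exact Or.inl ⟨merge A 0 h1, strictlyCoarser_merge A 0 h1, IsFlagKernel.zero⟩
      · exact Or.inr ⟨by omega, rfl⟩
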